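/- **Setting.** Let $d\in\{2,3\}$, $T>0$, $\mu>0$, $\lambda\ge 0$, $\kappa>0$, $\gamma>1$, $c_v=\frac1{\gamma-1}$, $-1<\varepsilon<1$, and let $\mathbb T^d=([0,1]|_{\{0,1\}})^d$ be the flat torus. Let $\varrho_0,\vartheta_0:\mathbb T^d\to\mathbb R$ and $\boldsymbol u_0:\mathbb T^d\to\mathbb R^d$ belong to $W^{1,2}(\mathbb T^d)$, with $\varrho_0>0$ and $\vartheta_0>0$ a.e. *Mesh.* For $h=1/N\in(0,1)$, $N\in\mathbb N$, let $\mathcal T_h$ be the uniform mesh of $\mathbb T^d$ by cubes $K$ of side $h$, $\mathcal E$ the set of its faces, $Q_h$ the piecewise constant functions on $\mathcal T_h$ (also for vector-valued functions, componentwise), and $\Pi_Q$ the projection onto $Q_h$ by cell averages. On a face $\sigma$ with unit normal $\boldsymbol n$ put $[\![v]\!]=v^{\rm out}-v^{\rm in}$ and $\{\!\{v\}\!\}=\frac12(v^{\rm in}+v^{\rm out})$, where $v^{\rm in},v^{\rm out}$ are the values of $v\in Q_h$ in the cells behind and ahead of $\sigma$ in direction $\boldsymbol n$. On a cell, $(\nabla_h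 r)_K=\frac{|\sigma|}{|K|}\sum_{\sigma\subset\partial K}\{\!\{r\}\!\}\boldsymbol n$ and $({\rm div}_h\boldsymbol v)_K=\frac{|\sigma|}{|K|}\sum_{\sigma\subset\partial K}\{\!\{\boldsymbol v\}\!\}\cdot\boldsymbol n$, with $\boldsymbol n$ outer to $K$. Let $\mathbb D_h(\boldsymbol v)$ be the symmetric part of $\nabla_h\boldsymbol v$, and $\mathbb S_h=2\mu\,\mathbb D_h(\boldsymbol u_h)+\lambda\,{\rm div}_h\boldsymbol u_h\,\mathbb I$. For a face $\sigma=K|L$ let the dual cell $D_\sigma$ be the union of the halves of $K$ and $L$ adjacent to $\sigma$. Then $\nabla_{\mathcal E}r_h=\sum_{\sigma\in\mathcal E}\frac{[\![r_h]\!]}{h}\boldsymbol n\,1_{D_\sigma}$; its $i$-th component comes from the faces orthogonal to $\boldsymbol e_i$. For $x\in D_\sigma\cap K$, $\vartheta_h^{\rm out}(x)$ is the value of $\vartheta_h$ in $L$, and $\frac{1}{\vartheta_h^{\rm out}\vartheta_h}|\nabla_{\mathcal E}\vartheta_h|^2$ means $\sum_{i=1}^d\frac{1}{\vartheta_h^{{\rm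 out}}\vartheta_h}|(\nabla_{\mathcal E}\vartheta_h)_i|^2$, with $\vartheta_h^{\rm out}$ in the $i$-th summand taken across faces orthogonal to $\boldsymbol e_i$. *Scheme.* Let $\Delta t=T/N_T\in(0,1)$, $N_T\in\mathbb N$. A numerical solution is a triple of sequences $(\varrho_h^k,\boldsymbol u_h^k,\vartheta_h^k)\in Q_h$, $k=0,\dots,N_T$, with $(\varrho_h^0,\boldsymbol u_h^0,\vartheta_h^0)=(\Pi_Q\varrho_0,\Pi_Q\boldsymbol u_0,\Pi_Q\vartheta_0)$, such that at every level $k=1,\dots,N_T$, with $D_tv_h=(v_h^k-v_h^{k-1})/\Delta t$ and all other quantities taken at level $k$, for all $\phi_h,\boldsymbol\phi_h\in Q_h$, $$\int_{\mathbb T^d}D_t\varrho_h\,\phi_h\,dx-\int_{\mathcal E}F_h^\varepsilon(\varrho_h,\boldsymbol u_h)[\![\phi_h]\!]\,dS=0,$$ $$\int_{\mathbb T^d}D_t(\varrho_h\boldsymbol u_h)\cdot\boldsymbol\phi_h\,dx-\int_{\mathcal E}F_h^\varepsilon(\varrho_h\boldsymbol u_h,\boldsymbol u_h)\cdot[\![\boldsymbol\phi_h]\!]\,dS+\int_{\mathbb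 T^d}(\mathbb S_h-p_h\mathbb I):\nabla_h\boldsymbol\phi_h\,dx=0,$$ $$c_v\int_{\mathbb T^d}D_t(\varrho_h\vartheta_h)\phi_h\,dx-c_v\int_{\mathcal E}F_h^\varepsilon(\varrho_h\vartheta_h,\boldsymbol u_h)[\![\phi_h]\!]\,dS+\int_{\mathcal E}\frac\kappa h[\![\vartheta_h]\!][\![\phi_h]\!]\,dS=\int_{\mathbb T^d}(\mathbb S_h-p_h\mathbb I):\nabla_h\boldsymbol u_h\,\phi_h\,dx.$$ Here $\int_{\mathcal E}=\sum_{\sigma\in\mathcal E}\int_\sigma$, $p_h=\varrho_h\vartheta_h$ where $\vartheta_h>0$ and $p_h=0$ elsewhere, and $F_h^\varepsilon(r,\boldsymbol u)=\{\!\{r\}\!\}\{\!\{\boldsymbol u\}\!\}\cdot\boldsymbol n-\frac12|\{\!\{\boldsymbol u\}\!\}\cdot\boldsymbol n|[\![r]\!]-h^\varepsilon[\![r]\!]$. As functions of time, $v_h(t)=v_h^k$ for $t\in[k\Delta t,(k+1)\Delta t)$. Finally $s_h=\log(\vartheta_h^{c_v}/\varrho_h)$. *Test functions.* Let $\mathcal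 W$ be the set of $\phi\in L^\infty(0,T;W^{2,\infty}(\mathbb T^d))$ with $\partial_t\phi,\partial_t^2\phi\in L^\infty((0,T)\times\mathbb T^d)$ (weak derivatives; $\phi$ is identified with its continuous representative on $[0,T]\times\mathbb T^d$). **Lemma (Consistency formulation).** Fix constants $0<\underline\varrho\le\overline\varrho$ and $0<\underline\vartheta\le\overline\vartheta$. Consider all $(\Delta t,h)\in(0,1)^2$ as above and all corresponding numerical solutions that satisfy $\underline\varrho\le\varrho_h\le\overline\varrho$ and $\underline\vartheta\le\vartheta_h\le\overline\vartheta$ (at all levels $k=0,\dots,N_T$). For all $\tau\in[0,T]$ the following holds. (1) For every $\phi\in\mathcal W$, $$\Big[\int_{\mathbb T^d}\varrho_h\phi\,dx\Big]_{t=0}^{\tau}=\int_0^\tau\!\!\int_{\mathbb T^d}\big(\varrho_h\partial_t\phi+\varrho_h\boldsymbol u_h\cdot\nabla_x\phi\big)\,dx\,dt+e_\varrho(\phi,\Delta t,h,\tau),$$ $$|e_\varrho|\le C_\varrho\big(\Delta t+h+h^{1-\varepsilon}+h^{1+\varepsilon}\big).$$ (2) For every $\boldsymbol\phi\in\mathcal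 W^d$, $$\Big[\int_{\mathbb T^d}\varrho_h\boldsymbol u_h\cdot\boldsymbol\phi\,dx\Big]_{t=0}^{\tau}=\int_0^\tau\!\!\int_{\mathbb T^d}\big(\varrho_h\boldsymbol u_h\cdot\partial_t\boldsymbol\phi+\varrho_h\boldsymbol u_h\otimes\boldsymbol u_h:\nabla_x\boldsymbol\phi\big)\,dx\,dt+\int_0^\tau\!\!\int_{\mathbb T^d}(p_h\mathbb I-\mathbb S_h):\nabla_x\boldsymbol\phi\,dx\,dt+e_{\boldsymbol m}(\boldsymbol\phi,\Delta t,h,\tau),$$ $$|e_{\boldsymbol m}|\le C_{\boldsymbol m}\big(\Delta t+h+h^{(1-\varepsilon)/2}+h^{1+\varepsilon}\big).$$ (3) For every $\phi\in\mathcal W$ with $\phi\ge0$, $$\Big[\int_{\mathbb T^d}\varrho_hs_h\phi\,dx\Big]_{t=0}^{\tau}\ge\int_0^\tau\!\!\int_{\mathbb T^d}\varrho_hs_h(\partial_t\phi+\boldsymbol u_h\cdot\nabla_x\phi)\,dx\,dt+\int_0^\tau\!\!\int_{\mathbb T^d}\mathbb S_h:\nabla_h\boldsymbol u_h\frac{\phi}{\vartheta_h}\,dx\,dt+\int_0^\tau\!\!\int_{\mathbb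 T^d}\frac{\kappa\phi}{\vartheta_h^{\rm out}\vartheta_h}|\nabla_{\mathcal E}\vartheta_h|^2\,dx\,dt-\int_0^\tau\!\!\int_{\mathbb T^d}\frac{\kappa}{\vartheta_h}\nabla_{\mathcal E}\vartheta_h\cdot\nabla_x\phi\,dx\,dt+e_s(\phi,\Delta t,h,\tau),$$ $$|e_s|\le C_s\big(\Delta t+h+h^{1-\varepsilon}+h^{(1+\varepsilon)/2}\big).$$ The constants $C_\varrho,C_{\boldsymbol m},C_s$ may depend on the test function, on $d,T,\mu,\lambda,\kappa,\gamma,\varepsilon$, on the bounds $\underline\varrho,\overline\varrho,\underline\vartheta,\overline\vartheta$ and on the initial data, but not on $h$, $\Delta t$, $\tau$ or the numerical solution. -/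

import Mathlib

open MeasureTheory Set
open scoped ContDiff

noncomputable section

namespace FVNSF

/-! ## The flat torus and weak derivatives

The torus is `[0,1]^d` with opposite faces identified: its functions are functions of `x : Fin d → ℝ`
of which only the values on the unit cube matter for integrals, and which are required to be
`ℤ^d`-periodic wherever continuity or smoothness on the torus is meant. -/

/-- Points of `ℝ^d`. -/
abbrev Pt (d : ℕ) : Type := Fin d → ℝ

/-- The fundamental domain `[0,1)^d` of the torus. -/
def unitCube (d : ℕ) : Set (Pt d) := Set.univ.pi fun _ => Set.Ico (0 : ℝ) 1

/-- Lebesgue measure of the torus. -/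
def torusMeasure (d : ℕ) : Measure (Pt d) := volume.restrict (unitCube d)

/-- Lebesgue measure of the space-time cylinder `(0,T) × 𝕋^d`. -/
def cylMeasure (d : ℕ) (T : ℝ) : Measure (ℝ × Pt d) :=
  (volume.restrict (Set.Ioo 0 T)).prod (torusMeasure d)

/-- `ℤ^d`-periodicity. -/
def IsPeriodic {d : ℕ} (f : Pt d → ℝ) : Prop :=
  ∀ (x : Pt d) (i : Fin d), f (x + Pi.single i 1) = f x

/-- `g` is the weak partial derivative `∂_i f` on the torus. -/
def HasWeakPartial {d : ℕ} (i : Fin d) (f g : Pt d → ℝ) : Prop :=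
  ∀ ψ : Pt d → ℝ, ContDiff ℝ ∞ ψ → IsPeriodic ψ →
    ∫ x, f x * fderiv ℝ ψ x (Pi.single i 1) ∂(torusMeasure d) =
      - ∫ x, g x * ψ x ∂(torusMeasure d)

/-- The Sobolev space `W^{1,2}(𝕋^d)`. -/
def MemW12 {d : ℕ} (f : Pt d → ℝ) : Prop :=
  MemLp f 2 (torusMeasure d) ∧
    ∀ i : Fin d, ∃ g : Pt d → ℝ, MemLp g 2 (torusMeasure d) ∧ HasWeakPartial i f g

/-- `g` is the weak time derivative `∂_t f` in `(0,T) × 𝕋^d`. -/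
def HasWeakTimeDeriv {d : ℕ} (T : ℝ) (f g : ℝ → Pt d → ℝ) : Prop :=
  ∀ ψ : ℝ → Pt d → ℝ, ContDiff ℝ ∞ (Function.uncurry ψ) → (∀ t, IsPeriodic (ψ t)) →
    (∃ a b : ℝ, 0 < a ∧ b < T ∧ ∀ t, t ∉ Set.Icc a b → ∀ x, ψ t x = 0) →
    ∫ z, f z.1 z.2 * deriv (fun s => ψ s z.2) z.1 ∂(cylMeasure d T) =
      - ∫ z, g z.1 z.2 * ψ z.1 z.2 ∂(cylMeasure d T)

/-- A scalar test function `φ ∈ L^∞(0,T; W^{2,∞}(𝕋^d))` with `∂_t φ, ∂_t² φ ∈ L^∞((0,T) × 𝕋^d)`,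
together with its weak derivatives. Such a function is Lipschitz continuous in `(t,x)` up to a
modification on a null set; `val` is this continuous representative on `[0,T] × 𝕋^d`, so that
`val t` makes sense for every `t ∈ [0,T]`. -/
structure TestFunction (d : ℕ) (T : ℝ) where
  /-- the function `φ` -/
  val : ℝ → Pt d → ℝ
  /-- `∂_t φ` -/
  dt : ℝ → Pt d → ℝ
  /-- `∂_t² φ` -/
  dtt : ℝ → Pt d → ℝ
  /-- `dx i` is `∂_i φ` -/
  dx : Fin d → ℝ → Pt d → ℝ
  /-- `dxx i j` is `∂_j ∂_i φ` -/
  dxx : Fin d → Fin d → ℝ → Pt d → ℝ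
  periodic : ∀ t ∈ Set.Icc 0 T, IsPeriodic (val t)
  continuousOn : ContinuousOn (Function.uncurry val) (Set.Icc 0 T ×ˢ Set.univ)
  memLp_dt : MemLp (Function.uncurry dt) ⊤ (cylMeasure d T)
  memLp_dtt : MemLp (Function.uncurry dtt) ⊤ (cylMeasure d T)
  memLp_dx : ∀ i, MemLp (Function.uncurry (dx i)) ⊤ (cylMeasure d T)
  memLp_dxx : ∀ i j, MemLp (Function.uncurry (dxx i j)) ⊤ (cylMeasure d T)
  weak_dt : HasWeakTimeDeriv T val dt
  weak_dtt : HasWeakTimeDeriv T dt dtt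
  weak_dx : ∀ i, ∀ᵐ t ∂(volume.restrict (Set.Ioo 0 T)), HasWeakPartial i (val t) (dx i t)
  weak_dxx : ∀ i j, ∀ᵐ t ∂(volume.restrict (Set.Ioo 0 T)),
    HasWeakPartial j (dx i t) (dxx i j t)

/-! ## The mesh and piecewise constant functions -/

/-- The cells of the uniform mesh with `N` cells in each direction, indexed periodically. -/
abbrev Cell (d N : ℕ) : Type := Fin d → ZMod N

/-- `Q_h`: a piecewise constant function on the mesh, given by its values on the cells. -/
abbrev QFun (d N : ℕ) : Type := Cell d N → ℝ

/-- The mesh size `h = 1/N`. -/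
def meshSize (N : ℕ) : ℝ := 1 / (N : ℝ)

/-- The neighbour of the cell `K` in direction `+e_i`. -/
def next {d N : ℕ} (i : Fin d) (K : Cell d N) : Cell d N := K + Pi.single i 1

/-- The neighbour of the cell `K` in direction `-e_i`. -/
def prev {d N : ℕ} (i : Fin d) (K : Cell d N) : Cell d N := K - Pi.single i 1

/-- The cell `∏ [k_i h, (k_i + 1) h)` containing the point `x`. -/
def cellOf {d : ℕ} (N : ℕ) (x : Pt d) : Cell d N :=
  fun i => ((⌊(N : ℝ) * x i⌋ : ℤ) : ZMod N)

/-- The projection `Π_Q`: mean values over the cells, `|K| = h^d`. -/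
def projQ {d : ℕ} (N : ℕ) (f : Pt d → ℝ) : QFun d N :=
  fun K => (1 / meshSize N ^ d) * ∫ x in {x | cellOf N x = K}, f x ∂(torusMeasure d)

/-- `∫_{𝕋^d} r_h dx` for a piecewise constant function. -/
def cellInt {d N : ℕ} [NeZero N] (r : QFun d N) : ℝ := meshSize N ^ d * ∑ K, r K

/-! Every face is `σ = K|next i K` for exactly one pair `(i, K)`. It is oriented by the normal
`n = e_i`, so that the inner value of `r_h` on it is `r K` and the outer one is `r (next i K)`. All
quantities below that are summed over faces do not depend on the orientation. -/

/-- The average `{{r}}` on the face `K|next i K`. -/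
def avg {d N : ℕ} (r : QFun d N) (i : Fin d) (K : Cell d N) : ℝ := (r (next i K) + r K) / 2

/-- The jump `⟦r⟧ = r^out - r^in` on the face `K|next i K` with normal `e_i`. -/
def jump {d N : ℕ} (r : QFun d N) (i : Fin d) (K : Cell d N) : ℝ := r (next i K) - r K

/-- `∫_ℰ f dS_x`, the sum over all faces of `|σ| f_σ`, with `|σ| = h^{d-1}`. -/
def faceInt {d N : ℕ} [NeZero N] (f : Fin d → Cell d N → ℝ) : ℝ :=
  meshSize N ^ (d - 1) * ∑ i, ∑ K, f i K

/-- The `i`-th component of the discrete gradient `(∇_h r)_K = |σ|/|K| ∑_{σ ∈ ℰ(K)} {{r}} n`, with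
`n` the outer normal of `K`: the faces `K|next i K` (`n = e_i`) and `prev i K|K` (`n = -e_i`)
contribute. -/
def discGrad {d N : ℕ} (r : QFun d N) (i : Fin d) : QFun d N :=
  fun K => (1 / meshSize N) * (avg r i K - avg r i (prev i K))

/-- The discrete divergence `div_h v`. -/
def discDiv {d N : ℕ} (v : Fin d → QFun d N) : QFun d N := fun K => ∑ i, discGrad (v i) i K

/-- The entry `(i,j)` of the symmetric discrete gradient `𝔻_h(v)`. -/
def discSymGrad {d N : ℕ} (v : Fin d → QFun d N) (i j : Fin d) : QFun d N :=
  fun K => (discGrad (v i) j K + discGrad (v j) i K) / 2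

/-- The entry `(i,j)` of the viscous stress `𝕊_h = 2 μ 𝔻_h(v) + λ div_h v 𝕀`. -/
def discStress {d N : ℕ} (mu lam : ℝ) (v : Fin d → QFun d N) (i j : Fin d) : QFun d N :=
  fun K => 2 * mu * discSymGrad v i j K + if i = j then lam * discDiv v K else 0

/-- The upwind flux `Up[r,u] = {{r}} {{u}}·n - ½ |{{u}}·n| ⟦r⟧` on the face `K|next i K`. -/
def upwind {d N : ℕ} (r : QFun d N) (u : Fin d → QFun d N) (i : Fin d) (K : Cell d N) : ℝ :=
  avg r i K * avg (u i) i K - (1 / 2) * |avg (u i) i K| * jump r i K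

/-- The diffusive upwind flux `F_h^ε(r,u) = Up[r,u] - h^ε ⟦r⟧`. -/
def diffFlux {d N : ℕ} (eps : ℝ) (r : QFun d N) (u : Fin d → QFun d N)
    (i : Fin d) (K : Cell d N) : ℝ :=
  upwind r u i K - meshSize N ^ eps * jump r i K

/-- The discrete pressure `p_h`. -/
def discPressure {d N : ℕ} (rho theta : QFun d N) : QFun d N :=
  fun K => if 0 < theta K then rho K * theta K else 0

/-- The entropy `s(ϱ,ϑ) = log (ϑ^{c_v} / ϱ)` with `c_v = 1/(γ-1)`. -/
def entropy (gamma rho theta : ℝ) : ℝ := Real.log (theta ^ (1 / (gamma - 1)) / rho)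

/-- The discrete entropy `s_h = s(ϱ_h, ϑ_h)`. -/
def discEntropy {d N : ℕ} (gamma : ℝ) (rho theta : QFun d N) : QFun d N :=
  fun K => entropy gamma (rho K) (theta K)

/-! ## The finite volume scheme -/

/-- The discrete density, velocity and temperature at the time levels `t^k = k Δt`. -/
structure FVFields (d N : ℕ) where
  rho : ℕ → QFun d N
  vel : ℕ → Fin d → QFun d N
  temp : ℕ → QFun d N

/-- The pressure `p_h^k`. -/
def FVFields.press {d N : ℕ} (w : FVFields d N) (k : ℕ) : QFun d N :=
  discPressure (w.rho k) (w.temp k)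

/-- `w` is a finite volume approximation with time step `dt` and time levels `0, …, NT`, started from
the projections of the initial data `(rho0, u0, theta0)`. The equations at the level `k + 1` are the
discrete continuity, momentum and internal energy equations, with the discrete time derivative
`D_t v = (v^{k+1} - v^k)/Δt`. -/
structure IsFVSolution {d N : ℕ} [NeZero N] (mu lam kappa gamma eps : ℝ) (NT : ℕ) (dt : ℝ)
    (rho0 : Pt d → ℝ) (u0 : Fin d → Pt d → ℝ) (theta0 : Pt d → ℝ) (w : FVFields d N) : Prop where
  init_rho : w.rho 0 = projQ N rho0
  init_vel : ∀ j, w.vel 0 j = projQ N (u0 j)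
  init_temp : w.temp 0 = projQ N theta0
  continuity : ∀ k < NT, ∀ φ : QFun d N,
    cellInt (fun K => (w.rho (k + 1) K - w.rho k K) / dt * φ K)
      - faceInt (fun i K => diffFlux eps (w.rho (k + 1)) (w.vel (k + 1)) i K * jump φ i K) = 0
  momentum : ∀ k < NT, ∀ φ : Fin d → QFun d N,
    cellInt (fun K => ∑ j,
        (w.rho (k + 1) K * w.vel (k + 1) j K - w.rho k K * w.vel k j K) / dt * φ j K)
      - faceInt (fun i K => ∑ j,
          diffFlux eps (fun L => w.rho (k + 1) L * w.vel (k + 1) j L) (w.vel (k + 1)) i K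
            * jump (φ j) i K)
      + cellInt (fun K => ∑ i, ∑ j,
          (discStress mu lam (w.vel (k + 1)) i j K - if i = j then w.press (k + 1) K else 0)
            * discGrad (φ i) j K) = 0
  energy : ∀ k < NT, ∀ φ : QFun d N,
    1 / (gamma - 1) * cellInt (fun K =>
        (w.rho (k + 1) K * w.temp (k + 1) K - w.rho k K * w.temp k K) / dt * φ K)
      - 1 / (gamma - 1) * faceInt (fun i K =>
          diffFlux eps (fun L => w.rho (k + 1) L * w.temp (k + 1) L) (w.vel (k + 1)) i K
            * jump φ i K)
      + faceInt (fun i K => kappa / meshSize N * jump (w.temp (k + 1)) i K * jump φ i K)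
      = cellInt (fun K => (∑ i, ∑ j,
          (discStress mu lam (w.vel (k + 1)) i j K - if i = j then w.press (k + 1) K else 0)
            * discGrad (w.vel (k + 1) i) j K) * φ K)

/-- The bounds `0 < ϱ_min ≤ ϱ_h ≤ ϱ_max` and `0 < ϑ_min ≤ ϑ_h ≤ ϑ_max` (positivity of the lower
bounds is stated separately). -/
def FVFields.Bounded {d N : ℕ} (w : FVFields d N) (NT : ℕ)
    (rhoMin rhoMax thetaMin thetaMax : ℝ) : Prop :=
  ∀ k ≤ NT, ∀ K : Cell d N,
    (rhoMin ≤ w.rho k K ∧ w.rho k K ≤ rhoMax) ∧ (thetaMin ≤ w.temp k K ∧ w.temp k K ≤ thetaMax)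

/-! ## The discrete fields as functions on space-time -/

/-- The function of `(t,x)` that is equal to `v^k` on `[k Δt, (k+1) Δt)` and constant on cells. -/
def recon {d N : ℕ} (dt : ℝ) (v : ℕ → QFun d N) (t : ℝ) (x : Pt d) : ℝ :=
  v ⌊t / dt⌋₊ (cellOf N x)

/-- The lower cell `K` of the face `σ = K|next i K` whose dual cell `D_σ` contains `x`; `D_σ` is the
cell `K` shifted by `h/2` in direction `e_i`. -/
def dualCellOf {d : ℕ} (N : ℕ) (i : Fin d) (x : Pt d) : Cell d N :=
  cellOf N (x - Pi.single i (meshSize N / 2))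

/-- The `i`-th component of `∇_ℰ r_h(x)`: it is `⟦r_h⟧/h` on the dual cells of the faces orthogonal
to `e_i`. -/
def edgeGrad {d N : ℕ} (r : QFun d N) (i : Fin d) (x : Pt d) : ℝ :=
  jump r i (dualCellOf N i x) / meshSize N

/-- `r_h^out` on the dual cell `D_σ ∋ x`, `σ` orthogonal to `e_i`, seen from the cell containing `x`:
the value in the cell on the other side of `σ`. -/
def outVal {d N : ℕ} (r : QFun d N) (i : Fin d) (x : Pt d) : ℝ :=
  if dualCellOf N i x = cellOf N x then r (next i (cellOf N x)) else r (prev i (cellOf N x))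

/-- `ϱ_h(t,x)`. -/
def FVFields.rhoAt {d N : ℕ} (w : FVFields d N) (dt t : ℝ) (x : Pt d) : ℝ := recon dt w.rho t x

/-- The `j`-th component of `u_h(t,x)`. -/
def FVFields.velAt {d N : ℕ} (w : FVFields d N) (dt : ℝ) (j : Fin d) (t : ℝ) (x : Pt d) : ℝ :=
  recon dt (fun k => w.vel k j) t x

/-- `ϑ_h(t,x)`. -/
def FVFields.tempAt {d N : ℕ} (w : FVFields d N) (dt t : ℝ) (x : Pt d) : ℝ := recon dt w.temp t x

/-- `p_h(t,x)`. -/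
def FVFields.pressAt {d N : ℕ} (w : FVFields d N) (dt t : ℝ) (x : Pt d) : ℝ := recon dt w.press t x

/-- `s_h(t,x)`. -/
def FVFields.entropyAt {d N : ℕ} (w : FVFields d N) (gamma dt t : ℝ) (x : Pt d) : ℝ :=
  recon dt (fun k => discEntropy gamma (w.rho k) (w.temp k)) t x

/-- The entry `(i,j)` of `𝕊_h(t,x)`. -/
def FVFields.stressAt {d N : ℕ} (w : FVFields d N) (mu lam dt : ℝ) (i j : Fin d)
    (t : ℝ) (x : Pt d) : ℝ :=
  recon dt (fun k => discStress mu lam (w.vel k) i j) t x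

/-- The entry `(i,j)` of `∇_h u_h(t,x)`, that is `(∇_h u_i)_j`. -/
def FVFields.gradVelAt {d N : ℕ} (w : FVFields d N) (dt : ℝ) (i j : Fin d)
    (t : ℝ) (x : Pt d) : ℝ :=
  recon dt (fun k => discGrad (w.vel k i) j) t x

/-- The `i`-th component of `∇_ℰ ϑ_h(t,x)`. -/
def FVFields.edgeGradTempAt {d N : ℕ} (w : FVFields d N) (dt : ℝ) (i : Fin d)
    (t : ℝ) (x : Pt d) : ℝ :=
  edgeGrad (w.temp ⌊t / dt⌋₊) i x

/-- `ϑ_h^out(t,x)` on the dual cells of the faces orthogonal to `e_i`. -/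
def FVFields.tempOutAt {d N : ℕ} (w : FVFields d N) (dt : ℝ) (i : Fin d)
    (t : ℝ) (x : Pt d) : ℝ :=
  outVal (w.temp ⌊t / dt⌋₊) i x

/-- `∫_{𝕋^d} f dx`. -/
def torusInt {d : ℕ} (f : Pt d → ℝ) : ℝ := ∫ x, f x ∂(torusMeasure d)

/-- `∫_0^τ ∫_{𝕋^d} f dx dt`. -/
def cylInt {d : ℕ} (τ : ℝ) (f : ℝ → Pt d → ℝ) : ℝ := ∫ t in (0 : ℝ)..τ, torusInt (f t)

end FVNSF

end

/-! For almost every fixed time `t` the scheme is tested with the cell averages of the test function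
at time `t`. This separates a spatial error at frozen time from a temporal error.

Space. If `φ` is in W^{2,∞} in space, its averages `a` have jumps `h Π∂_iφ + O(h²)` (`DiscTest`),
hence second differences of size `h²`. Write {{r}}{{u}} = {{ru}} - ¼⟦r⟧⟦u⟧ and sum the central,
upwind and `h^ε` terms by parts. The flux then reproduces ∫ r u·∇φ up to terms of order `h` and
`h^{1+ε}` and the sum of |⟦r⟧||⟦u⟧| (`flux_consistency`). The numerical dissipation controls squares
of jumps of density and velocity by `h^{1-ε}`. This gives the rate `h^{1-ε}` for density and density
times entropy, but only `h^{(1-ε)/2}` for momentum, where a jump of velocity is paired with a merely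
square integrable average of velocity.

Entropy. η = ϱ s is a concave function of (ϱ, ϱϑ). Testing continuity and internal energy with `φ`
times the two components of ∇η produces an inequality: concavity gives the sign of the time
difference and of the face terms (`entropy_face`, `SchemeStep.entropy_ineq`). The sign is lost only
where the test function jumps. The remainder there is `O(h)` times an entropy production that is
quadratic in the jumps, hence small. The heat terms are compared with integrals over halves of
cells, since ∇_ℰϑ lives on dual cells.

A priori bounds. All spatial errors are a rate times `levelSize`, which collects the kinetic energy
and the physical and numerical dissipations of one level. Its time sum is bounded
(`exists_level_bound`) by adding three budgets: total energy controls velocity jumps, the continuity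
equation tested with ϱ controls density jumps, and the entropy inequality with test function 1
controls the symmetric gradient and the temperature gradient.

Time. Put p_k(t) = ∫ v^k φ(t). The scheme gives (p_{k+1}(t) - p_k(t))/Δt for almost every `t`.
`time_telescope` compares the means of p_k over consecutive time slabs: their increments contain
this quotient and a time difference of `φ`, whose second difference is O(Δt²). Partial slabs cost
O(Δt) provided the spatial terms are bounded uniformly in time, not just after summation. The bounds
therefore use only the kinetic energy, with the viscous and heat terms integrated by parts. The
scheme gives no dissipation bound at level 0; there the W^{1,2} regularity of the initial velocity
and temperature is used.

Weak derivatives. Test functions have only weak derivatives, so everything known about their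
averages comes from `HasWeakPartial.translation`, which permits testing with indicator functions of
cells and of half cells. -/

set_option linter.unusedSectionVars false

noncomputable section

namespace FVNSF

/-! ## Discrete calculus -/

section DiscreteCalculus

variable {d N : ℕ}

lemma next_prev (i : Fin d) (K : Cell d N) : next i (prev i K) = K := by
  simp [next, prev]

lemma prev_next (i : Fin d) (K : Cell d N) : prev i (next i K) = K := by
  simp [next, prev]

variable [NeZero N]

lemma meshSize_pos : 0 < meshSize N := by
  have : (0 : ℝ) < N := Nat.cast_pos.2 (Nat.pos_of_ne_zero (NeZero.ne N))
  unfold meshSize; positivity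

lemma cellInt_add (f g : QFun d N) : cellInt (fun K => f K + g K) = cellInt f + cellInt g := by
  simp [cellInt, Finset.sum_add_distrib, mul_add]

lemma cellInt_neg (f : QFun d N) : cellInt (fun K => -f K) = -cellInt f := by
  simp [cellInt]

lemma cellInt_sub (f g : QFun d N) : cellInt (fun K => f K - g K) = cellInt f - cellInt g := by
  simp [cellInt, Finset.sum_sub_distrib, mul_sub]

lemma cellInt_const_mul (c : ℝ) (f : QFun d N) :
    cellInt (fun K => c * f K) = c * cellInt f := by
  simp only [cellInt, ← Finset.mul_sum]; ring

lemma cellInt_sum {ι : Type*} (s : Finset ι) (f : ι → QFun d N) :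
    cellInt (fun K => ∑ i ∈ s, f i K) = ∑ i ∈ s, cellInt (f i) := by
  simp only [cellInt]
  rw [Finset.sum_comm, Finset.mul_sum]

lemma cellInt_mono {f g : QFun d N} (h : ∀ K, f K ≤ g K) : cellInt f ≤ cellInt g := by
  unfold cellInt
  have := meshSize_pos (N := N)
  gcongr with K
  exact h K

lemma cellInt_nonneg {f : QFun d N} (h : ∀ K, 0 ≤ f K) : 0 ≤ cellInt f := by
  unfold cellInt
  have := meshSize_pos (N := N)
  exact mul_nonneg (by positivity) (Finset.sum_nonneg fun K _ => h K)

lemma cellInt_const (c : ℝ) : cellInt (fun _ : Cell d N => c) = c := by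
  have : (N : ℝ) ≠ 0 := Nat.cast_ne_zero.2 (NeZero.ne N)
  simp [cellInt, meshSize]
  field_simp

lemma abs_cellInt_le (f : QFun d N) : |cellInt f| ≤ cellInt fun K => |f K| := by
  have := meshSize_pos (N := N)
  unfold cellInt
  rw [abs_mul, abs_of_pos (by positivity : 0 < meshSize N ^ d)]
  gcongr
  exact Finset.abs_sum_le_sum_abs _ _

lemma abs_cellInt_le_of_le {f g : QFun d N} (h : ∀ K, |f K| ≤ g K) : |cellInt f| ≤ cellInt g :=
  (abs_cellInt_le f).trans (cellInt_mono h)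

lemma cellInt_next (i : Fin d) (f : QFun d N) : cellInt (fun K => f (next i K)) = cellInt f := by
  unfold cellInt next
  congr 1
  exact Equiv.sum_comp (Equiv.addRight (Pi.single i 1 : Cell d N)) f

lemma cellInt_prev (i : Fin d) (f : QFun d N) : cellInt (fun K => f (prev i K)) = cellInt f := by
  rw [← cellInt_next i]; simp only [prev_next]

/-- Summation by parts. -/
lemma cellInt_mul_jump (i : Fin d) (r F : QFun d N) :
    cellInt (fun K => F K * jump r i K) = -cellInt (fun K => r K * (F K - F (prev i K))) := by
  have h := cellInt_prev i (fun K => F K * r (next i K))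
  simp only [next_prev] at h
  have h1 : cellInt (fun K => F K * jump r i K)
      = cellInt (fun K => F K * r (next i K)) - cellInt (fun K => F K * r K) := by
    rw [← cellInt_sub]; congr 1; funext K; simp [jump]; ring
  have h2 : cellInt (fun K => r K * (F K - F (prev i K)))
      = cellInt (fun K => F K * r K) - cellInt (fun K => F (prev i K) * r K) := by
    rw [← cellInt_sub]; congr 1; funext K; ring
  rw [h1, h2, h]; ring

lemma discGrad_eq (r : QFun d N) (i : Fin d) (K : Cell d N) :
    discGrad r i K = (r (next i K) - r (prev i K)) / (2 * meshSize N) := by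
  have := (meshSize_pos (N := N)).ne'
  simp only [discGrad, avg, next_prev]
  field_simp; ring

lemma discGrad_eq_jump (r : QFun d N) (i : Fin d) (K : Cell d N) :
    discGrad r i K = (jump r i K + jump r i (prev i K)) / (2 * meshSize N) := by
  rw [discGrad_eq]; simp only [jump, next_prev]; ring

lemma cellInt_avg_mul_jump (r s : QFun d N) (i : Fin d) :
    1 / meshSize N * cellInt (fun K => avg s i K * jump r i K)
      = -cellInt (fun K => r K * discGrad s i K) := by
  rw [cellInt_mul_jump, mul_neg, ← cellInt_const_mul]
  congr 2; funext K; simp only [discGrad]; ring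

/-- Shifting the mesh moves the outer half of the average to the neighbouring cell, so that each
cell collects the jumps over both of its faces. Together with the preceding form this makes the
discrete gradient skew-adjoint. -/
lemma cellInt_avg_mul_jump' (r s : QFun d N) (i : Fin d) :
    1 / meshSize N * cellInt (fun K => avg s i K * jump r i K)
      = cellInt (fun K => s K * discGrad r i K) := by
  have h := cellInt_prev i (fun K => s (next i K) * jump r i K)
  simp only [next_prev] at h
  have h1 : cellInt (fun K => avg s i K * jump r i K)
      = 1 / 2 * (cellInt (fun K => s (next i K) * jump r i K)
        + cellInt (fun K => s K * jump r i K)) := by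
    rw [← cellInt_add, ← cellInt_const_mul]; congr 1; funext K; simp only [avg]; ring
  rw [h1, ← h, ← cellInt_add, ← cellInt_const_mul, ← cellInt_const_mul]
  congr 1; funext K; rw [discGrad_eq_jump]
  have := (meshSize_pos (N := N)).ne'
  field_simp; ring

lemma cellInt_discGrad_mul (r s : QFun d N) (i : Fin d) :
    cellInt (fun K => discGrad r i K * s K) = -cellInt (fun K => r K * discGrad s i K) := by
  rw [← cellInt_avg_mul_jump, cellInt_avg_mul_jump']
  congr 1; funext K; ring

/-- A face has measure |K|/h. Positivity of `d` matters because the exponent `d - 1` is a truncated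
subtraction. -/
lemma faceInt_eq (hd : 0 < d) (f : Fin d → Cell d N → ℝ) :
    faceInt f = 1 / meshSize N * ∑ i, cellInt (f i) := by
  have := (meshSize_pos (N := N)).ne'
  obtain ⟨e, rfl⟩ : ∃ e, d = e + 1 := ⟨d - 1, by omega⟩
  simp only [faceInt, cellInt, ← Finset.mul_sum, pow_succ, Nat.add_sub_cancel]
  field_simp

lemma cellInt_avg_sq_le (r : QFun d N) (i : Fin d) :
    cellInt (fun K => avg r i K ^ 2) ≤ cellInt (fun K => r K ^ 2) := by
  have h : cellInt (fun K => avg r i K ^ 2)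
      ≤ cellInt (fun K => 1 / 2 * (r (next i K) ^ 2 + r K ^ 2)) := by
    refine cellInt_mono fun K => ?_
    simp only [avg]
    nlinarith [sq_nonneg (r (next i K) - r K)]
  rw [cellInt_const_mul, cellInt_add, cellInt_next i (fun K => r K ^ 2)] at h
  linarith

end DiscreteCalculus

/-! ## Pointwise inequalities on a face -/

lemma entropy_eq {gamma r θ : ℝ} (hr : 0 < r) (hθ : 0 < θ) :
    entropy gamma r θ = 1 / (gamma - 1) * Real.log θ - Real.log r := by
  unfold entropy
  rw [Real.log_div (Real.rpow_pos_of_pos hθ _).ne' hr.ne', Real.log_rpow hθ]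

/-- Concavity of `(ϱ, ϱϑ) ↦ ϱ s(ϱ,ϑ)`. -/
lemma entropy_concave {gamma r R θ Θ : ℝ} (hg : 1 < gamma) (hr : 0 < r) (hR : 0 < R)
    (hθ : 0 < θ) (hΘ : 0 < Θ) :
    0 ≤ r * (entropy gamma R Θ - entropy gamma r θ - 1 / (gamma - 1) - 1)
      + 1 / (gamma - 1) * (r * (θ / Θ)) + R := by
  have hc : 0 < 1 / (gamma - 1) := by have := sub_pos.2 hg; positivity
  rw [entropy_eq hr hθ, entropy_eq hR hΘ]
  have h1 := Real.log_le_sub_one_of_pos (div_pos hθ hΘ)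
  have h2 := Real.log_le_sub_one_of_pos (div_pos hR hr)
  rw [Real.log_div hθ.ne' hΘ.ne'] at h1
  rw [Real.log_div hR.ne' hr.ne'] at h2
  have h3 : R = r * (R / r) := by field_simp
  set c := 1 / (gamma - 1)
  set x := θ / Θ
  set y := R / r
  have : 0 ≤ r * (c * (x - 1 - (Real.log θ - Real.log Θ))
      + (y - 1 - (Real.log R - Real.log r))) := by
    apply mul_nonneg hr.le
    have := mul_nonneg hc.le (sub_nonneg.2 h1)
    linarith
  nlinarith

/-- The numerical dissipation of the kinetic energy on a face. -/
lemma kinetic_face {v e a b r1 x y : ℝ} (he : 0 ≤ e) (ha : r1 ≤ a) (hb : r1 ≤ b) (hr1 : 0 < r1) :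
    ((a * x + b * y) / 2 * v - 1 / 2 * |v| * (a * x - b * y) - e * (a * x - b * y)) * (x - y)
      - ((a + b) / 2 * v - 1 / 2 * |v| * (a - b) - e * (a - b)) * (1 / 2 * (x ^ 2 - y ^ 2))
      ≤ -(e * r1 * (x - y) ^ 2) := by
  -- Subtracting the mass flux times ½⟦u²⟧ cancels every term not proportional to the squared jump.
  -- The convective remainder, of indefinite sign, is dominated by the upwind part because |a - b| ≤
  -- a + b.
  have h : ((a * x + b * y) / 2 * v - 1 / 2 * |v| * (a * x - b * y) - e * (a * x - b * y)) * (x - y)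
      - ((a + b) / 2 * v - 1 / 2 * |v| * (a - b) - e * (a - b)) * (1 / 2 * (x ^ 2 - y ^ 2))
      = (1 / 4 * v * (a - b) - (1 / 2 * |v| + e) * ((a + b) / 2)) * (x - y) ^ 2 := by ring
  rw [h, ← neg_mul]
  apply mul_le_mul_of_nonneg_right _ (sq_nonneg _)
  have h1 : v * (a - b) ≤ |v| * (a + b) := by
    calc v * (a - b) ≤ |v * (a - b)| := le_abs_self _
      _ = |v| * |a - b| := abs_mul _ _
      _ ≤ |v| * (a + b) := by
        gcongr
        rw [abs_le]; constructor <;> linarith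
  have h2 : e * r1 ≤ e * ((a + b) / 2) := by
    gcongr; linarith
  nlinarith

/-- The entropy production on a face, with test function values `P`, `p`. -/
lemma entropy_face {v e R r Θ θ P p c So Si : ℝ} (he : 0 ≤ e) (hΘ : 0 < Θ) (hθ : 0 < θ)
    (hP : 0 ≤ P) (hp : 0 ≤ p)
    (hA : 0 ≤ r * (So - Si - c - 1) + c * (r * (θ / Θ)) + R)
    (hB : 0 ≤ R * (Si - So - c - 1) + c * (R * (Θ / θ)) + r) :
    -(v * (R * P - r * p))
      + ((R * So + r * Si) / 2 * v - 1 / 2 * |v| * (R * So - r * Si) - e * (R * So - r * Si))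
        * (P - p)
      - 1 / 2 * (|v| + e) * (-((R - r) * (So - Si) + (R * Θ - r * θ) * (c / Θ - c / θ))) * |P - p|
    ≤ c * (((R * Θ + r * θ) / 2 * v - 1 / 2 * |v| * (R * Θ - r * θ) - e * (R * Θ - r * θ))
        * (P / Θ - p / θ))
      + ((R + r) / 2 * v - 1 / 2 * |v| * (R - r) - e * (R - r))
        * ((So - c - 1) * P - (Si - c - 1) * p) := by
  have e1 : ((R * Θ + r * θ) / 2 * v - 1 / 2 * |v| * (R * Θ - r * θ) - e * (R * Θ - r * θ))
        * (P / Θ - p / θ)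
      = v / 2 * (R * P - R * (Θ / θ) * p + r * (θ / Θ) * P - r * p)
        - (1 / 2 * |v| + e) * (R * P - R * (Θ / θ) * p - r * (θ / Θ) * P + r * p) := by
    field_simp; ring
  have e2 : (R * Θ - r * θ) * (c / Θ - c / θ)
      = c * (R - R * (Θ / θ) - r * (θ / Θ) + r) := by
    field_simp; ring
  rw [e1, e2]
  set m := θ / Θ
  set n := Θ / θ
  -- `A` is the gap between the tangent plane of the entropy at the outer state and the entropy at
  -- the inner state; `B` is the gap with the states exchanged. Their sum is the entropy production
  -- of the face.
  set A := r * (So - Si - c - 1) + c * (r * m) + R with hAd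
  set B := R * (Si - So - c - 1) + c * (R * n) + r with hBd
  have hAB : -((R - r) * (So - Si) + c * (R - R * n - r * m + r)) = A + B := by
    rw [hAd, hBd]; ring
  rw [hAB]
  have hV := abs_nonneg v
  have hv1 := le_abs_self v
  have hv2 := neg_abs_le v
  set V := |v|
  -- The mean of the two test values multiplies a nonnegative combination of the gaps. Only the jump
  -- `P - p` multiplies something of indefinite sign, and this is the remainder estimated in `t2`.
  have key : c * (v / 2 * (R * P - R * n * p + r * m * P - r * p)
        - (1 / 2 * V + e) * (R * P - R * n * p - r * m * P + r * p))
      + ((R + r) / 2 * v - 1 / 2 * V * (R - r) - e * (R - r))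
        * ((So - c - 1) * P - (Si - c - 1) * p)
      - (-(v * (R * P - r * p))
        + ((R * So + r * Si) / 2 * v - 1 / 2 * V * (R * So - r * Si) - e * (R * So - r * Si))
          * (P - p))
      = (P + p) / 2 * ((V + v) / 2 * A + (V - v) / 2 * B + e * (A + B))
        + (P - p) * (1 / 4 * v * (A + B) + (1 / 2 * V + e) * ((A - B) / 2)) := by
    rw [hAd, hBd]; ring
  have t1 : 0 ≤ (P + p) / 2 * ((V + v) / 2 * A + (V - v) / 2 * B + e * (A + B)) := by
    have a1 := mul_nonneg (by linarith : 0 ≤ (V + v) / 2) hA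
    have a2 := mul_nonneg (by linarith : 0 ≤ (V - v) / 2) hB
    have a3 := mul_nonneg he (add_nonneg hA hB)
    apply mul_nonneg <;> linarith
  have t2 : |1 / 4 * v * (A + B) + (1 / 2 * V + e) * ((A - B) / 2)| ≤ 1 / 2 * (V + e) * (A + B) := by
    have b1 : |1 / 4 * v * (A + B)| ≤ 1 / 4 * V * (A + B) := by
      rw [abs_mul, abs_mul, abs_of_nonneg (add_nonneg hA hB)]
      norm_num [V]
    have b2 : |(1 / 2 * V + e) * ((A - B) / 2)| ≤ (1 / 2 * V + e) * ((A + B) / 2) := by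
      rw [abs_mul, abs_of_nonneg (by positivity)]
      gcongr
      rw [abs_le]; constructor <;> linarith
    refine (abs_add_le _ _).trans ((add_le_add b1 b2).trans (le_of_eq ?_))
    ring
  have t3 : -((P - p) * (1 / 4 * v * (A + B) + (1 / 2 * V + e) * ((A - B) / 2)))
      ≤ 1 / 2 * (V + e) * (A + B) * |P - p| := by
    refine (neg_le_abs _).trans ?_
    rw [abs_mul, mul_comm]
    gcongr
  linarith

/-! ## One step of the scheme -/

section Step

variable {d N : ℕ} [NeZero N]

/-- The viscous dissipation `𝕊_h : ∇_h u`. -/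
def stressPower (mu lam : ℝ) (u : Fin d → QFun d N) : QFun d N :=
  fun K => ∑ i, ∑ j, discStress mu lam u i j K * discGrad (u i) j K

/-- The stress is symmetric, so only the symmetric part of the velocity gradient contributes. The
dissipation is a combination of squares. -/
lemma stressPower_eq (mu lam : ℝ) (u : Fin d → QFun d N) (K : Cell d N) :
    stressPower mu lam u K
      = 2 * mu * (∑ i, ∑ j, discSymGrad u i j K ^ 2) + lam * discDiv u K ^ 2 := by
  have hsym : ∑ i, ∑ j, discSymGrad u i j K * discGrad (u i) j K
      = ∑ i, ∑ j, discSymGrad u i j K ^ 2 := by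
    have h1 : ∑ i, ∑ j, discSymGrad u i j K * discGrad (u i) j K
        = ∑ i, ∑ j, discSymGrad u i j K * discGrad (u j) i K := by
      rw [Finset.sum_comm]
      refine Finset.sum_congr rfl fun i _ => Finset.sum_congr rfl fun j _ => ?_
      simp only [discSymGrad]; ring
    have h2 : ∑ i, ∑ j, discSymGrad u i j K ^ 2
        = 1 / 2 * (∑ i, ∑ j, discSymGrad u i j K * discGrad (u i) j K
          + ∑ i, ∑ j, discSymGrad u i j K * discGrad (u j) i K) := by
      rw [← Finset.sum_add_distrib, Finset.mul_sum]
      refine Finset.sum_congr rfl fun i _ => ?_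
      rw [← Finset.sum_add_distrib, Finset.mul_sum]
      refine Finset.sum_congr rfl fun j _ => ?_
      simp only [discSymGrad]; ring
    rw [h2, ← h1]; ring
  have hdiv : ∑ i, ∑ j, (if i = j then lam * discDiv u K else 0) * discGrad (u i) j K
      = lam * discDiv u K ^ 2 := by
    simp only [ite_mul, zero_mul, Finset.sum_ite_eq, Finset.mem_univ, if_true]
    rw [← Finset.mul_sum]; simp only [discDiv]; ring
  rw [← hsym, ← hdiv, Finset.mul_sum, ← Finset.sum_add_distrib]
  refine Finset.sum_congr rfl fun i _ => ?_
  rw [Finset.mul_sum, ← Finset.sum_add_distrib]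
  refine Finset.sum_congr rfl fun j _ => ?_
  simp only [discStress]; ring

/-- One time step of the scheme in integrated form. -/
structure SchemeStep (mu lam kappa gamma eps dt : ℝ) (r0 r : QFun d N) (u0 u : Fin d → QFun d N)
    (th0 th : QFun d N) : Prop where
  cont : ∀ φ : QFun d N, cellInt (fun K => (r K - r0 K) / dt * φ K)
    = 1 / meshSize N * ∑ i, cellInt (fun K => diffFlux eps r u i K * jump φ i K)
  mom : ∀ φ : Fin d → QFun d N,
    cellInt (fun K => ∑ j, (r K * u j K - r0 K * u0 j K) / dt * φ j K)
    = 1 / meshSize N * ∑ i, cellInt (fun K => ∑ j,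
        diffFlux eps (fun L => r L * u j L) u i K * jump (φ j) i K)
      - cellInt (fun K => ∑ i, ∑ j,
        (discStress mu lam u i j K - if i = j then r K * th K else 0) * discGrad (φ i) j K)
  energy : ∀ φ : QFun d N,
    1 / (gamma - 1) * cellInt (fun K => (r K * th K - r0 K * th0 K) / dt * φ K)
    = 1 / meshSize N * ∑ i, cellInt (fun K =>
        1 / (gamma - 1) * (diffFlux eps (fun L => r L * th L) u i K * jump φ i K))
      - 1 / meshSize N * ∑ i, cellInt (fun K => kappa / meshSize N * jump th i K * jump φ i K)
      + cellInt (fun K => (stressPower mu lam u K - r K * th K * discDiv u K) * φ K)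

lemma sum_stress_sub (mu lam : ℝ) (u : Fin d → QFun d N) (p : ℝ) (K : Cell d N) :
    ∑ i, ∑ j, (discStress mu lam u i j K - if i = j then p else 0) * discGrad (u i) j K
      = stressPower mu lam u K - p * discDiv u K := by
  simp only [sub_mul, ite_mul, zero_mul, Finset.sum_sub_distrib, Finset.sum_ite_eq,
    Finset.mem_univ, if_true]
  rw [← Finset.mul_sum]; rfl

/-- Positive temperature removes the truncation in the pressure, and face integrals become cell
sums; later estimates see the scheme only in this form. -/
lemma IsFVSolution.schemeStep (hd : 0 < d) {mu lam kappa gamma eps : ℝ} {NT : ℕ} {dt : ℝ}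
    {rho0 : Pt d → ℝ} {u0 : Fin d → Pt d → ℝ} {theta0 : Pt d → ℝ} {w : FVFields d N}
    (hw : IsFVSolution mu lam kappa gamma eps NT dt rho0 u0 theta0 w) {k : ℕ} (hk : k < NT)
    (hpos : ∀ K, 0 < w.temp (k + 1) K) :
    SchemeStep mu lam kappa gamma eps dt (w.rho k) (w.rho (k + 1)) (w.vel k) (w.vel (k + 1))
      (w.temp k) (w.temp (k + 1)) := by
  have hp : ∀ K, w.press (k + 1) K = w.rho (k + 1) K * w.temp (k + 1) K := fun K => by
    simp [FVFields.press, discPressure, hpos K]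
  refine ⟨fun φ => ?_, fun φ => ?_, fun φ => ?_⟩
  · have := hw.continuity k hk φ
    rw [faceInt_eq hd] at this
    linarith
  · have := hw.momentum k hk φ
    rw [faceInt_eq hd] at this
    simp only [hp] at this
    linarith
  · have := hw.energy k hk φ
    rw [faceInt_eq hd, faceInt_eq hd] at this
    simp only [hp, sum_stress_sub] at this
    have h2 : ∀ i, cellInt (fun K => 1 / (gamma - 1) *
        (diffFlux eps (fun L => w.rho (k + 1) L * w.temp (k + 1) L) (w.vel (k + 1)) i K
          * jump φ i K)) = 1 / (gamma - 1) * cellInt (fun K =>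
        (diffFlux eps (fun L => w.rho (k + 1) L * w.temp (k + 1) L) (w.vel (k + 1)) i K
          * jump φ i K)) := fun i => cellInt_const_mul _ _
    simp only [h2]
    rw [← Finset.mul_sum]
    linarith

end Step

/-! ### Energy, density and entropy balances of one time step. -/

section StepEstimates

variable {d N : ℕ} [NeZero N] {mu lam kappa gamma eps dt : ℝ} {r0 r : QFun d N}
  {u0 u : Fin d → QFun d N} {th0 th : QFun d N}

/-- The momentum equation is tested with `u` and the continuity equation with |u|²/2, and the two
are subtracted. The implicit step leaves the nonnegative term ½ϱ⁰|u - u⁰|², which is dropped; the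
faces contribute the dissipation of `kinetic_face`. -/
lemma SchemeStep.kinetic (hs : SchemeStep mu lam kappa gamma eps dt r0 r u0 u th0 th)
    (hdt : 0 < dt) {r1 : ℝ} (hr1 : 0 < r1) (hr : ∀ K, r1 ≤ r K) (hr0 : ∀ K, 0 ≤ r0 K) :
    cellInt (fun K => r K * (1 / 2 * ∑ j, u j K ^ 2))
      - cellInt (fun K => r0 K * (1 / 2 * ∑ j, u0 j K ^ 2))
      + dt * (meshSize N ^ eps * r1
          * (1 / meshSize N * ∑ i, cellInt (fun K => ∑ j, jump (u j) i K ^ 2)))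
      + dt * cellInt (fun K => stressPower mu lam u K - r K * th K * discDiv u K) ≤ 0 := by
  have hh := meshSize_pos (N := N)
  have he : 0 ≤ meshSize N ^ eps := Real.rpow_nonneg hh.le _
  have hm := hs.mom u
  have hc := hs.cont (fun K => 1 / 2 * ∑ j, u j K ^ 2)
  simp only [sum_stress_sub] at hm
  have hT : cellInt (fun K => r K * (1 / 2 * ∑ j, u j K ^ 2))
      - cellInt (fun K => r0 K * (1 / 2 * ∑ j, u0 j K ^ 2))
      ≤ dt * (cellInt (fun K => ∑ j, (r K * u j K - r0 K * u0 j K) / dt * u j K)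
        - cellInt (fun K => (r K - r0 K) / dt * (1 / 2 * ∑ j, u j K ^ 2))) := by
    rw [← cellInt_sub, ← cellInt_sub, ← cellInt_const_mul]
    refine cellInt_mono fun K => ?_
    have : 0 ≤ ∑ j, r0 K * (1 / 2) * (u j K - u0 j K) ^ 2 :=
      Finset.sum_nonneg fun j _ => by have := hr0 K; positivity
    have e : dt * (∑ j, (r K * u j K - r0 K * u0 j K) / dt * u j K
        - (r K - r0 K) / dt * (1 / 2 * ∑ j, u j K ^ 2))
        = r K * (1 / 2 * ∑ j, u j K ^ 2) - r0 K * (1 / 2 * ∑ j, u0 j K ^ 2)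
          + ∑ j, r0 K * (1 / 2) * (u j K - u0 j K) ^ 2 := by
      simp only [Finset.mul_sum, mul_sub, ← Finset.sum_sub_distrib, ← Finset.sum_add_distrib]
      refine Finset.sum_congr rfl fun j _ => ?_
      field_simp; ring
    rw [e]; linarith
  have hF : 1 / meshSize N * ∑ i, cellInt (fun K => ∑ j,
        diffFlux eps (fun L => r L * u j L) u i K * jump (u j) i K)
      - 1 / meshSize N * ∑ i, cellInt (fun K => diffFlux eps r u i K
          * jump (fun K => 1 / 2 * ∑ j, u j K ^ 2) i K)
      ≤ -(meshSize N ^ eps * r1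
          * (1 / meshSize N * ∑ i, cellInt (fun K => ∑ j, jump (u j) i K ^ 2))) := by
    have : ∀ i, cellInt (fun K => ∑ j, diffFlux eps (fun L => r L * u j L) u i K * jump (u j) i K)
        - cellInt (fun K => diffFlux eps r u i K * jump (fun K => 1 / 2 * ∑ j, u j K ^ 2) i K)
        ≤ -(meshSize N ^ eps * r1 * cellInt (fun K => ∑ j, jump (u j) i K ^ 2)) := by
      intro i
      rw [← cellInt_sub, ← cellInt_const_mul, ← cellInt_neg]
      refine cellInt_mono fun K => ?_
      have e : jump (fun K => 1 / 2 * ∑ j, u j K ^ 2) i K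
          = ∑ j, 1 / 2 * (u j (next i K) ^ 2 - u j K ^ 2) := by
        simp only [jump, Finset.mul_sum, mul_sub, Finset.sum_sub_distrib]
      rw [e, Finset.mul_sum, Finset.mul_sum, ← Finset.sum_sub_distrib, ← Finset.sum_neg_distrib]
      refine Finset.sum_le_sum fun j _ => ?_
      exact kinetic_face he (hr (next i K)) (hr K) hr1
    have h2 := Finset.sum_le_sum fun i (_ : i ∈ Finset.univ) => this i
    rw [Finset.sum_sub_distrib, Finset.sum_neg_distrib, ← Finset.mul_sum] at h2
    have h3 := mul_le_mul_of_nonneg_left h2 (by positivity : 0 ≤ 1 / meshSize N)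
    linarith
  have h4 := mul_le_mul_of_nonneg_left hF hdt.le
  rw [hm, hc] at hT
  linarith

/-- The internal energy equation tested with 1 has neither fluxes nor heat conduction left, and its
right-hand side cancels the viscous and pressure work in the kinetic energy balance. -/
lemma SchemeStep.total_energy (hs : SchemeStep mu lam kappa gamma eps dt r0 r u0 u th0 th)
    (hdt : 0 < dt) {r1 : ℝ} (hr1 : 0 < r1) (hr : ∀ K, r1 ≤ r K) (hr0 : ∀ K, 0 ≤ r0 K) :
    cellInt (fun K => r K * (1 / 2 * ∑ j, u j K ^ 2))
      + 1 / (gamma - 1) * cellInt (fun K => r K * th K)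
      + dt * (meshSize N ^ eps * r1
          * (1 / meshSize N * ∑ i, cellInt (fun K => ∑ j, jump (u j) i K ^ 2)))
      ≤ cellInt (fun K => r0 K * (1 / 2 * ∑ j, u0 j K ^ 2))
      + 1 / (gamma - 1) * cellInt (fun K => r0 K * th0 K) := by
  have h1 := hs.kinetic hdt hr1 hr hr0
  have h2 := hs.energy (fun _ => 1)
  have h3 : cellInt (fun K => (r K * th K - r0 K * th0 K) / dt * 1)
      = 1 / dt * (cellInt (fun K => r K * th K) - cellInt (fun K => r0 K * th0 K)) := by
    rw [← cellInt_sub, ← cellInt_const_mul]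
    congr 1; funext K; ring
  simp only [jump, sub_self, mul_zero, cellInt_const, Finset.sum_const_zero, zero_add,
    mul_one] at h2 h3
  rw [h3] at h2
  have h4 : 1 / (gamma - 1) * (cellInt (fun K => r K * th K) - cellInt (fun K => r0 K * th0 K))
      = dt * cellInt (fun K => stressPower mu lam u K - r K * th K * discDiv u K) := by
    rw [← h2]; field_simp
  linarith

lemma sum_cellInt_avg_mul_jump (r : QFun d N) (u : Fin d → QFun d N) :
    1 / meshSize N * ∑ i, cellInt (fun K => avg (u i) i K * jump r i K)
      = -cellInt (fun K => r K * discDiv u K) := by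
  rw [Finset.mul_sum]
  simp only [cellInt_avg_mul_jump, Finset.sum_neg_distrib, discDiv, Finset.mul_sum, cellInt_sum]

/-- Testing continuity with the density itself: {{ϱ}}⟦ϱ⟧ = ½⟦ϱ²⟧ turns the central flux into a term
with the divergence, while upwinding and the `h^ε` diffusion leave weighted squares of density
jumps. -/
lemma SchemeStep.density (hs : SchemeStep mu lam kappa gamma eps dt r0 r u0 u th0 th)
    (hdt : 0 < dt) :
    1 / 2 * cellInt (fun K => r K ^ 2) - 1 / 2 * cellInt (fun K => r0 K ^ 2)
      + dt * (1 / meshSize N * ∑ i, cellInt (fun K =>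
          (1 / 2 * |avg (u i) i K| + meshSize N ^ eps) * jump r i K ^ 2))
      ≤ -(dt * (1 / 2 * cellInt (fun K => r K ^ 2 * discDiv u K))) := by
  have hc := hs.cont r
  have hT : 1 / 2 * cellInt (fun K => r K ^ 2) - 1 / 2 * cellInt (fun K => r0 K ^ 2)
      ≤ dt * cellInt (fun K => (r K - r0 K) / dt * r K) := by
    rw [← cellInt_const_mul, ← cellInt_const_mul, ← cellInt_sub, ← cellInt_const_mul]
    refine cellInt_mono fun K => ?_
    have e : dt * ((r K - r0 K) / dt * r K) = (r K - r0 K) * r K := by field_simp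
    rw [e]; nlinarith [sq_nonneg (r K - r0 K)]
  have hF : ∑ i, cellInt (fun K => diffFlux eps r u i K * jump r i K)
      = 1 / 2 * ∑ i, cellInt (fun K => avg (u i) i K * jump (fun K => r K ^ 2) i K)
        - ∑ i, cellInt (fun K =>
          (1 / 2 * |avg (u i) i K| + meshSize N ^ eps) * jump r i K ^ 2) := by
    rw [Finset.mul_sum, ← Finset.sum_sub_distrib]
    refine Finset.sum_congr rfl fun i _ => ?_
    rw [← cellInt_const_mul, ← cellInt_sub]
    congr 1; funext K; simp only [diffFlux, upwind, jump, avg]; ring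
  have hD := sum_cellInt_avg_mul_jump (fun K => r K ^ 2) u
  rw [hc, hF] at hT
  have : 1 / meshSize N * (1 / 2 * ∑ i, cellInt (fun K => avg (u i) i K * jump (fun K => r K ^ 2) i K)
        - ∑ i, cellInt (fun K =>
          (1 / 2 * |avg (u i) i K| + meshSize N ^ eps) * jump r i K ^ 2))
      = -(1 / 2 * cellInt (fun K => r K ^ 2 * discDiv u K)) - 1 / meshSize N * ∑ i, cellInt (fun K =>
          (1 / 2 * |avg (u i) i K| + meshSize N ^ eps) * jump r i K ^ 2) := by
    linear_combination (1 / 2) * hD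
  rw [this] at hT
  linarith

/-- The entropy production `-⟦(ϱ,ϱϑ)⟧ · ⟦∇η⟧ ≥ 0` across a face, `η(ϱ,ϱϑ) = ϱ s(ϱ,ϑ)`. -/
def entropyProd (gamma : ℝ) (r th : QFun d N) (i : Fin d) (K : Cell d N) : ℝ :=
  -(jump r i K * jump (discEntropy gamma r th) i K
    + jump (fun L => r L * th L) i K * jump (fun L => 1 / (gamma - 1) / th L) i K)

/-- The production is the sum of the two tangent plane gaps between the states on either side of the
face. -/
lemma entropyProd_nonneg (hg : 1 < gamma) (hr : ∀ K, 0 < r K) (hth : ∀ K, 0 < th K)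
    (i : Fin d) (K : Cell d N) : 0 ≤ entropyProd gamma r th i K := by
  have hA := entropy_concave hg (hr K) (hr (next i K)) (hth K) (hth (next i K))
  have hB := entropy_concave hg (hr (next i K)) (hr K) (hth (next i K)) (hth K)
  have h1 := (hth K).ne'
  have h2 := (hth (next i K)).ne'
  have e : entropyProd gamma r th i K = (r K * (entropy gamma (r (next i K)) (th (next i K))
      - entropy gamma (r K) (th K) - 1 / (gamma - 1) - 1)
      + 1 / (gamma - 1) * (r K * (th K / th (next i K))) + r (next i K))
      + (r (next i K) * (entropy gamma (r K) (th K) - entropy gamma (r (next i K)) (th (next i K))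
        - 1 / (gamma - 1) - 1)
      + 1 / (gamma - 1) * (r (next i K) * (th (next i K) / th K)) + r K) := by
    simp only [entropyProd, jump, discEntropy]
    set c := 1 / (gamma - 1)
    field_simp; ring
  rw [e]; exact add_nonneg hA hB

/-- The discrete entropy inequality. -/
lemma SchemeStep.entropy_ineq (hs : SchemeStep mu lam kappa gamma eps dt r0 r u0 u th0 th)
    (hdt : 0 < dt) (hg : 1 < gamma) (hr : ∀ K, 0 < r K) (hr0 : ∀ K, 0 < r0 K)
    (hth : ∀ K, 0 < th K) (hth0 : ∀ K, 0 < th0 K) {Φ : QFun d N} (hΦ : ∀ K, 0 ≤ Φ K) :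
    1 / meshSize N * ∑ i, cellInt (fun K =>
        diffFlux eps (fun L => r L * discEntropy gamma r th L) u i K * jump Φ i K)
      - 1 / meshSize N * ∑ i, cellInt (fun K => 1 / 2 * (|avg (u i) i K| + meshSize N ^ eps)
        * entropyProd gamma r th i K * |jump Φ i K|)
      + 1 / meshSize N * ∑ i, cellInt (fun K => kappa / meshSize N
        * (avg Φ i K * (jump th i K ^ 2 / (th (next i K) * th K))))
      - 1 / meshSize N * ∑ i, cellInt (fun K => kappa / meshSize N
        * (jump th i K * avg (fun L => 1 / th L) i K * jump Φ i K))
      + cellInt (fun K => stressPower mu lam u K * (Φ K / th K))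
    ≤ cellInt (fun K => (r K * discEntropy gamma r th K - r0 K * discEntropy gamma r0 th0 K) / dt
        * Φ K) := by
  have hh := meshSize_pos (N := N)
  have he : 0 ≤ meshSize N ^ eps := Real.rpow_nonneg hh.le _
  set c := 1 / (gamma - 1) with hc_def
  set s := discEntropy gamma r th with hs_def
  -- The gradient of η(ϱ, m) = ϱ s with m = ϱϑ is (s - c - 1, c/ϑ). These components times `Φ` are
  -- the test functions in the continuity and internal energy equations.
  have hE := hs.energy (fun K => Φ K / th K)
  have hC := hs.cont (fun K => (s K - c - 1) * Φ K)
  rw [← cellInt_const_mul] at hE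
  -- Concavity in time: the tangent plane at the new state, evaluated at the old one, lies above the
  -- old entropy.
  have hT : cellInt (fun K => c * ((r K * th K - r0 K * th0 K) / dt * (Φ K / th K)))
      + cellInt (fun K => (r K - r0 K) / dt * ((s K - c - 1) * Φ K))
      ≤ cellInt (fun K => (r K * s K - r0 K * discEntropy gamma r0 th0 K) / dt * Φ K) := by
    rw [← cellInt_add]
    refine cellInt_mono fun K => ?_
    have hA := entropy_concave hg (hr0 K) (hr K) (hth0 K) (hth K)
    have h1 := (hth K).ne'
    have e : (r K * s K - r0 K * discEntropy gamma r0 th0 K) / dt * Φ K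
        - (c * ((r K * th K - r0 K * th0 K) / dt * (Φ K / th K))
          + (r K - r0 K) / dt * ((s K - c - 1) * Φ K))
        = (r0 K * (entropy gamma (r K) (th K) - entropy gamma (r0 K) (th0 K) - c - 1)
          + c * (r0 K * (th0 K / th K)) + r K) * (Φ K / dt) := by
      simp only [hs_def, discEntropy]
      field_simp; ring
    have := mul_nonneg hA (div_nonneg (hΦ K) hdt.le)
    linarith
  have hF : ∀ i, -cellInt (fun K => avg (u i) i K * jump (fun L => r L * Φ L) i K)
      + cellInt (fun K => diffFlux eps (fun L => r L * s L) u i K * jump Φ i K)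
      - cellInt (fun K => 1 / 2 * (|avg (u i) i K| + meshSize N ^ eps)
        * entropyProd gamma r th i K * |jump Φ i K|)
      ≤ cellInt (fun K => c * (diffFlux eps (fun L => r L * th L) u i K
          * jump (fun K => Φ K / th K) i K))
        + cellInt (fun K => diffFlux eps r u i K * jump (fun K => (s K - c - 1) * Φ K) i K) := by
    intro i
    rw [← cellInt_neg, ← cellInt_add, ← cellInt_sub, ← cellInt_add]
    refine cellInt_mono fun K => ?_
    exact entropy_face he (hth (next i K)) (hth K) (hΦ (next i K)) (hΦ K)
      (entropy_concave hg (hr K) (hr (next i K)) (hth K) (hth (next i K)))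
      (entropy_concave hg (hr (next i K)) (hr K) (hth (next i K)) (hth K))
  have hF' := Finset.sum_le_sum fun i (_ : i ∈ Finset.univ) => hF i
  simp only [Finset.sum_add_distrib, Finset.sum_sub_distrib, Finset.sum_neg_distrib] at hF'
  have hF'' := mul_le_mul_of_nonneg_left hF' (by positivity : 0 ≤ 1 / meshSize N)
  have hdiv := sum_cellInt_avg_mul_jump (fun L => r L * Φ L) u
  -- Discrete product rule for ⟦Φ/ϑ⟧. It separates conduction, which carries ⟦Φ⟧, from entropy
  -- production, which carries the average of `Φ`.
  have hκ : ∑ i, cellInt (fun K => kappa / meshSize N * jump th i K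
        * jump (fun K => Φ K / th K) i K)
      = ∑ i, cellInt (fun K => kappa / meshSize N
        * (jump th i K * avg (fun L => 1 / th L) i K * jump Φ i K))
      - ∑ i, cellInt (fun K => kappa / meshSize N
        * (avg Φ i K * (jump th i K ^ 2 / (th (next i K) * th K)))) := by
    rw [← Finset.sum_sub_distrib]
    refine Finset.sum_congr rfl fun i _ => ?_
    rw [← cellInt_sub]
    congr 1; funext K
    have h1 := (hth K).ne'
    have h2 := (hth (next i K)).ne'
    simp only [jump, avg]
    set q := kappa / meshSize N
    field_simp; ring
  -- After division by the temperature the pressure work becomes ∫ ϱΦ div u. By `hdiv` this cancels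
  -- the term -{{u}}·n⟦ϱΦ⟧ that `entropy_face` leaves on the faces.
  have hp : cellInt (fun K => (stressPower mu lam u K - r K * th K * discDiv u K) * (Φ K / th K))
      = cellInt (fun K => stressPower mu lam u K * (Φ K / th K))
        - cellInt (fun K => r K * Φ K * discDiv u K) := by
    rw [← cellInt_sub]
    congr 1; funext K
    have h1 := (hth K).ne'
    field_simp
  rw [hκ, hp] at hE
  rw [hE, hC] at hT
  refine le_trans ?_ hT
  linarith

end StepEstimates

/-! ## Consistency of the numerical fluxes -/

section Consistency

variable {d N : ℕ} [NeZero N]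

/-- `a` and `g` behave like the projections of a `W^{2,∞}` function and of its gradient. -/
structure DiscTest (M : ℝ) (a : QFun d N) (g : Fin d → QFun d N) : Prop where
  val_le : ∀ K, |a K| ≤ M
  grad_le : ∀ i K, |g i K| ≤ M
  jump_sub : ∀ i K, |jump a i K - meshSize N * g i K| ≤ M * meshSize N ^ 2
  jump_grad : ∀ i j K, |jump (g i) j K| ≤ M * meshSize N

lemma meshSize_le_one : meshSize N ≤ 1 := by
  have : (1 : ℝ) ≤ N := Nat.one_le_cast.2 (Nat.pos_of_ne_zero (NeZero.ne N))
  unfold meshSize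
  rw [div_le_one (by linarith)]; exact this

section DiscTest

variable {M : ℝ} {a : QFun d N} {g : Fin d → QFun d N} (ht : DiscTest M a g)

include ht

lemma DiscTest.nonneg : 0 ≤ M := (abs_nonneg _).trans (ht.val_le 0)

lemma DiscTest.abs_jump_le (i : Fin d) (K : Cell d N) : |jump a i K| ≤ 2 * M * meshSize N := by
  have hh := meshSize_pos (N := N)
  have h1 := ht.jump_sub i K
  have h2 := ht.grad_le i K
  have h3 : |meshSize N * g i K| ≤ M * meshSize N := by
    rw [abs_mul, abs_of_pos hh]; nlinarith
  have h4 : M * meshSize N ^ 2 ≤ M * meshSize N := by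
    have := meshSize_le_one (N := N)
    have := mul_nonneg ht.nonneg hh.le
    nlinarith
  have h5 := abs_add_le (jump a i K - meshSize N * g i K) (meshSize N * g i K)
  rw [sub_add_cancel] at h5
  linarith

lemma DiscTest.abs_grad_sub_prev (i j : Fin d) (K : Cell d N) :
    |g i K - g i (prev j K)| ≤ M * meshSize N := by
  have := ht.jump_grad i j (prev j K)
  simpa only [jump, next_prev] using this

lemma DiscTest.abs_jump_prev_sub (i : Fin d) (K : Cell d N) :
    |jump a i (prev i K) - meshSize N * g i K| ≤ 2 * M * meshSize N ^ 2 := by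
  have hh := meshSize_pos (N := N)
  have h1 := ht.jump_sub i (prev i K)
  have h2 : |meshSize N * (g i K - g i (prev i K))| ≤ M * meshSize N ^ 2 := by
    rw [abs_mul, abs_of_pos hh]
    have := ht.abs_grad_sub_prev i i K
    nlinarith
  have h3 := abs_sub (jump a i (prev i K) - meshSize N * g i (prev i K))
    (meshSize N * (g i K - g i (prev i K)))
  have e : jump a i (prev i K) - meshSize N * g i (prev i K)
    - meshSize N * (g i K - g i (prev i K)) = jump a i (prev i K) - meshSize N * g i K := by ring
  rw [e] at h3
  linarith

/-- The second difference gains a full power of `h` over a single jump. This is what makes the `h^ε`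
diffusion, after summation by parts, an error of order `h^{1+ε}`. -/
lemma DiscTest.abs_jump_sub_prev (i : Fin d) (K : Cell d N) :
    |jump a i K - jump a i (prev i K)| ≤ 3 * M * meshSize N ^ 2 := by
  have h1 := ht.jump_sub i K
  have h2 := ht.abs_jump_prev_sub i K
  have h3 := abs_sub (jump a i K - meshSize N * g i K)
    (jump a i (prev i K) - meshSize N * g i K)
  rw [sub_sub_sub_cancel_right] at h3
  linarith

lemma DiscTest.abs_discGrad_sub (i : Fin d) (K : Cell d N) :
    |discGrad a i K - g i K| ≤ 2 * M * meshSize N := by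
  have hh := meshSize_pos (N := N)
  have h1 := ht.jump_sub i K
  have h2 := ht.abs_jump_prev_sub i K
  have e : discGrad a i K - g i K = ((jump a i K - meshSize N * g i K)
      + (jump a i (prev i K) - meshSize N * g i K)) / (2 * meshSize N) := by
    rw [discGrad_eq_jump]; field_simp; ring
  have h3 := abs_add_le (jump a i K - meshSize N * g i K)
    (jump a i (prev i K) - meshSize N * g i K)
  have hM := ht.nonneg
  rw [e, abs_div, abs_of_pos (by positivity : 0 < 2 * meshSize N), div_le_iff₀ (by positivity)]
  nlinarith [mul_nonneg hM (sq_nonneg (meshSize N))]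

/-- This plays the role of bounded second derivatives when the viscous term is integrated by parts.
-/
lemma DiscTest.abs_discGrad_grad_le (i j : Fin d) (K : Cell d N) : |discGrad (g i) j K| ≤ M := by
  have hh := meshSize_pos (N := N)
  have h1 := ht.jump_grad i j K
  have h2 := ht.jump_grad i j (prev j K)
  rw [discGrad_eq_jump, abs_div, abs_of_pos (by positivity : 0 < 2 * meshSize N),
    div_le_iff₀ (by positivity)]
  have := abs_add_le (jump (g i) j K) (jump (g i) j (prev j K))
  linarith

end DiscTest

/-- Consistency of the diffusive upwind flux. -/
lemma flux_consistency {eps M : ℝ} {a : QFun d N} {g : Fin d → QFun d N} (ht : DiscTest M a g)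
    (r : QFun d N) (u : Fin d → QFun d N) (i : Fin d) :
    |1 / meshSize N * cellInt (fun K => diffFlux eps r u i K * jump a i K)
      - cellInt (fun K => r K * u i K * g i K)|
    ≤ M * (2 * meshSize N * cellInt (fun K => |r K| * |u i K|)
      + 1 / 2 * cellInt (fun K => |jump r i K| * |jump (u i) i K|)
      + meshSize N * cellInt (fun K => |r K| * |discGrad (u i) i K|)
      + 2 * meshSize N * cellInt (fun K => |r K| * |avg (u i) i (prev i K)|)
      + 3 * meshSize N ^ (1 + eps) * cellInt (fun K => |r K|)) := by
  have hh := meshSize_pos (N := N)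
  have he : 0 < meshSize N ^ eps := Real.rpow_pos_of_pos hh _
  have hM := ht.nonneg
  have hpow : meshSize N ^ (1 + eps) = meshSize N * meshSize N ^ eps := by
    rw [Real.rpow_add hh, Real.rpow_one]
  set h := meshSize N with hdef
  -- The four errors are: replacing ∇_h a by `g`; the product of jumps separating {{r}}{{u}} from
  -- {{ru}}; the upwind term; and the `h^ε` diffusion. In the last two the jump of `r` has been
  -- moved onto the test function by summation by parts, so no jump of `r` remains there.
  have key : 1 / h * cellInt (fun K => diffFlux eps r u i K * jump a i K)
      - cellInt (fun K => r K * u i K * g i K)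
      = cellInt (fun K => r K * u i K * (discGrad a i K - g i K))
        + (cellInt (fun K => -(1 / (4 * h)) * (jump r i K * jump (u i) i K * jump a i K))
        + (cellInt (fun K => 1 / (2 * h) * (r K * (|avg (u i) i K| * jump a i K
            - |avg (u i) i (prev i K)| * jump a i (prev i K))))
        + cellInt (fun K => h ^ eps / h * (r K * (jump a i K - jump a i (prev i K)))))) := by
    have e1 := cellInt_avg_mul_jump' a (fun K => r K * u i K) i
    have e2 := cellInt_mul_jump i r (fun K => |avg (u i) i K| * jump a i K)
    have e3 := cellInt_mul_jump i r (fun K => jump a i K)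
    have e0 : cellInt (fun K => diffFlux eps r u i K * jump a i K)
        = cellInt (fun K => avg (fun K => r K * u i K) i K * jump a i K)
          - 1 / 4 * cellInt (fun K => jump r i K * jump (u i) i K * jump a i K)
          - 1 / 2 * cellInt (fun K => |avg (u i) i K| * jump a i K * jump r i K)
          - h ^ eps * cellInt (fun K => jump a i K * jump r i K) := by
      rw [← cellInt_const_mul, ← cellInt_const_mul, ← cellInt_const_mul, ← cellInt_sub,
        ← cellInt_sub, ← cellInt_sub]
      congr 1; funext K; simp only [diffFlux, upwind, avg, jump]; ring
    rw [e0, e2, e3, cellInt_const_mul, cellInt_const_mul, cellInt_const_mul]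
    have e4 : cellInt (fun K => r K * u i K * (discGrad a i K - g i K))
        = cellInt (fun K => r K * u i K * discGrad a i K)
          - cellInt (fun K => r K * u i K * g i K) := by
      rw [← cellInt_sub]; congr 1; funext K; ring
    rw [e4, ← e1, ← hdef]; ring
  have b1 : |cellInt (fun K => r K * u i K * (discGrad a i K - g i K))|
      ≤ M * (2 * h * cellInt (fun K => |r K| * |u i K|)) := by
    rw [← cellInt_const_mul, ← cellInt_const_mul]
    refine abs_cellInt_le_of_le fun K => ?_
    rw [abs_mul, abs_mul]
    calc |r K| * |u i K| * |discGrad a i K - g i K|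
        ≤ |r K| * |u i K| * (2 * M * h) := by gcongr; exact ht.abs_discGrad_sub i K
      _ = _ := by ring
  have b2 : |cellInt (fun K => -(1 / (4 * h)) * (jump r i K * jump (u i) i K * jump a i K))|
      ≤ M * (1 / 2 * cellInt (fun K => |jump r i K| * |jump (u i) i K|)) := by
    rw [← cellInt_const_mul, ← cellInt_const_mul]
    refine abs_cellInt_le_of_le fun K => ?_
    rw [abs_mul, abs_mul, abs_mul, abs_neg, abs_of_pos (by positivity : 0 < 1 / (4 * h))]
    calc 1 / (4 * h) * (|jump r i K| * |jump (u i) i K| * |jump a i K|)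
        ≤ 1 / (4 * h) * (|jump r i K| * |jump (u i) i K| * (2 * M * h)) := by
          gcongr; exact ht.abs_jump_le i K
      _ = _ := by field_simp; ring
  have b3 : |cellInt (fun K => 1 / (2 * h) * (r K * (|avg (u i) i K| * jump a i K
            - |avg (u i) i (prev i K)| * jump a i (prev i K))))|
      ≤ M * (h * cellInt (fun K => |r K| * |discGrad (u i) i K|)
        + 2 * h * cellInt (fun K => |r K| * |avg (u i) i (prev i K)|)) := by
    rw [← cellInt_const_mul, ← cellInt_const_mul, ← cellInt_add, ← cellInt_const_mul]
    refine abs_cellInt_le_of_le fun K => ?_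
    have c1 : |avg (u i) i K| - |avg (u i) i (prev i K)| ≤ h * |discGrad (u i) i K| ∧
        -(h * |discGrad (u i) i K|) ≤ |avg (u i) i K| - |avg (u i) i (prev i K)| := by
      have e : h * |discGrad (u i) i K| = |avg (u i) i K - avg (u i) i (prev i K)| := by
        have e' : avg (u i) i K - avg (u i) i (prev i K) = h * discGrad (u i) i K := by
          simp only [discGrad, ← hdef]; field_simp
        rw [e', abs_mul, abs_of_pos hh]
      rw [e]
      have := abs_le.1 (abs_abs_sub_abs_le (avg (u i) i K) (avg (u i) i (prev i K)))
      exact ⟨this.2, this.1⟩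
    have c2 : |(|avg (u i) i K| * jump a i K - |avg (u i) i (prev i K)| * jump a i (prev i K))|
        ≤ h * |discGrad (u i) i K| * (2 * M * h) + |avg (u i) i (prev i K)| * (3 * M * h ^ 2) := by
      -- Product rule: either the modulus of the face velocity is differenced, which costs `h` times
      -- the discrete gradient, or the jump of `a` is, which is a second difference.
      have e : |avg (u i) i K| * jump a i K - |avg (u i) i (prev i K)| * jump a i (prev i K)
          = (|avg (u i) i K| - |avg (u i) i (prev i K)|) * jump a i K
            + |avg (u i) i (prev i K)| * (jump a i K - jump a i (prev i K)) := by ring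
      rw [e]
      refine (abs_add_le _ _).trans ?_
      rw [abs_mul, abs_mul, abs_abs]
      gcongr
      · exact abs_le.2 ⟨c1.2, c1.1⟩
      · exact ht.abs_jump_le i K
      · exact ht.abs_jump_sub_prev i K
    rw [abs_mul, abs_mul, abs_of_pos (by positivity : 0 < 1 / (2 * h))]
    calc _ ≤ 1 / (2 * h) * (|r K| * (h * |discGrad (u i) i K| * (2 * M * h)
          + |avg (u i) i (prev i K)| * (3 * M * h ^ 2))) := by gcongr
      _ = M * (h * (|r K| * |discGrad (u i) i K|)
          + 3 / 2 * h * (|r K| * |avg (u i) i (prev i K)|)) := by field_simp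
      _ ≤ _ := by gcongr; norm_num
  have b4 : |cellInt (fun K => h ^ eps / h * (r K * (jump a i K - jump a i (prev i K))))|
      ≤ M * (3 * (h * h ^ eps) * cellInt (fun K => |r K|)) := by
    rw [← cellInt_const_mul, ← cellInt_const_mul]
    refine abs_cellInt_le_of_le fun K => ?_
    rw [abs_mul, abs_mul, abs_of_pos (by positivity : 0 < h ^ eps / h)]
    calc h ^ eps / h * (|r K| * |jump a i K - jump a i (prev i K)|)
        ≤ h ^ eps / h * (|r K| * (3 * M * h ^ 2)) := by
          gcongr; exact ht.abs_jump_sub_prev i K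
      _ = _ := by field_simp
  rw [key, hpow]
  have t1 := abs_add_le (cellInt (fun K => r K * u i K * (discGrad a i K - g i K)))
    (cellInt (fun K => -(1 / (4 * h)) * (jump r i K * jump (u i) i K * jump a i K))
        + (cellInt (fun K => 1 / (2 * h) * (r K * (|avg (u i) i K| * jump a i K
            - |avg (u i) i (prev i K)| * jump a i (prev i K))))
        + cellInt (fun K => h ^ eps / h * (r K * (jump a i K - jump a i (prev i K))))))
  have t2 := abs_add_le (cellInt (fun K => -(1 / (4 * h))
      * (jump r i K * jump (u i) i K * jump a i K)))
    (cellInt (fun K => 1 / (2 * h) * (r K * (|avg (u i) i K| * jump a i K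
            - |avg (u i) i (prev i K)| * jump a i (prev i K))))
        + cellInt (fun K => h ^ eps / h * (r K * (jump a i K - jump a i (prev i K)))))
  have t3 := abs_add_le (cellInt (fun K => 1 / (2 * h) * (r K * (|avg (u i) i K| * jump a i K
            - |avg (u i) i (prev i K)| * jump a i (prev i K)))))
    (cellInt (fun K => h ^ eps / h * (r K * (jump a i K - jump a i (prev i K)))))
  linarith

/-! ## Size of one time level -/

/-- The kinetic energy, viscous and numerical dissipations of one time level. -/
def levelSize (eps : ℝ) (r : QFun d N) (u : Fin d → QFun d N) (th : QFun d N) : ℝ :=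
  1 + cellInt (fun K => ∑ j, u j K ^ 2)
    + cellInt (fun K => ∑ i, ∑ j, discSymGrad u i j K ^ 2)
    + meshSize N ^ eps * (1 / meshSize N * ∑ i, cellInt (fun K => ∑ j, jump (u j) i K ^ 2))
    + 1 / meshSize N * ∑ i, cellInt (fun K =>
        (1 / 2 * |avg (u i) i K| + meshSize N ^ eps) * jump r i K ^ 2)
    + ∑ i, cellInt (fun K => (1 / meshSize N * jump th i K) ^ 2)

end Consistency

section LevelSize

variable {d N : ℕ} [NeZero N]

/-- Young's inequality for cell integrals. -/
lemma cellInt_abs_mul_abs_le (f g : QFun d N) {c : ℝ} (hc : 0 < c) :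
    cellInt (fun K => |f K| * |g K|)
      ≤ 1 / 2 * (c * cellInt (fun K => f K ^ 2) + 1 / c * cellInt (fun K => g K ^ 2)) := by
  rw [← cellInt_const_mul, ← cellInt_const_mul, ← cellInt_add, ← cellInt_const_mul]
  refine cellInt_mono fun K => ?_
  rw [← sq_abs (f K), ← sq_abs (g K)]
  have e : 1 / 2 * (c * |f K| ^ 2 + 1 / c * |g K| ^ 2) - |f K| * |g K|
      = 1 / (2 * c) * (c * |f K| - |g K|) ^ 2 := by field_simp; ring
  have : 0 ≤ 1 / (2 * c) * (c * |f K| - |g K|) ^ 2 := by positivity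
  linarith

lemma cellInt_abs_le_half (f : QFun d N) :
    cellInt (fun K => |f K|) ≤ 1 / 2 * (1 + cellInt (fun K => f K ^ 2)) := by
  have := cellInt_abs_mul_abs_le f (fun _ => 1) one_pos
  simpa [cellInt_const, add_comm] using this

variable (eps : ℝ) (r : QFun d N) (u : Fin d → QFun d N) (th : QFun d N)

lemma levelSize_parts :
    (0 ≤ cellInt (fun K => ∑ j, u j K ^ 2)) ∧
    (0 ≤ cellInt (fun K => ∑ i, ∑ j, discSymGrad u i j K ^ 2)) ∧
    (0 ≤ meshSize N ^ eps * (1 / meshSize N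
      * ∑ i, cellInt (fun K => ∑ j, jump (u j) i K ^ 2))) ∧
    (0 ≤ 1 / meshSize N * ∑ i, cellInt (fun K =>
        (1 / 2 * |avg (u i) i K| + meshSize N ^ eps) * jump r i K ^ 2)) ∧
    (0 ≤ ∑ i, cellInt (fun K => (1 / meshSize N * jump th i K) ^ 2)) := by
  have hh := meshSize_pos (N := N)
  have he : 0 < meshSize N ^ eps := Real.rpow_pos_of_pos hh _
  refine ⟨cellInt_nonneg fun K => Finset.sum_nonneg fun j _ => sq_nonneg _,
    cellInt_nonneg fun K => Finset.sum_nonneg fun i _ => Finset.sum_nonneg fun j _ => sq_nonneg _,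
    mul_nonneg he.le (mul_nonneg (by positivity) (Finset.sum_nonneg fun i _ =>
      cellInt_nonneg fun K => Finset.sum_nonneg fun j _ => sq_nonneg _)),
    mul_nonneg (by positivity) (Finset.sum_nonneg fun i _ => cellInt_nonneg fun K => ?_),
    Finset.sum_nonneg fun i _ => cellInt_nonneg fun K => sq_nonneg _⟩
  positivity

lemma one_le_levelSize : 1 ≤ levelSize eps r u th := by
  obtain ⟨h1, h2, h3, h4, h5⟩ := levelSize_parts eps r u th
  unfold levelSize; linarith

lemma cellInt_vel_sq_le_sum (i : Fin d) :
    cellInt (fun K => u i K ^ 2) ≤ cellInt (fun K => ∑ j, u j K ^ 2) :=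
  cellInt_mono fun K =>
    Finset.single_le_sum (f := fun j => u j K ^ 2) (fun _ _ => sq_nonneg _) (Finset.mem_univ i)

lemma one_add_vel_sq_le (i : Fin d) : 1 + cellInt (fun K => u i K ^ 2) ≤ levelSize eps r u th := by
  obtain ⟨h1, h2, h3, h4, h5⟩ := levelSize_parts eps r u th
  have := cellInt_vel_sq_le_sum u i
  unfold levelSize; linarith

lemma vel_sq_add_symGrad_sq_le (l i j : Fin d) :
    1 + cellInt (fun K => u l K ^ 2) + cellInt (fun K => discSymGrad u i j K ^ 2)
      ≤ levelSize eps r u th := by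
  obtain ⟨h1, h2, h3, h4, h5⟩ := levelSize_parts eps r u th
  have := cellInt_vel_sq_le_sum u l
  have h6 : cellInt (fun K => discSymGrad u i j K ^ 2)
      ≤ cellInt (fun K => ∑ i, ∑ j, discSymGrad u i j K ^ 2) := by
    refine cellInt_mono fun K => ?_
    refine (Finset.single_le_sum (f := fun j => discSymGrad u i j K ^ 2)
      (fun j _ => sq_nonneg _) (Finset.mem_univ j)).trans ?_
    exact Finset.single_le_sum (f := fun i => ∑ j, discSymGrad u i j K ^ 2)
      (fun i _ => Finset.sum_nonneg fun j _ => sq_nonneg _) (Finset.mem_univ i)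
  unfold levelSize; linarith

lemma discSymGrad_self (i : Fin d) : discSymGrad u i i = discGrad (u i) i := by
  funext K; simp [discSymGrad]

/-- Both dissipations weight squared jumps with `h^ε/h`, so the unweighted sum carries its inverse
`h^{1-ε}`. -/
lemma jump_vel_sq_add_le (j i : Fin d) :
    cellInt (fun K => jump r i K ^ 2) + cellInt (fun K => jump (u j) i K ^ 2)
      ≤ meshSize N ^ (1 - eps) * levelSize eps r u th := by
  obtain ⟨h1, h2, h3, h4, h5⟩ := levelSize_parts eps r u th
  have hh := meshSize_pos (N := N)
  have he : 0 < meshSize N ^ eps := Real.rpow_pos_of_pos hh _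
  have hpow : meshSize N ^ (1 - eps) = meshSize N / meshSize N ^ eps := by
    rw [Real.rpow_sub hh, Real.rpow_one]
  have a1 : cellInt (fun K => jump (u j) i K ^ 2)
      ≤ ∑ i, cellInt (fun K => ∑ j, jump (u j) i K ^ 2) := by
    refine le_trans ?_ (Finset.single_le_sum
      (f := fun i => cellInt (fun K => ∑ j, jump (u j) i K ^ 2))
      (fun i _ => cellInt_nonneg fun K => Finset.sum_nonneg fun j _ => sq_nonneg _)
      (Finset.mem_univ i))
    exact cellInt_mono fun K => Finset.single_le_sum (f := fun j => jump (u j) i K ^ 2)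
      (fun j _ => sq_nonneg _) (Finset.mem_univ j)
  have a2 : meshSize N ^ eps * cellInt (fun K => jump r i K ^ 2) ≤ ∑ i, cellInt (fun K =>
        (1 / 2 * |avg (u i) i K| + meshSize N ^ eps) * jump r i K ^ 2) := by
    refine le_trans ?_ (Finset.single_le_sum (f := fun i => cellInt (fun K =>
        (1 / 2 * |avg (u i) i K| + meshSize N ^ eps) * jump r i K ^ 2))
      (fun i _ => cellInt_nonneg fun K => by positivity) (Finset.mem_univ i))
    rw [← cellInt_const_mul]
    refine cellInt_mono fun K => ?_
    have : 0 ≤ 1 / 2 * |avg (u i) i K| := by positivity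
    gcongr; linarith
  have a3 : meshSize N ^ eps / meshSize N * (cellInt (fun K => jump r i K ^ 2)
      + cellInt (fun K => jump (u j) i K ^ 2)) ≤ levelSize eps r u th := by
    have b1 := mul_le_mul_of_nonneg_left a2 (by positivity : 0 ≤ 1 / meshSize N)
    have b2 := mul_le_mul_of_nonneg_left a1 (by positivity : 0 ≤ meshSize N ^ eps / meshSize N)
    have b3 : meshSize N ^ eps / meshSize N * ∑ i, cellInt (fun K => ∑ j, jump (u j) i K ^ 2)
        = meshSize N ^ eps * (1 / meshSize N
          * ∑ i, cellInt (fun K => ∑ j, jump (u j) i K ^ 2)) := by ring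
    have b4 : 1 / meshSize N * (meshSize N ^ eps * cellInt (fun K => jump r i K ^ 2))
      = meshSize N ^ eps / meshSize N * cellInt (fun K => jump r i K ^ 2) := by ring
    rw [mul_add]
    unfold levelSize; linarith
  rw [hpow]
  have := mul_le_mul_of_nonneg_left a3 (by positivity : 0 ≤ meshSize N / meshSize N ^ eps)
  refine le_trans (le_of_eq ?_) this
  field_simp

lemma jump_vel_sq_le (j i : Fin d) :
    cellInt (fun K => jump (u j) i K ^ 2) ≤ meshSize N ^ (1 - eps) * levelSize eps r u th := by
  have := jump_vel_sq_add_le eps r u th j i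
  have h2 : 0 ≤ cellInt (fun K => jump r i K ^ 2) := cellInt_nonneg fun K => sq_nonneg _
  linarith

/-- The density jumps weighted with the stabilisation of the scheme. -/
lemma jump_density_sq_le (i : Fin d) :
    cellInt (fun K => (|avg (u i) i K| + meshSize N ^ eps) * jump r i K ^ 2)
      ≤ 2 * meshSize N * levelSize eps r u th := by
  obtain ⟨h1, h2, h3, h4, h5⟩ := levelSize_parts eps r u th
  have hh := meshSize_pos (N := N)
  have he : 0 < meshSize N ^ eps := Real.rpow_pos_of_pos hh _
  have a2 : 1 / 2 * cellInt (fun K => (|avg (u i) i K| + meshSize N ^ eps) * jump r i K ^ 2)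
      ≤ ∑ i, cellInt (fun K =>
        (1 / 2 * |avg (u i) i K| + meshSize N ^ eps) * jump r i K ^ 2) := by
    refine le_trans ?_ (Finset.single_le_sum (f := fun i => cellInt (fun K =>
        (1 / 2 * |avg (u i) i K| + meshSize N ^ eps) * jump r i K ^ 2))
      (fun i _ => cellInt_nonneg fun K => by positivity) (Finset.mem_univ i))
    rw [← cellInt_const_mul]
    refine cellInt_mono fun K => ?_
    have : 0 ≤ meshSize N ^ eps * jump r i K ^ 2 := by positivity
    linarith
  have a3 : 1 / meshSize N * (1 / 2 * cellInt (fun K =>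
      (|avg (u i) i K| + meshSize N ^ eps) * jump r i K ^ 2)) ≤ levelSize eps r u th := by
    have b1 := mul_le_mul_of_nonneg_left a2 (by positivity : 0 ≤ 1 / meshSize N)
    unfold levelSize; linarith
  have := mul_le_mul_of_nonneg_left a3 (by positivity : 0 ≤ 2 * meshSize N)
  refine le_trans (le_of_eq ?_) this
  field_simp

lemma vel_sq_add_jump_temp_sq_le (l i : Fin d) :
    meshSize N ^ 2 * (1 + cellInt (fun K => u l K ^ 2)) + cellInt (fun K => jump th i K ^ 2)
      ≤ meshSize N ^ 2 * levelSize eps r u th := by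
  obtain ⟨h1, h2, h3, h4, h5⟩ := levelSize_parts eps r u th
  have hh := meshSize_pos (N := N)
  have h7 := cellInt_vel_sq_le_sum u l
  have h6 : cellInt (fun K => (1 / meshSize N * jump th i K) ^ 2)
      ≤ ∑ i, cellInt (fun K => (1 / meshSize N * jump th i K) ^ 2) :=
    Finset.single_le_sum (f := fun i => cellInt (fun K => (1 / meshSize N * jump th i K) ^ 2))
      (fun i _ => cellInt_nonneg fun K => sq_nonneg _) (Finset.mem_univ i)
  have e : cellInt (fun K => (1 / meshSize N * jump th i K) ^ 2)
      = 1 / meshSize N ^ 2 * cellInt (fun K => jump th i K ^ 2) := by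
    rw [← cellInt_const_mul]; congr 1; funext K; field_simp
  rw [e] at h6
  have : 1 + cellInt (fun K => u l K ^ 2) + 1 / meshSize N ^ 2 * cellInt (fun K => jump th i K ^ 2)
      ≤ levelSize eps r u th := by
    unfold levelSize; linarith
  have := mul_le_mul_of_nonneg_left this (by positivity : 0 ≤ meshSize N ^ 2)
  refine le_trans (le_of_eq ?_) this
  field_simp

lemma jump_temp_sq_le (i : Fin d) :
    cellInt (fun K => jump th i K ^ 2) ≤ meshSize N ^ 2 * levelSize eps r u th := by
  have := vel_sq_add_jump_temp_sq_le eps r u th i i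
  have h2 : 0 ≤ cellInt (fun K => u i K ^ 2) := cellInt_nonneg fun K => sq_nonneg _
  have : 0 ≤ meshSize N ^ 2 * (1 + cellInt (fun K => u i K ^ 2)) := by positivity
  linarith

/-- Young's inequality with weight `1/h`, because the temperature jump divided by `h` is controlled
in L². -/
lemma abs_jump_temp_le (i : Fin d) :
    cellInt (fun K => |jump th i K|) ≤ meshSize N * levelSize eps r u th := by
  have hh := meshSize_pos (N := N)
  have h1 := cellInt_abs_mul_abs_le (jump th i) (fun _ => 1) (c := 1 / meshSize N) (by positivity)
  have h2 := vel_sq_add_jump_temp_sq_le eps r u th i i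
  have h3 : 0 ≤ cellInt (fun K => u i K ^ 2) := cellInt_nonneg fun K => sq_nonneg _
  simp only [abs_one, mul_one, one_pow, cellInt_const, one_div_one_div] at h1
  have h5 : meshSize N ^ 2 + cellInt (fun K => jump th i K ^ 2)
      ≤ meshSize N ^ 2 * levelSize eps r u th := by
    have : 0 ≤ meshSize N ^ 2 * cellInt (fun K => u i K ^ 2) := by positivity
    linarith
  have h6 := mul_le_mul_of_nonneg_left h5 (by positivity : 0 ≤ 1 / meshSize N)
  have e1 : 1 / meshSize N * (meshSize N ^ 2 + cellInt (fun K => jump th i K ^ 2))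
      = meshSize N + 1 / meshSize N * cellInt (fun K => jump th i K ^ 2) := by field_simp
  have e2 : 1 / meshSize N * (meshSize N ^ 2 * levelSize eps r u th)
      = meshSize N * levelSize eps r u th := by field_simp
  have h4 := one_le_levelSize eps r u th
  have h7 : 0 ≤ meshSize N * levelSize eps r u th := by positivity
  rw [e1, e2] at h6
  linarith

end LevelSize

/-! ### Flux errors in terms of the dissipation of one level. -/

section FluxBounds

variable {d N : ℕ} [NeZero N] {eps M b : ℝ} {a : QFun d N} {g : Fin d → QFun d N}
  {r : QFun d N} {u : Fin d → QFun d N}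

lemma meshSize_rpow_le_one {s : ℝ} (hs : 0 ≤ s) : meshSize N ^ s ≤ 1 :=
  Real.rpow_le_one meshSize_pos.le meshSize_le_one hs

lemma cellInt_abs_mul_le {f : QFun d N} (hf : ∀ K, |f K| ≤ b) (q : QFun d N) :
    cellInt (fun K => |f K| * |q K|) ≤ b * cellInt (fun K => |q K|) := by
  rw [← cellInt_const_mul]
  exact cellInt_mono fun K => mul_le_mul_of_nonneg_right (hf K) (abs_nonneg _)

lemma cellInt_avg_prev_sq_le (v : QFun d N) (i : Fin d) :
    cellInt (fun K => avg v i (prev i K) ^ 2) ≤ cellInt (fun K => v K ^ 2) :=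
  (cellInt_prev i (fun K => avg v i K ^ 2)).trans_le (cellInt_avg_sq_le v i)

/-- Stated for a bounded quantity whose jumps are controlled by those of density and temperature, so
that it serves both the density and the product of density and entropy. -/
lemma flux_consistency_bounded (ht : DiscTest M a g) {th q : QFun d N} {L : ℝ} (hL : 0 ≤ L)
    (hq : ∀ K, |q K| ≤ b) (i : Fin d)
    (hjq : ∀ K, |jump q i K| ≤ L * (|jump r i K| + |jump th i K|)) :
    |1 / meshSize N * cellInt (fun K => diffFlux eps q u i K * jump a i K)
      - cellInt (fun K => q K * u i K * g i K)|
    ≤ M * (5 * b + L) * (meshSize N + meshSize N ^ (1 - eps) + meshSize N ^ (1 + eps))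
        * levelSize eps r u th := by
  have hh := meshSize_pos (N := N)
  have hh1 := meshSize_le_one (N := N)
  have hM := ht.nonneg
  have hb : 0 ≤ b := (abs_nonneg _).trans (hq 0)
  have hS := one_le_levelSize eps r u th
  have h1 := one_add_vel_sq_le eps r u th i
  have h2 := vel_sq_add_symGrad_sq_le eps r u th i i i
  rw [discSymGrad_self] at h2
  have h3 := jump_vel_sq_add_le eps r u th i i
  have h4 := jump_temp_sq_le eps r u th i
  have h5 := jump_vel_sq_le eps r u th i i
  have n1 : 0 ≤ cellInt (fun K => u i K ^ 2) := cellInt_nonneg fun K => sq_nonneg _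
  have c1 := (cellInt_abs_mul_le hq (u i)).trans
    (mul_le_mul_of_nonneg_left (cellInt_abs_le_half (u i)) hb)
  have c3 := (cellInt_abs_mul_le hq (discGrad (u i) i)).trans
    (mul_le_mul_of_nonneg_left (cellInt_abs_le_half (discGrad (u i) i)) hb)
  have c4 := (cellInt_abs_mul_le hq (fun K => avg (u i) i (prev i K))).trans
    (mul_le_mul_of_nonneg_left (cellInt_abs_le_half _) hb)
  have c4' := cellInt_avg_prev_sq_le (u i) i
  have c5 : cellInt (fun K => |q K|) ≤ b := by
    have := cellInt_mono hq; rwa [cellInt_const] at this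
  have c2 : cellInt (fun K => |jump q i K| * |jump (u i) i K|)
      ≤ L * (cellInt (fun K => |jump r i K| * |jump (u i) i K|)
        + cellInt (fun K => |jump th i K| * |jump (u i) i K|)) := by
    rw [← cellInt_add, ← cellInt_const_mul]
    refine cellInt_mono fun K => ?_
    have := mul_le_mul_of_nonneg_right (hjq K) (abs_nonneg (jump (u i) i K))
    linarith
  have c6 := cellInt_abs_mul_abs_le (jump r i) (jump (u i) i) one_pos
  -- Squared temperature jumps have size `h²` and squared velocity jumps `h^{1-ε}`. The weight `1/h`
  -- turns them into `h` and `h^{2-ε}`, and the latter is at most `h^{1-ε}`.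
  have c7 := cellInt_abs_mul_abs_le (jump th i) (jump (u i) i) (c := 1 / meshSize N)
    (by positivity)
  rw [one_div_one_div] at c7
  have hflux := flux_consistency (eps := eps) ht q u i
  set S := levelSize eps r u th
  set h := meshSize N
  set A := h ^ (1 - eps) with hA
  set B := h ^ (1 + eps) with hB
  have hA0 : 0 < A := Real.rpow_pos_of_pos hh _
  have hB0 : 0 < B := Real.rpow_pos_of_pos hh _
  have d7 : cellInt (fun K => |jump th i K| * |jump (u i) i K|) ≤ 1 / 2 * (h * S + A * S) := by
    have e1 : 1 / h * cellInt (fun K => jump th i K ^ 2) ≤ h * S := by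
      have := mul_le_mul_of_nonneg_left h4 (by positivity : 0 ≤ 1 / h)
      refine this.trans (le_of_eq ?_); field_simp
    have e2 : h * cellInt (fun K => jump (u i) i K ^ 2) ≤ A * S := by
      have n : 0 ≤ A * S := by positivity
      exact (mul_le_mul_of_nonneg_left h5 hh.le).trans (mul_le_of_le_one_left n hh1)
    linarith
  have d2 : cellInt (fun K => |jump q i K| * |jump (u i) i K|) ≤ L * (h * S + A * S) := by
    refine c2.trans (mul_le_mul_of_nonneg_left ?_ hL)
    have : 0 ≤ h * S := by positivity
    linarith
  have d1 : cellInt (fun K => |q K| * |u i K|) ≤ b * S := by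
    refine c1.trans (mul_le_mul_of_nonneg_left ?_ hb); linarith
  have d3 : cellInt (fun K => |q K| * |discGrad (u i) i K|) ≤ b * S := by
    refine c3.trans (mul_le_mul_of_nonneg_left ?_ hb); linarith
  have d4 : cellInt (fun K => |q K| * |avg (u i) i (prev i K)|) ≤ b * S := by
    refine c4.trans (mul_le_mul_of_nonneg_left ?_ hb); linarith
  have d5 : cellInt (fun K => |q K|) ≤ b * S := c5.trans (le_mul_of_one_le_right hb hS)
  refine hflux.trans ?_
  calc _ ≤ M * (2 * h * (b * S) + 1 / 2 * (L * (h * S + A * S)) + h * (b * S) + 2 * h * (b * S)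
        + 3 * B * (b * S)) := by gcongr
    _ ≤ M * ((5 * b + L) * (h + A + B) * S) := by
      apply mul_le_mul_of_nonneg_left _ hM
      have p1 : 0 ≤ b * S * A := by positivity
      have p2 : 0 ≤ b * S * B := by positivity
      have p3 : 0 ≤ L * S * h := by positivity
      have p4 : 0 ≤ L * S * A := by positivity
      have p5 : 0 ≤ L * S * B := by positivity
      linarith
    _ = _ := by ring

/-- Momentum is not bounded pointwise. Its jump contains ⟦ϱ⟧{{u_j}}, which after bounding ⟦ϱ⟧ has no
smallness left, so only the factor ⟦u_i⟧ contributes. This is the origin of the halved exponent. -/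
lemma flux_consistency_momentum (heps : eps < 1) (ht : DiscTest M a g) {th : QFun d N}
    (hr0 : ∀ K, 0 ≤ r K) (hr : ∀ K, r K ≤ b) (i j : Fin d) :
    |1 / meshSize N * cellInt (fun K => diffFlux eps (fun L => r L * u j L) u i K * jump a i K)
      - cellInt (fun K => r K * u j K * u i K * g i K)|
    ≤ 6 * M * b * (meshSize N + meshSize N ^ ((1 - eps) / 2) + meshSize N ^ (1 + eps))
        * levelSize eps r u th := by
  have hh := meshSize_pos (N := N)
  have hh1 := meshSize_le_one (N := N)
  have hM := ht.nonneg
  have hb : 0 ≤ b := (hr0 0).trans (hr 0)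
  have hrb : ∀ K, |r K| ≤ b := fun K => (abs_of_nonneg (hr0 K)).trans_le (hr K)
  have hS := one_le_levelSize eps r u th
  have hi := one_add_vel_sq_le eps r u th i
  have hj := one_add_vel_sq_le eps r u th j
  have h2 := vel_sq_add_symGrad_sq_le eps r u th j i i
  rw [discSymGrad_self] at h2
  have h5 := jump_vel_sq_le eps r u th i i
  have h5' := jump_vel_sq_le eps r u th j i
  have n1 : 0 ≤ cellInt (fun K => u j K ^ 2) := cellInt_nonneg fun K => sq_nonneg _
  have c4' := cellInt_avg_prev_sq_le (u i) i
  have c4'' := cellInt_avg_sq_le (u j) i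
  have split : ∀ q : QFun d N, cellInt (fun K => |r K * u j K| * |q K|)
      ≤ b * (1 / 2 * (cellInt (fun K => u j K ^ 2) + cellInt (fun K => q K ^ 2))) := by
    intro q
    have := cellInt_abs_mul_abs_le (u j) q one_pos
    rw [one_mul, one_div_one, one_mul] at this
    refine le_trans ?_ (mul_le_mul_of_nonneg_left this hb)
    rw [← cellInt_const_mul]
    refine cellInt_mono fun K => ?_
    rw [abs_mul, mul_assoc]
    exact mul_le_mul_of_nonneg_right (hrb K) (by positivity)
  have c1 := split (u i)
  have c3 := split (discGrad (u i) i)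
  have c4 := split (fun K => avg (u i) i (prev i K))
  have c5 : cellInt (fun K => |r K * u j K|) ≤ b * (1 / 2 * (1 + cellInt (fun K => u j K ^ 2))) := by
    have := split (fun _ => 1)
    simpa [cellInt_const, add_comm] using this
  have c2 : cellInt (fun K => |jump (fun L => r L * u j L) i K| * |jump (u i) i K|)
      ≤ b * (cellInt (fun K => |jump (u j) i K| * |jump (u i) i K|)
        + cellInt (fun K => |avg (u j) i K| * |jump (u i) i K|)) := by
    rw [← cellInt_add, ← cellInt_const_mul]
    refine cellInt_mono fun K => ?_
    have e : jump (fun L => r L * u j L) i K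
        = avg r i K * jump (u j) i K + jump r i K * avg (u j) i K := by
      simp only [jump, avg]; ring
    have e1 : |avg r i K| ≤ b := by
      have := hr0 K; have := hr0 (next i K); have := hr K; have := hr (next i K)
      simp only [avg]; rw [abs_le]; constructor <;> linarith
    have e2 : |jump r i K| ≤ b := by
      have := hr0 K; have := hr0 (next i K); have := hr K; have := hr (next i K)
      simp only [jump]; rw [abs_le]; constructor <;> linarith
    have e3 : |jump (fun L => r L * u j L) i K| ≤ b * (|jump (u j) i K| + |avg (u j) i K|) := by
      rw [e, mul_add]
      refine (abs_add_le _ _).trans ?_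
      rw [abs_mul, abs_mul]
      gcongr
    have := mul_le_mul_of_nonneg_right e3 (abs_nonneg (jump (u i) i K))
    linarith
  have hP : meshSize N ^ ((1 - eps) / 2) * meshSize N ^ ((1 - eps) / 2)
      = meshSize N ^ (1 - eps) := by
    rw [← Real.rpow_add hh]; congr 1; ring
  have hP1 : meshSize N ^ ((1 - eps) / 2) ≤ 1 :=
    meshSize_rpow_le_one (by linarith)
  have hP0 : 0 < meshSize N ^ ((1 - eps) / 2) := Real.rpow_pos_of_pos hh _
  rw [← hP] at h5 h5'
  have c6 := cellInt_abs_mul_abs_le (jump (u j) i) (jump (u i) i) one_pos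
  -- The weight `h^{(1-ε)/2}` balances a bounded square integral against one of size `h^{1-ε}`.
  have c7 := cellInt_abs_mul_abs_le (avg (u j) i) (jump (u i) i) hP0
  have hflux := flux_consistency (eps := eps) ht (fun L => r L * u j L) u i
  set S := levelSize eps r u th
  set h := meshSize N
  set A := h ^ ((1 - eps) / 2) with hA
  set B := h ^ (1 + eps) with hB
  have hB0 : 0 < B := Real.rpow_pos_of_pos hh _
  have hAS : 0 ≤ A * S := by positivity
  have hAA : A * A * S ≤ A * S := by
    have := mul_le_of_le_one_left hAS hP1
    linarith
  have d7 : cellInt (fun K => |avg (u j) i K| * |jump (u i) i K|) ≤ A * S := by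
    have e1 : A * cellInt (fun K => avg (u j) i K ^ 2) ≤ A * S := by
      apply mul_le_mul_of_nonneg_left _ hP0.le; linarith
    have e2 : 1 / A * cellInt (fun K => jump (u i) i K ^ 2) ≤ A * S := by
      have := mul_le_mul_of_nonneg_left h5 (by positivity : 0 ≤ 1 / A)
      refine this.trans (le_of_eq ?_); field_simp
    linarith
  have d2 : cellInt (fun K => |jump (fun L => r L * u j L) i K| * |jump (u i) i K|)
      ≤ b * (2 * (A * S)) := by
    refine c2.trans (mul_le_mul_of_nonneg_left ?_ hb)
    linarith
  have d1 : cellInt (fun K => |r K * u j K| * |u i K|) ≤ b * S := by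
    refine c1.trans (mul_le_mul_of_nonneg_left ?_ hb); linarith
  have d3 : cellInt (fun K => |r K * u j K| * |discGrad (u i) i K|) ≤ b * S := by
    refine c3.trans (mul_le_mul_of_nonneg_left ?_ hb); linarith
  have d4 : cellInt (fun K => |r K * u j K| * |avg (u i) i (prev i K)|) ≤ b * S := by
    refine c4.trans (mul_le_mul_of_nonneg_left ?_ hb); linarith
  have d5 : cellInt (fun K => |r K * u j K|) ≤ b * S := by
    refine c5.trans (mul_le_mul_of_nonneg_left ?_ hb); linarith
  refine hflux.trans ?_
  calc _ ≤ M * (2 * h * (b * S) + 1 / 2 * (b * (2 * (A * S))) + h * (b * S) + 2 * h * (b * S)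
        + 3 * B * (b * S)) := by gcongr
    _ ≤ M * (6 * b * (h + A + B) * S) := by
      apply mul_le_mul_of_nonneg_left _ hM
      have p1 : 0 ≤ b * S * A := by positivity
      have p2 : 0 ≤ b * S * B := by positivity
      have p3 : 0 ≤ b * S * h := by positivity
      linarith
    _ = _ := by ring

/-- The rate at which the continuity equation is consistent. -/
lemma SchemeStep.continuity_consistency {mu lam kappa gamma dt : ℝ} {r0 : QFun d N}
    {u0 : Fin d → QFun d N} {th0 th : QFun d N}
    (hs : SchemeStep mu lam kappa gamma eps dt r0 r u0 u th0 th) (ht : DiscTest M a g)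
    (hr0 : ∀ K, 0 ≤ r K) (hr : ∀ K, r K ≤ b) :
    |cellInt (fun K => (r K - r0 K) / dt * a K) - ∑ i, cellInt (fun K => r K * u i K * g i K)|
      ≤ d * (M * (5 * b + 1)) * (meshSize N + meshSize N ^ (1 - eps) + meshSize N ^ (1 + eps))
        * levelSize eps r u th := by
  have h1 : ∀ i, _ := fun i => flux_consistency_bounded (eps := eps) (u := u) (r := r) (th := th)
    ht zero_le_one (q := r) (b := b) (fun K => (abs_of_nonneg (hr0 K)).trans_le (hr K)) i
    (fun K => by rw [one_mul]; linarith [abs_nonneg (jump th i K)])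
  rw [hs.cont, Finset.mul_sum, ← Finset.sum_sub_distrib]
  refine (Finset.abs_sum_le_sum_abs _ _).trans ?_
  refine (Finset.sum_le_sum fun i _ => h1 i).trans ?_
  rw [Finset.sum_const, Finset.card_univ, Fintype.card_fin, nsmul_eq_mul]
  exact le_of_eq (by ring)

/-- Only the kinetic energy enters, so this holds uniformly over the time levels. `levelSize` is
bounded only after summation in time, which would not suffice on a partial time slab. -/
lemma abs_cellInt_flux_le (hg : ∀ i K, |g i K| ≤ M) {q : QFun d N} (hq : ∀ K, |q K| ≤ b) :
    |∑ i, cellInt (fun K => q K * u i K * g i K)|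
      ≤ d * (b * M) * (1 + cellInt (fun K => ∑ j, u j K ^ 2)) := by
  have hb : 0 ≤ b := (abs_nonneg _).trans (hq 0)
  refine (Finset.abs_sum_le_sum_abs _ _).trans ?_
  have : ∀ i ∈ Finset.univ, |cellInt (fun K => q K * u i K * g i K)|
      ≤ b * M * (1 + cellInt (fun K => ∑ j, u j K ^ 2)) := by
    intro i _
    have hM : 0 ≤ M := (abs_nonneg _).trans (hg i 0)
    have h1 : |cellInt (fun K => q K * u i K * g i K)| ≤ b * M * cellInt (fun K => |u i K|) := by
      rw [← cellInt_const_mul]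
      refine abs_cellInt_le_of_le fun K => ?_
      rw [abs_mul, abs_mul]
      calc |q K| * |u i K| * |g i K| ≤ b * |u i K| * M := by
            gcongr
            · exact hq K
            · exact hg i K
        _ = _ := by ring
    refine h1.trans (mul_le_mul_of_nonneg_left ?_ (by positivity))
    have h2 := cellInt_abs_le_half (u i)
    have h3 := cellInt_vel_sq_le_sum u i
    have h4 : 0 ≤ cellInt (fun K => u i K ^ 2) := cellInt_nonneg fun K => sq_nonneg _
    linarith
  refine (Finset.sum_le_sum this).trans ?_
  rw [Finset.sum_const, Finset.card_univ, Fintype.card_fin, nsmul_eq_mul]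
  exact le_of_eq (by ring)

end FluxBounds

/-! ### Viscous stress, pressure and consistency of the momentum equation. -/

section MomentumConsistency

variable {d N : ℕ} [NeZero N] {eps M b c mu lam : ℝ} {a : Fin d → QFun d N}
  {g : Fin d → Fin d → QFun d N} {r : QFun d N} {u : Fin d → QFun d N} {th : QFun d N}

lemma discDiv_eq_sum_symGrad (u : Fin d → QFun d N) (K : Cell d N) :
    discDiv u K = ∑ k, discSymGrad u k k K := by
  simp [discDiv, discSymGrad_self]

lemma abs_discStress_le (hmu : 0 < mu) (hlam : 0 ≤ lam) (i j : Fin d) (K : Cell d N) :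
    |discStress mu lam u i j K|
      ≤ 2 * mu * |discSymGrad u i j K| + lam * ∑ k, |discSymGrad u k k K| := by
  unfold discStress
  refine (abs_add_le _ _).trans (add_le_add ?_ ?_)
  · rw [abs_mul, abs_of_pos (by positivity)]
  · have h : |lam * discDiv u K| ≤ lam * ∑ k, |discSymGrad u k k K| := by
      rw [abs_mul, abs_of_nonneg hlam, discDiv_eq_sum_symGrad]
      gcongr; exact Finset.abs_sum_le_sum_abs _ _
    split_ifs
    · exact h
    · rw [abs_zero]; exact (abs_nonneg _).trans h

lemma cellInt_abs_symGrad_le (i j : Fin d) :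
    cellInt (fun K => |discSymGrad u i j K|) ≤ levelSize eps r u th := by
  have h1 := cellInt_abs_le_half (discSymGrad u i j)
  have h2 := vel_sq_add_symGrad_sq_le eps r u th i i j
  have h3 : 0 ≤ cellInt (fun K => u i K ^ 2) := cellInt_nonneg fun K => sq_nonneg _
  have h4 : 0 ≤ cellInt (fun K => discSymGrad u i j K ^ 2) := cellInt_nonneg fun K => sq_nonneg _
  linarith

lemma cellInt_abs_stress_le (hmu : 0 < mu) (hlam : 0 ≤ lam) (i j : Fin d) :
    cellInt (fun K => |discStress mu lam u i j K|)
      ≤ (2 * mu + lam * d) * levelSize eps r u th := by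
  have h1 := cellInt_mono fun K => abs_discStress_le (u := u) hmu hlam i j K
  rw [cellInt_add, cellInt_const_mul, cellInt_const_mul, cellInt_sum] at h1
  have h2 : ∑ k, cellInt (fun K => |discSymGrad u k k K|) ≤ d * levelSize eps r u th := by
    refine (Finset.sum_le_sum fun k _ => cellInt_abs_symGrad_le (eps := eps) (r := r) (th := th)
      k k).trans ?_
    rw [Finset.sum_const, Finset.card_univ, Fintype.card_fin, nsmul_eq_mul]
  have h3 := cellInt_abs_symGrad_le (eps := eps) (r := r) (u := u) (th := th) i j
  have h4 := mul_le_mul_of_nonneg_left h2 hlam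
  have h5 := mul_le_mul_of_nonneg_left h3 (by positivity : 0 ≤ 2 * mu)
  linarith

/-- The spatial part of the weak momentum equation for the projected test function. -/
def momentumForm (mu lam : ℝ) (r : QFun d N) (u : Fin d → QFun d N) (th : QFun d N)
    (g : Fin d → Fin d → QFun d N) : ℝ :=
  ∑ i, ∑ j, (cellInt (fun K => r K * u i K * u j K * g i j K)
    + cellInt (fun K => ((if i = j then r K * th K else 0) - discStress mu lam u i j K) * g i j K))

lemma abs_pressure_le (hr0 : ∀ K, 0 ≤ r K) (hr : ∀ K, r K ≤ b) (ht0 : ∀ K, 0 ≤ th K)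
    (ht : ∀ K, th K ≤ c) (i j : Fin d) (K : Cell d N) :
    |(if i = j then r K * th K else 0)| ≤ b * c := by
  have h1 := hr0 K; have h2 := hr K; have h3 := ht0 K; have h4 := ht K
  have hb : 0 ≤ b := h1.trans h2
  split_ifs
  · rw [abs_of_nonneg (by positivity)]; gcongr
  · rw [abs_zero]; exact mul_nonneg hb (h3.trans h4)

/-- The flux error is joined by the error of replacing ∇_h of the averaged test function by averages
of its gradient. The latter is `O(h)` against stress and pressure, whose integrals are bounded by
the level size. -/
lemma SchemeStep.momentum_consistency {kappa gamma dt : ℝ} {r0 : QFun d N}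
    {u0 : Fin d → QFun d N} {th0 : QFun d N}
    (hs : SchemeStep mu lam kappa gamma eps dt r0 r u0 u th0 th)
    (hmu : 0 < mu) (hlam : 0 ≤ lam) (heps : eps < 1) (ht : ∀ j, DiscTest M (a j) (g j))
    (hr0 : ∀ K, 0 ≤ r K) (hr : ∀ K, r K ≤ b) (hth0 : ∀ K, 0 ≤ th K) (hth : ∀ K, th K ≤ c) :
    |cellInt (fun K => ∑ j, (r K * u j K - r0 K * u0 j K) / dt * a j K)
        - momentumForm mu lam r u th g|
      ≤ d * d * (6 * M * b + 2 * M * (2 * mu + lam * d + b * c))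
        * (meshSize N + meshSize N ^ ((1 - eps) / 2) + meshSize N ^ (1 + eps))
        * levelSize eps r u th := by
  have hh := meshSize_pos (N := N)
  have hS := one_le_levelSize eps r u th
  have hA0 : 0 < meshSize N ^ ((1 - eps) / 2) := Real.rpow_pos_of_pos hh _
  have hB0 : 0 < meshSize N ^ (1 + eps) := Real.rpow_pos_of_pos hh _
  have hb : 0 ≤ b := (hr0 0).trans (hr 0)
  have hc : 0 ≤ c := (hth0 0).trans (hth 0)
  have e1 : cellInt (fun K => ∑ j, (r K * u j K - r0 K * u0 j K) / dt * a j K)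
      = ∑ i, ∑ j, (1 / meshSize N * cellInt (fun K =>
          diffFlux eps (fun L => r L * u i L) u j K * jump (a i) j K)
        - cellInt (fun K => (discStress mu lam u i j K - if i = j then r K * th K else 0)
          * discGrad (a i) j K)) := by
    rw [hs.mom, cellInt_sum]
    simp only [cellInt_sum]
    rw [Finset.sum_comm, Finset.mul_sum, ← Finset.sum_sub_distrib]
    refine Finset.sum_congr rfl fun i _ => ?_
    rw [Finset.mul_sum, ← Finset.sum_sub_distrib]
  rw [e1, momentumForm, ← Finset.sum_sub_distrib]
  have key : ∀ i j, |(1 / meshSize N * cellInt (fun K =>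
          diffFlux eps (fun L => r L * u i L) u j K * jump (a i) j K)
        - cellInt (fun K => (discStress mu lam u i j K - if i = j then r K * th K else 0)
          * discGrad (a i) j K))
      - (cellInt (fun K => r K * u i K * u j K * g i j K)
        + cellInt (fun K => ((if i = j then r K * th K else 0) - discStress mu lam u i j K)
          * g i j K))|
      ≤ (6 * M * b + 2 * M * (2 * mu + lam * d + b * c))
        * (meshSize N + meshSize N ^ ((1 - eps) / 2) + meshSize N ^ (1 + eps))
        * levelSize eps r u th := by
    intro i j
    have hM := (ht i).nonneg
    have k1 := flux_consistency_momentum (eps := eps) (u := u) (th := th) heps (ht i) hr0 hr j i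
    have k2 : |cellInt (fun K => (discStress mu lam u i j K - if i = j then r K * th K else 0)
          * (discGrad (a i) j K - g i j K))|
        ≤ 2 * M * (2 * mu + lam * d + b * c) * (meshSize N * levelSize eps r u th) := by
      have : |cellInt (fun K => (discStress mu lam u i j K - if i = j then r K * th K else 0)
          * (discGrad (a i) j K - g i j K))|
          ≤ 2 * M * meshSize N * (cellInt (fun K => |discStress mu lam u i j K|)
            + cellInt (fun _ : Cell d N => b * c)) := by
        rw [← cellInt_add, ← cellInt_const_mul]
        refine abs_cellInt_le_of_le fun K => ?_
        rw [abs_mul, mul_comm]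
        gcongr
        · exact (ht i).abs_discGrad_sub j K
        · exact (abs_sub _ _).trans (add_le_add_right (abs_pressure_le hr0 hr hth0 hth i j K) _)
      refine this.trans ?_
      rw [cellInt_const]
      have h1 := cellInt_abs_stress_le (eps := eps) (r := r) (u := u) (th := th) hmu hlam i j
      have h2 : b * c ≤ b * c * levelSize eps r u th :=
        le_mul_of_one_le_right (by positivity) hS
      calc _ ≤ 2 * M * meshSize N * ((2 * mu + lam * d) * levelSize eps r u th
            + b * c * levelSize eps r u th) := by gcongr
        _ = _ := by ring
    have e2 : cellInt (fun K => (discStress mu lam u i j K - if i = j then r K * th K else 0)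
          * (discGrad (a i) j K - g i j K))
        = cellInt (fun K => (discStress mu lam u i j K - if i = j then r K * th K else 0)
          * discGrad (a i) j K)
        + cellInt (fun K => ((if i = j then r K * th K else 0) - discStress mu lam u i j K)
          * g i j K) := by
      rw [← cellInt_add]; congr 1; funext K; ring
    rw [e2] at k2
    have k3 := abs_sub (1 / meshSize N * cellInt (fun K =>
          diffFlux eps (fun L => r L * u i L) u j K * jump (a i) j K)
        - cellInt (fun K => r K * u i K * u j K * g i j K))
      (cellInt (fun K => (discStress mu lam u i j K - if i = j then r K * th K else 0)
          * discGrad (a i) j K)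
        + cellInt (fun K => ((if i = j then r K * th K else 0) - discStress mu lam u i j K)
          * g i j K))
    refine le_trans (le_of_eq ?_) (k3.trans ((add_le_add k1 k2).trans ?_))
    · congr 1; ring
    · set S := levelSize eps r u th
      set A := meshSize N ^ ((1 - eps) / 2)
      set B := meshSize N ^ (1 + eps)
      have : 0 ≤ 2 * M * (2 * mu + lam * d + b * c) * ((A + B) * S) := by positivity
      linarith
  refine (Finset.abs_sum_le_sum_abs _ _).trans ?_
  have : ∀ i ∈ Finset.univ, |(∑ j, (1 / meshSize N * cellInt (fun K =>
          diffFlux eps (fun L => r L * u i L) u j K * jump (a i) j K)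
        - cellInt (fun K => (discStress mu lam u i j K - if i = j then r K * th K else 0)
          * discGrad (a i) j K)))
      - ∑ j, (cellInt (fun K => r K * u i K * u j K * g i j K)
        + cellInt (fun K => ((if i = j then r K * th K else 0) - discStress mu lam u i j K)
          * g i j K))| ≤ d * ((6 * M * b + 2 * M * (2 * mu + lam * d + b * c))
        * (meshSize N + meshSize N ^ ((1 - eps) / 2) + meshSize N ^ (1 + eps))
        * levelSize eps r u th) := by
    intro i _
    rw [← Finset.sum_sub_distrib]
    refine (Finset.abs_sum_le_sum_abs _ _).trans ((Finset.sum_le_sum fun j _ => key i j).trans ?_)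
    rw [Finset.sum_const, Finset.card_univ, Fintype.card_fin, nsmul_eq_mul]
  refine (Finset.sum_le_sum this).trans ?_
  rw [Finset.sum_const, Finset.card_univ, Fintype.card_fin, nsmul_eq_mul]
  exact le_of_eq (by ring)

/-- The discrete derivative is moved onto the averaged gradient of the test function, whose
differences are bounded; what remains is an L¹ norm of the velocity. -/
lemma abs_cellInt_discGrad_mul_le (ht : ∀ j, DiscTest M (a j) (g j)) (k l i j : Fin d) :
    |cellInt (fun K => discGrad (u k) l K * g i j K)|
      ≤ M * (1 + cellInt (fun K => ∑ j, u j K ^ 2)) := by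
  have hM := (ht i).nonneg
  rw [cellInt_discGrad_mul, abs_neg]
  have h1 : |cellInt (fun K => u k K * discGrad (g i j) l K)| ≤ M * cellInt (fun K => |u k K|) := by
    rw [← cellInt_const_mul]
    refine abs_cellInt_le_of_le fun K => ?_
    rw [abs_mul, mul_comm]
    gcongr; exact (ht i).abs_discGrad_grad_le j l K
  refine h1.trans (mul_le_mul_of_nonneg_left ?_ hM)
  have h2 := cellInt_abs_le_half (u k)
  have h3 := cellInt_vel_sq_le_sum u k
  have h4 : 0 ≤ cellInt (fun K => u k K ^ 2) := cellInt_nonneg fun K => sq_nonneg _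
  linarith

/-- The spatial part of the momentum equation is bounded by the kinetic energy alone: the viscous
term can be integrated by parts. -/
lemma abs_momentumForm_le (hmu : 0 < mu) (hlam : 0 ≤ lam) (ht : ∀ j, DiscTest M (a j) (g j))
    (hr0 : ∀ K, 0 ≤ r K) (hr : ∀ K, r K ≤ b) (hth0 : ∀ K, 0 ≤ th K) (hth : ∀ K, th K ≤ c) :
    |momentumForm mu lam r u th g|
      ≤ d * d * (M * (b + b * c + 2 * mu + lam * d))
        * (1 + cellInt (fun K => ∑ j, u j K ^ 2)) := by
  have hb : 0 ≤ b := (hr0 0).trans (hr 0)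
  have hc : 0 ≤ c := (hth0 0).trans (hth 0)
  have hV0 : 0 ≤ cellInt (fun K => ∑ j, u j K ^ 2) :=
    cellInt_nonneg fun K => Finset.sum_nonneg fun j _ => sq_nonneg _
  set V := cellInt (fun K => ∑ j, u j K ^ 2) with hV
  have key : ∀ i j, |cellInt (fun K => r K * u i K * u j K * g i j K)
        + cellInt (fun K => ((if i = j then r K * th K else 0) - discStress mu lam u i j K)
          * g i j K)| ≤ M * (b + b * c + 2 * mu + lam * d) * (1 + V) := by
    intro i j
    have hM := (ht i).nonneg
    have k1 : |cellInt (fun K => r K * u i K * u j K * g i j K)| ≤ M * b * (1 + V) := by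
      have h1 : |cellInt (fun K => r K * u i K * u j K * g i j K)|
          ≤ M * b * cellInt (fun K => |u i K| * |u j K|) := by
        rw [← cellInt_const_mul]
        refine abs_cellInt_le_of_le fun K => ?_
        rw [abs_mul, abs_mul, abs_mul, abs_of_nonneg (hr0 K)]
        calc r K * |u i K| * |u j K| * |g i j K| ≤ b * |u i K| * |u j K| * M := by
              gcongr
              · exact hr K
              · exact (ht i).grad_le j K
          _ = _ := by ring
      refine h1.trans (mul_le_mul_of_nonneg_left ?_ (by positivity))
      have h2 := cellInt_abs_mul_abs_le (u i) (u j) one_pos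
      have h3 := cellInt_vel_sq_le_sum u i
      have h4 := cellInt_vel_sq_le_sum u j
      linarith
    have k2 : |cellInt (fun K => (if i = j then r K * th K else 0) * g i j K)|
        ≤ M * (b * c) * (1 + V) := by
      have h1 : |cellInt (fun K => (if i = j then r K * th K else 0) * g i j K)|
          ≤ cellInt (fun _ : Cell d N => M * (b * c)) := by
        refine abs_cellInt_le_of_le fun K => ?_
        rw [abs_mul, mul_comm]
        gcongr
        · exact (ht i).grad_le j K
        · exact abs_pressure_le hr0 hr hth0 hth i j K
      rw [cellInt_const] at h1
      have : 0 ≤ M * (b * c) * V := by positivity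
      linarith
    have k3 : |cellInt (fun K => discStress mu lam u i j K * g i j K)|
        ≤ M * (2 * mu + lam * d) * (1 + V) := by
      have e : cellInt (fun K => discStress mu lam u i j K * g i j K)
          = mu * (cellInt (fun K => discGrad (u i) j K * g i j K)
            + cellInt (fun K => discGrad (u j) i K * g i j K))
            + (if i = j then lam else 0) * ∑ k, cellInt (fun K => discGrad (u k) k K * g i j K) := by
        rw [← cellInt_add, ← cellInt_const_mul, ← cellInt_sum, ← cellInt_const_mul, ← cellInt_add]
        congr 1; funext K
        simp only [discStress, discSymGrad, discDiv, ← Finset.sum_mul]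
        split_ifs <;> ring
      have h1 := abs_cellInt_discGrad_mul_le (u := u) ht i j i j
      have h2 := abs_cellInt_discGrad_mul_le (u := u) ht j i i j
      have h3 : |∑ k, cellInt (fun K => discGrad (u k) k K * g i j K)| ≤ d * (M * (1 + V)) := by
        refine (Finset.abs_sum_le_sum_abs _ _).trans ((Finset.sum_le_sum fun k _ =>
          abs_cellInt_discGrad_mul_le (u := u) ht k k i j).trans ?_)
        rw [Finset.sum_const, Finset.card_univ, Fintype.card_fin, nsmul_eq_mul]
      have h4 : |(if i = j then lam else 0)| ≤ lam := by
        split_ifs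
        · exact (abs_of_nonneg hlam).le
        · rwa [abs_zero]
      rw [e]
      refine (abs_add_le _ _).trans ?_
      rw [abs_mul, abs_mul, abs_of_pos hmu]
      have h5 := (abs_add_le (cellInt (fun K => discGrad (u i) j K * g i j K))
        (cellInt (fun K => discGrad (u j) i K * g i j K))).trans (add_le_add h1 h2)
      calc _ ≤ mu * (M * (1 + V) + M * (1 + V)) + lam * (d * (M * (1 + V))) := by gcongr
        _ = _ := by ring
    have e : cellInt (fun K => ((if i = j then r K * th K else 0) - discStress mu lam u i j K)
          * g i j K) = cellInt (fun K => (if i = j then r K * th K else 0) * g i j K)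
          - cellInt (fun K => discStress mu lam u i j K * g i j K) := by
      rw [← cellInt_sub]; congr 1; funext K; ring
    rw [e]
    refine (abs_add_le _ _).trans ((add_le_add_right (abs_sub _ _) _).trans ?_)
    linarith
  unfold momentumForm
  refine (Finset.abs_sum_le_sum_abs _ _).trans ((Finset.sum_le_sum fun i _ =>
    (Finset.abs_sum_le_sum_abs _ _).trans (Finset.sum_le_sum fun j _ => key i j)).trans ?_)
  simp only [Finset.sum_const, Finset.card_univ, Fintype.card_fin, nsmul_eq_mul]
  exact le_of_eq (by ring)

end MomentumConsistency

/-! ## Consistency of the entropy inequality -/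

/-- Two-sided bounds for density and temperature. -/
structure InRange {d N : ℕ} (r1 r2 t1 t2 : ℝ) (r th : QFun d N) : Prop where
  rho_ge : ∀ K, r1 ≤ r K
  rho_le : ∀ K, r K ≤ r2
  temp_ge : ∀ K, t1 ≤ th K
  temp_le : ∀ K, th K ≤ t2

lemma abs_log_sub_log_le {m x y : ℝ} (hm : 0 < m) (hx : m ≤ x) (hy : m ≤ y) :
    |Real.log x - Real.log y| ≤ 1 / m * |x - y| := by
  have key : ∀ x y : ℝ, m ≤ x → m ≤ y → Real.log x - Real.log y ≤ 1 / m * |x - y| := by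
    intro x y hx hy
    have hx0 := hm.trans_le hx
    have hy0 := hm.trans_le hy
    rw [← Real.log_div hx0.ne' hy0.ne']
    refine (Real.log_le_sub_one_of_pos (div_pos hx0 hy0)).trans ?_
    have e : x / y - 1 = 1 / y * (x - y) := by field_simp
    rw [e]
    calc 1 / y * (x - y) ≤ 1 / y * |x - y| := by gcongr; exact le_abs_self _
      _ ≤ 1 / m * |x - y| := by gcongr
  rw [abs_le]
  constructor
  · have := key y x hy hx
    rw [abs_sub_comm] at this
    linarith
  · exact key x y hx hy

lemma abs_log_le {m M x : ℝ} (hm : 0 < m) (hx : m ≤ x) (hx' : x ≤ M) :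
    |Real.log x| ≤ |Real.log m| + |Real.log M| := by
  have h1 := Real.log_le_log hm hx
  have h2 := Real.log_le_log (hm.trans_le hx) hx'
  rw [abs_le]
  constructor
  · linarith [neg_abs_le (Real.log m), abs_nonneg (Real.log M)]
  · linarith [le_abs_self (Real.log M), abs_nonneg (Real.log m)]

/-- The trapezoidal rule for ∫ dz/z. Both signs follow from log z ≤ z - 1, applied to the two
quotients. It lets ⟦ϑ⟧{{1/ϑ}} be replaced by ⟦log ϑ⟧ at a quadratic cost. -/
lemma abs_log_sub_trapezoid_le {x y : ℝ} (hx : 0 < x) (hy : 0 < y) :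
    |(x - y) * ((1 / x + 1 / y) / 2) - (Real.log x - Real.log y)|
      ≤ 1 / 2 * ((x - y) ^ 2 / (x * y)) := by
  have h1 := Real.log_le_sub_one_of_pos (div_pos hx hy)
  have h2 := Real.log_le_sub_one_of_pos (div_pos hy hx)
  rw [Real.log_div hx.ne' hy.ne'] at h1
  rw [Real.log_div hy.ne' hx.ne'] at h2
  have e1 : (x - y) * ((1 / x + 1 / y) / 2) = 1 / 2 * (x / y - y / x) := by
    field_simp; ring
  have e2 : (x - y) ^ 2 / (x * y) = x / y - 2 + y / x := by
    field_simp; ring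
  rw [e1, e2, abs_le]
  constructor <;> linarith

/-- On the rectangle of admissible states the logarithms are bounded and Lipschitz. The constant
precedes the mesh, so it is uniform in `N`. -/
lemma exists_entropy_bound {gamma r1 r2 t1 t2 : ℝ} (hg : 1 < gamma) (hr1 : 0 < r1) (ht1 : 0 < t1) :
    ∃ C : ℝ, 0 ≤ C ∧ ∀ {d N : ℕ} {r th : QFun d N}, InRange r1 r2 t1 t2 r th →
      (∀ K, |discEntropy gamma r th K| ≤ C) ∧
      (∀ K, |Real.log (th K)| ≤ C) ∧
      (∀ i K, |jump (discEntropy gamma r th) i K| ≤ C * (|jump r i K| + |jump th i K|)) := by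
  have hc : 0 < 1 / (gamma - 1) := by have := sub_pos.2 hg; positivity
  set c := 1 / (gamma - 1) with hcd
  set LR := |Real.log r1| + |Real.log r2| with hLR
  set LT := |Real.log t1| + |Real.log t2| with hLT
  have hLR0 : 0 ≤ LR := by positivity
  have hLT0 : 0 ≤ LT := by positivity
  refine ⟨c * LT + LR + LT + c * (1 / t1) + 1 / r1, by positivity, fun {d N r th} h => ?_⟩
  have e0 : ∀ K, discEntropy gamma r th K = c * Real.log (th K) - Real.log (r K) := fun K =>
    entropy_eq (hr1.trans_le (h.rho_ge K)) (ht1.trans_le (h.temp_ge K))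
  have p1 : 0 ≤ c * LT := by positivity
  have p2 : 0 ≤ c * (1 / t1) := by positivity
  have p3 : 0 ≤ 1 / r1 := by positivity
  refine ⟨fun K => ?_, fun K => ?_, fun i K => ?_⟩
  · rw [e0]
    have h1 := abs_log_le ht1 (h.temp_ge K) (h.temp_le K)
    have h2 := abs_log_le hr1 (h.rho_ge K) (h.rho_le K)
    have h3 := abs_sub (c * Real.log (th K)) (Real.log (r K))
    rw [abs_mul, abs_of_pos hc] at h3
    have h4 := mul_le_mul_of_nonneg_left h1 hc.le
    linarith
  · have h1 := abs_log_le ht1 (h.temp_ge K) (h.temp_le K)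
    linarith
  · have h1 := abs_log_sub_log_le ht1 (h.temp_ge (next i K)) (h.temp_ge K)
    have h2 := abs_log_sub_log_le hr1 (h.rho_ge (next i K)) (h.rho_ge K)
    have e : jump (discEntropy gamma r th) i K
        = c * (Real.log (th (next i K)) - Real.log (th K))
          - (Real.log (r (next i K)) - Real.log (r K)) := by
      simp only [jump, e0]; ring
    have h3 := abs_sub (c * (Real.log (th (next i K)) - Real.log (th K)))
      (Real.log (r (next i K)) - Real.log (r K))
    rw [abs_mul, abs_of_pos hc] at h3
    have h4 := mul_le_mul_of_nonneg_left h1 hc.le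
    rw [e]
    change _ ≤ _ * (|r (next i K) - r K| + |th (next i K) - th K|)
    set A := |r (next i K) - r K|
    set B := |th (next i K) - th K|
    have hA : 0 ≤ A := abs_nonneg _
    have hB : 0 ≤ B := abs_nonneg _
    have q1 : 0 ≤ (c * LT + LR + LT + c * (1 / t1)) * A := by positivity
    have q2 : 0 ≤ (c * LT + LR + LT + 1 / r1) * B := by positivity
    linarith

/-- Being a product of jumps of states and of Lipschitz functions of the states, the production is
quadratic. It multiplies a jump of the test function, so the whole remainder is small. -/
lemma exists_entropyProd_bound {gamma r1 r2 t1 t2 : ℝ} (hg : 1 < gamma) (hr1 : 0 < r1)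
    (ht1 : 0 < t1) :
    ∃ C : ℝ, 0 ≤ C ∧ ∀ {d N : ℕ} {r th : QFun d N}, InRange r1 r2 t1 t2 r th →
      ∀ i K, entropyProd gamma r th i K ≤ C * (jump r i K ^ 2 + jump th i K ^ 2) := by
  have hc : 0 < 1 / (gamma - 1) := by have := sub_pos.2 hg; positivity
  obtain ⟨C, hC, hCb⟩ := exists_entropy_bound (r2 := r2) (t2 := t2) hg hr1 ht1
  refine ⟨2 * C + 2 * (1 / (gamma - 1) / t1 ^ 2) * (|r2| + |t2|), by positivity,
    fun {d N r th} h i K => ?_⟩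
  have h1 := (hCb h).2.2 i K
  have hT := ht1.trans_le (h.temp_ge (next i K))
  have ht := ht1.trans_le (h.temp_ge K)
  have h2 : |jump (fun L => 1 / (gamma - 1) / th L) i K|
      ≤ 1 / (gamma - 1) / t1 ^ 2 * |jump th i K| := by
    have e : jump (fun L => 1 / (gamma - 1) / th L) i K
        = -(1 / (gamma - 1) / (th (next i K) * th K) * jump th i K) := by
      simp only [jump]
      set c := 1 / (gamma - 1)
      field_simp; ring
    rw [e, abs_neg, abs_mul, abs_of_pos (by positivity)]
    gcongr
    rw [sq]
    exact mul_le_mul (h.temp_ge _) (h.temp_ge _) ht1.le hT.le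
  have h3 : |jump (fun L => r L * th L) i K| ≤ |r2| * |jump th i K| + |t2| * |jump r i K| := by
    have e : jump (fun L => r L * th L) i K
        = r (next i K) * jump th i K + th K * jump r i K := by
      simp only [jump]; ring
    rw [e]
    refine (abs_add_le _ _).trans ?_
    rw [abs_mul, abs_mul, abs_of_pos (hr1.trans_le (h.rho_ge (next i K))), abs_of_pos ht]
    gcongr
    · exact (h.rho_le _).trans (le_abs_self _)
    · exact (h.temp_le _).trans (le_abs_self _)
  have h4 : entropyProd gamma r th i K ≤ |jump r i K| * |jump (discEntropy gamma r th) i K|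
      + |jump (fun L => r L * th L) i K| * |jump (fun L => 1 / (gamma - 1) / th L) i K| := by
    unfold entropyProd
    rw [← abs_mul, ← abs_mul]
    refine (neg_le_abs _).trans (abs_add_le _ _)
  refine h4.trans ?_
  rw [← sq_abs (jump r i K), ← sq_abs (jump th i K)]
  set A := |jump r i K|
  set B := |jump th i K|
  have hA : 0 ≤ A := abs_nonneg _
  have hB : 0 ≤ B := abs_nonneg _
  set D := 1 / (gamma - 1) / t1 ^ 2
  have hD : 0 < D := by positivity
  set p := |r2|
  set q := |t2|
  have hp : 0 ≤ p := abs_nonneg _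
  have hq : 0 ≤ q := abs_nonneg _
  have hAB : A * B ≤ A ^ 2 + B ^ 2 := by nlinarith [sq_nonneg (A - B), sq_nonneg (A + B)]
  calc _ ≤ A * (C * (A + B)) + (p * B + q * A) * (D * B) := by gcongr
    _ = C * (A ^ 2 + A * B) + D * (p * B ^ 2 + q * (A * B)) := by ring
    _ ≤ C * (A ^ 2 + (A ^ 2 + B ^ 2)) + D * (p * B ^ 2 + q * (A ^ 2 + B ^ 2)) := by gcongr
    _ ≤ _ := by
      have s1 : 0 ≤ C * B ^ 2 := by positivity
      have s2 : 0 ≤ D * p * A ^ 2 := by positivity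
      have s3 : 0 ≤ D * q * (A ^ 2 + B ^ 2) := by positivity
      have s4 : 0 ≤ D * p * (A ^ 2 + B ^ 2) := by positivity
      linarith

section EntropyConsistency

variable {d N : ℕ} [NeZero N] {eps M : ℝ} {a : QFun d N} {g : Fin d → QFun d N}
  {r : QFun d N} {u : Fin d → QFun d N} {th : QFun d N}

/-- The continuity equation gives weighted control of density jumps only; here the temperature
supplies the same. One factor of the jump is bounded by `t2` next to the unbounded face velocity,
and h·h^ε ≤ 1 tames the other weight. -/
lemma jump_temp_sq_weighted_le (heps : -1 < eps) {t2 : ℝ} (hth0 : ∀ K, 0 ≤ th K)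
    (hth : ∀ K, th K ≤ t2) (i : Fin d) :
    cellInt (fun K => (|avg (u i) i K| + meshSize N ^ eps) * jump th i K ^ 2)
      ≤ (t2 + 1) * meshSize N * levelSize eps r u th := by
  have hh := meshSize_pos (N := N)
  have hh1 := meshSize_le_one (N := N)
  have he : 0 < meshSize N ^ eps := Real.rpow_pos_of_pos hh _
  have ht2 : 0 ≤ t2 := (hth0 0).trans (hth 0)
  have h1 : meshSize N * meshSize N ^ eps ≤ 1 := by
    have := meshSize_rpow_le_one (N := N) (s := 1 + eps) (by linarith)
    rwa [Real.rpow_add hh, Real.rpow_one] at this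
  have h2 := vel_sq_add_jump_temp_sq_le eps r u th i i
  have h3 := cellInt_abs_mul_abs_le (avg (u i) i) (jump th i) hh
  have h4 := cellInt_avg_sq_le (u i) i
  have h5 := jump_temp_sq_le eps r u th i
  have hS := one_le_levelSize eps r u th
  have n1 : 0 ≤ cellInt (fun K => u i K ^ 2) := cellInt_nonneg fun K => sq_nonneg _
  have h6 : cellInt (fun K => (|avg (u i) i K| + meshSize N ^ eps) * jump th i K ^ 2)
      ≤ t2 * cellInt (fun K => |avg (u i) i K| * |jump th i K|)
        + meshSize N ^ eps * cellInt (fun K => jump th i K ^ 2) := by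
    rw [← cellInt_const_mul, ← cellInt_const_mul, ← cellInt_add]
    refine cellInt_mono fun K => ?_
    have e2 : |jump th i K| ≤ t2 := by
      have := hth0 K; have := hth0 (next i K); have := hth K; have := hth (next i K)
      simp only [jump]; rw [abs_le]; constructor <;> linarith
    have : |avg (u i) i K| * jump th i K ^ 2 ≤ |avg (u i) i K| * (t2 * |jump th i K|) := by
      rw [← sq_abs, sq]; gcongr
    linarith
  set S := levelSize eps r u th
  set h := meshSize N
  have h7 : cellInt (fun K => |avg (u i) i K| * |jump th i K|) ≤ h * S := by
    have := mul_le_mul_of_nonneg_left h2 (by positivity : 0 ≤ 1 / h)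
    have e1 : 1 / h * (h ^ 2 * (1 + cellInt (fun K => u i K ^ 2)) + cellInt (fun K => jump th i K ^ 2))
      = h * (1 + cellInt (fun K => u i K ^ 2)) + 1 / h * cellInt (fun K => jump th i K ^ 2) := by
      field_simp
    have e2 : 1 / h * (h ^ 2 * S) = h * S := by field_simp
    rw [e1, e2] at this
    have h8 := mul_le_mul_of_nonneg_left h4 hh.le
    have : 0 ≤ h * S := by positivity
    linarith
  calc _ ≤ _ := h6
    _ ≤ t2 * (h * S) + h ^ eps * (h ^ 2 * S) := by gcongr
    _ = t2 * (h * S) + (h * h ^ eps) * (h * S) := by ring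
    _ ≤ t2 * (h * S) + 1 * (h * S) := by gcongr
    _ = _ := by ring

/-- The integrals of a function over the two halves of the cells. -/
structure HalfSplit (c : ℝ) (f U L : QFun d N) : Prop where
  add_eq : ∀ K, U K + L K = f K
  abs_sub_le : ∀ K, |U K - L K| ≤ c

/-- The heat flux term of the discrete entropy balance. -/
lemma heat_flux_consistency (ht : DiscTest M a g) {t1 : ℝ} (ht1 : 0 < t1) (hth : ∀ K, t1 ≤ th K)
    (i : Fin d) {U L : QFun d N} (hUL : HalfSplit (M * meshSize N) (g i) U L) :
    |1 / meshSize N ^ 2 * cellInt (fun K => jump th i K * avg (fun L => 1 / th L) i K * jump a i K)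
      - cellInt (fun K => 1 / th K * (jump th i K / meshSize N * U K
          + jump th i (prev i K) / meshSize N * L K))|
      ≤ 4 * M / t1 * (meshSize N * levelSize eps r u th) := by
  have hh := meshSize_pos (N := N)
  have hM := ht.nonneg
  have hj := abs_jump_temp_le eps r u th i
  set h := meshSize N with hdef
  -- The half with the outer temperature is shifted by one cell. Each cell then pairs its own 1/ϑ
  -- with both of its faces, as in the integral over its two halves.
  have e1 : cellInt (fun K => jump th i K * avg (fun L => 1 / th L) i K * jump a i K)
      = 1 / 2 * (cellInt (fun K => jump th i K * (1 / th K) * jump a i K)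
        + cellInt (fun K => jump th i (prev i K) * (1 / th K) * jump a i (prev i K))) := by
    have := cellInt_prev i (fun K => jump th i K * (1 / th (next i K)) * jump a i K)
    simp only [next_prev] at this
    rw [this, ← cellInt_add, ← cellInt_const_mul]
    congr 1; funext K; simp only [avg]; ring
  have e2 : 1 / h ^ 2 * cellInt (fun K => jump th i K * avg (fun L => 1 / th L) i K * jump a i K)
      - cellInt (fun K => 1 / th K * (jump th i K / h * U K + jump th i (prev i K) / h * L K))
      = cellInt (fun K => 1 / h ^ 2 * (1 / th K) * (jump th i K * (1 / 2 * jump a i K - h * U K)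
        + jump th i (prev i K) * (1 / 2 * jump a i (prev i K) - h * L K))) := by
    rw [e1, ← cellInt_add, ← cellInt_const_mul, ← cellInt_const_mul, ← cellInt_sub]
    congr 1; funext K; field_simp; ring
  have e3 : cellInt (fun K => |jump th i (prev i K)|) = cellInt (fun K => |jump th i K|) :=
    cellInt_prev i (fun K => |jump th i K|)
  rw [e2]
  have b : |cellInt (fun K => 1 / h ^ 2 * (1 / th K) * (jump th i K * (1 / 2 * jump a i K - h * U K)
        + jump th i (prev i K) * (1 / 2 * jump a i (prev i K) - h * L K)))|
      ≤ 2 * M / t1 * (cellInt (fun K => |jump th i K|)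
        + cellInt (fun K => |jump th i (prev i K)|)) := by
    rw [← cellInt_add, ← cellInt_const_mul]
    refine abs_cellInt_le_of_le fun K => ?_
    have hK := ht1.trans_le (hth K)
    have hs := hUL.add_eq K
    have hd := abs_le.1 (hUL.abs_sub_le K)
    have hA := abs_le.1 (ht.jump_sub i K)
    have hB := abs_le.1 (ht.abs_jump_prev_sub i K)
    have hhd : h * (U K - L K) ≤ M * h ^ 2 ∧ -(M * h ^ 2) ≤ h * (U K - L K) := by
      have h1 := mul_le_mul_of_nonneg_left hd.1 hh.le
      have h2 := mul_le_mul_of_nonneg_left hd.2 hh.le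
      constructor <;> nlinarith
    have hgU : h * g i K = h * U K + h * L K := by rw [← hs]; ring
    have hMh : 0 ≤ M * h ^ 2 := by positivity
    -- Each half carries half of `g` up to `O(h)`, and a jump of `a` is `h g + O(h²)`, so half of it
    -- matches `h` times one half-cell weight.
    have c1 : |1 / 2 * jump a i K - h * U K| ≤ 2 * M * h ^ 2 := by
      rw [abs_le]; constructor <;> nlinarith
    have c2 : |1 / 2 * jump a i (prev i K) - h * L K| ≤ 2 * M * h ^ 2 := by
      rw [abs_le]; constructor <;> nlinarith
    rw [abs_mul, abs_of_pos (by positivity : 0 < 1 / h ^ 2 * (1 / th K))]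
    calc _ ≤ 1 / h ^ 2 * (1 / t1) * (|jump th i K| * (2 * M * h ^ 2)
          + |jump th i (prev i K)| * (2 * M * h ^ 2)) := by
          gcongr
          · exact hth K
          · refine (abs_add_le _ _).trans ?_
            rw [abs_mul, abs_mul]; gcongr
      _ = _ := by field_simp
  refine b.trans ?_
  rw [e3]
  calc _ ≤ 2 * M / t1 * (h * levelSize eps r u th + h * levelSize eps r u th) := by gcongr
    _ = _ := by ring

/-- The heat flux term can be integrated by parts. -/
lemma abs_heat_flux_le (ht : DiscTest M a g) {t1 C : ℝ} (ht1 : 0 < t1) (hth : ∀ K, t1 ≤ th K)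
    (hC : ∀ K, |Real.log (th K)| ≤ C) (i : Fin d) :
    |1 / meshSize N ^ 2 * cellInt (fun K => jump th i K * avg (fun L => 1 / th L) i K * jump a i K)|
      ≤ 3 * M * C + M / t1 ^ 2 * (meshSize N * levelSize eps r u th) := by
  have hh := meshSize_pos (N := N)
  have hM := ht.nonneg
  have hj := jump_temp_sq_le eps r u th i
  set h := meshSize N with hdef
  -- The first sum, with ⟦log ϑ⟧, is summed by parts onto a second difference of `a`. The second is
  -- the trapezoidal error, quadratic in the temperature jump, times a jump of `a`.
  have e1 : cellInt (fun K => jump th i K * avg (fun L => 1 / th L) i K * jump a i K)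
      = cellInt (fun K => jump a i K * jump (fun L => Real.log (th L)) i K)
        + cellInt (fun K => (jump th i K * avg (fun L => 1 / th L) i K
          - jump (fun L => Real.log (th L)) i K) * jump a i K) := by
    rw [← cellInt_add]; congr 1; funext K; ring
  have b1 : |cellInt (fun K => jump a i K * jump (fun L => Real.log (th L)) i K)|
      ≤ 3 * M * C * h ^ 2 := by
    rw [cellInt_mul_jump, abs_neg, ← cellInt_const (d := d) (N := N) (3 * M * C * h ^ 2)]
    refine abs_cellInt_le_of_le fun K => ?_
    rw [abs_mul]
    calc _ ≤ C * (3 * M * h ^ 2) := by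
          gcongr
          · exact (abs_nonneg _).trans (hC K)
          · exact hC K
          · exact ht.abs_jump_sub_prev i K
      _ = _ := by ring
  have b2 : |cellInt (fun K => (jump th i K * avg (fun L => 1 / th L) i K
          - jump (fun L => Real.log (th L)) i K) * jump a i K)|
      ≤ M * h / t1 ^ 2 * cellInt (fun K => jump th i K ^ 2) := by
    rw [← cellInt_const_mul]
    refine abs_cellInt_le_of_le fun K => ?_
    have hK := ht1.trans_le (hth K)
    have hK' := ht1.trans_le (hth (next i K))
    rw [abs_mul]
    have c1 := abs_log_sub_trapezoid_le hK' hK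
    have c2 : 1 / 2 * ((th (next i K) - th K) ^ 2 / (th (next i K) * th K))
        ≤ 1 / 2 * ((th (next i K) - th K) ^ 2 / t1 ^ 2) := by
      gcongr; rw [sq]; exact mul_le_mul (hth _) (hth _) ht1.le hK'.le
    calc _ ≤ 1 / 2 * ((th (next i K) - th K) ^ 2 / t1 ^ 2) * (2 * M * h) := by
          refine mul_le_mul (c1.trans c2) (ht.abs_jump_le i K) (abs_nonneg _) (by positivity)
      _ = _ := by simp only [jump]; field_simp
  rw [e1, abs_mul, abs_of_pos (by positivity : 0 < 1 / h ^ 2)]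
  calc _ ≤ 1 / h ^ 2 * (3 * M * C * h ^ 2 + M * h / t1 ^ 2 * (h ^ 2 * levelSize eps r u th)) := by
        gcongr
        refine (abs_add_le _ _).trans (add_le_add b1 (b2.trans ?_))
        gcongr
    _ = _ := by field_simp

/-- The temperature dissipation on dual cells. -/
lemma heat_dissipation_consistency (hM : 0 ≤ M) {t1 : ℝ} (ht1 : 0 < t1) (hth : ∀ K, t1 ≤ th K)
    (i : Fin d) {U L : QFun d N} (hUL : HalfSplit (M * meshSize N) a U L) :
    |1 / meshSize N ^ 2
        * cellInt (fun K => avg a i K * (jump th i K ^ 2 / (th (next i K) * th K)))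
      - cellInt (fun K => U K / (th (next i K) * th K) * (jump th i K / meshSize N) ^ 2
          + L K / (th (prev i K) * th K) * (jump th i (prev i K) / meshSize N) ^ 2)|
      ≤ M / t1 ^ 2 * (meshSize N * levelSize eps r u th) := by
  have hh := meshSize_pos (N := N)
  have hj := jump_temp_sq_le eps r u th i
  set h := meshSize N with hdef
  -- Regrouped by faces, the dual cell of K|next K receives the upper half of `K` and the lower half
  -- of its successor; their joint weight differs from the face average of `a` by `O(h)`.
  have e1 : 1 / h ^ 2 * cellInt (fun K => avg a i K * (jump th i K ^ 2 / (th (next i K) * th K)))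
      - cellInt (fun K => U K / (th (next i K) * th K) * (jump th i K / h) ^ 2
          + L K / (th (prev i K) * th K) * (jump th i (prev i K) / h) ^ 2)
      = cellInt (fun K => 1 / h ^ 2 * ((avg a i K - (U K + L (next i K)))
        * (jump th i K ^ 2 / (th (next i K) * th K)))) := by
    have := cellInt_prev i (fun K => L (next i K) / (th K * th (next i K)) * (jump th i K / h) ^ 2)
    simp only [next_prev] at this
    rw [cellInt_add, this, ← cellInt_add, ← cellInt_const_mul, ← cellInt_sub]
    congr 1; funext K
    have := (ht1.trans_le (hth K)).ne'
    have := (ht1.trans_le (hth (next i K))).ne'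
    field_simp
  rw [e1]
  have b : |cellInt (fun K => 1 / h ^ 2 * ((avg a i K - (U K + L (next i K)))
        * (jump th i K ^ 2 / (th (next i K) * th K))))|
      ≤ M / (h * t1 ^ 2) * cellInt (fun K => jump th i K ^ 2) := by
    rw [← cellInt_const_mul]
    refine abs_cellInt_le_of_le fun K => ?_
    have hK := ht1.trans_le (hth K)
    have hK' := ht1.trans_le (hth (next i K))
    have c1 : |avg a i K - (U K + L (next i K))| ≤ M * h := by
      have h1 := hUL.add_eq K
      have h2 := hUL.add_eq (next i K)
      have h3 := abs_le.1 (hUL.abs_sub_le K)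
      have h4 := abs_le.1 (hUL.abs_sub_le (next i K))
      simp only [avg]
      rw [abs_le]; constructor <;> linarith
    have c2 : jump th i K ^ 2 / (th (next i K) * th K) ≤ jump th i K ^ 2 / t1 ^ 2 := by
      gcongr; rw [sq]; exact mul_le_mul (hth _) (hth _) ht1.le hK'.le
    have c3 : 0 ≤ jump th i K ^ 2 / (th (next i K) * th K) := by positivity
    rw [abs_mul, abs_mul, abs_of_pos (by positivity : 0 < 1 / h ^ 2), abs_of_nonneg c3]
    calc _ ≤ 1 / h ^ 2 * (M * h * (jump th i K ^ 2 / t1 ^ 2)) := by gcongr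
      _ = _ := by field_simp
  refine b.trans ?_
  calc _ ≤ M / (h * t1 ^ 2) * (h ^ 2 * levelSize eps r u th) := by gcongr
    _ = _ := by field_simp

end EntropyConsistency

/-! ### Consistency of the spatial part of the entropy balance. -/

section EntropyForm

variable {d N : ℕ} [NeZero N]

/-- The spatial part of the weak entropy inequality; `U, L` and `U', L'` are the integrals of the
test function and of its partial derivatives over half cells. -/
def entropyForm (mu lam kappa gamma : ℝ) (r : QFun d N) (u : Fin d → QFun d N) (th : QFun d N)
    (a : QFun d N) (g U L U' L' : Fin d → QFun d N) : ℝ :=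
  (∑ i, cellInt (fun K => r K * discEntropy gamma r th K * u i K * g i K))
    + cellInt (fun K => stressPower mu lam u K * (a K / th K))
    + kappa * ∑ i, cellInt (fun K => U i K / (th (next i K) * th K) * (jump th i K / meshSize N) ^ 2
          + L i K / (th (prev i K) * th K) * (jump th i (prev i K) / meshSize N) ^ 2)
    - kappa * ∑ i, cellInt (fun K => 1 / th K * (jump th i K / meshSize N * U' i K
          + jump th i (prev i K) / meshSize N * L' i K))

lemma stressPower_nonneg {mu lam : ℝ} (hmu : 0 < mu) (hlam : 0 ≤ lam) (u : Fin d → QFun d N)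
    (K : Cell d N) : 0 ≤ stressPower mu lam u K := by
  rw [stressPower_eq]
  have : 0 ≤ ∑ i, ∑ j, discSymGrad u i j K ^ 2 :=
    Finset.sum_nonneg fun i _ => Finset.sum_nonneg fun j _ => sq_nonneg _
  positivity

-- Both lower bounds are needed by the telescoping in time. The first reproduces the limit form and
-- is used where that form is integrated. The second serves the remainder of a time slab: the
-- dissipation is dropped by its sign, and the heat flux is integrated by parts so that only the
-- kinetic energy is left.
set_option maxHeartbeats 800000 in
lemma exists_entropy_consistency (d : ℕ) {mu lam kappa gamma eps r1 r2 t1 t2 M : ℝ} (hM : 0 ≤ M)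
    (hmu : 0 < mu) (hlam : 0 ≤ lam) (hkappa : 0 < kappa) (hg : 1 < gamma) (heps : -1 < eps)
    (hr1 : 0 < r1) (ht1 : 0 < t1) :
    ∃ C : ℝ, 0 ≤ C ∧ ∀ {N : ℕ} [NeZero N] {dt : ℝ} {r0 r : QFun d N} {u0 u : Fin d → QFun d N}
      {th0 th : QFun d N}, 0 < dt → SchemeStep mu lam kappa gamma eps dt r0 r u0 u th0 th →
      InRange r1 r2 t1 t2 r0 th0 → InRange r1 r2 t1 t2 r th →
      ∀ {a : QFun d N} {g U L U' L' : Fin d → QFun d N}, DiscTest M a g → (∀ K, 0 ≤ a K) →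
      (∀ i, HalfSplit (M * meshSize N) a (U i) (L i)) →
      (∀ i, HalfSplit (M * meshSize N) (g i) (U' i) (L' i)) →
      (entropyForm mu lam kappa gamma r u th a g U L U' L'
          - C * (meshSize N + meshSize N ^ (1 - eps) + meshSize N ^ (1 + eps))
            * levelSize eps r u th
        ≤ cellInt (fun K => (r K * discEntropy gamma r th K - r0 K * discEntropy gamma r0 th0 K) / dt
          * a K)) ∧
      (-(C * (1 + cellInt (fun K => ∑ j, u j K ^ 2)))
          - C * (meshSize N + meshSize N ^ (1 - eps) + meshSize N ^ (1 + eps))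
            * levelSize eps r u th
        ≤ cellInt (fun K => (r K * discEntropy gamma r th K - r0 K * discEntropy gamma r0 th0 K) / dt
          * a K)) := by
  obtain ⟨Ce, hCe, hCeb⟩ := exists_entropy_bound (r2 := r2) (t2 := t2) hg hr1 ht1
  obtain ⟨Cp, hCp, hCpb⟩ := exists_entropyProd_bound (r2 := r2) (t2 := t2) hg hr1 ht1
  set b := |r2| * Ce with hb
  have hb0 : 0 ≤ b := by positivity
  -- The constants belong to the entropy flux, the numerical production, the heat dissipation on
  -- dual cells, the heat flux, and, in `E5`, the size of the flux terms themselves. `E3` also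
  -- absorbs the trapezoidal error in the second bound.
  set E1 := d * (M * (5 * b + (b + Ce))) with hE1
  set E2 := d * (M * Cp * (|t2| + 3)) with hE2
  set E3 := d * (kappa * (M / t1 ^ 2)) with hE3
  set E4 := d * (kappa * (4 * M / t1)) with hE4
  set E5 := d * (b * M) + d * (kappa * (3 * M * Ce)) with hE5
  have p1 : 0 ≤ E1 := by positivity
  have p2 : 0 ≤ E2 := by positivity
  have p3 : 0 ≤ E3 := by positivity
  have p4 : 0 ≤ E4 := by positivity
  have p5 : 0 ≤ E5 := by positivity
  refine ⟨E1 + E2 + E3 + E4 + E5, by positivity, ?_⟩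
  intro N _ dt r0 r u0 u th0 th hdt hs hR0 hR a g U L U' L' hT ha hU hU'
  have hh := meshSize_pos (N := N)
  have hA0 : 0 < meshSize N ^ (1 - eps) := Real.rpow_pos_of_pos hh _
  have hB0 : 0 < meshSize N ^ (1 + eps) := Real.rpow_pos_of_pos hh _
  have hpos : ∀ K, 0 < r K := fun K => hr1.trans_le (hR.rho_ge K)
  have tpos : ∀ K, 0 < th K := fun K => ht1.trans_le (hR.temp_ge K)
  have hr2 : ∀ K, |r K| ≤ |r2| := fun K => by
    rw [abs_of_pos (hpos K)]; exact (hR.rho_le K).trans (le_abs_self _)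
  obtain ⟨hs1, hs2, hs3⟩ := hCeb hR
  have hineq := hs.entropy_ineq hdt hg hpos (fun K => hr1.trans_le (hR0.rho_ge K)) tpos
    (fun K => ht1.trans_le (hR0.temp_ge K)) ha
  set s := discEntropy gamma r th with hsdef
  set S := levelSize eps r u th with hSdef
  have hS1 : 1 ≤ S := one_le_levelSize eps r u th
  set h := meshSize N with hhdef
  set A := h ^ (1 - eps) with hA
  set B := h ^ (1 + eps) with hB
  -- flux of the entropy
  have hq : ∀ K, |r K * s K| ≤ b := fun K => by
    rw [abs_mul]; exact mul_le_mul (hr2 K) (hs1 K) (abs_nonneg _) (abs_nonneg _)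
  have hjq : ∀ i K, |jump (fun L => r L * s L) i K|
      ≤ (b + Ce) * (|jump r i K| + |jump th i K|) := by
    intro i K
    have e : jump (fun L => r L * s L) i K = r (next i K) * jump s i K + s K * jump r i K := by
      simp only [jump]; ring
    rw [e]
    refine (abs_add_le _ _).trans ?_
    rw [abs_mul, abs_mul]
    have k1 := mul_le_mul (hr2 (next i K)) (hs3 i K) (abs_nonneg _) (abs_nonneg _)
    have k2 := mul_le_mul_of_nonneg_right (hs1 K) (abs_nonneg (jump r i K))
    have k3 : 0 ≤ Ce * |jump th i K| := by positivity
    rw [add_mul, hb]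
    linarith
  have b1 : |1 / h * ∑ i, cellInt (fun K => diffFlux eps (fun L => r L * s L) u i K * jump a i K)
      - ∑ i, cellInt (fun K => r K * s K * u i K * g i K)| ≤ E1 * (h + A + B) * S := by
    have key : ∀ i, _ := fun i => flux_consistency_bounded (eps := eps) (u := u) (r := r) (th := th)
      hT (by positivity : 0 ≤ b + Ce) hq i (hjq i)
    rw [Finset.mul_sum, ← Finset.sum_sub_distrib]
    refine (Finset.abs_sum_le_sum_abs _ _).trans ((Finset.sum_le_sum fun i _ => key i).trans ?_)
    rw [Finset.sum_const, Finset.card_univ, Fintype.card_fin, nsmul_eq_mul]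
    exact le_of_eq (by rw [hE1]; ring)
  -- numerical entropy production
  have b2 : 1 / h * ∑ i, cellInt (fun K => 1 / 2 * (|avg (u i) i K| + h ^ eps)
        * entropyProd gamma r th i K * |jump a i K|) ≤ E2 * (h * S) := by
    have key : ∀ i, 1 / h * cellInt (fun K => 1 / 2 * (|avg (u i) i K| + h ^ eps)
        * entropyProd gamma r th i K * |jump a i K|) ≤ M * Cp * (|t2| + 3) * (h * S) := by
      intro i
      have k1 := jump_density_sq_le eps r u th i
      have k2 := jump_temp_sq_weighted_le (u := u) (r := r) heps (fun K => (tpos K).le)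
        (fun K => (hR.temp_le K).trans (le_abs_self t2)) i
      have k3 : cellInt (fun K => 1 / 2 * (|avg (u i) i K| + h ^ eps)
          * entropyProd gamma r th i K * |jump a i K|)
          ≤ M * h * Cp * (cellInt (fun K => (|avg (u i) i K| + h ^ eps) * jump r i K ^ 2)
            + cellInt (fun K => (|avg (u i) i K| + h ^ eps) * jump th i K ^ 2)) := by
        rw [← cellInt_add, ← cellInt_const_mul]
        refine cellInt_mono fun K => ?_
        have he : 0 < h ^ eps := Real.rpow_pos_of_pos hh _
        have n := entropyProd_nonneg hg hpos tpos i K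
        calc _ ≤ 1 / 2 * (|avg (u i) i K| + h ^ eps) * (Cp * (jump r i K ^ 2 + jump th i K ^ 2))
              * (2 * M * h) := by
              gcongr
              · exact hCpb hR i K
              · exact hT.abs_jump_le i K
          _ = _ := by ring
      calc _ ≤ 1 / h * (M * h * Cp * (2 * h * S + (|t2| + 1) * h * S)) := by gcongr; exact k3.trans (by gcongr)
        _ = _ := by field_simp; ring
    rw [Finset.mul_sum]
    refine (Finset.sum_le_sum fun i _ => key i).trans ?_
    rw [Finset.sum_const, Finset.card_univ, Fintype.card_fin, nsmul_eq_mul]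
    exact le_of_eq (by rw [hE2]; ring)
  -- heat conduction
  have e3 : 1 / h * ∑ i, cellInt (fun K => kappa / h
        * (avg a i K * (jump th i K ^ 2 / (th (next i K) * th K))))
      = kappa * ∑ i, 1 / h ^ 2
        * cellInt (fun K => avg a i K * (jump th i K ^ 2 / (th (next i K) * th K))) := by
    rw [Finset.mul_sum, Finset.mul_sum]
    refine Finset.sum_congr rfl fun i _ => ?_
    rw [cellInt_const_mul]; field_simp
  have e4 : 1 / h * ∑ i, cellInt (fun K => kappa / h
        * (jump th i K * avg (fun L => 1 / th L) i K * jump a i K))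
      = kappa * ∑ i, 1 / h ^ 2
        * cellInt (fun K => jump th i K * avg (fun L => 1 / th L) i K * jump a i K) := by
    rw [Finset.mul_sum, Finset.mul_sum]
    refine Finset.sum_congr rfl fun i _ => ?_
    rw [cellInt_const_mul]; field_simp
  have b3 : |∑ i, 1 / h ^ 2
        * cellInt (fun K => avg a i K * (jump th i K ^ 2 / (th (next i K) * th K)))
      - ∑ i, cellInt (fun K => U i K / (th (next i K) * th K) * (jump th i K / h) ^ 2
          + L i K / (th (prev i K) * th K) * (jump th i (prev i K) / h) ^ 2)|
      ≤ d * (M / t1 ^ 2 * (h * S)) := by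
    rw [← Finset.sum_sub_distrib]
    refine (Finset.abs_sum_le_sum_abs _ _).trans ((Finset.sum_le_sum fun i _ =>
      heat_dissipation_consistency (eps := eps) (u := u) (r := r) hM ht1 hR.temp_ge i
        (hU i)).trans ?_)
    rw [Finset.sum_const, Finset.card_univ, Fintype.card_fin, nsmul_eq_mul]
  have b4 : |∑ i, 1 / h ^ 2
        * cellInt (fun K => jump th i K * avg (fun L => 1 / th L) i K * jump a i K)
      - ∑ i, cellInt (fun K => 1 / th K * (jump th i K / h * U' i K
          + jump th i (prev i K) / h * L' i K))|
      ≤ d * (4 * M / t1 * (h * S)) := by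
    rw [← Finset.sum_sub_distrib]
    refine (Finset.abs_sum_le_sum_abs _ _).trans ((Finset.sum_le_sum fun i _ =>
      heat_flux_consistency (eps := eps) (u := u) (r := r) hT ht1 hR.temp_ge i (hU' i)).trans ?_)
    rw [Finset.sum_const, Finset.card_univ, Fintype.card_fin, nsmul_eq_mul]
  have b5 : |∑ i, 1 / h ^ 2
        * cellInt (fun K => jump th i K * avg (fun L => 1 / th L) i K * jump a i K)|
      ≤ d * (3 * M * Ce + M / t1 ^ 2 * (h * S)) := by
    refine (Finset.abs_sum_le_sum_abs _ _).trans ((Finset.sum_le_sum fun i _ =>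
      abs_heat_flux_le (eps := eps) (u := u) (r := r) hT ht1 hR.temp_ge hs2 i).trans ?_)
    rw [Finset.sum_const, Finset.card_univ, Fintype.card_fin, nsmul_eq_mul]
  rw [e3, e4] at hineq
  have hV0 : 0 ≤ cellInt (fun K => ∑ j, u j K ^ 2) :=
    cellInt_nonneg fun K => Finset.sum_nonneg fun j _ => sq_nonneg _
  set V := cellInt (fun K => ∑ j, u j K ^ 2) with hVdef
  have hAS : 0 ≤ A * S := by positivity
  have hBS : 0 ≤ B * S := by positivity
  have hhS : 0 ≤ h * S := by positivity
  have c1 := abs_le.1 b1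
  have c3 := abs_le.1 b3
  have c4 := abs_le.1 b4
  have c5 := abs_le.1 b5
  have zz : ∀ E : ℝ, 0 ≤ E → E * (h * S) ≤ E * (h + A + B) * S := fun E hE => by
    have := mul_nonneg hE (add_nonneg hAS hBS)
    linarith
  have z2 := zz E2 p2
  have z3 := zz E3 p3
  have z4 := zz E4 p4
  have z5 : 0 ≤ E5 * (h + A + B) * S := by positivity
  have z4' : 0 ≤ E4 * (h + A + B) * S := by positivity
  have hsplit : (E1 + E2 + E3 + E4 + E5) * (h + A + B) * S = E1 * (h + A + B) * S
      + E2 * (h + A + B) * S + E3 * (h + A + B) * S + E4 * (h + A + B) * S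
      + E5 * (h + A + B) * S := by ring
  constructor
  · refine le_trans ?_ hineq
    unfold entropyForm
    have m3 := mul_le_mul_of_nonneg_left c3.1 hkappa.le
    have m4 := mul_le_mul_of_nonneg_left c4.2 hkappa.le
    have y3 : kappa * (d * (M / t1 ^ 2 * (h * S))) = E3 * (h * S) := by rw [hE3]; ring
    have y4 : kappa * (d * (4 * M / t1 * (h * S))) = E4 * (h * S) := by rw [hE4]; ring
    rw [mul_sub] at m3 m4
    rw [mul_neg, y3] at m3
    rw [y4] at m4
    rw [hsplit]
    linarith [c1.1]
  · refine le_trans ?_ hineq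
    have m5 := mul_le_mul_of_nonneg_left c5.2 hkappa.le
    have y5 : kappa * (d * (3 * M * Ce + M / t1 ^ 2 * (h * S)))
        = d * (kappa * (3 * M * Ce)) + E3 * (h * S) := by rw [hE3]; ring
    rw [y5] at m5
    have n1 : 0 ≤ cellInt (fun K => stressPower mu lam u K * (a K / th K)) :=
      cellInt_nonneg fun K => mul_nonneg (stressPower_nonneg hmu hlam u K)
        (div_nonneg (ha K) (tpos K).le)
    have n2 : 0 ≤ kappa * ∑ i, 1 / h ^ 2
        * cellInt (fun K => avg a i K * (jump th i K ^ 2 / (th (next i K) * th K))) := by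
      refine mul_nonneg hkappa.le (Finset.sum_nonneg fun i _ => mul_nonneg (by positivity)
        (cellInt_nonneg fun K => mul_nonneg ?_ ?_))
      · simp only [avg]; have := ha K; have := ha (next i K); positivity
      · have := tpos K; have := tpos (next i K); positivity
    have n3 := abs_le.1 (abs_cellInt_flux_le (u := u) hT.grad_le hq)
    have w5 : d * (b * M) * (1 + V) + d * (kappa * (3 * M * Ce)) ≤ E5 * (1 + V) := by
      rw [hE5]
      have : 0 ≤ d * (kappa * (3 * M * Ce)) * V := by positivity
      linarith
    have w : E5 * (1 + V) ≤ (E1 + E2 + E3 + E4 + E5) * (1 + V) := by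
      gcongr; linarith
    rw [hsplit]
    linarith [c1.1, n3.1]

end EntropyForm

/-! ## Mollification of periodic functions and the weak translation formula -/

section Mollification

open Filter Topology

variable {d : ℕ}

/-- A sequence of bump functions shrinking to the origin. -/
def bumpSeq (d n : ℕ) : ContDiffBump (0 : Pt d) where
  rIn := 1 / ((n : ℝ) + 1)
  rOut := 2 / ((n : ℝ) + 1)
  rIn_pos := by positivity
  rIn_lt_rOut := by gcongr; norm_num

/-- Mollification. -/
def mollify (n : ℕ) (f : Pt d → ℝ) : Pt d → ℝ :=
  convolution ((bumpSeq d n).normed volume) f (ContinuousLinearMap.lsmul ℝ ℝ) volume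

lemma mollify_apply (n : ℕ) (f : Pt d → ℝ) (x : Pt d) :
    mollify n f x = ∫ t, (bumpSeq d n).normed volume t * f (x - t) := by
  simp [mollify, convolution]

lemma locallyIntegrable_of_bounded {f : Pt d → ℝ} {B : ℝ} (hf : Measurable f)
    (hB : ∀ x, |f x| ≤ B) : LocallyIntegrable f volume := by
  intro x
  refine ⟨Metric.ball x 1, Metric.ball_mem_nhds x one_pos, ?_⟩
  refine Measure.integrableOn_of_bounded (M := B) measure_ball_lt_top.ne
    hf.aestronglyMeasurable ?_
  exact Eventually.of_forall fun y => hB y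

lemma contDiff_mollify (n : ℕ) {f : Pt d → ℝ} {B : ℝ} (hf : Measurable f)
    (hB : ∀ x, |f x| ≤ B) : ContDiff ℝ ∞ (mollify n f) :=
  (bumpSeq d n).hasCompactSupport_normed.contDiff_convolution_left _
    (bumpSeq d n).contDiff_normed (locallyIntegrable_of_bounded hf hB)

lemma abs_mollify_le (n : ℕ) {f : Pt d → ℝ} {B : ℝ}
    (hB : ∀ x, |f x| ≤ B) (x : Pt d) : |mollify n f x| ≤ B := by
  rw [mollify_apply]
  have h := norm_integral_le_of_norm_le (μ := volume)
    (f := fun t => (bumpSeq d n).normed volume t * f (x - t))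
    ((bumpSeq d n).integrable_normed.mul_const B) (Eventually.of_forall fun t => by
      rw [Real.norm_eq_abs, abs_mul, abs_of_nonneg ((bumpSeq d n).nonneg_normed t)]
      exact mul_le_mul_of_nonneg_left (hB _) ((bumpSeq d n).nonneg_normed t))
  rwa [integral_mul_const, (bumpSeq d n).integral_normed, one_mul] at h

lemma mollify_periodic (n : ℕ) {f : Pt d → ℝ} (hp : IsPeriodic f) : IsPeriodic (mollify n f) := by
  intro x i
  simp only [mollify_apply]
  congr 1; funext t
  rw [add_sub_right_comm, hp]

/-- Lebesgue differentiation; convergence holds almost everywhere because the radii of each bump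
have the fixed ratio 2. Indicator functions are discontinuous, so no better convergence is
available. -/
lemma ae_tendsto_mollify {f : Pt d → ℝ} {B : ℝ} (hf : Measurable f) (hB : ∀ x, |f x| ≤ B) :
    ∀ᵐ x, Tendsto (fun n => mollify n f x) atTop (𝓝 (f x)) := by
  refine ContDiffBump.ae_convolution_tendsto_right_of_locallyIntegrable (K := 2) ?_ ?_
    (locallyIntegrable_of_bounded hf hB)
  · have := tendsto_one_div_add_atTop_nhds_zero_nat (𝕜 := ℝ)
    have := this.const_mul 2
    simpa [bumpSeq, div_eq_mul_inv] using this
  · refine Eventually.of_forall fun n => le_of_eq ?_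
    simp only [bumpSeq]; ring

/-- The integral of `f` over the segment from `x - s v` to `x`. -/
def backInt (v : Pt d) (s : ℝ) (f : Pt d → ℝ) (x : Pt d) : ℝ := ∫ r in (0 : ℝ)..s, f (x - r • v)

lemma measurable_backInt (v : Pt d) (s : ℝ) {f : Pt d → ℝ} (hf : Measurable f) :
    Measurable (backInt v s f) := by
  have h : StronglyMeasurable (Function.uncurry fun (x : Pt d) (r : ℝ) => f (x - r • v)) := by
    apply Measurable.stronglyMeasurable
    exact hf.comp (measurable_fst.sub (measurable_snd.smul_const v))
  unfold backInt intervalIntegral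
  exact (h.integral_prod_right.measurable).sub (h.integral_prod_right.measurable)

lemma abs_backInt_le (v : Pt d) {s : ℝ} (hs : 0 ≤ s) {f : Pt d → ℝ} {B : ℝ}
    (hB : ∀ x, |f x| ≤ B) (x : Pt d) : |backInt v s f x| ≤ B * s := by
  have := intervalIntegral.norm_integral_le_of_norm_le_const (a := 0) (b := s)
    (f := fun r => f (x - r • v)) (C := B) (fun r _ => hB _)
  rwa [sub_zero, abs_of_nonneg hs] at this

lemma backInt_periodic (v : Pt d) (s : ℝ) {f : Pt d → ℝ} (hp : IsPeriodic f) :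
    IsPeriodic (backInt v s f) := by
  intro x i
  unfold backInt
  congr 1; funext r
  rw [add_sub_right_comm, hp]

/-- Both operations average translates of `f`, so they commute by Fubini. -/
lemma mollify_backInt (n : ℕ) (v : Pt d) (s : ℝ) {f : Pt d → ℝ} {B : ℝ} (hf : Measurable f)
    (hB : ∀ x, |f x| ≤ B) (x : Pt d) :
    mollify n (backInt v s f) x = backInt v s (mollify n f) x := by
  simp only [backInt, mollify_apply]
  rw [intervalIntegral_integral_swap]
  · congr 1; funext t
    rw [← intervalIntegral.integral_const_mul]
    congr 1; funext r
    rw [sub_right_comm]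
  · have hi : Integrable (fun z : ℝ × Pt d => (bumpSeq d n).normed volume z.2)
        ((volume.restrict (Set.uIoc 0 s)).prod volume) := by
      have : IsFiniteMeasure (volume.restrict (Set.uIoc (0 : ℝ) s)) :=
        ⟨by simp [Set.uIoc]⟩
      exact (bumpSeq d n).integrable_normed.comp_snd _
    refine hi.mul_bdd (c := B) (g := fun z : ℝ × Pt d => f (x - z.1 • v - z.2)) ?_ ?_
    · refine (hf.comp ?_).aestronglyMeasurable
      exact (measurable_const.sub (measurable_fst.smul_const v)).sub measurable_snd
    · exact Eventually.of_forall fun t => hB _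

lemma fderiv_mollify_backInt (n : ℕ) (v : Pt d) (s : ℝ) {f : Pt d → ℝ} {B : ℝ} (hf : Measurable f)
    (hB : ∀ x, |f x| ≤ B) (hs : 0 ≤ s) (x : Pt d) :
    fderiv ℝ (mollify n (backInt v s f)) x v = mollify n f x - mollify n f (x - s • v) := by
  have hd : DifferentiableAt ℝ (mollify n (backInt v s f)) x :=
    ((contDiff_mollify n (measurable_backInt v s hf) (abs_backInt_le v hs hB)).differentiable
      (by simp)) x
  have h1 : HasDerivAt (fun σ : ℝ => mollify n (backInt v s f) (x + σ • v))
      (fderiv ℝ (mollify n (backInt v s f)) x v) 0 := by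
    have hl : HasDerivAt (fun σ : ℝ => x + σ • v) v 0 := by
      simpa using ((hasDerivAt_id (0 : ℝ)).smul_const v).const_add x
    have hd' : HasFDerivAt (mollify n (backInt v s f)) (fderiv ℝ (mollify n (backInt v s f)) x)
        (x + (0 : ℝ) • v) := by simpa using hd.hasFDerivAt
    exact hd'.comp_hasDerivAt (0 : ℝ) hl
  set G : ℝ → ℝ := fun q => mollify n f (x + q • v) with hG
  have hGc : Continuous G :=
    (contDiff_mollify n hf hB).continuous.comp (by fun_prop)
  -- Along the line through `x` in direction `v` the function is the integral of a continuous
  -- function over the sliding window from σ - s to σ. Its derivative is the difference of the end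
  -- values.
  have h2 : (fun σ : ℝ => mollify n (backInt v s f) (x + σ • v))
      = fun σ => (∫ q in (0 : ℝ)..σ, G q) - ∫ q in (0 : ℝ)..(σ - s), G q := by
    funext σ
    rw [mollify_backInt n v s hf hB]
    have e : backInt v s (mollify n f) (x + σ • v) = ∫ r in (0 : ℝ)..s, G (σ - r) := by
      unfold backInt
      congr 1; funext r
      simp only [hG]; congr 1; module
    rw [e, intervalIntegral.integral_comp_sub_left, sub_zero,
      intervalIntegral.integral_interval_sub_left (hGc.intervalIntegrable _ _)
        (hGc.intervalIntegrable _ _)]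
  have h3 : HasDerivAt (fun σ : ℝ => mollify n (backInt v s f) (x + σ • v)) (G 0 - G (-s)) 0 := by
    rw [h2]
    have a1 : HasDerivAt (fun σ => ∫ q in (0 : ℝ)..σ, G q) (G 0) 0 :=
      intervalIntegral.integral_hasDerivAt_right (hGc.intervalIntegrable _ _)
        (hGc.stronglyMeasurableAtFilter _ _) hGc.continuousAt
    have a2 : HasDerivAt (fun σ => ∫ q in (0 : ℝ)..(σ - s), G q) (G (-s)) 0 := by
      have b1 : HasDerivAt (fun σ => ∫ q in (0 : ℝ)..σ, G q) (G (0 - s)) (0 - s) :=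
        intervalIntegral.integral_hasDerivAt_right (hGc.intervalIntegrable _ _)
          (hGc.stronglyMeasurableAtFilter _ _) hGc.continuousAt
      have b2 := b1.comp_sub_const 0 s
      rwa [zero_sub] at b2
    exact a1.sub a2
  rw [h1.unique h3]
  simp only [hG]
  congr 2
  · simp
  · module

instance : IsFiniteMeasure (torusMeasure d) := by
  refine ⟨?_⟩
  unfold torusMeasure unitCube
  rw [Measure.restrict_apply_univ, volume_pi_pi]
  simp

/-- Weak derivatives tested with bounded measurable periodic functions: integration along
translations. -/
lemma HasWeakPartial.translation {i : Fin d} {f g : Pt d → ℝ} (h : HasWeakPartial i f g)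
    (hf : Integrable f (torusMeasure d)) (hg : Integrable g (torusMeasure d))
    {χ : Pt d → ℝ} {B s : ℝ} (hχ : Measurable χ) (hB : ∀ x, |χ x| ≤ B) (hp : IsPeriodic χ)
    (hs : 0 ≤ s) :
    ∫ x, f x * (χ x - χ (x - s • Pi.single i 1)) ∂(torusMeasure d)
      = -∫ x, g x * backInt (Pi.single i 1) s χ x ∂(torusMeasure d) := by
  set v : Pt d := Pi.single i 1 with hv
  have hψm := measurable_backInt v s hχ
  have hψb := abs_backInt_le v hs hB
  -- The mollified segment integral is smooth and periodic, hence admissible, and its derivative in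
  -- direction `v` is a difference of translates. Both sides then pass to the limit by dominated
  -- convergence.
  have hn : ∀ n, ∫ x, f x * (mollify n χ x - mollify n χ (x - s • v)) ∂(torusMeasure d)
      = -∫ x, g x * mollify n (backInt v s χ) x ∂(torusMeasure d) := by
    intro n
    rw [← h _ (contDiff_mollify n hψm hψb) (mollify_periodic n (backInt_periodic v s hp))]
    congr 1; funext x
    rw [fderiv_mollify_backInt n v s hχ hB hs]
  have c1 := ae_tendsto_mollify hχ hB
  have c2 : ∀ᵐ x, Tendsto (fun n => mollify n χ (x - s • v)) atTop (𝓝 (χ (x - s • v))) :=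
    (measurePreserving_sub_right volume (s • v)).quasiMeasurePreserving.ae c1
  have c3 := ae_tendsto_mollify hψm hψb
  have t1 : Tendsto (fun n => ∫ x, f x * (mollify n χ x - mollify n χ (x - s • v))
      ∂(torusMeasure d)) atTop (𝓝 (∫ x, f x * (χ x - χ (x - s • v)) ∂(torusMeasure d))) := by
    refine tendsto_integral_of_dominated_convergence (fun x => |f x| * (B + B)) ?_
      (hf.abs.mul_const _) ?_ ?_
    · intro n
      have hc := (contDiff_mollify n hχ hB).continuous
      exact hf.aestronglyMeasurable.mul (Continuous.aestronglyMeasurable (by fun_prop))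
    · intro n
      refine Eventually.of_forall fun x => ?_
      rw [Real.norm_eq_abs, abs_mul]
      refine mul_le_mul_of_nonneg_left ?_ (abs_nonneg _)
      exact (abs_sub _ _).trans (add_le_add (abs_mollify_le n hB _) (abs_mollify_le n hB _))
    · filter_upwards [ae_restrict_of_ae c1, ae_restrict_of_ae c2] with x h1 h2
      exact (h1.sub h2).const_mul _
  have t2 : Tendsto (fun n => -∫ x, g x * mollify n (backInt v s χ) x ∂(torusMeasure d)) atTop
      (𝓝 (-∫ x, g x * backInt v s χ x ∂(torusMeasure d))) := by
    refine Tendsto.neg ?_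
    refine tendsto_integral_of_dominated_convergence (fun x => |g x| * (B * s)) ?_
      (hg.abs.mul_const _) ?_ ?_
    · intro n
      have hc := (contDiff_mollify n hψm hψb).continuous
      exact hg.aestronglyMeasurable.mul hc.aestronglyMeasurable
    · intro n
      refine Eventually.of_forall fun x => ?_
      rw [Real.norm_eq_abs, abs_mul]
      exact mul_le_mul_of_nonneg_left (abs_mollify_le n hψb _) (abs_nonneg _)
    · filter_upwards [ae_restrict_of_ae c3] with x h1
      exact h1.const_mul _
  simp only [hn] at t1
  exact tendsto_nhds_unique t1 t2

end Mollification

/-! ## Integrals over cells -/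

section Cells

open Filter

variable {d N : ℕ} [NeZero N]

lemma natCast_mul_meshSize : (N : ℝ) * meshSize N = 1 := by
  have : (N : ℝ) ≠ 0 := Nat.cast_ne_zero.2 (NeZero.ne N)
  unfold meshSize; field_simp

lemma measurableSet_cellOf (K : Cell d N) : MeasurableSet {x : Pt d | cellOf N x = K} := by
  have : {x : Pt d | cellOf N x = K}
      = ⋂ i, (fun x : Pt d => ⌊(N : ℝ) * x i⌋) ⁻¹' {z : ℤ | (z : ZMod N) = K i} := by
    ext x; simp [cellOf, funext_iff]
  rw [this]
  refine MeasurableSet.iInter fun i => ?_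
  have hm : Measurable (fun x : Pt d => ⌊(N : ℝ) * x i⌋) :=
    Int.measurable_floor.comp ((measurable_pi_apply i).const_mul _)
  exact hm (MeasurableSet.of_discrete)

lemma cellOf_add_single (x : Pt d) (i : Fin d) (z : ℤ) (s : ℝ) (hs : (N : ℝ) * s = z) :
    cellOf N (x + Pi.single i s) = cellOf N x + Pi.single i (z : ZMod N) := by
  funext j
  rcases eq_or_ne j i with rfl | hj
  · simp [cellOf, mul_add, hs]
  · simp [cellOf, hj]

lemma cellOf_add_single_one (x : Pt d) (i : Fin d) :
    cellOf N (x + Pi.single i 1) = cellOf N x := by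
  rw [cellOf_add_single x i N 1 (by simp)]; simp

lemma cellOf_sub_meshSize (x : Pt d) (i : Fin d) :
    cellOf N (x - meshSize N • Pi.single i (1 : ℝ)) = prev i (cellOf N x) := by
  have : x - meshSize N • Pi.single i (1 : ℝ) = x + Pi.single i (-meshSize N) := by
    rw [sub_eq_add_neg, ← Pi.single_smul, ← Pi.single_neg]; simp
  rw [this, cellOf_add_single x i (-1) _ (by rw [mul_neg, natCast_mul_meshSize]; simp)]
  simp [prev, Pi.single_neg, sub_eq_add_neg]

/-- Moving back by at most one mesh size changes the cell by at most one. -/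
lemma cellOf_sub_smul (x : Pt d) (i : Fin d) {r : ℝ} (hr0 : 0 ≤ r) (hr : r ≤ meshSize N) :
    cellOf N (x - r • Pi.single i (1 : ℝ)) = cellOf N x ∨
      cellOf N (x - r • Pi.single i (1 : ℝ)) = prev i (cellOf N x) := by
  have hN : (0 : ℝ) < N := Nat.cast_pos.2 (Nat.pos_of_ne_zero (NeZero.ne N))
  have h1 : ⌊(N : ℝ) * (x i - r)⌋ = ⌊(N : ℝ) * x i⌋ ∨ ⌊(N : ℝ) * (x i - r)⌋ = ⌊(N : ℝ) * x i⌋ - 1 := by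
    have a1 : ⌊(N : ℝ) * (x i - r)⌋ ≤ ⌊(N : ℝ) * x i⌋ := by
      apply Int.floor_le_floor; gcongr; linarith
    have a2 : ⌊(N : ℝ) * x i⌋ - 1 ≤ ⌊(N : ℝ) * (x i - r)⌋ := by
      rw [← Int.floor_sub_one]
      apply Int.floor_le_floor
      have := mul_le_mul_of_nonneg_left hr hN.le
      rw [natCast_mul_meshSize] at this
      linarith
    omega
  rcases h1 with h1 | h1
  · left
    funext j
    rcases eq_or_ne j i with rfl | hj
    · simp [cellOf, h1]
    · simp [cellOf, hj]
  · right
    funext j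
    rcases eq_or_ne j i with rfl | hj
    · simp [cellOf, prev, h1]
    · simp [cellOf, prev, hj]

lemma measurable_comp_cellOf (F : QFun d N) : Measurable fun x : Pt d => F (cellOf N x) := by
  have : (fun x : Pt d => F (cellOf N x))
      = fun x => ∑ K, {x : Pt d | cellOf N x = K}.indicator (fun _ => F K) x := by
    funext x
    simp [Set.indicator_apply]
  rw [this]
  exact Finset.measurable_sum _ fun K _ => measurable_const.indicator (measurableSet_cellOf K)

lemma exists_bound_comp_cellOf (F : QFun d N) : ∃ B, ∀ x : Pt d, |F (cellOf N x)| ≤ B :=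
  ⟨∑ K, |F K|, fun _ => Finset.single_le_sum (f := fun K => |F K|) (fun _ _ => abs_nonneg _)
    (Finset.mem_univ _)⟩

lemma integrable_comp_cellOf_mul (F : QFun d N) {ψ : Pt d → ℝ}
    (hψ : Integrable ψ (torusMeasure d)) :
    Integrable (fun x => F (cellOf N x) * ψ x) (torusMeasure d) := by
  obtain ⟨B, hB⟩ := exists_bound_comp_cellOf F
  exact hψ.bdd_mul (measurable_comp_cellOf F).aestronglyMeasurable (Eventually.of_forall hB)

lemma torusInt_eq_sum_cells {G : Pt d → ℝ} (hG : Integrable G (torusMeasure d)) :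
    torusInt G = ∑ K, ∫ x in {x | cellOf N x = K}, G x ∂(torusMeasure d) := by
  have h : G = fun x => ∑ K, {x : Pt d | cellOf N x = K}.indicator G x := by
    ext; simp [Set.indicator_apply]
  unfold torusInt
  conv_lhs => rw [h]
  rw [integral_finsetSum _ fun K _ => hG.indicator (measurableSet_cellOf K)]
  refine Finset.sum_congr rfl fun K _ => ?_
  rw [integral_indicator (measurableSet_cellOf K)]

/-- Integrals of piecewise constant functions against an integrable function. -/
lemma torusInt_comp_cellOf_mul (F : QFun d N) {ψ : Pt d → ℝ}
    (hψ : Integrable ψ (torusMeasure d)) :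
    torusInt (fun x => F (cellOf N x) * ψ x) = cellInt (fun K => F K * projQ N ψ K) := by
  have hh := meshSize_pos (N := N)
  rw [torusInt_eq_sum_cells (N := N) (integrable_comp_cellOf_mul F hψ), cellInt, Finset.mul_sum]
  refine Finset.sum_congr rfl fun K _ => ?_
  have : ∫ x in {x | cellOf N x = K}, F (cellOf N x) * ψ x ∂(torusMeasure d)
      = ∫ x in {x | cellOf N x = K}, F K * ψ x ∂(torusMeasure d) := by
    refine setIntegral_congr_fun (measurableSet_cellOf K) fun x hx => ?_
    have hx' : cellOf N x = K := hx
    simp only [hx']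
  rw [this, integral_const_mul, projQ]
  field_simp

lemma cellOf_eq_iff {x : Pt d} (hx : x ∈ unitCube d) (K : Cell d N) :
    cellOf N x = K ↔ x ∈ Set.univ.pi fun i =>
      Set.Ico (((K i).val : ℝ) * meshSize N) ((((K i).val : ℝ) + 1) * meshSize N) := by
  have hN : (0 : ℝ) < N := Nat.cast_pos.2 (Nat.pos_of_ne_zero (NeZero.ne N))
  have hh := meshSize_pos (N := N)
  rw [funext_iff, Set.mem_univ_pi]
  refine forall_congr' fun i => ?_
  have hx0 : 0 ≤ x i := (hx i (Set.mem_univ i)).1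
  have hx1 : x i < 1 := (hx i (Set.mem_univ i)).2
  have f0 : 0 ≤ ⌊(N : ℝ) * x i⌋ := Int.floor_nonneg.2 (by positivity)
  have f1 : ⌊(N : ℝ) * x i⌋ < N := by
    rw [Int.floor_lt]; push_cast
    nlinarith
  have e1 : ((⌊(N : ℝ) * x i⌋ : ℤ) : ZMod N) = K i ↔ ⌊(N : ℝ) * x i⌋ = ((K i).val : ℤ) := by
    have hk : K i = (((K i).val : ℤ) : ZMod N) := by simp
    constructor
    · intro h
      rw [hk, ZMod.intCast_eq_intCast_iff] at h
      have hlt := ZMod.val_lt (K i)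
      have := h.eq
      rwa [Int.emod_eq_of_lt f0 f1, Int.emod_eq_of_lt (by positivity) (by exact_mod_cast hlt)] at this
    · intro h; rw [h]; exact hk.symm
  unfold cellOf
  rw [e1, Int.floor_eq_iff, Set.mem_Ico]
  have e2 : x i = (N : ℝ) * x i * meshSize N := by
    rw [mul_right_comm, natCast_mul_meshSize, one_mul]
  push_cast
  constructor
  · rintro ⟨h1, h2⟩
    rw [e2]
    exact ⟨by gcongr, by gcongr⟩
  · rintro ⟨h1, h2⟩
    rw [e2] at h1 h2
    exact ⟨le_of_mul_le_mul_right h1 hh, lt_of_mul_lt_mul_right h2 hh.le⟩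

lemma torusMeasure_cell (K : Cell d N) :
    torusMeasure d {x | cellOf N x = K} = ENNReal.ofReal (meshSize N ^ d) := by
  have hh := meshSize_pos (N := N)
  have e : {x : Pt d | cellOf N x = K} ∩ unitCube d = Set.univ.pi fun i =>
      Set.Ico (((K i).val : ℝ) * meshSize N) ((((K i).val : ℝ) + 1) * meshSize N) := by
    ext x
    constructor
    · rintro ⟨h1, h2⟩; exact (cellOf_eq_iff h2 K).1 h1
    · intro h
      have h2 : x ∈ unitCube d := by
        intro i _
        have hi := h i (Set.mem_univ i)
        refine ⟨le_trans (by positivity) hi.1, hi.2.trans_le ?_⟩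
        have : ((K i).val : ℝ) + 1 ≤ N := by exact_mod_cast ZMod.val_lt (K i)
        calc _ ≤ (N : ℝ) * meshSize N := by gcongr
          _ = 1 := natCast_mul_meshSize
      exact ⟨(cellOf_eq_iff h2 K).2 h, h2⟩
  rw [torusMeasure, Measure.restrict_apply (measurableSet_cellOf K), e, volume_pi_pi]
  simp only [Real.volume_Ico, add_mul, one_mul, add_sub_cancel_left, Finset.prod_const,
    Finset.card_univ, Fintype.card_fin]
  rw [ENNReal.ofReal_pow hh.le]

lemma projQ_one (K : Cell d N) : projQ N (fun _ => (1 : ℝ)) K = 1 := by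
  have hh := meshSize_pos (N := N)
  simp only [projQ, integral_const, smul_eq_mul, mul_one, measureReal_def,
    Measure.restrict_apply_univ, torusMeasure_cell]
  rw [ENNReal.toReal_ofReal (by positivity)]
  field_simp

lemma torusInt_comp_cellOf (F : QFun d N) : torusInt (fun x => F (cellOf N x)) = cellInt F := by
  have := torusInt_comp_cellOf_mul F (integrable_const (μ := torusMeasure d) (1 : ℝ))
  simpa [projQ_one] using this

lemma integrable_comp_cellOf (F : QFun d N) :
    Integrable (fun x => F (cellOf N x)) (torusMeasure d) := by
  simpa using integrable_comp_cellOf_mul F (integrable_const (μ := torusMeasure d) (1 : ℝ))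

/-- Bound for integrals against functions dominated by piecewise constant ones. -/
lemma abs_torusInt_mul_le {g b : Pt d → ℝ} {M : ℝ} (hM : 0 ≤ M) {F : QFun d N}
    (hg : ∀ᵐ x ∂(torusMeasure d), |g x| ≤ M) (hb : ∀ x, |b x| ≤ F (cellOf N x)) :
    |∫ x, g x * b x ∂(torusMeasure d)| ≤ M * cellInt F := by
  have h := norm_integral_le_of_norm_le (μ := torusMeasure d) (f := fun x => g x * b x)
    ((integrable_comp_cellOf F).const_mul M) (by
      filter_upwards [hg] with x hx
      rw [Real.norm_eq_abs, abs_mul]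
      exact mul_le_mul hx (hb x) (abs_nonneg _) hM)
  rw [integral_const_mul] at h
  have e := torusInt_comp_cellOf F
  unfold torusInt at e
  rwa [e] at h

/-- A segment no longer than the mesh size meets only the cell of its end point and the preceding
one. Adding the two bounds is crude and produces the factors 2 below. -/
lemma abs_backInt_comp_cellOf_le (i : Fin d) {s : ℝ} (hs0 : 0 ≤ s) (hs : s ≤ meshSize N)
    {b : Pt d → ℝ} {F : QFun d N} (hb : ∀ x, |b x| ≤ F (cellOf N x)) (x : Pt d) :
    |backInt (Pi.single i 1) s b x| ≤ s * (F (cellOf N x) + F (prev i (cellOf N x))) := by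
  have h := intervalIntegral.norm_integral_le_of_norm_le_const (a := 0) (b := s)
    (f := fun r => b (x - r • Pi.single i (1 : ℝ)))
    (C := F (cellOf N x) + F (prev i (cellOf N x))) (fun r hr => by
      rw [Set.uIoc_of_le hs0] at hr
      refine (hb _).trans ?_
      have h1 : 0 ≤ F (cellOf N x) := (abs_nonneg _).trans (hb x)
      have h2 : 0 ≤ F (prev i (cellOf N x)) := by
        rw [← cellOf_sub_meshSize]; exact (abs_nonneg _).trans (hb _)
      rcases cellOf_sub_smul x i hr.1.le (hr.2.trans hs) with h | h <;> rw [h] <;> linarith)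
  rw [sub_zero, abs_of_nonneg hs0, Real.norm_eq_abs] at h
  unfold backInt
  linarith

lemma isPeriodic_comp_cellOf (F : QFun d N) : IsPeriodic fun x : Pt d => F (cellOf N x) := by
  intro x i
  simp only [cellOf_add_single_one]

/-! ### Means of weakly differentiable functions -/

lemma projQ_eq (f : Pt d → ℝ) (K : Cell d N) :
    projQ N f K = 1 / meshSize N ^ d * ∫ x, f x * (if cellOf N x = K then 1 else 0)
      ∂(torusMeasure d) := by
  rw [projQ, ← integral_indicator (measurableSet_cellOf K)]
  congr 2; funext x
  simp [Set.indicator_apply]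

lemma cellInt_single (K : Cell d N) :
    cellInt (fun L : Cell d N => if L = K then (1 : ℝ) else 0) = meshSize N ^ d := by
  simp [cellInt]

/-- The test weight `c` of a cell integrates against jumps like the weak derivative. -/
lemma HasWeakPartial.cellInt_mul_jump {i : Fin d} {f g : Pt d → ℝ} (h : HasWeakPartial i f g)
    (hf : Integrable f (torusMeasure d)) (hg : Integrable g (torusMeasure d)) (c : QFun d N) :
    cellInt (fun K => c K * jump (projQ N f) i K)
      = ∫ x, g x * backInt (Pi.single i 1) (meshSize N) (fun y => c (cellOf N y)) x
        ∂(torusMeasure d) := by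
  obtain ⟨B, hB⟩ := exists_bound_comp_cellOf c
  have ht := h.translation hf hg (measurable_comp_cellOf c) hB (isPeriodic_comp_cellOf c)
    meshSize_pos.le (s := meshSize N)
  have e := torusInt_comp_cellOf_mul (fun K => c K - c (prev i K)) hf
  unfold torusInt at e
  rw [FVNSF.cellInt_mul_jump, neg_eq_iff_eq_neg, ← ht]
  simp only [cellOf_sub_meshSize]
  have e2 : cellInt (fun K => projQ N f K * (c K - c (prev i K)))
      = cellInt (fun K => (c K - c (prev i K)) * projQ N f K) := by
    congr 1; funext K; ring
  rw [e2, ← e]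
  congr 1; funext x; ring

lemma jump_projQ_eq {i : Fin d} {f g : Pt d → ℝ} (h : HasWeakPartial i f g)
    (hf : Integrable f (torusMeasure d)) (hg : Integrable g (torusMeasure d)) (K : Cell d N) :
    meshSize N ^ d * jump (projQ N f) i K = ∫ x, g x * backInt (Pi.single i 1) (meshSize N)
      (fun y => if cellOf N y = K then 1 else 0) x ∂(torusMeasure d) := by
  rw [← h.cellInt_mul_jump hf hg (fun L => if L = K then 1 else 0)]
  simp [cellInt]

lemma abs_jump_projQ_le {i : Fin d} {f g : Pt d → ℝ} {M : ℝ} (hM : 0 ≤ M)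
    (h : HasWeakPartial i f g)
    (hf : Integrable f (torusMeasure d)) (hg : Integrable g (torusMeasure d))
    (hgM : ∀ᵐ x ∂(torusMeasure d), |g x| ≤ M) (K : Cell d N) :
    |jump (projQ N f) i K| ≤ 2 * M * meshSize N := by
  have hh := meshSize_pos (N := N)
  have e := jump_projQ_eq h hf hg K
  have b := abs_torusInt_mul_le (N := N) hM hgM (fun x => abs_backInt_comp_cellOf_le i
    hh.le le_rfl (b := fun y => if cellOf N y = K then 1 else 0)
    (F := fun L => if L = K then 1 else 0) (fun x => by split_ifs <;> simp) x)
    (F := fun L => meshSize N * ((if L = K then 1 else 0) + if prev i L = K then 1 else 0))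
  rw [← e, cellInt_const_mul, cellInt_add,
    cellInt_prev i (fun L => if L = K then (1 : ℝ) else 0), cellInt_single, abs_mul,
    abs_of_pos (by positivity)] at b
  have hp : 0 < meshSize N ^ d := by positivity
  refine le_of_mul_le_mul_left (b.trans (le_of_eq ?_)) hp
  ring

lemma abs_projQ_le {f : Pt d → ℝ} {M : ℝ} (hM : 0 ≤ M)
    (hfM : ∀ᵐ x ∂(torusMeasure d), |f x| ≤ M) (K : Cell d N) : |projQ N f K| ≤ M := by
  have hh := meshSize_pos (N := N)
  have hp : 0 < meshSize N ^ d := by positivity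
  have b := abs_torusInt_mul_le (N := N) hM hfM (b := fun y => if cellOf N y = K then 1 else 0)
    (F := fun L => if L = K then 1 else 0) (fun x => by split_ifs <;> simp)
  rw [cellInt_single] at b
  rw [projQ_eq, abs_mul, abs_of_pos (by positivity)]
  calc _ ≤ 1 / meshSize N ^ d * (M * meshSize N ^ d) := by gcongr
    _ = M := by field_simp

/-- A second-order Taylor estimate by two applications of the translation formula. The first writes
the jump as an integral of `g` over translates of the cell; the second compares these translates
with the cell itself, at a cost of `h` each. -/
lemma abs_jump_projQ_sub_le {i : Fin d} {f g g' : Pt d → ℝ} {M : ℝ} (hM : 0 ≤ M)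
    (h : HasWeakPartial i f g) (h' : HasWeakPartial i g g')
    (hf : Integrable f (torusMeasure d)) (hg : Integrable g (torusMeasure d))
    (hg' : Integrable g' (torusMeasure d))
    (hgM : ∀ᵐ x ∂(torusMeasure d), |g' x| ≤ M) (K : Cell d N) :
    |jump (projQ N f) i K - meshSize N * projQ N g K| ≤ 2 * M * meshSize N ^ 2 := by
  have hh := meshSize_pos (N := N)
  have hp : 0 < meshSize N ^ d := by positivity
  set χ : Pt d → ℝ := fun y => if cellOf N y = K then 1 else 0 with hχ
  have hχm : Measurable χ := measurable_comp_cellOf (fun L => if L = K then (1 : ℝ) else 0)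
  have hχb : ∀ x, |χ x| ≤ 1 := fun x => by simp only [hχ]; split_ifs <;> simp
  have hχp : IsPeriodic χ := isPeriodic_comp_cellOf (fun L => if L = K then (1 : ℝ) else 0)
  set v : Pt d := Pi.single i 1 with hv
  have hm : Measurable fun z : ℝ × Pt d => χ z.2 - χ (z.2 - z.1 • v) :=
    (hχm.comp measurable_snd).sub
      (hχm.comp (measurable_snd.sub (measurable_fst.smul_const v)))
  have hii : ∀ x, IntervalIntegrable (fun r : ℝ => χ (x - r • v)) volume 0 (meshSize N) := by
    intro x
    rw [intervalIntegrable_iff]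
    refine Measure.integrableOn_of_bounded (M := 1) (by simp [Set.uIoc]) ?_
      (Eventually.of_forall fun r => hχb _)
    exact (hχm.comp (measurable_const.sub (measurable_id.smul_const v))).aestronglyMeasurable
  -- The weight of the jump is ∫₀ʰ χ(x - r v) dr and that of `h Πg` is h χ(x). Exchanging the
  -- integrals leaves, for each `r`, a pairing of `g` with a translation difference of `χ`.
  have e : meshSize N ^ d * (jump (projQ N f) i K - meshSize N * projQ N g K)
      = -∫ r in (0 : ℝ)..meshSize N, ∫ x, g x * (χ x - χ (x - r • v)) ∂(torusMeasure d) := by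
    rw [mul_sub, jump_projQ_eq h hf hg K, projQ_eq, intervalIntegral_integral_swap]
    · have i1 : Integrable (fun x => g x * backInt v (meshSize N) χ x) (torusMeasure d) :=
        hg.mul_bdd (measurable_backInt v _ hχm).aestronglyMeasurable
          (Eventually.of_forall (abs_backInt_le v hh.le hχb))
      have i2 : Integrable (fun x => g x * χ x) (torusMeasure d) :=
        hg.mul_bdd hχm.aestronglyMeasurable (Eventually.of_forall hχb)
      have e1 : meshSize N ^ d * (meshSize N * (1 / meshSize N ^ d
          * ∫ x, g x * χ x ∂(torusMeasure d)))
          = ∫ x, meshSize N * (g x * χ x) ∂(torusMeasure d) := by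
        rw [integral_const_mul]; field_simp
      rw [e1, ← integral_sub i1 (i2.const_mul _), ← integral_neg]
      congr 1; funext x
      have e2 : ∫ r in (0 : ℝ)..meshSize N, g x * (χ x - χ (x - r • v))
          = g x * (meshSize N * χ x - backInt v (meshSize N) χ x) := by
        rw [intervalIntegral.integral_const_mul, intervalIntegral.integral_sub
          intervalIntegrable_const (hii x), intervalIntegral.integral_const]
        simp [backInt]
      rw [e2]; ring
    · have : IsFiniteMeasure (volume.restrict (Set.uIoc (0 : ℝ) (meshSize N))) :=
        ⟨by simp [Set.uIoc]⟩
      refine (hg.comp_snd _).mul_bdd (c := 2) hm.aestronglyMeasurable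
        (Eventually.of_forall fun z => ?_)
      refine (abs_sub _ _).trans ?_
      linarith [hχb z.2, hχb (z.2 - z.1 • v)]
  have b : |∫ r in (0 : ℝ)..meshSize N, ∫ x, g x * (χ x - χ (x - r • v)) ∂(torusMeasure d)|
      ≤ (2 * M * meshSize N * meshSize N ^ d) * |meshSize N - 0| := by
    rw [← Real.norm_eq_abs]
    refine intervalIntegral.norm_integral_le_of_norm_le_const fun r hr => ?_
    rw [Set.uIoc_of_le hh.le] at hr
    rw [h'.translation hg hg' hχm hχb hχp hr.1.le, norm_neg]
    have b := abs_torusInt_mul_le (N := N) hM hgM (fun x => abs_backInt_comp_cellOf_le i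
      hr.1.le hr.2 (b := χ) (F := fun L => if L = K then 1 else 0)
      (fun x => by simp only [hχ]; split_ifs <;> simp) x)
      (F := fun L => r * ((if L = K then 1 else 0) + if prev i L = K then 1 else 0))
    rw [cellInt_const_mul, cellInt_add,
      cellInt_prev i (fun L => if L = K then (1 : ℝ) else 0), cellInt_single] at b
    refine b.trans ?_
    have h3 : 0 ≤ 2 * M * meshSize N ^ d := by positivity
    have h4 := mul_le_mul_of_nonneg_left hr.2 h3
    linarith
  rw [sub_zero, abs_of_pos hh] at b
  have e3 := congrArg abs e
  rw [abs_mul, abs_of_pos hp, abs_neg] at e3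
  rw [← e3] at b
  refine le_of_mul_le_mul_left (b.trans (le_of_eq ?_)) hp
  ring

/-- The projection is orthogonal: pairing Πf with `f` already gives the squared norm of Πf, and
Young's inequality concludes. -/
lemma cellInt_projQ_sq_le {f : Pt d → ℝ} (hf : MemLp f 2 (torusMeasure d)) :
    cellInt (fun K : Cell d N => projQ N f K ^ 2) ≤ torusInt (fun x => f x ^ 2) := by
  have hi := hf.integrable (by norm_num)
  have e := torusInt_comp_cellOf_mul (projQ N f) hi
  have e2 := torusInt_comp_cellOf (fun K : Cell d N => projQ N f K ^ 2)
  have hm : torusInt (fun x => projQ N f (cellOf N x) * f x)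
      ≤ ∫ x, (1 / 2 * (projQ N f (cellOf N x) ^ 2) + 1 / 2 * f x ^ 2) ∂(torusMeasure d) := by
    refine integral_mono (integrable_comp_cellOf_mul _ hi)
      (((integrable_comp_cellOf (fun K => projQ N f K ^ 2)).const_mul _).add
        (hf.integrable_sq.const_mul _)) fun x => ?_
    nlinarith [sq_nonneg (projQ N f (cellOf N x) - f x)]
  rw [integral_add ((integrable_comp_cellOf (fun K => projQ N f K ^ 2)).const_mul _)
    (hf.integrable_sq.const_mul _), integral_const_mul, integral_const_mul, e] at hm
  unfold torusInt at e2 ⊢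
  rw [e2] at hm
  simp only [← sq] at hm
  linarith

/-- The discrete gradient of the projection is controlled by the weak gradient. -/
lemma cellInt_jump_projQ_sq_le {i : Fin d} {f g : Pt d → ℝ} (h : HasWeakPartial i f g)
    (hf : MemLp f 2 (torusMeasure d)) (hg : MemLp g 2 (torusMeasure d)) :
    cellInt (fun K : Cell d N => jump (projQ N f) i K ^ 2)
      ≤ 4 * meshSize N ^ 2 * torusInt (fun x => g x ^ 2) := by
  have hh := meshSize_pos (N := N)
  -- Duality: the jumps are paired with themselves through the translation formula. Young's
  -- inequality then returns half of their squared norm to the left-hand side.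
  set c : QFun d N := jump (projQ N f) i with hc
  have e := h.cellInt_mul_jump (hf.integrable (by norm_num)) (hg.integrable (by norm_num)) c
  set F : QFun d N := fun K => 1 / 4 * (c K ^ 2 + c (prev i K) ^ 2) with hF
  have hFi : cellInt F = 1 / 2 * cellInt (fun K => c K ^ 2) := by
    rw [hF, cellInt_const_mul, cellInt_add, cellInt_prev i (fun K => c K ^ 2)]; ring
  have hm : ∫ x, g x * backInt (Pi.single i 1) (meshSize N) (fun y => c (cellOf N y)) x
        ∂(torusMeasure d)
      ≤ ∫ x, (2 * meshSize N ^ 2 * g x ^ 2 + F (cellOf N x)) ∂(torusMeasure d) := by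
    obtain ⟨B, hB⟩ := exists_bound_comp_cellOf c
    refine integral_mono ?_ ((hg.integrable_sq.const_mul _).add (integrable_comp_cellOf F))
      fun x => ?_
    · exact (hg.integrable (by norm_num)).mul_bdd
        (measurable_backInt _ _ (measurable_comp_cellOf c)).aestronglyMeasurable
        (Eventually.of_forall (abs_backInt_le _ hh.le hB))
    · have b := abs_backInt_comp_cellOf_le i hh.le le_rfl (b := fun y => c (cellOf N y))
        (F := fun K => |c K|) (fun x => le_rfl) x
      set k := backInt (Pi.single i 1) (meshSize N) (fun y => c (cellOf N y)) x
      set p := |c (cellOf N x)|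
      set q := |c (prev i (cellOf N x))|
      have hF' : F (cellOf N x) = 1 / 4 * (p ^ 2 + q ^ 2) := by simp [hF, p, q, sq_abs]
      simp only [hF']
      have hp : 0 ≤ p := abs_nonneg _
      have hq : 0 ≤ q := abs_nonneg _
      have h1 : g x * k ≤ |g x| * (meshSize N * (p + q)) := by
        refine (le_abs_self _).trans ?_
        rw [abs_mul]; gcongr
      rw [← sq_abs (g x)]
      nlinarith [sq_nonneg (2 * meshSize N * |g x| - 1 / 2 * (p + q)), sq_nonneg (p - q)]
  rw [integral_add (hg.integrable_sq.const_mul _) (integrable_comp_cellOf F),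
    integral_const_mul] at hm
  have e2 := torusInt_comp_cellOf F
  unfold torusInt at e2 ⊢
  have e3 : cellInt (fun K => c K * jump (projQ N f) i K) = cellInt (fun K => c K ^ 2) := by
    congr 1; funext K; rw [hc]; ring
  rw [e2, ← e, e3, hFi] at hm
  linarith

end Cells

/-! ## Half cells -/

section HalfCells

open Filter

variable {d N : ℕ} [NeZero N]

/-- The integral of `f` over the upper half (in direction `e_i`) of each cell, divided by `|K|`. -/
def upperMean (N : ℕ) (i : Fin d) (f : Pt d → ℝ) : QFun d N :=
  projQ N fun x => f x * if Int.fract ((N : ℝ) * x i) < 1 / 2 then 0 else 1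

/-- The integral of `f` over the lower half (in direction `e_i`) of each cell, divided by `|K|`. -/
def lowerMean (N : ℕ) (i : Fin d) (f : Pt d → ℝ) : QFun d N :=
  projQ N fun x => f x * if Int.fract ((N : ℝ) * x i) < 1 / 2 then 1 else 0

lemma measurableSet_fract_lt (N : ℕ) (i : Fin d) :
    MeasurableSet {x : Pt d | Int.fract ((N : ℝ) * x i) < 1 / 2} := by
  have hm : Measurable fun x : Pt d => Int.fract ((N : ℝ) * x i) :=
    ((measurable_pi_apply i).const_mul _).fract
  exact hm measurableSet_Iio

lemma measurable_ite_fract (N : ℕ) (i : Fin d) (a b : ℝ) :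
    Measurable fun x : Pt d => if Int.fract ((N : ℝ) * x i) < 1 / 2 then a else b :=
  Measurable.ite (measurableSet_fract_lt N i) measurable_const measurable_const

lemma integrable_mul_ite_fract (N : ℕ) (i : Fin d) (a b : ℝ) {f : Pt d → ℝ}
    (hf : Integrable f (torusMeasure d)) :
    Integrable (fun x => f x * if Int.fract ((N : ℝ) * x i) < 1 / 2 then a else b)
      (torusMeasure d) :=
  hf.mul_bdd (c := |a| + |b|) (measurable_ite_fract N i a b).aestronglyMeasurable
    (Eventually.of_forall fun x => by
      rw [Real.norm_eq_abs]
      split_ifs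
      · linarith [abs_nonneg b]
      · linarith [abs_nonneg a])

/-- Moving back by half a cell leaves the cell exactly when the point lies in its lower half. -/
lemma cellOf_sub_half (x : Pt d) (i : Fin d) :
    cellOf N (x - (meshSize N / 2) • Pi.single i (1 : ℝ))
      = if Int.fract ((N : ℝ) * x i) < 1 / 2 then prev i (cellOf N x) else cellOf N x := by
  have e : (N : ℝ) * (x i - meshSize N / 2) = (N : ℝ) * x i - 1 / 2 := by
    rw [mul_sub, mul_div_assoc', natCast_mul_meshSize]
  have h0 := Int.fract_nonneg ((N : ℝ) * x i)
  have h1 := Int.fract_lt_one ((N : ℝ) * x i)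
  have h2 := Int.floor_add_fract ((N : ℝ) * x i)
  funext j
  rcases eq_or_ne j i with rfl | hj
  · split_ifs with h
    · have : ⌊(N : ℝ) * x j - 1 / 2⌋ = ⌊(N : ℝ) * x j⌋ - 1 := by
        rw [Int.floor_eq_iff]; push_cast; constructor <;> linarith
      simp only [cellOf, prev, Pi.sub_apply, Pi.smul_apply, Pi.single_eq_same, smul_eq_mul,
        mul_one, e, this]
      push_cast; ring
    · push Not at h
      have : ⌊(N : ℝ) * x j - 1 / 2⌋ = ⌊(N : ℝ) * x j⌋ := by
        rw [Int.floor_eq_iff]; constructor <;> linarith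
      simp only [cellOf, Pi.sub_apply, Pi.smul_apply, Pi.single_eq_same, smul_eq_mul,
        mul_one, e, this]
  · split_ifs <;> simp [cellOf, prev, hj]

lemma dualCellOf_eq (x : Pt d) (i : Fin d) :
    dualCellOf N i x
      = if Int.fract ((N : ℝ) * x i) < 1 / 2 then prev i (cellOf N x) else cellOf N x := by
  rw [← cellOf_sub_half, dualCellOf, ← Pi.single_smul, smul_eq_mul, mul_one]

lemma fract_sub_half_lt_iff (x : Pt d) (i : Fin d) :
    Int.fract ((N : ℝ) * (x - (meshSize N / 2) • (Pi.single i (1 : ℝ) : Pt d) : Pt d) i) < 1 / 2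
      ↔ ¬ Int.fract ((N : ℝ) * x i) < 1 / 2 := by
  have e : (N : ℝ) * (x - (meshSize N / 2) • (Pi.single i (1 : ℝ) : Pt d) : Pt d) i
      = (N : ℝ) * x i - 1 / 2 := by
    simp only [Pi.sub_apply, Pi.smul_apply, Pi.single_eq_same, smul_eq_mul, mul_one]
    rw [mul_sub, mul_div_assoc', natCast_mul_meshSize]
  have h0 := Int.fract_nonneg ((N : ℝ) * x i)
  have h1 := Int.fract_lt_one ((N : ℝ) * x i)
  have h2 := Int.floor_add_fract ((N : ℝ) * x i)
  rw [e]
  by_cases h : Int.fract ((N : ℝ) * x i) < 1 / 2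
  · have : Int.fract ((N : ℝ) * x i - 1 / 2) = Int.fract ((N : ℝ) * x i) + 1 / 2 := by
      rw [Int.fract_eq_iff]
      exact ⟨by linarith, by linarith, ⌊(N : ℝ) * x i⌋ - 1, by push_cast; linarith⟩
    rw [this]
    constructor
    · intro h'; linarith
    · intro h'; exact absurd h h'
  · have : Int.fract ((N : ℝ) * x i - 1 / 2) = Int.fract ((N : ℝ) * x i) - 1 / 2 := by
      push Not at h
      rw [Int.fract_eq_iff]
      exact ⟨by linarith, by linarith, ⌊(N : ℝ) * x i⌋, by linarith⟩
    rw [this]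
    exact ⟨fun _ => h, fun _ => by linarith⟩

lemma projQ_add {f g : Pt d → ℝ} (hf : Integrable f (torusMeasure d))
    (hg : Integrable g (torusMeasure d)) (K : Cell d N) :
    projQ N (fun x => f x + g x) K = projQ N f K + projQ N g K := by
  simp only [projQ]
  rw [integral_add hf.integrableOn hg.integrableOn, mul_add]

lemma projQ_sub {f g : Pt d → ℝ} (hf : Integrable f (torusMeasure d))
    (hg : Integrable g (torusMeasure d)) (K : Cell d N) :
    projQ N (fun x => f x - g x) K = projQ N f K - projQ N g K := by
  simp only [projQ]
  rw [integral_sub hf.integrableOn hg.integrableOn, mul_sub]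

lemma HasWeakPartial.halfSplit {i : Fin d} {f g : Pt d → ℝ} {M : ℝ} (hM : 0 ≤ M)
    (h : HasWeakPartial i f g)
    (hf : Integrable f (torusMeasure d)) (hg : Integrable g (torusMeasure d))
    (hgM : ∀ᵐ x ∂(torusMeasure d), |g x| ≤ M) :
    HalfSplit (M * meshSize N) (projQ N f) (upperMean N i f) (lowerMean N i f) := by
  have hh := meshSize_pos (N := N)
  have hp : 0 < meshSize N ^ d := by positivity
  refine ⟨fun K => ?_, fun K => ?_⟩
  · unfold upperMean lowerMean
    rw [← projQ_add (integrable_mul_ite_fract N i 0 1 hf) (integrable_mul_ite_fract N i 1 0 hf)]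
    congr 2; funext x; split_ifs <;> ring
  · set χ : Pt d → ℝ := fun x => (if cellOf N x = K then 1 else 0)
      * (if Int.fract ((N : ℝ) * x i) < 1 / 2 then 1 else 0) with hχ
    have hχm : Measurable χ := (measurable_comp_cellOf (fun L => if L = K then (1 : ℝ) else 0)).mul
      (measurable_ite_fract N i 1 0)
    have hχle : ∀ x, |χ x| ≤ if cellOf N x = K then 1 else 0 := fun x => by
      simp only [hχ]; split_ifs <;> simp
    have hχb : ∀ x, |χ x| ≤ 1 := fun x => (hχle x).trans (by split_ifs <;> simp)
    have hχp : IsPeriodic χ := by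
      intro x j
      simp only [hχ, cellOf_add_single_one]
      congr 2
      rcases eq_or_ne i j with rfl | hj
      · simp [mul_add]
      · simp [hj]
    -- Translating by half a mesh size carries the indicator of the lower half of `K` to that of its
    -- upper half. The difference of the half means is therefore an integral of `g` along segments
    -- of length `h/2`.
    have hshift : ∀ x, χ (x - (meshSize N / 2) • Pi.single i (1 : ℝ))
        = (if cellOf N x = K then 1 else 0)
          * (if Int.fract ((N : ℝ) * x i) < 1 / 2 then 0 else 1) := by
      intro x
      simp only [hχ, fract_sub_half_lt_iff, cellOf_sub_half]
      split_ifs <;> simp_all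
    have ht := h.translation hf hg hχm hχb hχp (by positivity : 0 ≤ meshSize N / 2)
    have e : meshSize N ^ d * (upperMean N i f K - lowerMean N i f K)
        = ∫ x, g x * backInt (Pi.single i 1) (meshSize N / 2) χ x ∂(torusMeasure d) := by
      rw [← neg_inj, ← ht]
      unfold upperMean lowerMean
      rw [← projQ_sub (integrable_mul_ite_fract N i 0 1 hf) (integrable_mul_ite_fract N i 1 0 hf),
        projQ_eq, ← mul_assoc, mul_one_div_cancel hp.ne', one_mul, ← integral_neg]
      congr 1; funext x
      rw [hshift]; simp only [hχ]; ring
    have b := abs_torusInt_mul_le (N := N) hM hgM (fun x => abs_backInt_comp_cellOf_le i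
      (by positivity : 0 ≤ meshSize N / 2) (by linarith) (b := χ)
      (F := fun L => if L = K then 1 else 0) hχle x)
      (F := fun L => meshSize N / 2 * ((if L = K then 1 else 0) + if prev i L = K then 1 else 0))
    rw [← e, cellInt_const_mul, cellInt_add,
      cellInt_prev i (fun L => if L = K then (1 : ℝ) else 0), cellInt_single, abs_mul,
      abs_of_pos hp] at b
    refine le_of_mul_le_mul_left (b.trans (le_of_eq ?_)) hp
    ring

/-- Integrals of functions that are constant on the half cells. -/
lemma torusInt_comp_dualCellOf_mul (i : Fin d) (G : Cell d N → Cell d N → ℝ) {ψ : Pt d → ℝ}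
    (hψ : Integrable ψ (torusMeasure d)) :
    Integrable (fun x => G (cellOf N x) (dualCellOf N i x) * ψ x) (torusMeasure d) ∧
    torusInt (fun x => G (cellOf N x) (dualCellOf N i x) * ψ x)
      = cellInt (fun K => G K K * upperMean N i ψ K + G K (prev i K) * lowerMean N i ψ K) := by
  have i1 := integrable_mul_ite_fract N i 0 1 hψ
  have i2 := integrable_mul_ite_fract N i 1 0 hψ
  have e : (fun x => G (cellOf N x) (dualCellOf N i x) * ψ x) = fun x =>
      (fun K => G K K) (cellOf N x) * (ψ x * if Int.fract ((N : ℝ) * x i) < 1 / 2 then 0 else 1)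
      + (fun K => G K (prev i K)) (cellOf N x)
        * (ψ x * if Int.fract ((N : ℝ) * x i) < 1 / 2 then 1 else 0) := by
    funext x
    rw [dualCellOf_eq]
    split_ifs <;> simp
  have j1 := integrable_comp_cellOf_mul (fun K => G K K) i1
  have j2 := integrable_comp_cellOf_mul (fun K => G K (prev i K)) i2
  have k1 := torusInt_comp_cellOf_mul (fun K => G K K) i1
  have k2 := torusInt_comp_cellOf_mul (fun K => G K (prev i K)) i2
  refine ⟨?_, ?_⟩
  · rw [e]; exact j1.add j2
  · rw [e, cellInt_add]
    unfold torusInt at k1 k2 ⊢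
    rw [integral_add j1 j2, k1, k2]
    rfl

end HalfCells

/-! ## Test functions at fixed time -/

section Slices

open Filter

variable {d : ℕ} {T : ℝ}

instance : IsFiniteMeasure (cylMeasure d T) := by
  unfold cylMeasure; infer_instance

/-- Slices of essentially bounded functions. -/
lemma exists_slice_bound {f : ℝ → Pt d → ℝ} (hf : MemLp (Function.uncurry f) ⊤ (cylMeasure d T)) :
    ∃ M : ℝ, 0 ≤ M ∧ ∀ᵐ t ∂(volume.restrict (Set.Ioo 0 T)),
      Integrable (f t) (torusMeasure d) ∧ ∀ᵐ x ∂(torusMeasure d), |f t x| ≤ M := by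
  have hC : ∀ᵐ z ∂(cylMeasure d T), ‖Function.uncurry f z‖
      ≤ (eLpNormEssSup (Function.uncurry f) (cylMeasure d T)).toReal := by
    have hlt := hf.2
    rw [eLpNorm_exponent_top] at hlt
    filter_upwards [ae_le_eLpNormEssSup (f := Function.uncurry f) (μ := cylMeasure d T)] with z hz
    rw [← toReal_enorm]
    exact ENNReal.toReal_mono hlt.ne hz
  refine ⟨(eLpNormEssSup (Function.uncurry f) (cylMeasure d T)).toReal, ENNReal.toReal_nonneg, ?_⟩
  have h1 := Measure.ae_ae_of_ae_prod hC
  have h2 := (hf.integrable le_top).prod_right_ae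
  filter_upwards [h1, h2] with t h1 h2
  exact ⟨h2, h1⟩

/-- Regularity of a test function at a fixed time, with a uniform constant. -/
structure TestFunction.RegularAt (φ : TestFunction d T) (M t : ℝ) : Prop where
  integrable_val : Integrable (φ.val t) (torusMeasure d)
  integrable_dt : Integrable (φ.dt t) (torusMeasure d)
  integrable_dx : ∀ i, Integrable (φ.dx i t) (torusMeasure d)
  abs_dt_le : ∀ᵐ x ∂(torusMeasure d), |φ.dt t x| ≤ M
  abs_dtt_le : ∀ᵐ x ∂(torusMeasure d), |φ.dtt t x| ≤ M
  discTest : ∀ (N : ℕ) [NeZero N], DiscTest M (projQ N (φ.val t)) fun i => projQ N (φ.dx i t)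
  halfSplit_val : ∀ (N : ℕ) [NeZero N] (i : Fin d), HalfSplit (M * meshSize N)
    (projQ N (φ.val t)) (upperMean N i (φ.val t)) (lowerMean N i (φ.val t))
  halfSplit_dx : ∀ (N : ℕ) [NeZero N] (i : Fin d), HalfSplit (M * meshSize N)
    (projQ N (φ.dx i t)) (upperMean N i (φ.dx i t)) (lowerMean N i (φ.dx i t))

lemma ae_mem_unitCube : ∀ᵐ x ∂(torusMeasure d), x ∈ unitCube d :=
  ae_restrict_mem (MeasurableSet.univ_pi fun _ => measurableSet_Ico)

lemma TestFunction.exists_bound_val (φ : TestFunction d T) :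
    ∃ M : ℝ, 0 ≤ M ∧ ∀ t ∈ Set.Icc 0 T, ∀ x ∈ unitCube d, |φ.val t x| ≤ M := by
  have hK : IsCompact (Set.Icc (0 : ℝ) T ×ˢ (Set.univ.pi fun _ : Fin d => Set.Icc (0 : ℝ) 1)) :=
    isCompact_Icc.prod (isCompact_univ_pi fun _ => isCompact_Icc)
  obtain ⟨C, hC⟩ := hK.exists_bound_of_continuousOn
    (φ.continuousOn.mono (Set.prod_mono le_rfl (Set.subset_univ _)))
  refine ⟨|C|, abs_nonneg _, fun t ht x hx => ?_⟩
  have := hC (t, x) ⟨ht, fun i hi => Set.Ico_subset_Icc_self (hx i hi)⟩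
  exact this.trans (le_abs_self _)

lemma TestFunction.integrable_val (φ : TestFunction d T) {t : ℝ} (ht : t ∈ Set.Icc 0 T) :
    Integrable (φ.val t) (torusMeasure d) := by
  obtain ⟨M, -, hM⟩ := φ.exists_bound_val
  have hc : Continuous (φ.val t) := by
    rw [← continuousOn_univ]
    exact φ.continuousOn.comp (f := fun x : Pt d => (t, x)) (by fun_prop)
      fun x hx => ⟨ht, hx⟩
  refine Integrable.of_bound hc.aestronglyMeasurable M ?_
  filter_upwards [ae_mem_unitCube] with x hx
  exact hM t ht x hx

lemma HalfSplit.mono {N : ℕ} {c c' : ℝ} {f U L : QFun d N} (h : HalfSplit c f U L) (hc : c ≤ c') :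
    HalfSplit c' f U L := ⟨h.add_eq, fun K => (h.abs_sub_le K).trans hc⟩

lemma TestFunction.exists_regularAt (φ : TestFunction d T) :
    ∃ M : ℝ, 0 ≤ M ∧ (∀ t ∈ Set.Icc 0 T, ∀ x ∈ unitCube d, |φ.val t x| ≤ M) ∧
      ∀ᵐ t ∂(volume.restrict (Set.Ioo 0 T)), φ.RegularAt M t := by
  obtain ⟨M0, hM0, h0⟩ := φ.exists_bound_val
  obtain ⟨M1, hM1, h1⟩ := exists_slice_bound φ.memLp_dt
  obtain ⟨M2, hM2, h2⟩ := exists_slice_bound φ.memLp_dtt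
  choose M3 hM3 h3 using fun i => exists_slice_bound (φ.memLp_dx i)
  choose M4 hM4 h4 using fun i j => exists_slice_bound (φ.memLp_dxx i j)
  have s3 : ∀ i, M3 i ≤ ∑ i, M3 i := fun i =>
    Finset.single_le_sum (fun j _ => hM3 j) (Finset.mem_univ i)
  have s4 : ∀ i j, M4 i j ≤ ∑ i, ∑ j, M4 i j := fun i j =>
    (Finset.single_le_sum (fun j _ => hM4 i j) (Finset.mem_univ j)).trans
      (Finset.single_le_sum (f := fun i => ∑ j, M4 i j)
        (fun i _ => Finset.sum_nonneg fun j _ => hM4 i j) (Finset.mem_univ i))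
  set S3 := ∑ i, M3 i
  set S4 := ∑ i, ∑ j, M4 i j
  have hS3 : 0 ≤ S3 := Finset.sum_nonneg fun i _ => hM3 i
  have hS4 : 0 ≤ S4 := Finset.sum_nonneg fun i _ => Finset.sum_nonneg fun j _ => hM4 i j
  -- The bounds of all derivatives are added. The factor 2 in front of `S4` is the one in the jump
  -- estimates for projections.
  refine ⟨M0 + M1 + M2 + 2 * S3 + 2 * S4, by positivity,
    fun t ht x hx => (h0 t ht x hx).trans (by linarith), ?_⟩
  filter_upwards [h1, h2, ae_all_iff.2 h3, ae_all_iff.2 fun i => ae_all_iff.2 (h4 i),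
    ae_all_iff.2 φ.weak_dx, ae_all_iff.2 fun i => ae_all_iff.2 (φ.weak_dxx i),
    ae_restrict_mem measurableSet_Ioo] with t k1 k2 k3 k4 w1 w2 ht
  have ht' := Set.Ioo_subset_Icc_self ht
  have iv := φ.integrable_val ht'
  have hv : ∀ᵐ x ∂(torusMeasure d), |φ.val t x| ≤ M0 := by
    filter_upwards [ae_mem_unitCube] with x hx using h0 t ht' x hx
  refine ⟨iv, k1.1, fun i => (k3 i).1, ?_, ?_, fun N _ => ⟨?_, ?_, ?_, ?_⟩, fun N _ i => ?_,
    fun N _ i => ?_⟩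
  · filter_upwards [k1.2] with x hx; linarith
  · filter_upwards [k2.2] with x hx; linarith
  · exact fun K => (abs_projQ_le hM0 hv K).trans (by linarith)
  · exact fun i K => (abs_projQ_le (hM3 i) (k3 i).2 K).trans (by linarith [s3 i])
  · intro i K
    refine (abs_jump_projQ_sub_le (hM4 i i) (w1 i) (w2 i i) iv (k3 i).1 (k4 i i).1
      (k4 i i).2 K).trans ?_
    gcongr; linarith [s4 i i]
  · intro i j K
    have hh := meshSize_pos (N := N)
    refine (abs_jump_projQ_le (hM4 i j) (w2 i j) (k3 i).1 (k4 i j).1 (k4 i j).2 K).trans ?_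
    gcongr; linarith [s4 i j]
  · have hh := meshSize_pos (N := N)
    refine ((w1 i).halfSplit (hM3 i) iv (k3 i).1 (k3 i).2).mono ?_
    gcongr; linarith [s3 i]
  · have hh := meshSize_pos (N := N)
    refine ((w2 i i).halfSplit (hM4 i i) (k3 i).1 (k4 i i).1 (k4 i i).2).mono ?_
    gcongr; linarith [s4 i i]

end Slices

/-! ## Weak derivatives on an interval -/

section WeakDerivative

open Filter Topology

/-- A sequence of bump functions on the line shrinking to the origin. -/
def lineBump (n : ℕ) : ContDiffBump (0 : ℝ) where
  rIn := 1 / ((n : ℝ) + 1)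
  rOut := 2 / ((n : ℝ) + 1)
  rIn_pos := by positivity
  rIn_lt_rOut := by gcongr; norm_num

lemma tendsto_rOut_lineBump : Tendsto (fun n => (lineBump n).rOut) atTop (𝓝 0) := by
  have := (tendsto_one_div_add_atTop_nhds_zero_nat (𝕜 := ℝ)).const_mul 2
  simpa [lineBump, div_eq_mul_inv] using this

lemma normed_lineBump_eq_zero {n : ℕ} {t : ℝ} (ht : (lineBump n).rOut ≤ |t|) :
    (lineBump n).normed volume t = 0 := by
  rw [← Function.notMem_support, (lineBump n).support_normed_eq, Metric.mem_ball, dist_zero_right,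
    Real.norm_eq_abs]
  exact not_lt.2 ht

/-- A smooth approximation of the indicator function of `[a, b]`. -/
def softStep (n : ℕ) (a b t : ℝ) : ℝ := ∫ s in (t - b)..(t - a), (lineBump n).normed volume s

lemma hasDerivAt_softStep (n : ℕ) (a b t : ℝ) : HasDerivAt (softStep n a b)
    ((lineBump n).normed volume (t - a) - (lineBump n).normed volume (t - b)) t := by
  have hc := (lineBump n).continuous_normed (μ := volume)
  have hP : ∀ u, HasDerivAt (fun u => ∫ s in (0 : ℝ)..u, (lineBump n).normed volume s)
      ((lineBump n).normed volume u) u := fun u =>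
    intervalIntegral.integral_hasDerivAt_right (hc.intervalIntegrable _ _)
      (hc.stronglyMeasurableAtFilter _ _) hc.continuousAt
  have h1 := (hP (t - a)).comp_sub_const t a
  have h2 := (hP (t - b)).comp_sub_const t b
  refine (h1.sub h2).congr_of_eventuallyEq (Eventually.of_forall fun u => ?_)
  exact (intervalIntegral.integral_interval_sub_left (hc.intervalIntegrable _ _)
    (hc.intervalIntegrable _ _)).symm

lemma contDiff_softStep (n : ℕ) (a b : ℝ) : ContDiff ℝ ∞ (softStep n a b) := by
  have hc : ContDiff ℝ ∞ ((lineBump n).normed (volume : Measure ℝ)) := (lineBump n).contDiff_normed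
  rw [contDiff_infty_iff_deriv]
  refine ⟨fun t => (hasDerivAt_softStep n a b t).differentiableAt, ?_⟩
  have : deriv (softStep n a b) = fun t =>
      (lineBump n).normed volume (t - a) - (lineBump n).normed volume (t - b) :=
    funext fun t => (hasDerivAt_softStep n a b t).deriv
  rw [this]
  fun_prop

lemma softStep_eq_zero {n : ℕ} {a b t : ℝ} (hab : a ≤ b)
    (ht : t + (lineBump n).rOut ≤ a ∨ b + (lineBump n).rOut ≤ t) : softStep n a b t = 0 := by
  have hr := (lineBump n).rOut_pos
  rw [softStep, intervalIntegral.integral_of_le (by linarith)]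
  refine setIntegral_eq_zero_of_forall_eq_zero fun s hs => normed_lineBump_eq_zero ?_
  rcases ht with ht | ht
  · exact le_trans (by linarith [hs.2]) (neg_le_abs s)
  · exact le_trans (by linarith [hs.1]) (le_abs_self s)

lemma softStep_eq_one {n : ℕ} {a b t : ℝ} (ha : a + (lineBump n).rOut ≤ t)
    (hb : t + (lineBump n).rOut ≤ b) : softStep n a b t = 1 := by
  have hr := (lineBump n).rOut_pos
  rw [softStep, intervalIntegral.integral_of_le (by linarith),
    setIntegral_eq_integral_of_forall_compl_eq_zero, (lineBump n).integral_normed]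
  intro s hs
  refine normed_lineBump_eq_zero ?_
  rw [Set.mem_Ioc, not_and_or, not_lt, not_le] at hs
  rcases hs with hs | hs
  · exact le_trans (by linarith) (neg_le_abs s)
  · exact le_trans (by linarith) (le_abs_self s)

lemma abs_softStep_le {n : ℕ} {a b t : ℝ} (hab : a ≤ b) : |softStep n a b t| ≤ 1 := by
  have h0 : ∀ s, 0 ≤ (lineBump n).normed volume s := (lineBump n).nonneg_normed
  rw [softStep, intervalIntegral.integral_of_le (by linarith), abs_of_nonneg
    (integral_nonneg h0), ← (lineBump n).integral_normed (μ := volume)]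
  exact setIntegral_le_integral (lineBump n).integrable_normed (Eventually.of_forall h0)

/-- A function with an integrable weak derivative is a primitive of it almost everywhere. -/
lemma sub_eq_integral_of_weak_deriv {T : ℝ} {F G : ℝ → ℝ} (hF : IntegrableOn F (Set.Ioo 0 T))
    (hG : IntegrableOn G (Set.Ioo 0 T))
    (h : ∀ A : ℝ → ℝ, ContDiff ℝ ∞ A →
      (∃ a b : ℝ, 0 < a ∧ b < T ∧ ∀ t, t ∉ Set.Icc a b → A t = 0) →
      ∫ t in Set.Ioo 0 T, F t * deriv A t = -∫ t in Set.Ioo 0 T, G t * A t) :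
    ∀ᵐ a ∂(volume.restrict (Set.Ioo 0 T)), ∀ᵐ b ∂(volume.restrict (Set.Ioo 0 T)),
      F b - F a = ∫ t in a..b, G t := by
  set F' := (Set.Ioo 0 T).indicator F with hF'
  -- For almost every `a` the convolution with shrinking bumps recovers `F a`. Evenness of the bump
  -- puts the integral in this form.
  have hconv : ∀ᵐ a : ℝ, Tendsto (fun n => ∫ t in Set.Ioo 0 T,
      F t * (lineBump n).normed volume (t - a)) atTop (𝓝 (F' a)) := by
    have hl : LocallyIntegrable F' volume :=
      ((integrable_indicator_iff measurableSet_Ioo).2 hF).locallyIntegrable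
    have := ContDiffBump.ae_convolution_tendsto_right_of_locallyIntegrable (K := 2)
      tendsto_rOut_lineBump (Eventually.of_forall fun n => le_of_eq (by
        simp only [lineBump]; ring)) hl
    filter_upwards [this] with a ha
    refine ha.congr fun n => ?_
    rw [← integral_indicator measurableSet_Ioo]
    simp only [convolution, ContinuousLinearMap.lsmul_apply, smul_eq_mul]
    rw [← integral_sub_left_eq_self _ _ a]
    congr 1; funext t
    rw [sub_sub_cancel, ← (lineBump n).normed_neg, neg_sub, hF']
    by_cases ht : t ∈ Set.Ioo 0 T <;> simp [ht, mul_comm]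
  -- The test function is a smoothed indicator of [a, b]. Its derivative is a bump at `a` minus a
  -- bump at `b`, so the limit gives F b - F a on one side and ∫ G over [a, b] on the other.
  have key : ∀ a b : ℝ, a ∈ Set.Ioo 0 T → b ∈ Set.Ioo 0 T → a < b →
      Tendsto (fun n => ∫ t in Set.Ioo 0 T, F t * (lineBump n).normed volume (t - a)) atTop
        (𝓝 (F' a)) →
      Tendsto (fun n => ∫ t in Set.Ioo 0 T, F t * (lineBump n).normed volume (t - b)) atTop
        (𝓝 (F' b)) → F b - F a = ∫ t in a..b, G t := by
    intro a b ha hb hab h1 h2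
    have l1 : Tendsto (fun n => ∫ t in Set.Ioo 0 T, G t * softStep n a b t) atTop
        (𝓝 (∫ t in Set.Ioo 0 T, G t * (Set.Ioc a b).indicator 1 t)) := by
      refine tendsto_integral_of_dominated_convergence (fun t => |G t|) (fun n => ?_) hG.abs
        (fun n => ?_) ?_
      · exact hG.aestronglyMeasurable.mul (contDiff_softStep n a b).continuous.aestronglyMeasurable
      · refine Eventually.of_forall fun t => ?_
        rw [Real.norm_eq_abs, abs_mul]
        exact mul_le_of_le_one_right (abs_nonneg _) (abs_softStep_le hab.le)
      · have hne : ∀ᵐ t ∂(volume.restrict (Set.Ioo 0 T)), t ≠ a ∧ t ≠ b :=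
          (Measure.ae_ne _ a).and (Measure.ae_ne _ b)
        filter_upwards [hne] with t ht
        refine Tendsto.const_mul _ (tendsto_const_nhds.congr' ?_)
        rcases lt_trichotomy t a with hta | hta | hta
        · filter_upwards [tendsto_rOut_lineBump.eventually_lt_const (sub_pos.2 hta)] with n hn
          rw [softStep_eq_zero hab.le (Or.inl (by linarith))]
          simp [hta.le]
        · exact absurd hta ht.1
        · rcases lt_trichotomy t b with htb | htb | htb
          · filter_upwards [tendsto_rOut_lineBump.eventually_lt_const (sub_pos.2 hta),
              tendsto_rOut_lineBump.eventually_lt_const (sub_pos.2 htb)] with n hn hn'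
            rw [softStep_eq_one (by linarith) (by linarith)]
            simp [hta, htb.le]
          · exact absurd htb ht.2
          · filter_upwards [tendsto_rOut_lineBump.eventually_lt_const (sub_pos.2 htb)] with n hn
            rw [softStep_eq_zero hab.le (Or.inr (by linarith))]
            simp [htb]
    have e1 : ∫ t in Set.Ioo 0 T, G t * (Set.Ioc a b).indicator 1 t = ∫ t in a..b, G t := by
      rw [intervalIntegral.integral_of_le hab.le]
      have : (fun t => G t * (Set.Ioc a b).indicator 1 t) = (Set.Ioc a b).indicator G := by
        funext t; by_cases ht : t ∈ Set.Ioc a b <;> simp [ht]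
      rw [this, setIntegral_indicator measurableSet_Ioc, Set.inter_eq_right.2]
      exact fun t ht => ⟨ha.1.trans ht.1, ht.2.trans_lt hb.2⟩
    -- Only for large `n` does the smoothed indicator vanish near both ends of the time interval, as
    -- admissibility requires.
    have ev : ∀ᶠ n in atTop, -∫ t in Set.Ioo 0 T, G t * softStep n a b t
        = (∫ t in Set.Ioo 0 T, F t * (lineBump n).normed volume (t - a))
          - ∫ t in Set.Ioo 0 T, F t * (lineBump n).normed volume (t - b) := by
      filter_upwards [tendsto_rOut_lineBump.eventually_lt_const ha.1,
        tendsto_rOut_lineBump.eventually_lt_const (sub_pos.2 hb.2)] with n hn hn'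
      have hint : ∀ c : ℝ, IntegrableOn (fun t => F t * (lineBump n).normed volume (t - c))
          (Set.Ioo 0 T) := by
        intro c
        have hc := (lineBump n).continuous_normed (μ := volume)
        obtain ⟨B, hB⟩ := (lineBump n).hasCompactSupport_normed (μ := volume)
          |>.exists_bound_of_continuous hc
        exact hF.mul_bdd (c := B) (Continuous.aestronglyMeasurable (by fun_prop))
          (Eventually.of_forall fun t => hB _)
      rw [← integral_sub (hint a) (hint b), ← h _ (contDiff_softStep n a b)
        ⟨a - (lineBump n).rOut, b + (lineBump n).rOut, by linarith, by linarith, fun t ht => ?_⟩]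
      · congr 1; funext t
        rw [(hasDerivAt_softStep n a b t).deriv, mul_sub]
      · rw [Set.mem_Icc, not_and_or, not_le, not_le] at ht
        exact softStep_eq_zero hab.le (ht.imp (fun h => by linarith) fun h => h.le)
    have := tendsto_nhds_unique ((h1.sub h2).congr' (ev.mono fun n hn => hn.symm)) l1.neg
    rw [e1] at this
    simp only [hF', Set.indicator_of_mem ha, Set.indicator_of_mem hb] at this
    linarith
  have hconv' := ae_restrict_of_ae (s := Set.Ioo 0 T) hconv
  filter_upwards [hconv', ae_restrict_mem measurableSet_Ioo] with a ha ha'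
  filter_upwards [hconv', ae_restrict_mem measurableSet_Ioo] with b hb hb'
  rcases lt_trichotomy a b with hab | rfl | hab
  · exact key a b ha' hb' hab ha hb
  · simp
  · rw [intervalIntegral.integral_symm, ← key b a hb' ha' hab hb ha]; ring

/-- The weak time derivative of integrals over the torus. -/
lemma HasWeakTimeDeriv.slice {d : ℕ} {T : ℝ} {f g : ℝ → Pt d → ℝ} (h : HasWeakTimeDeriv T f g)
    (hf : Integrable (Function.uncurry f) (cylMeasure d T))
    (hg : Integrable (Function.uncurry g) (cylMeasure d T)) {b : Pt d → ℝ} {B : ℝ}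
    (hb : Measurable b) (hB : ∀ x, |b x| ≤ B) (hp : IsPeriodic b) (A : ℝ → ℝ)
    (hA : ContDiff ℝ ∞ A) (hA' : ∃ a b : ℝ, 0 < a ∧ b < T ∧ ∀ t, t ∉ Set.Icc a b → A t = 0) :
    ∫ t in Set.Ioo 0 T, (∫ x, f t x * b x ∂(torusMeasure d)) * deriv A t
      = -∫ t in Set.Ioo 0 T, (∫ x, g t x * b x ∂(torusMeasure d)) * A t := by
  have hsupp : HasCompactSupport A := by
    obtain ⟨a, b, -, -, hab⟩ := hA'
    exact HasCompactSupport.intro isCompact_Icc (fun t ht => hab t ht)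
  obtain ⟨A0, hA0⟩ := hsupp.exists_bound_of_continuous hA.continuous
  have hdA : Continuous (deriv A) := hA.continuous_deriv (by simp)
  obtain ⟨A1, hA1⟩ := hsupp.deriv.exists_bound_of_continuous hdA
  have hlim : ∀ {k : ℝ → Pt d → ℝ} {D : ℝ → ℝ} {C : ℝ},
      Integrable (Function.uncurry k) (cylMeasure d T) → Continuous D → (∀ t, ‖D t‖ ≤ C) →
      Tendsto (fun n => ∫ z, k z.1 z.2 * (D z.1 * mollify n b z.2) ∂(cylMeasure d T)) atTop
        (𝓝 (∫ t in Set.Ioo 0 T, (∫ x, k t x * b x ∂(torusMeasure d)) * D t)) := by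
    intro k D C hk hD hC
    have i1 : Integrable (fun z : ℝ × Pt d => k z.1 z.2 * (D z.1 * b z.2)) (cylMeasure d T) := by
      refine hk.mul_bdd (c := C * B) ?_ (Eventually.of_forall fun z => ?_)
      · exact ((hD.measurable.comp measurable_fst).mul
          (hb.comp measurable_snd)).aestronglyMeasurable
      · rw [norm_mul]
        exact mul_le_mul (hC _) (hB _) (norm_nonneg _) ((norm_nonneg _).trans (hC 0))
    have e : ∫ t in Set.Ioo 0 T, (∫ x, k t x * b x ∂(torusMeasure d)) * D t
        = ∫ z, k z.1 z.2 * (D z.1 * b z.2) ∂(cylMeasure d T) := by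
      rw [cylMeasure, integral_prod _ i1]
      congr 1; funext t
      rw [← integral_mul_const]
      congr 1; funext x; ring
    rw [e]
    refine tendsto_integral_of_dominated_convergence (fun z => |k z.1 z.2| * (C * B))
      (fun n => ?_) (hk.abs.mul_const _) (fun n => Eventually.of_forall fun z => ?_) ?_
    · exact hk.aestronglyMeasurable.mul ((hD.measurable.comp measurable_fst).mul
        ((contDiff_mollify n hb hB).continuous.measurable.comp
          measurable_snd)).aestronglyMeasurable
    · rw [norm_mul, norm_mul, Real.norm_eq_abs (k _ _)]
      have h1 : ‖mollify n b z.2‖ ≤ B := abs_mollify_le n hB z.2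
      have h2 := hC z.1
      have h3 := (norm_nonneg _).trans h2
      gcongr
    · have hm : ∀ᵐ x ∂(torusMeasure d), Tendsto (fun n => mollify n b x) atTop (𝓝 (b x)) :=
        ae_restrict_of_ae (ae_tendsto_mollify hb hB)
      have hm' : ∀ᵐ z ∂(cylMeasure d T), Tendsto (fun n => mollify n b z.2) atTop (𝓝 (b z.2)) :=
        Measure.quasiMeasurePreserving_snd.ae hm
      filter_upwards [hm'] with z hz
      exact (hz.const_mul _).const_mul _
  -- The products `A(t)` times the mollified `b` are admissible space-time test functions. Both
  -- sides converge as the mollification is removed.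
  refine tendsto_nhds_unique (hlim hf hdA hA1) (((hlim hg hA.continuous hA0).neg).congr fun n => ?_)
  rw [← h (fun t x => A t * mollify n b x)]
  · congr 1; funext z
    rw [deriv_mul_const (hA.differentiable (by simp) _)]
  · exact (hA.comp contDiff_fst).mul ((contDiff_mollify n hb hB).comp contDiff_snd)
  · intro t x i
    simp only [mollify_periodic n hp x i]
  · obtain ⟨a, c, h1, h2, h3⟩ := hA'
    exact ⟨a, c, h1, h2, fun t ht x => by simp [h3 t ht]⟩

/-- Integrals over the torus of a test function are integrable functions of time. -/
lemma integrableOn_torus_integral_mul {d : ℕ} {T : ℝ} {k : ℝ → Pt d → ℝ}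
    (hk : Integrable (Function.uncurry k) (cylMeasure d T)) {b : Pt d → ℝ} {B : ℝ}
    (hb : Measurable b) (hB : ∀ x, |b x| ≤ B) :
    IntegrableOn (fun t => ∫ x, k t x * b x ∂(torusMeasure d)) (Set.Ioo 0 T) := by
  have i1 : Integrable (fun z : ℝ × Pt d => k z.1 z.2 * b z.2) (cylMeasure d T) :=
    hk.mul_bdd (c := B) (hb.comp measurable_snd).aestronglyMeasurable
      (Eventually.of_forall fun z => hB _)
  exact i1.integral_prod_left

section TestFunction

variable {d : ℕ} {T : ℝ} (φ : TestFunction d T)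

lemma TestFunction.integrable_val_cyl : Integrable (Function.uncurry φ.val) (cylMeasure d T) := by
  obtain ⟨M, hM, h⟩ := φ.exists_bound_val
  have hs : MeasurableSet (Set.Ioo 0 T ×ˢ unitCube d) :=
    measurableSet_Ioo.prod (MeasurableSet.univ_pi fun _ => measurableSet_Ico)
  have e : cylMeasure d T = volume.restrict (Set.Ioo 0 T ×ˢ unitCube d) := by
    rw [cylMeasure, torusMeasure, Measure.prod_restrict, ← Measure.volume_eq_prod]
  refine Integrable.of_bound (C := M) ?_ ?_
  · rw [e]
    exact (φ.continuousOn.mono (Set.prod_mono Set.Ioo_subset_Icc_self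
      (Set.subset_univ _))).aestronglyMeasurable hs
  · rw [e]
    filter_upwards [ae_restrict_mem hs] with z hz
    exact h z.1 (Set.Ioo_subset_Icc_self hz.1) z.2 hz.2

lemma TestFunction.continuousOn_integral {b : Pt d → ℝ} {B : ℝ}
    (hb : Measurable b) (hB : ∀ x, |b x| ≤ B) :
    ContinuousOn (fun t => ∫ x, φ.val t x * b x ∂(torusMeasure d)) (Set.Icc 0 T) := by
  obtain ⟨M, hM, h⟩ := φ.exists_bound_val
  refine continuousOn_of_dominated (bound := fun _ => M * B) (fun t ht => ?_) (fun t ht => ?_)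
    (integrable_const _) (Eventually.of_forall fun x => ?_)
  · exact (φ.integrable_val ht).aestronglyMeasurable.mul hb.aestronglyMeasurable
  · filter_upwards [ae_mem_unitCube] with x hx
    rw [Real.norm_eq_abs, abs_mul]
    exact mul_le_mul (h t ht x hx) (hB x) (abs_nonneg _) hM
  · refine ContinuousOn.mul ?_ continuousOn_const
    exact φ.continuousOn.comp (f := fun t : ℝ => (t, x)) (by fun_prop) fun t ht => ⟨ht, trivial⟩

/-- Time regularity of the integrals of a test function against a fixed function. -/
lemma TestFunction.time_regularity (hT : 0 < T) {M : ℝ}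
    (hreg : ∀ᵐ t ∂(volume.restrict (Set.Ioo 0 T)), φ.RegularAt M t) {b : Pt d → ℝ} {B : ℝ}
    (hb : Measurable b) (hB : ∀ x, |b x| ≤ B) (hp : IsPeriodic b) :
    IntegrableOn (fun t => ∫ x, φ.dt t x * b x ∂(torusMeasure d)) (Set.Ioo 0 T) ∧
    (∀ s ∈ Set.Icc 0 T, ∀ t ∈ Set.Icc 0 T, (∫ x, φ.val t x * b x ∂(torusMeasure d))
      - ∫ x, φ.val s x * b x ∂(torusMeasure d)
        = ∫ r in s..t, ∫ x, φ.dt r x * b x ∂(torusMeasure d)) ∧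
    (∀ᵐ t ∂(volume.restrict (Set.Ioo 0 T)), |∫ x, φ.dt t x * b x ∂(torusMeasure d)|
      ≤ M * ∫ x, |b x| ∂(torusMeasure d)) ∧
    ∀ t r s : ℝ, 0 ≤ t → 0 ≤ r → 0 ≤ s → t + r + s ≤ T →
      |(∫ x, φ.val (t + r + s) x * b x ∂(torusMeasure d))
        - (∫ x, φ.val (t + r) x * b x ∂(torusMeasure d))
        - (∫ x, φ.val (t + s) x * b x ∂(torusMeasure d))
        + ∫ x, φ.val t x * b x ∂(torusMeasure d)|
      ≤ M * (∫ x, |b x| ∂(torusMeasure d)) * r * s := by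
  set P := fun t => ∫ x, φ.val t x * b x ∂(torusMeasure d) with hPdef
  set q := fun t => ∫ x, φ.dt t x * b x ∂(torusMeasure d) with hqdef
  set g := fun t => ∫ x, φ.dtt t x * b x ∂(torusMeasure d) with hgdef
  set D := M * ∫ x, |b x| ∂(torusMeasure d) with hD
  have i0 := φ.integrable_val_cyl
  have i1 := φ.memLp_dt.integrable le_top
  have i2 := φ.memLp_dtt.integrable le_top
  have iP : IntegrableOn P (Set.Ioo 0 T) := integrableOn_torus_integral_mul i0 hb hB
  have iq : IntegrableOn q (Set.Ioo 0 T) := integrableOn_torus_integral_mul i1 hb hB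
  have ig : IntegrableOn g (Set.Ioo 0 T) := integrableOn_torus_integral_mul i2 hb hB
  have ibd : Integrable (fun x => |b x|) (torusMeasure d) :=
    (Integrable.of_bound hb.aestronglyMeasurable B (Eventually.of_forall hB)).abs
  have hbound : ∀ k : Pt d → ℝ, (∀ᵐ x ∂(torusMeasure d), |k x| ≤ M) →
      |∫ x, k x * b x ∂(torusMeasure d)| ≤ D := by
    intro k hk
    rw [hD, ← integral_const_mul]
    refine norm_integral_le_of_norm_le (f := fun x => k x * b x) (ibd.const_mul M) ?_
    filter_upwards [hk] with x hx
    rw [Real.norm_eq_abs, abs_mul]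
    gcongr
  have hqb : ∀ᵐ t ∂(volume.restrict (Set.Ioo 0 T)), |q t| ≤ D :=
    hreg.mono fun t ht => hbound _ ht.abs_dt_le
  have hgb : ∀ᵐ t ∂(volume.restrict (Set.Ioo 0 T)), |g t| ≤ D :=
    hreg.mono fun t ht => hbound _ ht.abs_dtt_le
  have w1 := sub_eq_integral_of_weak_deriv iP iq fun A hA hA' =>
    φ.weak_dt.slice i0 i1 hb hB hp A hA hA'
  have w2 := sub_eq_integral_of_weak_deriv iq ig fun A hA hA' =>
    φ.weak_dtt.slice i1 i2 hb hB hp A hA hA'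
  have hne : (ae (volume.restrict (Set.Ioo 0 T))).NeBot := by
    rw [ae_neBot, Ne, Measure.restrict_eq_zero]; simp [hT]
  have toInt : ∀ {f : ℝ → ℝ}, IntegrableOn f (Set.Ioo 0 T) → ∀ s ∈ Set.Icc 0 T, ∀ t ∈ Set.Icc 0 T,
      IntervalIntegrable f volume s t := fun {f} hf s hs t ht => by
    have h : IntervalIntegrable f volume 0 T := by
      rwa [intervalIntegrable_iff_integrableOn_Ioo_of_le hT.le]
    refine h.mono_set ?_
    rw [Set.uIcc_of_le hT.le]
    exact Set.uIcc_subset_Icc hs ht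
  have e1 : ∀ s ∈ Set.Icc 0 T, ∀ t ∈ Set.Icc 0 T, P t - P s = ∫ r in s..t, q r := by
    -- One good base point suffices: `P` equals a primitive of `q` almost everywhere, and both are
    -- continuous on [0, T], so they agree everywhere, end points included.
    obtain ⟨a, ha, ha'⟩ := (w1.and (ae_restrict_mem measurableSet_Ioo)).exists
    have haI := Set.Ioo_subset_Icc_self ha'
    have hcq : ContinuousOn (fun t => P a + ∫ r in a..t, q r) (Set.Icc 0 T) := by
      have := intervalIntegral.continuousOn_primitive_interval' (a := a)
        (toInt iq 0 ⟨le_rfl, hT.le⟩ T ⟨hT.le, le_rfl⟩) (by rwa [Set.uIcc_of_le hT.le])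
      rw [Set.uIcc_of_le hT.le] at this
      exact continuousOn_const.add this
    have heq : Set.EqOn P (fun t => P a + ∫ r in a..t, q r) (Set.Icc 0 T) := by
      refine Measure.eqOn_Icc_of_ae_eq volume hT.ne ?_ (φ.continuousOn_integral hb hB) hcq
      rw [← restrict_Ioo_eq_restrict_Icc]
      filter_upwards [ha] with t ht
      linarith
    intro s hs t ht
    rw [heq hs, heq ht]
    rw [add_sub_add_left_eq_sub, intervalIntegral.integral_interval_sub_left
      (toInt iq _ haI _ ht) (toInt iq _ haI _ hs)]
  refine ⟨iq, e1, hqb, fun t r s ht hr hs hle => ?_⟩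
  obtain ⟨a, ha, ha'⟩ := (w2.and (ae_restrict_mem measurableSet_Ioo)).exists
  have haI := Set.Ioo_subset_Icc_self ha'
  -- `k` is the Lipschitz representative of `q`. Since `q` itself is known only almost everywhere,
  -- the second difference of `P` is estimated by integrating differences of `k`.
  set k := fun t => q a + ∫ r in a..t, g r with hk
  have hkq : ∀ᵐ t, t ∈ Set.Ioo 0 T → q t = k t := by
    rw [← ae_restrict_iff' measurableSet_Ioo]
    filter_upwards [ha] with t ht
    simp only [hk]; linarith
  have hkL : ∀ t ∈ Set.Icc 0 T, ∀ r, 0 ≤ r → t + r ≤ T → |k (t + r) - k t| ≤ D * r := by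
    intro t ht r hr htr
    have ht2 : t + r ∈ Set.Icc 0 T := ⟨by linarith [ht.1], htr⟩
    simp only [hk]
    rw [add_sub_add_left_eq_sub, intervalIntegral.integral_interval_sub_left
      (toInt ig _ haI _ ht2) (toInt ig _ haI _ ht)]
    have := intervalIntegral.norm_integral_le_of_norm_le_const_ae (a := t) (b := t + r) (f := g)
      (C := D) (by
        have h := (ae_restrict_iff' measurableSet_Ioo).1 hgb
        filter_upwards [h, Measure.ae_ne volume (t + r)] with u hu hne hu'
        rw [Set.uIoc_of_le (by linarith)] at hu'
        exact hu ⟨lt_of_le_of_lt ht.1 hu'.1, lt_of_lt_of_le (lt_of_le_of_ne hu'.2 hne) htr⟩)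
    rwa [add_sub_cancel_left, abs_of_nonneg hr] at this
  have m0 : t ∈ Set.Icc 0 T := ⟨ht, by linarith⟩
  have m1 : t + s ∈ Set.Icc 0 T := ⟨by linarith, by linarith⟩
  have m2 : t + r ∈ Set.Icc 0 T := ⟨by linarith, by linarith⟩
  have m3 : t + r + s ∈ Set.Icc 0 T := ⟨by linarith, hle⟩
  have s1 : P (t + r + s) - P (t + r) = ∫ u in t..(t + s), q (u + r) := by
    rw [e1 _ m2 _ m3, intervalIntegral.integral_comp_add_right]
    congr 1; ring
  have s2 := e1 _ m0 _ m1
  have ii1 : IntervalIntegrable (fun u => q (u + r)) volume t (t + s) := by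
    have := (toInt iq _ m2 _ m3).comp_add_right r
    simpa [add_right_comm t r s] using this
  have e2 : P (t + r + s) - P (t + r) - P (t + s) + P t
      = ∫ u in t..(t + s), (q (u + r) - q u) := by
    rw [intervalIntegral.integral_sub ii1 (toInt iq _ m0 _ m1), ← s1, ← s2]; ring
  change |P (t + r + s) - P (t + r) - P (t + s) + P t| ≤ D * r * s
  rw [e2]
  have := intervalIntegral.norm_integral_le_of_norm_le_const_ae (a := t) (b := t + s)
    (f := fun u => q (u + r) - q u) (C := D * r) (by
      have hkq' : ∀ᵐ u, u + r ∈ Set.Ioo 0 T → q (u + r) = k (u + r) :=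
        (measurePreserving_add_right volume r).quasiMeasurePreserving.ae hkq
      filter_upwards [hkq, hkq', Measure.ae_ne volume (t + s)] with u hu hu' hne hu''
      rw [Set.uIoc_of_le (by linarith)] at hu''
      have h1 : 0 < u := lt_of_le_of_lt ht hu''.1
      have h2 : u < t + s := lt_of_le_of_ne hu''.2 hne
      rw [hu ⟨h1, by linarith⟩, hu' ⟨by linarith, by linarith⟩]
      exact hkL u ⟨h1.le, by linarith⟩ r hr (by linarith))
  rwa [add_sub_cancel_left, abs_of_nonneg hs] at this

end TestFunction

end WeakDerivative

/-! ## Telescoping in time -/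

section Telescope

/-- `p` is a `C^{1,1}` function on `[0,T]` with derivative `q`, with constant `M`. -/
structure TimeTest (T M : ℝ) (p q : ℝ → ℝ) : Prop where
  continuousOn : ContinuousOn p (Set.Icc 0 T)
  integrable : IntervalIntegrable q volume 0 T
  sub_eq : ∀ s ∈ Set.Icc 0 T, ∀ t ∈ Set.Icc 0 T, p t - p s = ∫ r in s..t, q r
  abs_le : ∀ᵐ t ∂(volume.restrict (Set.Ioo 0 T)), |q t| ≤ M
  second_diff : ∀ t r s : ℝ, 0 ≤ t → 0 ≤ r → 0 ≤ s → t + r + s ≤ T →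
    |p (t + r + s) - p (t + r) - p (t + s) + p t| ≤ M * r * s

variable {T M dt : ℝ} {p q : ℝ → ℝ}

lemma intervalIntegrable_mono {f : ℝ → ℝ} (hf : IntervalIntegrable f volume 0 T) {s t : ℝ}
    (hs : s ∈ Set.Icc 0 T) (ht : t ∈ Set.Icc 0 T) : IntervalIntegrable f volume s t := by
  refine hf.mono_set ?_
  rw [Set.uIcc_of_le (hs.1.trans hs.2)]
  exact Set.uIcc_subset_Icc hs ht

lemma TimeTest.lipschitz (h : TimeTest T M p q) {s t : ℝ} (hs : 0 ≤ s) (hst : s ≤ t) (ht : t ≤ T) :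
    |p t - p s| ≤ M * (t - s) := by
  rw [h.sub_eq s ⟨hs, by linarith⟩ t ⟨by linarith, ht⟩, ← abs_of_nonneg (sub_nonneg.2 hst)]
  refine intervalIntegral.norm_integral_le_of_norm_le_const_ae (f := q) ?_
  filter_upwards [(ae_restrict_iff' measurableSet_Ioo).1 h.abs_le, Measure.ae_ne volume t]
    with u hu hne hu'
  rw [Set.uIoc_of_le hst] at hu'
  exact hu ⟨lt_of_le_of_lt hs hu'.1, lt_of_lt_of_le (lt_of_le_of_ne hu'.2 hne) ht⟩

lemma TimeTest.neg (h : TimeTest T M p q) : TimeTest T M (fun t => -p t) (fun t => -q t) where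
  continuousOn := h.continuousOn.neg
  integrable := h.integrable.neg
  sub_eq s hs t ht := by
    rw [intervalIntegral.integral_neg, ← h.sub_eq s hs t ht]; ring
  abs_le := by simpa using h.abs_le
  second_diff t r s h1 h2 h3 h4 := by
    rw [← abs_neg]
    convert h.second_diff t r s h1 h2 h3 h4 using 2
    ring

lemma TimeTest.zero : TimeTest T 0 (fun _ => 0) (fun _ => 0) where
  continuousOn := continuousOn_const
  integrable := intervalIntegrable_const
  sub_eq s hs t ht := by simp
  abs_le := by simp
  second_diff t r s h1 h2 h3 h4 := by simp

lemma TimeTest.add {M' : ℝ} {p' q' : ℝ → ℝ} (h : TimeTest T M p q) (h' : TimeTest T M' p' q') :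
    TimeTest T (M + M') (fun t => p t + p' t) (fun t => q t + q' t) where
  continuousOn := h.continuousOn.add h'.continuousOn
  integrable := h.integrable.add h'.integrable
  sub_eq s hs t ht := by
    rw [intervalIntegral.integral_add (intervalIntegrable_mono h.integrable hs ht)
      (intervalIntegrable_mono h'.integrable hs ht), ← h.sub_eq s hs t ht, ← h'.sub_eq s hs t ht]
    ring
  abs_le := by
    filter_upwards [h.abs_le, h'.abs_le] with t h1 h2
    exact (abs_add_le _ _).trans (add_le_add h1 h2)
  second_diff t r s h1 h2 h3 h4 := by
    have a := h.second_diff t r s h1 h2 h3 h4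
    have b := h'.second_diff t r s h1 h2 h3 h4
    rw [_root_.abs_le] at a b ⊢
    constructor <;> linarith [a.1, a.2, b.1, b.2]

lemma TimeTest.sum {ι : Type*} (I : Finset ι) {M : ι → ℝ} {p q : ι → ℝ → ℝ}
    (h : ∀ i ∈ I, TimeTest T (M i) (p i) (q i)) :
    TimeTest T (∑ i ∈ I, M i) (fun t => ∑ i ∈ I, p i t) (fun t => ∑ i ∈ I, q i t) := by
  classical
  induction I using Finset.induction_on with
  | empty => simpa using TimeTest.zero
  | insert i I hi ih =>
    simp only [Finset.sum_insert hi]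
    exact (h i (Finset.mem_insert_self i I)).add
      (ih fun j hj => h j (Finset.mem_insert_of_mem hj))

lemma TimeTest.mono {M' : ℝ} (h : TimeTest T M p q) (hM : M ≤ M') : TimeTest T M' p q where
  continuousOn := h.continuousOn
  integrable := h.integrable
  sub_eq := h.sub_eq
  abs_le := h.abs_le.mono fun t ht => ht.trans hM
  second_diff t r s h1 h2 h3 h4 := (h.second_diff t r s h1 h2 h3 h4).trans (by gcongr)

section Floor

variable {NT : ℕ} {H : ℕ → ℝ → ℝ}

lemma floor_div_eq (hdt : 0 < dt) {k : ℕ} {t : ℝ} (h1 : k * dt ≤ t) (h2 : t < (k + 1) * dt) :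
    ⌊t / dt⌋₊ = k := by
  have h0 : 0 ≤ t := le_trans (by positivity) h1
  rw [Nat.floor_eq_iff (by positivity)]
  exact ⟨by rwa [le_div_iff₀ hdt], by rwa [div_lt_iff₀ hdt]⟩

lemma integral_floor_eq (hdt : 0 < dt) (H : ℕ → ℝ → ℝ) {k : ℕ} {s t : ℝ} (h0 : k * dt ≤ s)
    (hst : s ≤ t) (h1 : t ≤ (k + 1) * dt) :
    ∫ r in s..t, H ⌊r / dt⌋₊ r = ∫ r in s..t, H k r := by
  rw [intervalIntegral.integral_of_le hst, intervalIntegral.integral_of_le hst,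
    integral_Ioc_eq_integral_Ioo, integral_Ioc_eq_integral_Ioo]
  refine setIntegral_congr_fun measurableSet_Ioo fun r hr => ?_
  simp only [floor_div_eq hdt (h0.trans hr.1.le) (hr.2.trans_le h1)]

lemma intervalIntegrable_floor (hdt : 0 < dt) (hNT : NT * dt = T)
    (hH : ∀ k ≤ NT, IntervalIntegrable (H k) volume 0 T) :
    IntervalIntegrable (fun r => H ⌊r / dt⌋₊ r) volume 0 T := by
  have h := IntervalIntegrable.trans_iterate (μ := volume) (f := fun r => H ⌊r / dt⌋₊ r)
    (a := fun k : ℕ => (k : ℝ) * dt) (n := NT) fun k hk => by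
      have e0 : (0 : ℝ) ≤ k * dt := by positivity
      have e1 : ((k + 1 : ℕ) : ℝ) * dt ≤ T := by
        rw [← hNT]; gcongr; exact hk
      have e2 : (k : ℝ) * dt ≤ ((k + 1 : ℕ) : ℝ) * dt := by gcongr; simp
      have := intervalIntegrable_mono (hH k hk.le) ⟨e0, e2.trans e1⟩ ⟨e0.trans e2, e1⟩
      rw [intervalIntegrable_iff_integrableOn_Ioo_of_le e2] at this ⊢
      refine this.congr_fun (fun r hr => ?_) measurableSet_Ioo
      simp only [floor_div_eq hdt hr.1.le (hr.2.trans_le (by push_cast; exact le_rfl))]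
  simpa [hNT] using h

end Floor

/-- The lower bound for a piecewise constant in time discrete balance, up to errors of order `dt`. -/
lemma time_telescope {NT : ℕ} {C0 : ℝ} {p q H : ℕ → ℝ → ℝ} {R : ℕ → ℝ}
    (hT : 0 < T) (hdt : 0 < dt) (hNT : NT * dt = T) (hM : 0 ≤ M) (hC0 : 0 ≤ C0)
    (hR : ∀ k, 0 ≤ R k)
    (hp : ∀ k ≤ NT, TimeTest T M (p k) (q k))
    (hH : ∀ k ≤ NT, IntervalIntegrable (H k) volume 0 T)
    (hstep : ∀ᵐ t ∂(volume.restrict (Set.Ioo 0 T)), ∀ k < NT,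
      H (k + 1) t - R (k + 1) ≤ (p (k + 1) t - p k t) / dt ∧
        -(C0 + R (k + 1)) ≤ (p (k + 1) t - p k t) / dt)
    (hH0 : ∀ᵐ t ∂(volume.restrict (Set.Ioo 0 T)), H 0 t ≤ C0) {τ : ℝ} (hτ : τ ∈ Set.Icc 0 T) :
    (∫ t in (0 : ℝ)..τ, q ⌊t / dt⌋₊ t) + (∫ t in (0 : ℝ)..τ, H ⌊t / dt⌋₊ t)
        - dt * ((5 + T) * M + 3 * C0 + ∑ k ∈ Finset.range NT, R (k + 1))
      ≤ p ⌊τ / dt⌋₊ τ - p 0 0 := by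
  have iq := intervalIntegrable_floor hdt hNT (H := q) fun k hk => (hp k hk).integrable
  have iH := intervalIntegrable_floor hdt hNT hH
  have ip : ∀ k ≤ NT, IntervalIntegrable (p k) volume 0 T := fun k hk =>
    ContinuousOn.intervalIntegrable (by rw [Set.uIcc_of_le hT.le]; exact (hp k hk).continuousOn)
  have hmem : ∀ k ≤ NT, (k : ℝ) * dt ∈ Set.Icc 0 T := fun k hk => by
    refine ⟨by positivity, ?_⟩
    rw [← hNT]; gcongr
  have hae : ∀ {P : ℝ → Prop}, (∀ᵐ t ∂(volume.restrict (Set.Ioo 0 T)), P t) →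
      ∀ {s t : ℝ}, 0 ≤ s → t ≤ T → ∀ᵐ u ∂(volume.restrict (Set.Icc s t)), P u := by
    intro P hP s t hs ht
    refine ae_restrict_of_ae_restrict_of_subset (Set.Icc_subset_Icc hs ht) ?_
    rwa [← restrict_Ioo_eq_restrict_Icc]
  -- The balance is known for almost every `t` only, so slab means are telescoped in place of point
  -- values.
  set a : ℕ → ℝ := fun k => (1 / dt) * ∫ t in (k * dt)..((k + 1) * dt), p k t with ha
  -- averages are close to values
  have havg : ∀ k < NT, ∀ t ∈ Set.Icc (k * dt) ((k + 1) * dt), |a k - p k t| ≤ M * dt := by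
    intro k hk t ht
    have m0 := hmem k hk.le
    have m1 := hmem (k + 1) hk
    push_cast at m1
    have e : a k - p k t = (1 / dt) * ∫ s in (k * dt)..((k + 1) * dt), (p k s - p k t) := by
      rw [intervalIntegral.integral_sub (intervalIntegrable_mono (ip k hk.le) m0 m1)
        intervalIntegrable_const, intervalIntegral.integral_const, smul_eq_mul]
      simp only [ha]; field_simp; ring
    have b := intervalIntegral.norm_integral_le_of_norm_le_const (a := k * dt) (b := (k + 1) * dt)
      (f := fun s => p k s - p k t) (C := M * dt) (fun s hs => by
        rw [Set.uIoc_of_le (by linarith)] at hs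
        rw [Real.norm_eq_abs]
        rcases le_total s t with h | h
        · rw [abs_sub_comm]
          refine ((hp k hk.le).lipschitz (by linarith [m0.1, hs.1]) h (by linarith [ht.2, m1.2])).trans
            (mul_le_mul_of_nonneg_left ?_ hM)
          linarith [ht.2, hs.1]
        · refine ((hp k hk.le).lipschitz (by linarith [m0.1, ht.1]) h (by linarith [hs.2, m1.2])).trans
            (mul_le_mul_of_nonneg_left ?_ hM)
          linarith [ht.1, hs.2])
    rw [show ((k : ℝ) + 1) * dt - k * dt = dt by ring, abs_of_pos hdt, Real.norm_eq_abs] at b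
    rw [e, abs_mul, abs_of_pos (by positivity)]
    calc _ ≤ 1 / dt * (M * dt * dt) := by gcongr
      _ = M * dt := by field_simp
  -- one step of the averages
  have hincr : ∀ k, k + 1 < NT →
      (1 / dt) * (∫ t in ((k + 1) * dt)..((k + 2) * dt), (p (k + 1) t - p k t))
        + (∫ t in (k * dt)..((k + 1) * dt), q k t) - M * dt ^ 2 ≤ a (k + 1) - a k := by
    intro k hk
    have m0 := hmem k (by omega)
    have m1 := hmem (k + 1) hk.le
    have m2 := hmem (k + 2) hk
    push_cast at m1 m2
    have h1 : ∫ t in (k * dt)..((k + 1) * dt), p k t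
        = ∫ t in ((k + 1) * dt)..((k + 2) * dt), p k (t - dt) := by
      rw [intervalIntegral.integral_comp_sub_right (fun t => p k t)]
      congr 1 <;> ring
    have i1 := intervalIntegrable_mono (ip k (by omega)) m1 m2
    have i2 := intervalIntegrable_mono (ip (k + 1) hk.le) m1 m2
    have i3 : IntervalIntegrable (fun t => p k (t - dt)) volume ((k + 1) * dt) ((k + 2) * dt) := by
      have := (intervalIntegrable_mono (ip k (by omega)) m0 m1).comp_sub_right dt
      convert this using 1 <;> ring
    -- Two changes are separated: of the level at fixed time, which the scheme describes, and of the
    -- time at fixed level, which is the time derivative of the test function.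
    have h2 : a (k + 1) - a k
        = (1 / dt) * (∫ t in ((k + 1) * dt)..((k + 2) * dt), (p (k + 1) t - p k t))
          + (1 / dt) * ∫ t in ((k + 1) * dt)..((k + 2) * dt), (p k t - p k (t - dt)) := by
      rw [intervalIntegral.integral_sub i2 i1, intervalIntegral.integral_sub i1 i3, ← h1]
      simp only [ha]; push_cast
      rw [show (k : ℝ) + 1 + 1 = k + 2 by ring]; ring
    -- The difference with lag `dt` taken at `t` is compared with the same difference over the slab
    -- `k`. They differ by a second difference, at most `M dt²`.
    have h3 : (∫ t in (k * dt)..((k + 1) * dt), q k t) - M * dt ^ 2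
        ≤ (1 / dt) * ∫ t in ((k + 1) * dt)..((k + 2) * dt), (p k t - p k (t - dt)) := by
      rw [← (hp k (by omega)).sub_eq _ m0 _ m1]
      have := intervalIntegral.integral_mono_on (a := ((k : ℝ) + 1) * dt) (b := (k + 2) * dt)
        (f := fun _ => p k ((k + 1) * dt) - p k (k * dt) - M * dt ^ 2)
        (g := fun t => p k t - p k (t - dt)) (by linarith) intervalIntegrable_const (i1.sub i3)
        (fun t ht => by
          have b := (hp k (by omega)).second_diff (k * dt) dt (t - (k + 1) * dt) m0.1 hdt.le
            (by linarith [ht.1]) (by linarith [ht.2, m2.2])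
          rw [show (k : ℝ) * dt + dt + (t - (k + 1) * dt) = t by ring,
            show (k : ℝ) * dt + dt = (k + 1) * dt by ring,
            show (k : ℝ) * dt + (t - (k + 1) * dt) = t - dt by ring] at b
          have b2 : M * dt * (t - (k + 1) * dt) ≤ M * dt * dt := by
            gcongr; linarith [ht.2]
          have := (abs_le.1 b).1
          linarith)
      rw [intervalIntegral.integral_const, smul_eq_mul,
        show ((k : ℝ) + 2) * dt - (k + 1) * dt = dt by ring] at this
      rw [one_div, ← div_eq_inv_mul, le_div_iff₀ hdt]
      linarith
    rw [h2]; linarith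
  -- lower bound for the increments
  have hlow : ∀ k < NT, ∀ s t, 0 ≤ s → s ≤ t → t ≤ T →
      -((C0 + R (k + 1)) * (t - s)) ≤ (1 / dt) * ∫ u in s..t, (p (k + 1) u - p k u) := by
    intro k hk s t hs hst ht
    have i := (intervalIntegrable_mono (ip (k + 1) hk) ⟨hs, hst.trans ht⟩ ⟨hs.trans hst, ht⟩).sub
      (intervalIntegrable_mono (ip k hk.le) ⟨hs, hst.trans ht⟩ ⟨hs.trans hst, ht⟩)
    rw [← intervalIntegral.integral_const_mul]
    have := intervalIntegral.integral_mono_ae_restrict hst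
      (intervalIntegrable_const (c := -(C0 + R (k + 1)))) (i.const_mul (1 / dt)) (by
        filter_upwards [hae hstep hs ht] with u hu
        have := (hu k hk).2
        rw [div_eq_inv_mul, ← one_div] at this
        exact this)
    rw [intervalIntegral.integral_const, smul_eq_mul] at this
    linarith
  have hlow' : ∀ k < NT, ∀ s t, 0 ≤ s → s ≤ t → t ≤ T →
      (∫ u in s..t, H (k + 1) u) - R (k + 1) * (t - s)
        ≤ (1 / dt) * ∫ u in s..t, (p (k + 1) u - p k u) := by
    intro k hk s t hs hst ht
    have ms : s ∈ Set.Icc 0 T := ⟨hs, hst.trans ht⟩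
    have mt : t ∈ Set.Icc 0 T := ⟨hs.trans hst, ht⟩
    have i := (intervalIntegrable_mono (ip (k + 1) hk) ms mt).sub
      (intervalIntegrable_mono (ip k hk.le) ms mt)
    have i' := intervalIntegrable_mono (hH (k + 1) hk) ms mt
    rw [← intervalIntegral.integral_const_mul]
    have := intervalIntegral.integral_mono_ae_restrict hst
      (i'.sub (intervalIntegrable_const (c := R (k + 1)))) (i.const_mul (1 / dt)) (by
        filter_upwards [hae hstep hs ht] with u hu
        have := (hu k hk).1
        rw [div_eq_inv_mul, ← one_div] at this
        exact this)
    rw [intervalIntegral.integral_sub i' intervalIntegrable_const,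
      intervalIntegral.integral_const, smul_eq_mul] at this
    linarith
  have hclaim : ∀ n < NT, ∀ τ ∈ Set.Icc (n * dt) ((n + 1) * dt),
      (∫ t in (0 : ℝ)..(n * dt), q ⌊t / dt⌋₊ t) + (∫ t in (0 : ℝ)..τ, H ⌊t / dt⌋₊ t)
        - (n * (M * dt ^ 2) + C0 * (dt + ((n + 1) * dt - τ))
          + dt * ∑ k ∈ Finset.range n, R (k + 1)) ≤ a n - a 0 := by
    intro n
    induction n with
    | zero =>
      intro hn τ hτ
      have m1 := hmem 1 hn
      simp only [Nat.cast_zero, zero_mul, zero_add, one_mul, Nat.cast_one] at hτ m1 ⊢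
      have e := integral_floor_eq hdt H (k := 0) (s := 0) (t := τ) (by simp) hτ.1 (by simpa using hτ.2)
      have := intervalIntegral.integral_mono_ae_restrict hτ.1
        (intervalIntegrable_mono (hH 0 (by omega)) ⟨le_rfl, hT.le⟩ ⟨hτ.1, hτ.2.trans m1.2⟩)
        (intervalIntegrable_const (c := C0)) (hae hH0 le_rfl (hτ.2.trans m1.2))
      rw [intervalIntegral.integral_const, smul_eq_mul] at this
      rw [e]
      simp only [intervalIntegral.integral_same, Finset.range_zero, Finset.sum_empty]
      nlinarith [mul_le_mul_of_nonneg_left hτ.2 hC0]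
    | succ n ih =>
      intro hn τ hτ
      have m0 := hmem n (by omega)
      have m1 := hmem (n + 1) hn.le
      have m2 := hmem (n + 2) hn
      push_cast at hτ m1 m2 ⊢
      rw [show (n : ℝ) + 1 + 1 = n + 2 by ring] at hτ ⊢
      have hτT : τ ∈ Set.Icc 0 T := ⟨m1.1.trans hτ.1, hτ.2.trans m2.2⟩
      have ih' := ih (by omega) ((n + 1) * dt) ⟨by linarith, le_rfl⟩
      have e1 : (∫ t in (0 : ℝ)..((n + 1) * dt), q ⌊t / dt⌋₊ t)
          = (∫ t in (0 : ℝ)..(n * dt), q ⌊t / dt⌋₊ t) + ∫ t in (n * dt)..((n + 1) * dt), q n t := by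
        rw [← integral_floor_eq hdt q (k := n) le_rfl (by linarith) le_rfl,
          intervalIntegral.integral_add_adjacent_intervals
            (intervalIntegrable_mono iq ⟨le_rfl, hT.le⟩ m0) (intervalIntegrable_mono iq m0 m1)]
      have e2 : (∫ t in (0 : ℝ)..τ, H ⌊t / dt⌋₊ t)
          = (∫ t in (0 : ℝ)..((n + 1) * dt), H ⌊t / dt⌋₊ t)
            + ∫ t in ((n + 1) * dt)..τ, H (n + 1) t := by
        rw [← integral_floor_eq hdt H (k := n + 1) (by push_cast; exact le_rfl) hτ.1
            (by push_cast; linarith [hτ.2]),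
          intervalIntegral.integral_add_adjacent_intervals
            (intervalIntegrable_mono iH ⟨le_rfl, hT.le⟩ m1) (intervalIntegrable_mono iH m1 hτT)]
      have s1 := hincr n hn
      have i := (intervalIntegrable_mono (ip (n + 1) hn.le) m1 hτT).sub
        (intervalIntegrable_mono (ip n (by omega)) m1 hτT)
      have i' := (intervalIntegrable_mono (ip (n + 1) hn.le) hτT m2).sub
        (intervalIntegrable_mono (ip n (by omega)) hτT m2)
      have s2 := intervalIntegral.integral_add_adjacent_intervals i i'
      have s3 := hlow' n (by omega) _ _ m1.1 hτ.1 hτT.2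
      have s4 := hlow n (by omega) _ _ hτT.1 hτ.2 m2.2
      rw [← s2] at s1
      rw [e1, e2, Finset.sum_range_succ]
      linarith
  have hsum : ∀ n ≤ NT, ∑ k ∈ Finset.range n, R (k + 1) ≤ ∑ k ∈ Finset.range NT, R (k + 1) :=
    fun n hn => Finset.sum_le_sum_of_subset_of_nonneg (by simpa using hn) fun k _ _ => hR _
  have hNTpos : 0 < NT := by
    rcases Nat.eq_zero_or_pos NT with h | h
    · simp [h] at hNT; linarith
    · exact h
  -- the bound on a closed time step
  have hmain : ∀ n < NT, ∀ τ ∈ Set.Icc (n * dt) ((n + 1) * dt),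
      (∫ t in (0 : ℝ)..τ, q ⌊t / dt⌋₊ t) + (∫ t in (0 : ℝ)..τ, H ⌊t / dt⌋₊ t)
        - dt * ((3 + T) * M + 2 * C0 + ∑ k ∈ Finset.range n, R (k + 1)) ≤ p n τ - p 0 0 := by
    intro n hn τ hτ
    have m0 := hmem n hn.le
    have m1 := hmem (n + 1) hn
    push_cast at m1
    have hτT : τ ∈ Set.Icc 0 T := ⟨m0.1.trans hτ.1, hτ.2.trans m1.2⟩
    have c := hclaim n hn τ hτ
    have b0 := havg 0 hNTpos 0 (by simp [hdt.le])
    have b1 := havg n hn τ hτ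
    have b2 : (∫ t in (0 : ℝ)..τ, q ⌊t / dt⌋₊ t)
        = (∫ t in (0 : ℝ)..(n * dt), q ⌊t / dt⌋₊ t) + (p n τ - p n (n * dt)) := by
      rw [(hp n hn.le).sub_eq _ m0 _ hτT, ← integral_floor_eq hdt q (k := n) le_rfl hτ.1 hτ.2,
        intervalIntegral.integral_add_adjacent_intervals
          (intervalIntegrable_mono iq ⟨le_rfl, hT.le⟩ m0) (intervalIntegrable_mono iq m0 hτT)]
    have b3 := (hp n hn.le).lipschitz m0.1 hτ.1 hτT.2
    have b4 : M * (τ - n * dt) ≤ M * dt := by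
      gcongr; linarith [hτ.2]
    have b5 : n * (M * dt ^ 2) ≤ T * (M * dt) := by
      calc n * (M * dt ^ 2) = n * dt * (M * dt) := by ring
        _ ≤ T * (M * dt) := by gcongr; exact m0.2
    have b6 : C0 * (dt + ((n + 1) * dt - τ)) ≤ C0 * (2 * dt) := by
      gcongr; linarith [hτ.1]
    rw [b2]
    linarith [(abs_le.1 b0).1, (abs_le.1 b1).2, (abs_le.1 b3).2]
  have hfl : (⌊τ / dt⌋₊ : ℝ) * dt ≤ τ := by
    rw [← le_div_iff₀ hdt]; exact Nat.floor_le (div_nonneg hτ.1 hdt.le)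
  have hfl' : τ < (⌊τ / dt⌋₊ + 1) * dt := by
    rw [← div_lt_iff₀ hdt]; exact Nat.lt_floor_add_one _
  have hle : ⌊τ / dt⌋₊ ≤ NT := by
    have : (⌊τ / dt⌋₊ : ℝ) * dt ≤ NT * dt := by rw [hNT]; exact hfl.trans hτ.2
    exact_mod_cast le_of_mul_le_mul_right this hdt
  have hMdt : 0 ≤ M * dt := by positivity
  have hC0dt : 0 ≤ C0 * dt := by positivity
  rcases hle.lt_or_eq with hlt | heq
  · have h1 := hmain _ hlt τ ⟨hfl, hfl'.le⟩
    have h2 := mul_le_mul_of_nonneg_left (hsum _ hle) hdt.le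
    linarith
  -- The floor reaches `NT` only for τ = T, a level with no slab of its own. The preceding slab is
  -- taken up to its end, and one crude increment leads from level NT - 1 to level NT at the cost
  -- O(dt).
  · obtain ⟨m, rfl⟩ : ∃ m, NT = m + 1 := ⟨NT - 1, by omega⟩
    have hτe : τ = T := le_antisymm hτ.2 (by rw [← hNT, ← heq]; exact hfl)
    have m0 := hmem m (by omega)
    have hT' : ((m : ℝ) + 1) * dt = T := by exact_mod_cast hNT
    have h1 := hmain m (by omega) τ ⟨by rw [hτe, ← hT']; linarith, by rw [hτe, hT']⟩
    rw [heq]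
    have h2 := hlow m (by omega) (m * dt) T m0.1 m0.2 le_rfl
    have mT : T ∈ Set.Icc 0 T := ⟨hT.le, le_rfl⟩
    have h3 : (1 / dt) * ∫ u in (m * dt)..T, (p (m + 1) u - p m u)
        ≤ p (m + 1) T - p m T + 2 * (M * dt) := by
      have := intervalIntegral.integral_mono_on (a := (m : ℝ) * dt) (b := T)
        (f := fun u => p (m + 1) u - p m u)
        (g := fun _ => p (m + 1) T - p m T + 2 * (M * dt)) m0.2
        ((intervalIntegrable_mono (ip (m + 1) le_rfl) m0 mT).sub
          (intervalIntegrable_mono (ip m (by omega)) m0 mT)) intervalIntegrable_const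
        (fun u hu => by
          have c1 := (hp (m + 1) le_rfl).lipschitz (m0.1.trans hu.1) hu.2 le_rfl
          have c2 := (hp m (by omega)).lipschitz (m0.1.trans hu.1) hu.2 le_rfl
          have c3 : M * (T - u) ≤ M * dt := by gcongr; linarith [hu.1]
          linarith [(abs_le.1 c1).1, (abs_le.1 c2).2])
      rw [intervalIntegral.integral_const, smul_eq_mul,
        show T - (m : ℝ) * dt = dt by linarith] at this
      rw [one_div, ← div_eq_inv_mul, div_le_iff₀ hdt]
      linarith
    rw [show T - (m : ℝ) * dt = dt by linarith] at h2
    rw [Finset.sum_range_succ, hτe]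
    rw [hτe] at h1
    linarith

end Telescope

/-! ## A priori bounds -/

section Apriori

variable {d N : ℕ} [NeZero N] {mu lam kappa gamma eps dt r1 r2 t1 t2 : ℝ} {r0 r : QFun d N}
  {u0 u : Fin d → QFun d N} {th0 th : QFun d N}

/-- The discrete total energy. -/
def totalEnergy (gamma : ℝ) (r : QFun d N) (u : Fin d → QFun d N) (th : QFun d N) : ℝ :=
  cellInt (fun K => r K * (1 / 2 * ∑ j, u j K ^ 2)) + 1 / (gamma - 1) * cellInt (fun K => r K * th K)

/-- The discrete total entropy. -/
def totalEntropy (gamma : ℝ) (r th : QFun d N) : ℝ :=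
  cellInt (fun K => r K * discEntropy gamma r th K)

lemma InRange.pos (h : InRange r1 r2 t1 t2 r th) (hr1 : 0 < r1) (ht1 : 0 < t1) :
    0 < r2 ∧ 0 < t2 :=
  ⟨hr1.trans_le ((h.rho_ge 0).trans (h.rho_le 0)), ht1.trans_le ((h.temp_ge 0).trans (h.temp_le 0))⟩

/-- The entropy inequality with test function 1: fluxes and production remainders vanish with the
jumps of the test function, and the upper temperature bound frees the dissipations of their weights.
-/
lemma SchemeStep.entropy_dissipation (hs : SchemeStep mu lam kappa gamma eps dt r0 r u0 u th0 th)
    (hdt : 0 < dt) (hmu : 0 < mu) (hlam : 0 ≤ lam) (hkappa : 0 < kappa) (hg : 1 < gamma)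
    (hr1 : 0 < r1) (ht1 : 0 < t1) (h0 : InRange r1 r2 t1 t2 r0 th0) (h : InRange r1 r2 t1 t2 r th) :
    dt * (kappa / t2 ^ 2 * (∑ i, cellInt (fun K => (1 / meshSize N * jump th i K) ^ 2))
      + 2 * mu / t2 * cellInt (fun K => ∑ i, ∑ j, discSymGrad u i j K ^ 2))
    ≤ totalEntropy gamma r th - totalEntropy gamma r0 th0 := by
  obtain ⟨hr2, ht2⟩ := h.pos hr1 ht1
  have hh := meshSize_pos (N := N)
  have hth : ∀ K, 0 < th K := fun K => ht1.trans_le (h.temp_ge K)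
  have e := hs.entropy_ineq hdt hg (fun K => hr1.trans_le (h.rho_ge K))
    (fun K => hr1.trans_le (h0.rho_ge K)) hth (fun K => ht1.trans_le (h0.temp_ge K))
    (Φ := fun _ => 1) (fun _ => zero_le_one)
  have hj : ∀ i (K : Cell d N), jump (fun _ : Cell d N => (1 : ℝ)) i K = 0 := fun i K => by
    simp [jump]
  have ha : ∀ i (K : Cell d N), avg (fun _ : Cell d N => (1 : ℝ)) i K = 1 := fun i K => by
    simp [avg]
  have hz : cellInt (fun _ : Cell d N => (0 : ℝ)) = 0 := cellInt_const 0
  simp only [hj, ha, abs_zero, mul_zero, one_mul, mul_one, hz, Finset.sum_const_zero, sub_zero,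
    zero_add] at e
  have w1 : kappa / t2 ^ 2 * (∑ i, cellInt (fun K => (1 / meshSize N * jump th i K) ^ 2))
      ≤ 1 / meshSize N * ∑ i, cellInt (fun K => kappa / meshSize N
        * (jump th i K ^ 2 / (th (next i K) * th K))) := by
    rw [Finset.mul_sum, Finset.mul_sum]
    refine Finset.sum_le_sum fun i _ => ?_
    rw [← cellInt_const_mul, ← cellInt_const_mul]
    refine cellInt_mono fun K => ?_
    have h1 := hth K
    have h2 := hth (next i K)
    have h3 : jump th i K ^ 2 / t2 ^ 2 ≤ jump th i K ^ 2 / (th (next i K) * th K) := by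
      have := mul_le_mul (h.temp_le (next i K)) (h.temp_le K) h1.le ht2.le
      rw [← sq] at this
      gcongr
    calc kappa / t2 ^ 2 * (1 / meshSize N * jump th i K) ^ 2
        = 1 / meshSize N * (kappa / meshSize N) * (jump th i K ^ 2 / t2 ^ 2) := by ring
      _ ≤ 1 / meshSize N * (kappa / meshSize N) * (jump th i K ^ 2 / (th (next i K) * th K)) := by
        gcongr
      _ = _ := by ring
  have w2 : 2 * mu / t2 * cellInt (fun K => ∑ i, ∑ j, discSymGrad u i j K ^ 2)
      ≤ cellInt (fun K => stressPower mu lam u K * (1 / th K)) := by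
    rw [← cellInt_const_mul]
    refine cellInt_mono fun K => ?_
    have hX : 0 ≤ ∑ i, ∑ j, discSymGrad u i j K ^ 2 :=
      Finset.sum_nonneg fun i _ => Finset.sum_nonneg fun j _ => sq_nonneg _
    have h1 : 2 * mu * (∑ i, ∑ j, discSymGrad u i j K ^ 2) ≤ stressPower mu lam u K := by
      rw [stressPower_eq]
      have := mul_nonneg hlam (sq_nonneg (discDiv u K))
      linarith
    have h2 : 1 / t2 ≤ 1 / th K := one_div_le_one_div_of_le (hth K) (h.temp_le K)
    calc _ = 2 * mu * (∑ i, ∑ j, discSymGrad u i j K ^ 2) * (1 / t2) := by ring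
      _ ≤ _ := mul_le_mul h1 h2 (by positivity) (stressPower_nonneg hmu hlam u K)
  have w3 : dt * cellInt (fun K =>
      (r K * discEntropy gamma r th K - r0 K * discEntropy gamma r0 th0 K) / dt)
      = totalEntropy gamma r th - totalEntropy gamma r0 th0 := by
    rw [totalEntropy, totalEntropy, ← cellInt_sub, ← cellInt_const_mul]
    congr 1; funext K; field_simp
  rw [← w3]
  gcongr
  linarith

lemma two_mul_abs_discDiv_le (u : Fin d → QFun d N) (K : Cell d N) :
    2 * |discDiv u K| ≤ d + ∑ i, ∑ j, discSymGrad u i j K ^ 2 := by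
  rw [discDiv_eq_sum_symGrad]
  have h1 := Finset.abs_sum_le_sum_abs (fun k => discSymGrad u k k K) Finset.univ
  have h2 : ∑ k, 2 * |discSymGrad u k k K| ≤ ∑ k : Fin d, (1 + ∑ j, discSymGrad u k j K ^ 2) := by
    refine Finset.sum_le_sum fun k _ => ?_
    have h3 : discSymGrad u k k K ^ 2 ≤ ∑ j, discSymGrad u k j K ^ 2 :=
      Finset.single_le_sum (f := fun j => discSymGrad u k j K ^ 2) (fun j _ => sq_nonneg _)
        (Finset.mem_univ k)
    have h4 := sq_nonneg (|discSymGrad u k k K| - 1)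
    rw [sub_sq, sq_abs] at h4
    linarith
  rw [← Finset.mul_sum, Finset.sum_add_distrib] at h2
  simp only [Finset.sum_const, Finset.card_univ, Fintype.card_fin, nsmul_eq_mul, mul_one] at h2
  linarith

/-- The part of the level size not bounded by the current energy is paid for by decrements of energy
and of ∫ϱ²/2 and by the increment of entropy, all of which telescope. The divergence term of the
density balance is absorbed by the symmetric gradient. -/
lemma SchemeStep.level_step (hs : SchemeStep mu lam kappa gamma eps dt r0 r u0 u th0 th)
    (hdt : 0 < dt) (hmu : 0 < mu) (hlam : 0 ≤ lam) (hkappa : 0 < kappa) (hg : 1 < gamma)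
    (hr1 : 0 < r1) (ht1 : 0 < t1) (h0 : InRange r1 r2 t1 t2 r0 th0) (h : InRange r1 r2 t1 t2 r th) :
    totalEnergy gamma r u th ≤ totalEnergy gamma r0 u0 th0 ∧
    dt * levelSize eps r u th ≤ dt * (1 + 2 / r1 * totalEnergy gamma r u th + r2 ^ 2 / 4 * d)
      + 1 / r1 * (totalEnergy gamma r0 u0 th0 - totalEnergy gamma r u th)
      + (1 / 2 * cellInt (fun K => r0 K ^ 2) - 1 / 2 * cellInt (fun K => r K ^ 2))
      + (t2 ^ 2 / kappa + t2 * (1 + r2 ^ 2 / 4) / (2 * mu))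
        * (totalEntropy gamma r th - totalEntropy gamma r0 th0) := by
  obtain ⟨hr2, ht2⟩ := h.pos hr1 ht1
  have hh := meshSize_pos (N := N)
  have hc : 0 < 1 / (gamma - 1) := by have := sub_pos.2 hg; positivity
  obtain ⟨nV, nX, nY, nZ, nW⟩ := levelSize_parts eps r u th
  have a1 := hs.entropy_dissipation hdt hmu hlam hkappa hg hr1 ht1 h0 h
  have a2 := hs.density hdt
  have a3 : totalEnergy gamma r u th + dt * (meshSize N ^ eps * r1
      * (1 / meshSize N * ∑ i, cellInt (fun K => ∑ j, jump (u j) i K ^ 2)))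
      ≤ totalEnergy gamma r0 u0 th0 := by
    have := hs.total_energy hdt hr1 h.rho_ge fun K => hr1.le.trans (h0.rho_ge K)
    unfold totalEnergy
    exact this
  have a4 : r1 / 2 * cellInt (fun K => ∑ j, u j K ^ 2) ≤ totalEnergy gamma r u th := by
    have n1 : 0 ≤ cellInt (fun K => r K * th K) := cellInt_nonneg fun K =>
      mul_nonneg (hr1.le.trans (h.rho_ge K)) (ht1.le.trans (h.temp_ge K))
    have n2 : r1 / 2 * cellInt (fun K => ∑ j, u j K ^ 2)
        ≤ cellInt (fun K => r K * (1 / 2 * ∑ j, u j K ^ 2)) := by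
      rw [← cellInt_const_mul]
      refine cellInt_mono fun K => ?_
      have : 0 ≤ ∑ j, u j K ^ 2 := Finset.sum_nonneg fun j _ => sq_nonneg _
      have := mul_le_mul_of_nonneg_right (h.rho_ge K) this
      linarith
    unfold totalEnergy
    have := mul_nonneg hc.le n1
    linarith
  have a5 : -(cellInt (fun K => r K ^ 2 * discDiv u K))
      ≤ r2 ^ 2 / 2 * (d + cellInt (fun K => ∑ i, ∑ j, discSymGrad u i j K ^ 2)) := by
    rw [← cellInt_const (N := N) (d := d) (d : ℝ), ← cellInt_add, ← cellInt_neg,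
      ← cellInt_const_mul]
    refine cellInt_mono fun K => ?_
    have b1 := two_mul_abs_discDiv_le u K
    have b2 : r K ^ 2 ≤ r2 ^ 2 :=
      pow_le_pow_left₀ (hr1.le.trans (h.rho_ge K)) (h.rho_le K) 2
    calc -(r K ^ 2 * discDiv u K) = r K ^ 2 * (-discDiv u K) := by ring
      _ ≤ r K ^ 2 * |discDiv u K| := mul_le_mul_of_nonneg_left (neg_le_abs _) (sq_nonneg _)
      _ ≤ r2 ^ 2 * |discDiv u K| := by gcongr
      _ ≤ r2 ^ 2 / 2 * (d + ∑ i, ∑ j, discSymGrad u i j K ^ 2) := by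
          have := mul_le_mul_of_nonneg_left b1 (sq_nonneg r2)
          linarith
  unfold levelSize
  generalize cellInt (fun K => ∑ j, u j K ^ 2) = V at *
  generalize cellInt (fun K => ∑ i, ∑ j, discSymGrad u i j K ^ 2) = X at *
  generalize 1 / meshSize N * ∑ i, cellInt (fun K => ∑ j, jump (u j) i K ^ 2) = y at *
  generalize 1 / meshSize N * ∑ i, cellInt (fun K =>
    (1 / 2 * |avg (u i) i K| + meshSize N ^ eps) * jump r i K ^ 2) = Z at *
  generalize ∑ i, cellInt (fun K => (1 / meshSize N * jump th i K) ^ 2) = W at *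
  have nY' : 0 ≤ dt * (meshSize N ^ eps * r1 * y) := by
    have : meshSize N ^ eps * r1 * y = r1 * (meshSize N ^ eps * y) := by ring
    rw [this]; positivity
  refine ⟨by linarith, ?_⟩
  have b1 : V ≤ 2 / r1 * totalEnergy gamma r u th := by
    rw [div_mul_eq_mul_div, le_div_iff₀ hr1]; linarith
  have b2 : dt * (meshSize N ^ eps * y)
      ≤ 1 / r1 * (totalEnergy gamma r0 u0 th0 - totalEnergy gamma r u th) := by
    rw [div_mul_eq_mul_div, le_div_iff₀ hr1]; linarith
  have b3 : dt * Z ≤ (1 / 2 * cellInt (fun K => r0 K ^ 2) - 1 / 2 * cellInt (fun K => r K ^ 2))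
      + dt * (r2 ^ 2 / 4 * (d + X)) := by
    have := mul_le_mul_of_nonneg_left a5 hdt.le
    linarith
  -- The first summand of the coefficient normalises the temperature dissipation and the second the
  -- viscous one. The extra r2²/4 pays for the divergence in the density balance.
  have b4 : dt * (W + (1 + r2 ^ 2 / 4) * X) ≤ (t2 ^ 2 / kappa + t2 * (1 + r2 ^ 2 / 4) / (2 * mu))
        * (totalEntropy gamma r th - totalEntropy gamma r0 th0) := by
    refine le_trans ?_ (mul_le_mul_of_nonneg_left a1 (by positivity))
    have e : (t2 ^ 2 / kappa + t2 * (1 + r2 ^ 2 / 4) / (2 * mu))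
          * (dt * (kappa / t2 ^ 2 * W + 2 * mu / t2 * X))
        = dt * (W + (1 + r2 ^ 2 / 4) * X)
          + dt * (t2 ^ 2 / kappa * (2 * mu / t2) * X)
          + dt * (t2 * (1 + r2 ^ 2 / 4) / (2 * mu) * (kappa / t2 ^ 2) * W) := by
      field_simp; ring
    rw [e]
    have p1 : 0 ≤ dt * (t2 ^ 2 / kappa * (2 * mu / t2) * X) := by positivity
    have p2 : 0 ≤ dt * (t2 * (1 + r2 ^ 2 / 4) / (2 * mu) * (kappa / t2 ^ 2) * W) := by positivity
    linarith
  have b1' := mul_le_mul_of_nonneg_left b1 hdt.le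
  linarith

/-- Bounds for the solutions in terms of the initial velocity. -/
lemma exists_level_bound (d : ℕ) {mu lam kappa gamma eps r1 r2 t1 t2 T V0 : ℝ}
    (hmu : 0 < mu) (hlam : 0 ≤ lam) (hkappa : 0 < kappa) (hg : 1 < gamma)
    (hr1 : 0 < r1) (ht1 : 0 < t1) (hV0 : 0 ≤ V0) (hT : 0 < T) :
    ∃ C : ℝ, 0 ≤ C ∧ ∀ {N : ℕ} [NeZero N] {NT : ℕ} {dt : ℝ} {r : ℕ → QFun d N}
      {u : ℕ → Fin d → QFun d N} {th : ℕ → QFun d N}, 0 < dt → NT * dt = T →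
      (∀ k < NT, SchemeStep mu lam kappa gamma eps dt (r k) (r (k + 1)) (u k) (u (k + 1))
        (th k) (th (k + 1))) →
      (∀ k ≤ NT, InRange r1 r2 t1 t2 (r k) (th k)) →
      cellInt (fun K => ∑ j, u 0 j K ^ 2) ≤ V0 →
      (∀ k ≤ NT, cellInt (fun K => ∑ j, u k j K ^ 2) ≤ C) ∧
      dt * ∑ k ∈ Finset.range NT, levelSize eps (r (k + 1)) (u (k + 1)) (th (k + 1)) ≤ C := by
  obtain ⟨Ce, hCe, hCeb⟩ := exists_entropy_bound (r2 := r2) (t2 := t2) hg hr1 ht1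
  have hc : 0 < 1 / (gamma - 1) := by have := sub_pos.2 hg; positivity
  set e0 := |r2| / 2 * V0 + 1 / (gamma - 1) * (|r2| * |t2|) with he0
  set A := t2 ^ 2 / kappa + |t2| * (1 + r2 ^ 2 / 4) / (2 * mu) with hA
  set B := 1 + 2 / r1 * e0 + r2 ^ 2 / 4 * d with hB
  have he0n : 0 ≤ e0 := by positivity
  have hAn : 0 ≤ A := by positivity
  have hBn : 0 ≤ B := by positivity
  refine ⟨2 / r1 * e0 + (T * B + 1 / r1 * e0 + r2 ^ 2 + A * (2 * (|r2| * Ce))), by positivity, ?_⟩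
  intro N _ NT dt r u th hdt hNT hs hR hV
  obtain ⟨hr2, ht2⟩ := (hR 0 (Nat.zero_le _)).pos hr1 ht1
  rw [abs_of_pos hr2] at *
  rw [abs_of_pos ht2] at *
  have hE : ∀ k ≤ NT, |totalEntropy gamma (r k) (th k)| ≤ r2 * Ce := by
    intro k hk
    have := abs_cellInt_le_of_le (f := fun K => r k K * discEntropy gamma (r k) (th k) K)
      (g := fun _ => r2 * Ce) (fun K => by
        rw [abs_mul, abs_of_pos (hr1.trans_le ((hR k hk).rho_ge K))]
        exact mul_le_mul ((hR k hk).rho_le K) ((hCeb (hR k hk)).1 K) (abs_nonneg _) hr2.le)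
    rwa [cellInt_const] at this
  have hD : ∀ k ≤ NT, 0 ≤ cellInt (fun K => r k K ^ 2) ∧ cellInt (fun K => r k K ^ 2) ≤ r2 ^ 2 := by
    intro k hk
    refine ⟨cellInt_nonneg fun K => sq_nonneg _, ?_⟩
    rw [← cellInt_const (N := N) (d := d) (r2 ^ 2)]
    exact cellInt_mono fun K =>
      pow_le_pow_left₀ (hr1.le.trans ((hR k hk).rho_ge K)) ((hR k hk).rho_le K) 2
  have hpos : ∀ k ≤ NT, r1 / 2 * cellInt (fun K => ∑ j, u k j K ^ 2)
      ≤ totalEnergy gamma (r k) (u k) (th k) := by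
    intro k hk
    have n1 : 0 ≤ cellInt (fun K => r k K * th k K) := cellInt_nonneg fun K =>
      mul_nonneg (hr1.le.trans ((hR k hk).rho_ge K)) (ht1.le.trans ((hR k hk).temp_ge K))
    have n2 : r1 / 2 * cellInt (fun K => ∑ j, u k j K ^ 2)
        ≤ cellInt (fun K => r k K * (1 / 2 * ∑ j, u k j K ^ 2)) := by
      rw [← cellInt_const_mul]
      refine cellInt_mono fun K => ?_
      have : 0 ≤ ∑ j, u k j K ^ 2 := Finset.sum_nonneg fun j _ => sq_nonneg _
      have := mul_le_mul_of_nonneg_right ((hR k hk).rho_ge K) this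
      linarith
    unfold totalEnergy
    have := mul_nonneg hc.le n1
    linarith
  have hinit : totalEnergy gamma (r 0) (u 0) (th 0) ≤ e0 := by
    have hR0 := hR 0 (Nat.zero_le _)
    have n1 : cellInt (fun K => r 0 K * th 0 K) ≤ r2 * t2 := by
      rw [← cellInt_const (N := N) (d := d) (r2 * t2)]
      exact cellInt_mono fun K => mul_le_mul (hR0.rho_le K) (hR0.temp_le K)
        (ht1.le.trans (hR0.temp_ge K)) hr2.le
    have n2 : cellInt (fun K => r 0 K * (1 / 2 * ∑ j, u 0 j K ^ 2))
        ≤ r2 / 2 * cellInt (fun K => ∑ j, u 0 j K ^ 2) := by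
      rw [← cellInt_const_mul]
      refine cellInt_mono fun K => ?_
      have : 0 ≤ ∑ j, u 0 j K ^ 2 := Finset.sum_nonneg fun j _ => sq_nonneg _
      have := mul_le_mul_of_nonneg_right (hR0.rho_le K) this
      linarith
    have n3 : r2 / 2 * cellInt (fun K => ∑ j, u 0 j K ^ 2) ≤ r2 / 2 * V0 := by gcongr
    have n4 := mul_le_mul_of_nonneg_left n1 hc.le
    unfold totalEnergy
    linarith
  -- The budgets are kept in telescoped form. At the end energy and ∫ϱ² are used through their
  -- signs, and the total entropy through its two-sided bound on the admissible states.
  have hind : ∀ n ≤ NT, totalEnergy gamma (r n) (u n) (th n) ≤ e0 ∧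
      dt * ∑ k ∈ Finset.range n, levelSize eps (r (k + 1)) (u (k + 1)) (th (k + 1))
        ≤ n * dt * B + 1 / r1 * (e0 - totalEnergy gamma (r n) (u n) (th n))
          + (1 / 2 * cellInt (fun K => r 0 K ^ 2) - 1 / 2 * cellInt (fun K => r n K ^ 2))
          + A * (totalEntropy gamma (r n) (th n) - totalEntropy gamma (r 0) (th 0)) := by
    intro n
    induction n with
    | zero =>
      intro _
      refine ⟨hinit, ?_⟩
      have : 0 ≤ 1 / r1 * (e0 - totalEnergy gamma (r 0) (u 0) (th 0)) :=
        mul_nonneg (by positivity) (sub_nonneg.2 hinit)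
      simp only [Finset.range_zero, Finset.sum_empty, Nat.cast_zero]
      linarith
    | succ n ih =>
      intro hn
      obtain ⟨i1, i2⟩ := ih (by omega)
      obtain ⟨s1, s2⟩ := (hs n hn).level_step hdt hmu hlam hkappa hg hr1 ht1 (hR n (by omega))
        (hR (n + 1) hn)
      rw [← hA] at s2
      refine ⟨s1.trans i1, ?_⟩
      have s3 : dt * (1 + 2 / r1 * totalEnergy gamma (r (n + 1)) (u (n + 1)) (th (n + 1))
          + r2 ^ 2 / 4 * d) ≤ dt * B := by
        rw [hB]
        gcongr
        exact s1.trans i1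
      rw [Finset.sum_range_succ, mul_add]
      push_cast
      linarith
  have hx1 : 0 ≤ T * B := by positivity
  have hx2 : 0 ≤ 1 / r1 * e0 := by positivity
  have hx3 : 0 ≤ A * (2 * (r2 * Ce)) := by positivity
  have hx4 : 0 ≤ 2 / r1 * e0 := by positivity
  refine ⟨fun k hk => ?_, ?_⟩
  · have h1 := (hpos k hk).trans (hind k hk).1
    have h2 : cellInt (fun K => ∑ j, u k j K ^ 2) ≤ 2 / r1 * e0 := by
      rw [div_mul_eq_mul_div, le_div_iff₀ hr1]; linarith
    have := sq_nonneg r2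
    linarith
  · have h1 := (hind NT le_rfl).2
    rw [hNT] at h1
    have h2 : 0 ≤ totalEnergy gamma (r NT) (u NT) (th NT) := by
      refine le_trans ?_ (hpos NT le_rfl)
      have : 0 ≤ cellInt (fun K => ∑ j, u NT j K ^ 2) := cellInt_nonneg fun K =>
        Finset.sum_nonneg fun j _ => sq_nonneg _
      positivity
    have h3 : 1 / r1 * (e0 - totalEnergy gamma (r NT) (u NT) (th NT)) ≤ 1 / r1 * e0 := by
      gcongr; linarith
    have h4 : A * (totalEntropy gamma (r NT) (th NT) - totalEntropy gamma (r 0) (th 0))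
        ≤ A * (2 * (r2 * Ce)) := by
      gcongr
      linarith [(abs_le.1 (hE NT le_rfl)).2, (abs_le.1 (hE 0 (Nat.zero_le _))).1]
    have h5 := (hD 0 (Nat.zero_le _)).2
    have h6 := (hD NT le_rfl).1
    have := sq_nonneg r2
    linarith

/-- The quantities of the initial level. -/
lemma exists_initial_bound {d : ℕ} {u0 : Fin d → Pt d → ℝ} {theta0 : Pt d → ℝ}
    (hu0 : ∀ j, MemW12 (u0 j)) (htheta0 : MemW12 theta0) :
    ∃ C : ℝ, 0 ≤ C ∧ ∀ (N : ℕ) [NeZero N],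
      cellInt (fun K : Cell d N => ∑ j, projQ N (u0 j) K ^ 2) ≤ C ∧
      cellInt (fun K : Cell d N => ∑ i, ∑ j, discSymGrad (fun l => projQ N (u0 l)) i j K ^ 2) ≤ C ∧
      ∑ i, cellInt (fun K : Cell d N => (1 / meshSize N * jump (projQ N theta0) i K) ^ 2) ≤ C := by
  choose g hg hg' using fun j => (hu0 j).2
  choose gt hgt hgt' using htheta0.2
  have hI : ∀ f : Pt d → ℝ, 0 ≤ torusInt (fun x => f x ^ 2) := fun f =>
    integral_nonneg fun x => sq_nonneg _
  set C1 := ∑ j, torusInt (fun x => u0 j x ^ 2) with hC1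
  set C2 := ∑ i, ∑ j, 2 * (torusInt (fun x => g i j x ^ 2) + torusInt (fun x => g j i x ^ 2))
    with hC2
  set C3 := ∑ i, 4 * torusInt (fun x => gt i x ^ 2) with hC3
  have n1 : 0 ≤ C1 := Finset.sum_nonneg fun j _ => hI _
  have n2 : 0 ≤ C2 := Finset.sum_nonneg fun i _ => Finset.sum_nonneg fun j _ => by
    have := hI (g i j); have := hI (g j i); positivity
  have n3 : 0 ≤ C3 := Finset.sum_nonneg fun i _ => by have := hI (gt i); positivity
  refine ⟨C1 + C2 + C3, by positivity, fun N _ => ?_⟩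
  have hh := meshSize_pos (N := N)
  have hj : ∀ {f k : Pt d → ℝ} {i : Fin d}, HasWeakPartial i f k → MemLp f 2 (torusMeasure d) →
      MemLp k 2 (torusMeasure d) →
      cellInt (fun K : Cell d N => (1 / meshSize N * jump (projQ N f) i K) ^ 2)
        ≤ 4 * torusInt (fun x => k x ^ 2) := by
    intro f k i h1 h2 h3
    have := cellInt_jump_projQ_sq_le (N := N) h1 h2 h3
    simp only [mul_pow]
    rw [cellInt_const_mul]
    calc _ ≤ (1 / meshSize N) ^ 2 * (4 * meshSize N ^ 2 * torusInt fun x => k x ^ 2) := by gcongr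
      _ = _ := by field_simp
  have hgrad : ∀ i j, cellInt (fun K : Cell d N => discGrad (projQ N (u0 i)) j K ^ 2)
      ≤ 4 * torusInt (fun x => g i j x ^ 2) := by
    intro i j
    refine le_trans ?_ (hj (hg' i j) (hu0 i).1 (hg i j))
    set F : QFun d N := fun K => (1 / meshSize N * jump (projQ N (u0 i)) j K) ^ 2 with hF
    -- The central difference is the mean of the two one-sided differences, so by convexity its
    -- square is at most the mean of theirs; the shift makes both integrals equal.
    have e : cellInt F = cellInt (fun K => 1 / 2 * (F K + F (prev j K))) := by
      rw [cellInt_const_mul, cellInt_add, cellInt_prev]; ring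
    rw [e]
    refine cellInt_mono fun K => ?_
    rw [discGrad_eq_jump]
    set a := jump (projQ N (u0 i)) j K
    set b := jump (projQ N (u0 i)) j (prev j K)
    have e1 : ((a + b) / (2 * meshSize N)) ^ 2
        = (1 / meshSize N * a) ^ 2 / 2 + (1 / meshSize N * b) ^ 2 / 2
          - (1 / meshSize N * (a - b) / 2) ^ 2 := by
      field_simp; ring
    rw [e1]
    have := sq_nonneg (1 / meshSize N * (a - b) / 2)
    simp only [hF]
    linarith
  refine ⟨?_, ?_, ?_⟩
  · rw [cellInt_sum]
    have : ∑ j, cellInt (fun K : Cell d N => projQ N (u0 j) K ^ 2) ≤ C1 :=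
      Finset.sum_le_sum fun j _ => cellInt_projQ_sq_le (hu0 j).1
    linarith
  · have : cellInt (fun K : Cell d N => ∑ i, ∑ j, discSymGrad (fun l => projQ N (u0 l)) i j K ^ 2)
        ≤ C2 := by
      rw [cellInt_sum]
      refine Finset.sum_le_sum fun i _ => ?_
      rw [cellInt_sum]
      refine Finset.sum_le_sum fun j _ => ?_
      have h1 := hgrad i j
      have h2 := hgrad j i
      have h3 : cellInt (fun K : Cell d N => discSymGrad (fun l => projQ N (u0 l)) i j K ^ 2)
          ≤ cellInt (fun K => 1 / 2 * (discGrad (projQ N (u0 i)) j K ^ 2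
            + discGrad (projQ N (u0 j)) i K ^ 2)) := by
        refine cellInt_mono fun K => ?_
        simp only [discSymGrad]
        nlinarith [sq_nonneg (discGrad (projQ N (u0 i)) j K - discGrad (projQ N (u0 j)) i K)]
      rw [cellInt_const_mul, cellInt_add] at h3
      linarith
    linarith
  · have : ∑ i, cellInt (fun K : Cell d N => (1 / meshSize N * jump (projQ N theta0) i K) ^ 2)
        ≤ C3 := Finset.sum_le_sum fun i _ => hj (hgt' i) htheta0.1 (hgt i)
    linarith

/-- A bound of the limit form of the entropy balance. -/
lemma exists_entropyForm_bound (d : ℕ) {mu lam kappa gamma r1 r2 t1 t2 M : ℝ} (hM : 0 ≤ M)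
    (hmu : 0 < mu) (hlam : 0 ≤ lam) (hkappa : 0 < kappa) (hg : 1 < gamma)
    (hr1 : 0 < r1) (ht1 : 0 < t1) :
    ∃ C : ℝ, 0 ≤ C ∧ ∀ {N : ℕ} [NeZero N] {r : QFun d N} {u : Fin d → QFun d N} {th : QFun d N},
      InRange r1 r2 t1 t2 r th →
      ∀ {a : QFun d N} {g U L U' L' : Fin d → QFun d N}, DiscTest M a g →
      (∀ i, HalfSplit (M * meshSize N) a (U i) (L i)) →
      (∀ i, HalfSplit (M * meshSize N) (g i) (U' i) (L' i)) →
      entropyForm mu lam kappa gamma r u th a g U L U' L'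
        ≤ C * (1 + cellInt (fun K => ∑ j, u j K ^ 2)
          + cellInt (fun K => ∑ i, ∑ j, discSymGrad u i j K ^ 2)
          + ∑ i, cellInt (fun K => (1 / meshSize N * jump th i K) ^ 2)) := by
  obtain ⟨Ce, hCe, hCeb⟩ := exists_entropy_bound (r2 := r2) (t2 := t2) hg hr1 ht1
  set b := |r2| * Ce with hb
  set E1 := d * (b * M) with hE1
  set E2 := (2 * mu + lam * (d + 1)) * (M / t1) with hE2
  set E3 := kappa * (2 * (M / t1 ^ 2)) with hE3
  set E4 := kappa * (M / t1 * (d + 1)) with hE4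
  have p1 : 0 ≤ E1 := by positivity
  have p2 : 0 ≤ E2 := by positivity
  have p3 : 0 ≤ E3 := by positivity
  have p4 : 0 ≤ E4 := by positivity
  refine ⟨E1 + E2 + E3 + E4, by positivity, ?_⟩
  intro N _ r u th hR a g U L U' L' ht hUL hUL'
  obtain ⟨hr2, ht2⟩ := hR.pos hr1 ht1
  have hh := meshSize_pos (N := N)
  have hh1 := meshSize_le_one (N := N)
  have hth : ∀ K, 0 < th K := fun K => ht1.trans_le (hR.temp_ge K)
  set V := cellInt (fun K => ∑ j, u j K ^ 2) with hV
  set X := cellInt (fun K => ∑ i, ∑ j, discSymGrad u i j K ^ 2) with hX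
  set W := ∑ i, cellInt (fun K => (1 / meshSize N * jump th i K) ^ 2) with hW
  obtain ⟨nV, nX, -, -, nW⟩ := levelSize_parts 0 r u th
  -- A half weight is half the sum plus or minus half the difference of the two; since h ≤ 1 both
  -- are bounded by `M`.
  have hhalf : ∀ {f U L : QFun d N}, HalfSplit (M * meshSize N) f U L → (∀ K, |f K| ≤ M) →
      ∀ K, |U K| ≤ M ∧ |L K| ≤ M := by
    intro f U L h hf K
    have h1 := h.add_eq K
    have h2 := abs_le.1 (h.abs_sub_le K)
    have h3 := abs_le.1 (hf K)
    have h4 : M * meshSize N ≤ M := mul_le_of_le_one_right hM hh1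
    constructor <;> rw [abs_le] <;> constructor <;> linarith
  have q1 : ∑ i, cellInt (fun K => r K * discEntropy gamma r th K * u i K * g i K)
      ≤ E1 * (1 + V) := by
    refine (le_abs_self _).trans ?_
    exact abs_cellInt_flux_le (q := fun K => r K * discEntropy gamma r th K) ht.grad_le
      (b := b) (fun K => by
        rw [abs_mul, abs_of_pos (hr1.trans_le (hR.rho_ge K)), hb, abs_of_pos hr2]
        exact mul_le_mul (hR.rho_le K) ((hCeb hR).1 K) (abs_nonneg _) hr2.le)
  have q2 : cellInt (fun K => stressPower mu lam u K * (a K / th K)) ≤ E2 * (1 + X) := by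
    have : cellInt (fun K => stressPower mu lam u K * (a K / th K)) ≤ E2 * X := by
      rw [hX, ← cellInt_const_mul]
      refine cellInt_mono fun K => ?_
      have h1 : a K / th K ≤ M / t1 :=
        div_le_div₀ hM ((le_abs_self _).trans (ht.val_le K)) ht1 (hR.temp_ge K)
      have h2 : stressPower mu lam u K
          ≤ (2 * mu + lam * (d + 1)) * ∑ i, ∑ j, discSymGrad u i j K ^ 2 := by
        rw [stressPower_eq]
        have h3 : discDiv u K ^ 2 ≤ d * ∑ i, ∑ j, discSymGrad u i j K ^ 2 := by
          rw [discDiv_eq_sum_symGrad]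
          refine (sq_sum_le_card_mul_sum_sq (s := Finset.univ)
            (f := fun k => discSymGrad u k k K)).trans ?_
          simp only [Finset.card_univ, Fintype.card_fin]
          gcongr with i _
          exact Finset.single_le_sum (f := fun j => discSymGrad u i j K ^ 2)
            (fun j _ => sq_nonneg _) (Finset.mem_univ i)
        have h4 : 0 ≤ ∑ i, ∑ j, discSymGrad u i j K ^ 2 :=
          Finset.sum_nonneg fun i _ => Finset.sum_nonneg fun j _ => sq_nonneg _
        have h5 := mul_le_mul_of_nonneg_left h3 hlam
        have h6 := mul_nonneg hlam h4
        linarith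
      have h7 := stressPower_nonneg hmu hlam u K
      calc _ ≤ stressPower mu lam u K * (M / t1) := by gcongr
        _ ≤ ((2 * mu + lam * (d + 1)) * ∑ i, ∑ j, discSymGrad u i j K ^ 2) * (M / t1) := by gcongr
        _ = _ := by rw [hE2]; ring
    linarith
  have q3 : kappa * ∑ i, cellInt (fun K =>
      U i K / (th (next i K) * th K) * (jump th i K / meshSize N) ^ 2
        + L i K / (th (prev i K) * th K) * (jump th i (prev i K) / meshSize N) ^ 2) ≤ E3 * W := by
    rw [hE3, mul_assoc]
    refine mul_le_mul_of_nonneg_left ?_ hkappa.le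
    rw [hW, Finset.mul_sum]
    refine Finset.sum_le_sum fun i _ => ?_
    set F : QFun d N := fun K => (1 / meshSize N * jump th i K) ^ 2 with hF
    have e : 2 * (M / t1 ^ 2) * cellInt F
        = cellInt (fun K => M / t1 ^ 2 * F K + M / t1 ^ 2 * F (prev i K)) := by
      rw [cellInt_add, cellInt_const_mul, cellInt_const_mul, cellInt_prev]; ring
    rw [e]
    refine cellInt_mono fun K => ?_
    obtain ⟨hU, hL⟩ := hhalf (hUL i) ht.val_le K
    have hpr : ∀ K K', t1 ^ 2 ≤ th K * th K' := fun K K' => by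
      rw [sq]; exact mul_le_mul (hR.temp_ge K) (hR.temp_ge K') ht1.le (hth K).le
    have ht1' : 0 < t1 ^ 2 := by positivity
    have e1 : (jump th i K / meshSize N) ^ 2 = F K := by rw [hF]; ring
    have e2 : (jump th i (prev i K) / meshSize N) ^ 2 = F (prev i K) := by rw [hF]; ring
    rw [e1, e2]
    have f1 : 0 ≤ F K := sq_nonneg _
    have f2 : 0 ≤ F (prev i K) := sq_nonneg _
    gcongr ?_ * _ + ?_ * _
    · exact div_le_div₀ hM ((le_abs_self _).trans hU) ht1' (hpr _ _)
    · exact div_le_div₀ hM ((le_abs_self _).trans hL) ht1' (hpr _ _)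
  have q4 : -(kappa * ∑ i, cellInt (fun K => 1 / th K * (jump th i K / meshSize N * U' i K
      + jump th i (prev i K) / meshSize N * L' i K))) ≤ E4 * (1 + W) := by
    have : ∑ i, cellInt (fun K => -(1 / th K * (jump th i K / meshSize N * U' i K
        + jump th i (prev i K) / meshSize N * L' i K))) ≤ M / t1 * (d + W) := by
      have e0 : M / t1 * (d + W)
          = ∑ i, M / t1 * (1 + cellInt (fun K => (1 / meshSize N * jump th i K) ^ 2)) := by
        rw [← Finset.mul_sum, Finset.sum_add_distrib]; simp [hW]
      rw [e0]
      refine Finset.sum_le_sum fun i _ => ?_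
      set F : QFun d N := fun K => |1 / meshSize N * jump th i K| with hF
      have e : cellInt (fun K => M / t1 * (F K + F (prev i K))) = M / t1 * (2 * cellInt F) := by
        rw [cellInt_const_mul, cellInt_add, cellInt_prev]; ring
      have hm : cellInt F ≤ 1 / 2 * (1 + cellInt fun K => (1 / meshSize N * jump th i K) ^ 2) :=
        cellInt_abs_le_half _
      calc _ ≤ cellInt (fun K => M / t1 * (F K + F (prev i K))) := cellInt_mono fun K => by
            obtain ⟨hU, hL⟩ := hhalf (hUL' i) (ht.grad_le i) K
            refine (neg_le_abs _).trans ?_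
            have h1 : |1 / th K| ≤ 1 / t1 := by
              rw [abs_of_pos (by have := hth K; positivity)]
              exact one_div_le_one_div_of_le ht1 (hR.temp_ge K)
            have e1 : jump th i K / meshSize N = 1 / meshSize N * jump th i K := by ring
            have e2 : jump th i (prev i K) / meshSize N = 1 / meshSize N * jump th i (prev i K) := by
              ring
            rw [abs_mul, e1, e2]
            calc _ ≤ 1 / t1 * (F K * M + F (prev i K) * M) := by
                  refine mul_le_mul h1 ((abs_add_le _ _).trans ?_) (abs_nonneg _) (by positivity)
                  rw [abs_mul _ (U' i K), abs_mul _ (L' i K)]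
                  gcongr
              _ = _ := by ring
        _ = M / t1 * (2 * cellInt F) := e
        _ ≤ _ := by gcongr; linarith
    simp only [cellInt_neg, Finset.sum_neg_distrib] at this
    have h2 := mul_le_mul_of_nonneg_left this hkappa.le
    have h3 : kappa * (M / t1 * (d + W)) ≤ E4 * (1 + W) := by
      rw [hE4, mul_assoc, mul_assoc]
      have h4 : (d : ℝ) + W ≤ (d + 1) * (1 + W) := by
        have := mul_nonneg (Nat.cast_nonneg (α := ℝ) d) nW
        linarith
      gcongr
    linarith
  unfold entropyForm
  have z1 := mul_nonneg p1 nX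
  have z2 := mul_nonneg p1 nW
  have z3 := mul_nonneg p2 nV
  have z4 := mul_nonneg p2 nW
  have z5 := mul_nonneg p3 nV
  have z6 := mul_nonneg p3 nX
  have z7 := mul_nonneg p4 nV
  have z8 := mul_nonneg p4 nX
  linarith

end Apriori

/-! ## Uniform bounds for solutions of the scheme -/

section Assembly

open Filter

variable {d : ℕ} {T mu lam kappa gamma eps : ℝ}

/-- What is used of a numerical solution that satisfies the bounds. -/
structure SolutionBounds {d N : ℕ} [NeZero N] (mu lam kappa gamma eps r1 r2 t1 t2 C : ℝ) (NT : ℕ)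
    (dt : ℝ) (w : FVFields d N) : Prop where
  step : ∀ k < NT, SchemeStep mu lam kappa gamma eps dt (w.rho k) (w.rho (k + 1))
    (w.vel k) (w.vel (k + 1)) (w.temp k) (w.temp (k + 1))
  range : ∀ k ≤ NT, InRange r1 r2 t1 t2 (w.rho k) (w.temp k)
  vel_sq_le : ∀ k ≤ NT, cellInt (fun K => ∑ j, w.vel k j K ^ 2) ≤ C
  sum_level_le : dt * ∑ k ∈ Finset.range NT,
    levelSize eps (w.rho (k + 1)) (w.vel (k + 1)) (w.temp (k + 1)) ≤ C
  symGrad_zero_le : cellInt (fun K => ∑ i, ∑ j, discSymGrad (w.vel 0) i j K ^ 2) ≤ C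
  jump_temp_zero_le : ∑ i, cellInt (fun K => (1 / meshSize N * jump (w.temp 0) i K) ^ 2) ≤ C

lemma exists_solutionBounds (hd : 0 < d) (hT : 0 < T) (hmu : 0 < mu) (hlam : 0 ≤ lam)
    (hkappa : 0 < kappa) (hg : 1 < gamma) {rho0 : Pt d → ℝ} {u0 : Fin d → Pt d → ℝ}
    {theta0 : Pt d → ℝ} (hu0 : ∀ j, MemW12 (u0 j)) (htheta0 : MemW12 theta0)
    {r1 r2 t1 t2 : ℝ} (hr1 : 0 < r1) (ht1 : 0 < t1) :
    ∃ C : ℝ, 0 ≤ C ∧ ∀ (N NT : ℕ) [NeZero N] (dt : ℝ), 0 < dt → NT * dt = T →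
      ∀ w : FVFields d N, IsFVSolution mu lam kappa gamma eps NT dt rho0 u0 theta0 w →
      w.Bounded NT r1 r2 t1 t2 →
      SolutionBounds mu lam kappa gamma eps r1 r2 t1 t2 C NT dt w := by
  obtain ⟨C0, hC0, h0⟩ := exists_initial_bound hu0 htheta0
  obtain ⟨C1, hC1, h1⟩ := exists_level_bound (eps := eps) (r2 := r2) (t2 := t2) d hmu hlam hkappa hg
    hr1 ht1 hC0 hT
  refine ⟨C0 + C1, by positivity, fun N NT _ dt hdt hNT w hw hb => ?_⟩
  have hR : ∀ k ≤ NT, InRange r1 r2 t1 t2 (w.rho k) (w.temp k) := fun k hk =>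
    ⟨fun K => (hb k hk K).1.1, fun K => (hb k hk K).1.2, fun K => (hb k hk K).2.1,
      fun K => (hb k hk K).2.2⟩
  have hs : ∀ k < NT, SchemeStep mu lam kappa gamma eps dt (w.rho k) (w.rho (k + 1))
      (w.vel k) (w.vel (k + 1)) (w.temp k) (w.temp (k + 1)) := fun k hk =>
    hw.schemeStep hd hk fun K => ht1.trans_le ((hR (k + 1) hk).temp_ge K)
  have hv : w.vel 0 = fun l => projQ N (u0 l) := funext hw.init_vel
  obtain ⟨i1, i2, i3⟩ := h0 N
  obtain ⟨l1, l2⟩ := h1 hdt hNT hs hR (by rw [hv]; exact i1)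
  refine ⟨hs, hR, fun k hk => (l1 k hk).trans (by linarith), l2.trans (by linarith), ?_, ?_⟩
  · rw [hv]; exact i2.trans (by linarith)
  · rw [hw.init_temp]; exact i3.trans (by linarith)

/-! ## Pairings with test functions -/

lemma DiscTest.mono {N : ℕ} [NeZero N] {M M' : ℝ} {a : QFun d N} {g : Fin d → QFun d N}
    (h : DiscTest M a g) (hM : M ≤ M') : DiscTest M' a g := by
  have hh := meshSize_pos (N := N)
  exact ⟨fun K => (h.val_le K).trans hM, fun i K => (h.grad_le i K).trans hM,
    fun i K => (h.jump_sub i K).trans (by gcongr), fun i j K => (h.jump_grad i j K).trans (by gcongr)⟩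

lemma TestFunction.RegularAt.mono {φ : TestFunction d T} {M M' t : ℝ} (h : φ.RegularAt M t)
    (hM : M ≤ M') : φ.RegularAt M' t where
  integrable_val := h.integrable_val
  integrable_dt := h.integrable_dt
  integrable_dx := h.integrable_dx
  abs_dt_le := h.abs_dt_le.mono fun _ hx => hx.trans hM
  abs_dtt_le := h.abs_dtt_le.mono fun _ hx => hx.trans hM
  discTest N _ := (h.discTest N).mono hM
  halfSplit_val N _ i := (h.halfSplit_val N i).mono
    (mul_le_mul_of_nonneg_right hM (meshSize_pos (N := N)).le)
  halfSplit_dx N _ i := (h.halfSplit_dx N i).mono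
    (mul_le_mul_of_nonneg_right hM (meshSize_pos (N := N)).le)

/-- Pairing with a piecewise constant function reduces the time regularity of the test function to
that of a scalar. The constant depends on the mesh only through an L¹ norm. -/
lemma TestFunction.timeTest {N : ℕ} [NeZero N] (φ : TestFunction d T) (hT : 0 < T) {M D : ℝ}
    (hM : 0 ≤ M) (hreg : ∀ᵐ t ∂(volume.restrict (Set.Ioo 0 T)), φ.RegularAt M t) (F : QFun d N)
    (hF : cellInt (fun K => |F K|) ≤ D) :
    TimeTest T (M * D) (fun t => torusInt fun x => F (cellOf N x) * φ.val t x)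
      (fun t => torusInt fun x => F (cellOf N x) * φ.dt t x) := by
  obtain ⟨B, hB⟩ := exists_bound_comp_cellOf F
  have hm := measurable_comp_cellOf F
  obtain ⟨h1, h2, h3, h4⟩ := φ.time_regularity hT hreg hm hB (isPeriodic_comp_cellOf F)
  have hc := φ.continuousOn_integral hm hB
  have e := torusInt_comp_cellOf fun K => |F K|
  unfold torusInt at e ⊢
  rw [e] at h3 h4
  simp only [mul_comm (F _)]
  refine TimeTest.mono (M := M * cellInt fun K => |F K|) ⟨hc, ?_, h2, h3, h4⟩ (by gcongr)
  rwa [intervalIntegrable_iff_integrableOn_Ioo_of_le hT.le]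

lemma intervalIntegrable_cellInt_projQ {N : ℕ} [NeZero N] (hT : 0 < T) {k : ℝ → Pt d → ℝ}
    (hk : Integrable (Function.uncurry k) (cylMeasure d T)) (F : QFun d N) :
    IntervalIntegrable (fun t => cellInt fun K => F K * projQ N (k t) K) volume 0 T := by
  unfold cellInt
  refine IntervalIntegrable.const_mul ?_ _
  have : (fun t => ∑ K, F K * projQ N (k t) K) = ∑ K, fun t => F K * projQ N (k t) K := by
    funext t; simp
  rw [this]
  refine IntervalIntegrable.sum _ fun K _ => IntervalIntegrable.const_mul ?_ _
  simp only [projQ_eq]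
  refine IntervalIntegrable.const_mul ?_ _
  rw [intervalIntegrable_iff_integrableOn_Ioo_of_le hT.le]
  exact integrableOn_torus_integral_mul hk
    (measurable_comp_cellOf (fun L => if L = K then (1 : ℝ) else 0)) (B := 1)
    (fun x => by split_ifs <;> simp)

lemma torusInt_sum_comp_cellOf_mul {N : ℕ} [NeZero N] {ι : Type*} [Fintype ι] (G : ι → QFun d N)
    {g : ι → Pt d → ℝ} (hg : ∀ i, Integrable (g i) (torusMeasure d)) :
    Integrable (fun x => ∑ i, G i (cellOf N x) * g i x) (torusMeasure d) ∧
    torusInt (fun x => ∑ i, G i (cellOf N x) * g i x)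
      = ∑ i, cellInt (fun K => G i K * projQ N (g i) K) := by
  have h : ∀ i ∈ Finset.univ, Integrable (fun x => G i (cellOf N x) * g i x) (torusMeasure d) :=
    fun i _ => integrable_comp_cellOf_mul (G i) (hg i)
  refine ⟨integrable_finsetSum _ h, ?_⟩
  have e := fun i => torusInt_comp_cellOf_mul (G i) (hg i)
  unfold torusInt at e ⊢
  rw [integral_finsetSum _ h]
  exact Finset.sum_congr rfl fun i _ => e i

/-- Slices of the test function are regular only for almost every time, so space-time integrals are
identified with discrete sums in this sense. -/
lemma cylInt_congr {f : ℝ → Pt d → ℝ} {g : ℝ → ℝ} {τ : ℝ} (hτ : τ ∈ Set.Icc 0 T)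
    (h : ∀ᵐ t ∂(volume.restrict (Set.Ioo 0 T)), torusInt (f t) = g t) :
    cylInt τ f = ∫ t in (0 : ℝ)..τ, g t := by
  unfold cylInt
  refine intervalIntegral.integral_congr_ae ?_
  filter_upwards [(ae_restrict_iff' measurableSet_Ioo).1 h, Measure.ae_ne volume T] with t ht hne hm
  rw [Set.uIoc_of_le hτ.1] at hm
  exact ht ⟨hm.1, lt_of_le_of_ne (hm.2.trans hτ.2) hne⟩

lemma floor_div_le {dt τ : ℝ} {NT : ℕ} (hdt : 0 < dt) (hNT : NT * dt = T)
    (hτ : τ ∈ Set.Icc 0 T) : ⌊τ / dt⌋₊ ≤ NT := by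
  have h : τ / dt ≤ NT := by rw [div_le_iff₀ hdt, hNT]; exact hτ.2
  exact (Nat.floor_le_floor h).trans_eq (Nat.floor_natCast NT)

/-- The two-sided form of `time_telescope`. -/
lemma abs_time_telescope_le {NT : ℕ} {C0 M dt : ℝ} {p q H : ℕ → ℝ → ℝ} {R : ℕ → ℝ}
    (hT : 0 < T) (hdt : 0 < dt) (hNT : NT * dt = T) (hM : 0 ≤ M) (hC0 : 0 ≤ C0)
    (hR : ∀ k, 0 ≤ R k)
    (hp : ∀ k ≤ NT, TimeTest T M (p k) (q k))
    (hH : ∀ k ≤ NT, IntervalIntegrable (H k) volume 0 T)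
    (hstep : ∀ᵐ t ∂(volume.restrict (Set.Ioo 0 T)), ∀ k < NT,
      |(p (k + 1) t - p k t) / dt - H (k + 1) t| ≤ R (k + 1))
    (hHb : ∀ᵐ t ∂(volume.restrict (Set.Ioo 0 T)), ∀ k ≤ NT, |H k t| ≤ C0)
    {τ : ℝ} (hτ : τ ∈ Set.Icc 0 T) :
    |p ⌊τ / dt⌋₊ τ - p 0 0
        - ((∫ t in (0 : ℝ)..τ, q ⌊t / dt⌋₊ t) + ∫ t in (0 : ℝ)..τ, H ⌊t / dt⌋₊ t)|
      ≤ dt * ((5 + T) * M + 3 * C0 + ∑ k ∈ Finset.range NT, R (k + 1)) := by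
  have h1 := time_telescope hT hdt hNT hM hC0 hR hp hH (by
    filter_upwards [hstep, hHb] with t ht ht' k hk
    have a := abs_le.1 (ht k hk)
    have b := abs_le.1 (ht' (k + 1) hk)
    constructor <;> linarith) (by
    filter_upwards [hHb] with t ht using (le_abs_self _).trans (ht 0 (Nat.zero_le _))) hτ
  have h2 := time_telescope hT hdt hNT hM hC0 hR (fun k hk => (hp k hk).neg)
    (H := fun k t => -H k t) (fun k hk => (hH k hk).neg) (by
    filter_upwards [hstep, hHb] with t ht ht' k hk
    have a := abs_le.1 (ht k hk)
    have b := abs_le.1 (ht' (k + 1) hk)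
    have e : (-p (k + 1) t - -p k t) / dt = -((p (k + 1) t - p k t) / dt) := by ring
    rw [e]
    constructor <;> linarith) (by
    filter_upwards [hHb] with t ht using (neg_le_abs _).trans (ht 0 (Nat.zero_le _))) hτ
  rw [intervalIntegral.integral_neg, intervalIntegral.integral_neg] at h2
  rw [abs_le]
  constructor <;> linarith

/-! ## The continuity equation -/

theorem continuity_consistent (hd : 0 < d) (hT : 0 < T) (hmu : 0 < mu) (hlam : 0 ≤ lam)
    (hkappa : 0 < kappa) (hg : 1 < gamma) {rho0 : Pt d → ℝ} {u0 : Fin d → Pt d → ℝ}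
    {theta0 : Pt d → ℝ} (hu0 : ∀ j, MemW12 (u0 j)) (htheta0 : MemW12 theta0)
    {r1 r2 t1 t2 : ℝ} (hr1 : 0 < r1) (ht1 : 0 < t1) (φ : TestFunction d T) :
    ∃ C : ℝ, 0 < C ∧
      ∀ (N NT : ℕ) [NeZero N] (dt : ℝ), 0 < dt → NT * dt = T →
      ∀ w : FVFields d N, IsFVSolution mu lam kappa gamma eps NT dt rho0 u0 theta0 w →
      w.Bounded NT r1 r2 t1 t2 → ∀ τ ∈ Set.Icc 0 T, ∃ e : ℝ,
        torusInt (fun x => w.rhoAt dt τ x * φ.val τ x)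
            - torusInt (fun x => w.rhoAt dt 0 x * φ.val 0 x)
          = cylInt τ (fun t x => w.rhoAt dt t x * φ.dt t x
              + (∑ i, w.rhoAt dt t x * w.velAt dt i t x * φ.dx i t x)) + e ∧
        |e| ≤ C * (dt + meshSize N + meshSize N ^ (1 - eps) + meshSize N ^ (1 + eps)) := by
  obtain ⟨Cs, hCs, hsol⟩ := exists_solutionBounds (eps := eps) (rho0 := rho0) (r2 := r2) (t2 := t2)
    hd hT hmu hlam hkappa hg hu0 htheta0 hr1 ht1
  obtain ⟨M, hM, -, hreg⟩ := φ.exists_regularAt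
  -- `C0` bounds the spatial term uniformly over the levels and pays for partial time slabs; `c` is
  -- the constant of the spatial consistency error.
  set C0 := d * (|r2| * M) * (1 + Cs) with hC0
  set c := d * (M * (5 * |r2| + 1)) with hc
  have hC0n : 0 ≤ C0 := by positivity
  have hcn : 0 ≤ c := by positivity
  refine ⟨(5 + T) * (M * |r2|) + 3 * C0 + c * Cs + 1, by positivity, ?_⟩
  intro N NT _ dt hdt hNT w hw hb τ hτ
  have hS := hsol N NT dt hdt hNT w hw hb
  have hh := meshSize_pos (N := N)
  obtain ⟨hr2, -⟩ := (hS.range 0 (Nat.zero_le _)).pos hr1 ht1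
  rw [abs_of_pos hr2] at hC0 hc ⊢
  set rate := meshSize N + meshSize N ^ (1 - eps) + meshSize N ^ (1 + eps) with hrate
  have hrn : 0 ≤ rate := by positivity
  have hrho : ∀ k ≤ NT, ∀ K, |w.rho k K| ≤ r2 := fun k hk K => by
    rw [abs_of_pos (hr1.trans_le ((hS.range k hk).rho_ge K))]; exact (hS.range k hk).rho_le K
  set p : ℕ → ℝ → ℝ := fun k t => torusInt fun x => w.rho k (cellOf N x) * φ.val t x with hp
  set q : ℕ → ℝ → ℝ := fun k t => torusInt fun x => w.rho k (cellOf N x) * φ.dt t x with hq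
  set H : ℕ → ℝ → ℝ := fun k t =>
    ∑ i, cellInt fun K => w.rho k K * w.vel k i K * projQ N (φ.dx i t) K with hH
  set R : ℕ → ℝ := fun k => c * rate * levelSize eps (w.rho k) (w.vel k) (w.temp k) with hR
  have hRn : ∀ k, 0 ≤ R k := fun k =>
    mul_nonneg (by positivity) (zero_le_one.trans (one_le_levelSize _ _ _ _))
  have hpt : ∀ k ≤ NT, TimeTest T (M * r2) (p k) (q k) := fun k hk =>
    φ.timeTest hT hM hreg (w.rho k) (by
      rw [← cellInt_const (N := N) (d := d) r2]; exact cellInt_mono (hrho k hk))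
  have hHi : ∀ k ≤ NT, IntervalIntegrable (H k) volume 0 T := fun k _ => by
    have : H k = ∑ i, fun t => cellInt fun K =>
        (fun K => w.rho k K * w.vel k i K) K * projQ N (φ.dx i t) K := by
      funext t; simp [hH]
    rw [this]
    exact IntervalIntegrable.sum _ fun i _ =>
      intervalIntegrable_cellInt_projQ hT ((φ.memLp_dx i).integrable le_top) _
  have key := abs_time_telescope_le hT hdt hNT (by positivity) hC0n hRn hpt hHi (by
    filter_upwards [hreg] with t ht k hk
    have e : (p (k + 1) t - p k t) / dt
        = cellInt fun K => (w.rho (k + 1) K - w.rho k K) / dt * projQ N (φ.val t) K := by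
      simp only [hp]
      rw [torusInt_comp_cellOf_mul _ ht.integrable_val, torusInt_comp_cellOf_mul _ ht.integrable_val,
        ← cellInt_sub, div_eq_inv_mul, ← cellInt_const_mul]
      congr 1; funext K; ring
    rw [e]
    have hR1 := hS.range (k + 1) hk
    exact (hS.step k hk).continuity_consistency (ht.discTest N)
      (fun K => hr1.le.trans (hR1.rho_ge K)) fun K => (hR1.rho_le K).trans (le_abs_self r2)) (by
    filter_upwards [hreg] with t ht k hk
    refine (abs_cellInt_flux_le (ht.discTest N).grad_le (hrho k hk)).trans ?_
    rw [hC0]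
    gcongr
    exact hS.vel_sq_le k hk) hτ
  have hcyl : cylInt τ (fun t x => w.rhoAt dt t x * φ.dt t x
      + (∑ i, w.rhoAt dt t x * w.velAt dt i t x * φ.dx i t x))
      = (∫ t in (0 : ℝ)..τ, q ⌊t / dt⌋₊ t) + ∫ t in (0 : ℝ)..τ, H ⌊t / dt⌋₊ t := by
    have m0 : (0 : ℝ) ∈ Set.Icc 0 T := ⟨le_rfl, hT.le⟩
    rw [← intervalIntegral.integral_add
      (intervalIntegrable_mono (intervalIntegrable_floor hdt hNT
        fun k hk => (hpt k hk).integrable) m0 hτ)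
      (intervalIntegrable_mono (intervalIntegrable_floor hdt hNT hHi) m0 hτ)]
    refine cylInt_congr hτ ?_
    filter_upwards [hreg] with t ht
    obtain ⟨s1, s2⟩ := torusInt_sum_comp_cellOf_mul (N := N)
      (fun i K => w.rho ⌊t / dt⌋₊ K * w.vel ⌊t / dt⌋₊ i K) ht.integrable_dx
    simp only [hH, hq]
    rw [← s2]
    exact integral_add (integrable_comp_cellOf_mul (w.rho ⌊t / dt⌋₊) ht.integrable_dt) s1
  have e0 : torusInt (fun x => w.rhoAt dt 0 x * φ.val 0 x) = p 0 0 := by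
    simp [hp, FVFields.rhoAt, recon]
  refine ⟨_, (add_sub_cancel _ _).symm, ?_⟩
  rw [hcyl, e0]
  refine key.trans ?_
  -- The level sizes are not bounded individually; only their time sum is, and that is all the
  -- spatial errors require.
  have h1 : dt * ∑ k ∈ Finset.range NT, R (k + 1) ≤ c * rate * Cs := by
    simp only [hR]
    rw [← Finset.mul_sum, mul_left_comm]
    have := hS.sum_level_le
    gcongr
  have h2 : 0 ≤ ((5 + T) * (M * r2) + 3 * C0) * rate := by positivity
  have h3 : 0 ≤ (c * Cs + 1) * dt := by positivity
  have h4 : dt + meshSize N + meshSize N ^ (1 - eps) + meshSize N ^ (1 + eps) = dt + rate := by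
    rw [hrate]; ring
  rw [h4]
  linarith

end Assembly

/-! ## The momentum equation -/

section Momentum

open Filter

variable {d : ℕ} {T mu lam kappa gamma eps : ℝ}

/-- Convection, pressure and viscosity enter a single telescoping argument. Their sum `momentumForm`
is bounded uniformly in time only after the viscous part has been integrated by parts; the
convective and stress integrals are separated again at the end. -/
theorem momentum_consistent (hd : 0 < d) (hT : 0 < T) (hmu : 0 < mu) (hlam : 0 ≤ lam)
    (hkappa : 0 < kappa) (hg : 1 < gamma) (heps : eps < 1) {rho0 : Pt d → ℝ}
    {u0 : Fin d → Pt d → ℝ} {theta0 : Pt d → ℝ} (hu0 : ∀ j, MemW12 (u0 j))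
    (htheta0 : MemW12 theta0) {r1 r2 t1 t2 : ℝ} (hr1 : 0 < r1) (ht1 : 0 < t1)
    (φ : Fin d → TestFunction d T) :
    ∃ C : ℝ, 0 < C ∧
      ∀ (N NT : ℕ) [NeZero N] (dt : ℝ), 0 < dt → NT * dt = T →
      ∀ w : FVFields d N, IsFVSolution mu lam kappa gamma eps NT dt rho0 u0 theta0 w →
      w.Bounded NT r1 r2 t1 t2 → ∀ τ ∈ Set.Icc 0 T, ∃ e : ℝ,
        torusInt (fun x => ∑ i, w.rhoAt dt τ x * w.velAt dt i τ x * (φ i).val τ x)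
            - torusInt (fun x => ∑ i, w.rhoAt dt 0 x * w.velAt dt i 0 x * (φ i).val 0 x)
          = cylInt τ (fun t x =>
              (∑ i, w.rhoAt dt t x * w.velAt dt i t x * (φ i).dt t x)
              + (∑ i, ∑ j, w.rhoAt dt t x * w.velAt dt i t x * w.velAt dt j t x * (φ i).dx j t x))
            + cylInt τ (fun t x => ∑ i, ∑ j,
                ((if i = j then w.pressAt dt t x else 0) - w.stressAt mu lam dt i j t x)
                  * (φ i).dx j t x)
            + e ∧
        |e| ≤ C * (dt + meshSize N + meshSize N ^ ((1 - eps) / 2) + meshSize N ^ (1 + eps)) := by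
  obtain ⟨Cs, hCs, hsol⟩ := exists_solutionBounds (eps := eps) (rho0 := rho0) (r2 := r2) (t2 := t2)
    hd hT hmu hlam hkappa hg hu0 htheta0 hr1 ht1
  choose m hm _ hreg' using fun i => (φ i).exists_regularAt
  set M := ∑ i, m i with hMdef
  have hM : 0 ≤ M := Finset.sum_nonneg fun i _ => hm i
  have hreg : ∀ᵐ t ∂(volume.restrict (Set.Ioo 0 T)), ∀ i, (φ i).RegularAt M t := by
    rw [ae_all_iff]
    exact fun i => (hreg' i).mono fun t ht =>
      ht.mono (Finset.single_le_sum (fun j _ => hm j) (Finset.mem_univ i))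
  -- The time regularity of the pairing needs momentum in L¹ only, which the kinetic energy
  -- controls.
  set D := d * (M * (|r2| * (1 + Cs))) with hD
  set C0 := d * d * (M * (|r2| + |r2| * |t2| + 2 * mu + lam * d)) * (1 + Cs) with hC0
  set c := d * d * (6 * M * |r2| + 2 * M * (2 * mu + lam * d + |r2| * |t2|)) with hc
  have hDn : 0 ≤ D := by positivity
  have hC0n : 0 ≤ C0 := by positivity
  have hcn : 0 ≤ c := by positivity
  refine ⟨(5 + T) * D + 3 * C0 + c * Cs + 1, by positivity, ?_⟩
  intro N NT _ dt hdt hNT w hw hb τ hτ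
  have hS := hsol N NT dt hdt hNT w hw hb
  have hh := meshSize_pos (N := N)
  have m0 : (0 : ℝ) ∈ Set.Icc 0 T := ⟨le_rfl, hT.le⟩
  set rate := meshSize N + meshSize N ^ ((1 - eps) / 2) + meshSize N ^ (1 + eps) with hrate
  have hrn : 0 ≤ rate := by positivity
  have hrho : ∀ k ≤ NT, ∀ K, 0 ≤ w.rho k K ∧ w.rho k K ≤ |r2| := fun k hk K =>
    ⟨hr1.le.trans ((hS.range k hk).rho_ge K), ((hS.range k hk).rho_le K).trans (le_abs_self _)⟩
  have htemp : ∀ k ≤ NT, ∀ K, 0 < w.temp k K ∧ w.temp k K ≤ |t2| := fun k hk K =>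
    ⟨ht1.trans_le ((hS.range k hk).temp_ge K), ((hS.range k hk).temp_le K).trans (le_abs_self _)⟩
  set p : ℕ → ℝ → ℝ := fun k t =>
    ∑ i, torusInt fun x => w.rho k (cellOf N x) * w.vel k i (cellOf N x) * (φ i).val t x with hp
  set q : ℕ → ℝ → ℝ := fun k t =>
    ∑ i, torusInt fun x => w.rho k (cellOf N x) * w.vel k i (cellOf N x) * (φ i).dt t x with hq
  set H1 : ℕ → ℝ → ℝ := fun k t => ∑ i, ∑ j, cellInt fun K =>
    w.rho k K * w.vel k i K * w.vel k j K * projQ N ((φ i).dx j t) K with hH1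
  set H2 : ℕ → ℝ → ℝ := fun k t => ∑ i, ∑ j, cellInt fun K =>
    ((if i = j then w.rho k K * w.temp k K else 0) - discStress mu lam (w.vel k) i j K)
      * projQ N ((φ i).dx j t) K with hH2
  set R : ℕ → ℝ := fun k => c * rate * levelSize eps (w.rho k) (w.vel k) (w.temp k) with hR
  have hRn : ∀ k, 0 ≤ R k := fun k =>
    mul_nonneg (by positivity) (zero_le_one.trans (one_le_levelSize _ _ _ _))
  have hpt : ∀ k ≤ NT, TimeTest T D (p k) (q k) := by
    intro k hk
    have h := TimeTest.sum (T := T) Finset.univ (M := fun _ : Fin d => M * (|r2| * (1 + Cs)))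
      fun i _ => (φ i).timeTest hT hM (hreg.mono fun t ht => ht i)
        (fun K => w.rho k K * w.vel k i K) (D := |r2| * (1 + Cs)) (by
          have h1 := cellInt_abs_le_half (w.vel k i)
          have h2 := (cellInt_vel_sq_le_sum (w.vel k) i).trans (hS.vel_sq_le k hk)
          have h3 : cellInt (fun K => |w.rho k K * w.vel k i K|)
              ≤ |r2| * cellInt (fun K => |w.vel k i K|) := by
            rw [← cellInt_const_mul]
            refine cellInt_mono fun K => ?_
            rw [abs_mul, abs_of_nonneg (hrho k hk K).1]
            exact mul_le_mul_of_nonneg_right (hrho k hk K).2 (abs_nonneg _)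
          refine h3.trans (mul_le_mul_of_nonneg_left ?_ (abs_nonneg _))
          linarith)
    simpa [hD] using h
  have hHi : ∀ (G : Fin d → Fin d → QFun d N), IntervalIntegrable
      (fun t => ∑ i, ∑ j, cellInt fun K => G i j K * projQ N ((φ i).dx j t) K) volume 0 T := by
    intro G
    have : (fun t => ∑ i, ∑ j, cellInt fun K => G i j K * projQ N ((φ i).dx j t) K)
        = ∑ i, ∑ j, fun t => cellInt fun K => G i j K * projQ N ((φ i).dx j t) K := by
      funext t; simp
    rw [this]
    exact IntervalIntegrable.sum _ fun i _ => IntervalIntegrable.sum _ fun j _ =>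
      intervalIntegrable_cellInt_projQ hT (((φ i).memLp_dx j).integrable le_top) _
  have hH1i : ∀ k ≤ NT, IntervalIntegrable (H1 k) volume 0 T := fun k _ =>
    hHi fun i j K => w.rho k K * w.vel k i K * w.vel k j K
  have hH2i : ∀ k ≤ NT, IntervalIntegrable (H2 k) volume 0 T := fun k _ =>
    hHi fun i j K => (if i = j then w.rho k K * w.temp k K else 0)
      - discStress mu lam (w.vel k) i j K
  have hform : ∀ k t, H1 k t + H2 k t = momentumForm mu lam (w.rho k) (w.vel k) (w.temp k)
      fun i j => projQ N ((φ i).dx j t) := fun k t => by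
    simp only [hH1, hH2, momentumForm, Finset.sum_add_distrib]
  have key := abs_time_telescope_le hT hdt hNT hDn hC0n hRn hpt
    (H := fun k t => H1 k t + H2 k t) (fun k hk => (hH1i k hk).add (hH2i k hk)) (by
    filter_upwards [hreg] with t ht k hk
    have e : (p (k + 1) t - p k t) / dt
        = cellInt fun K => ∑ i, (w.rho (k + 1) K * w.vel (k + 1) i K - w.rho k K * w.vel k i K) / dt
          * projQ N ((φ i).val t) K := by
      simp only [hp]
      rw [cellInt_sum, ← Finset.sum_sub_distrib, Finset.sum_div]
      refine Finset.sum_congr rfl fun i _ => ?_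
      rw [torusInt_comp_cellOf_mul (fun K => w.rho (k + 1) K * w.vel (k + 1) i K)
          (ht i).integrable_val,
        torusInt_comp_cellOf_mul (fun K => w.rho k K * w.vel k i K) (ht i).integrable_val,
        ← cellInt_sub, div_eq_inv_mul, ← cellInt_const_mul]
      congr 1; funext K; ring
    rw [e, hform]
    exact (hS.step k hk).momentum_consistency hmu hlam heps (fun j => (ht j).discTest N)
      (fun K => (hrho (k + 1) hk K).1) (fun K => (hrho (k + 1) hk K).2)
      (fun K => (htemp (k + 1) hk K).1.le) (fun K => (htemp (k + 1) hk K).2)) (by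
    filter_upwards [hreg] with t ht k hk
    rw [hform]
    refine (abs_momentumForm_le hmu hlam (fun j => (ht j).discTest N)
      (fun K => (hrho k hk K).1) (fun K => (hrho k hk K).2)
      (fun K => (htemp k hk K).1.le) (fun K => (htemp k hk K).2)).trans ?_
    rw [hC0]
    gcongr
    exact hS.vel_sq_le k hk) hτ
  have iq := intervalIntegrable_mono (intervalIntegrable_floor hdt hNT
    fun k hk => (hpt k hk).integrable) m0 hτ
  have iH1 := intervalIntegrable_mono (intervalIntegrable_floor hdt hNT hH1i) m0 hτ
  have iH2 := intervalIntegrable_mono (intervalIntegrable_floor hdt hNT hH2i) m0 hτ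
  have hcyl1 : cylInt τ (fun t x =>
      (∑ i, w.rhoAt dt t x * w.velAt dt i t x * (φ i).dt t x)
      + (∑ i, ∑ j, w.rhoAt dt t x * w.velAt dt i t x * w.velAt dt j t x * (φ i).dx j t x))
      = (∫ t in (0 : ℝ)..τ, q ⌊t / dt⌋₊ t) + ∫ t in (0 : ℝ)..τ, H1 ⌊t / dt⌋₊ t := by
    rw [← intervalIntegral.integral_add iq iH1]
    refine cylInt_congr hτ ?_
    filter_upwards [hreg] with t ht
    obtain ⟨s1, s2⟩ := torusInt_sum_comp_cellOf_mul (N := N)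
      (fun (z : Fin d × Fin d) K => w.rho ⌊t / dt⌋₊ K * w.vel ⌊t / dt⌋₊ z.1 K
        * w.vel ⌊t / dt⌋₊ z.2 K) (g := fun z => (φ z.1).dx z.2 t)
      fun z => (ht z.1).integrable_dx z.2
    obtain ⟨s3, s4⟩ := torusInt_sum_comp_cellOf_mul (N := N)
      (fun i K => w.rho ⌊t / dt⌋₊ K * w.vel ⌊t / dt⌋₊ i K) fun i => (ht i).integrable_dt
    have s5 : q ⌊t / dt⌋₊ t = ∑ i, cellInt fun K => w.rho ⌊t / dt⌋₊ K * w.vel ⌊t / dt⌋₊ i K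
        * projQ N ((φ i).dt t) K :=
      Finset.sum_congr rfl fun i _ => torusInt_comp_cellOf_mul
        (fun K => w.rho ⌊t / dt⌋₊ K * w.vel ⌊t / dt⌋₊ i K) (ht i).integrable_dt
    simp only [Fintype.sum_prod_type] at s1 s2
    rw [s5, ← s4, hH1]
    simp only
    rw [← s2]
    exact integral_add s3 s1
  have hcyl2 : cylInt τ (fun t x => ∑ i, ∑ j,
      ((if i = j then w.pressAt dt t x else 0) - w.stressAt mu lam dt i j t x) * (φ i).dx j t x)
      = ∫ t in (0 : ℝ)..τ, H2 ⌊t / dt⌋₊ t := by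
    refine cylInt_congr hτ ?_
    filter_upwards [hreg, ae_restrict_mem measurableSet_Ioo] with t ht htm
    have hk := floor_div_le hdt hNT (Set.Ioo_subset_Icc_self htm)
    obtain ⟨-, s2⟩ := torusInt_sum_comp_cellOf_mul (N := N)
      (fun (z : Fin d × Fin d) K =>
        (if z.1 = z.2 then w.rho ⌊t / dt⌋₊ K * w.temp ⌊t / dt⌋₊ K else 0)
          - discStress mu lam (w.vel ⌊t / dt⌋₊) z.1 z.2 K) (g := fun z => (φ z.1).dx z.2 t)
      fun z => (ht z.1).integrable_dx z.2
    simp only [Fintype.sum_prod_type] at s2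
    rw [hH2]
    simp only
    rw [← s2]
    have hpr : ∀ x, w.pressAt dt t x
        = w.rho ⌊t / dt⌋₊ (cellOf N x) * w.temp ⌊t / dt⌋₊ (cellOf N x) := fun x => by
      simp [FVFields.pressAt, recon, FVFields.press, discPressure, (htemp _ hk (cellOf N x)).1]
    simp only [hpr]
    rfl
  have hval : ∀ s ∈ Set.Icc 0 T, torusInt (fun x => ∑ i, w.rhoAt dt s x * w.velAt dt i s x
      * (φ i).val s x) = p ⌊s / dt⌋₊ s := by
    intro s hs
    obtain ⟨-, s4⟩ := torusInt_sum_comp_cellOf_mul (N := N)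
      (fun i K => w.rho ⌊s / dt⌋₊ K * w.vel ⌊s / dt⌋₊ i K) fun i => (φ i).integrable_val hs
    have s5 : p ⌊s / dt⌋₊ s = ∑ i, cellInt fun K => w.rho ⌊s / dt⌋₊ K * w.vel ⌊s / dt⌋₊ i K
        * projQ N ((φ i).val s) K :=
      Finset.sum_congr rfl fun i _ => torusInt_comp_cellOf_mul
        (fun K => w.rho ⌊s / dt⌋₊ K * w.vel ⌊s / dt⌋₊ i K) ((φ i).integrable_val hs)
    rw [s5, ← s4]
    rfl
  have e0 := hval 0 m0
  rw [zero_div, Nat.floor_zero] at e0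
  refine ⟨_, (add_sub_cancel _ _).symm, ?_⟩
  rw [hval τ hτ, e0, hcyl1, hcyl2, add_assoc, ← intervalIntegral.integral_add iH1 iH2]
  refine key.trans ?_
  have h1 : dt * ∑ k ∈ Finset.range NT, R (k + 1) ≤ c * rate * Cs := by
    simp only [hR]
    rw [← Finset.mul_sum, mul_left_comm]
    have := hS.sum_level_le
    gcongr
  have h2 : 0 ≤ ((5 + T) * D + 3 * C0) * rate := by positivity
  have h3 : 0 ≤ (c * Cs + 1) * dt := by positivity
  have h4 : dt + meshSize N + meshSize N ^ ((1 - eps) / 2) + meshSize N ^ (1 + eps) = dt + rate := by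
    rw [hrate]; ring
  rw [h4]
  linarith

end Momentum

/-! ## The entropy inequality -/

section Entropy

open Filter

variable {d : ℕ} {T mu lam kappa gamma eps : ℝ}

/-- With a single cell per direction every cell is its own neighbour, and comparing `dualCellOf`
with `cellOf` could not tell the two halves of a cell apart. -/
lemma prev_ne_self {N : ℕ} (hN : meshSize N < 1) [NeZero N] (i : Fin d) (K : Cell d N) :
    prev i K ≠ K := by
  have h1 : 1 < N := by
    by_contra h
    have h0 := NeZero.ne N
    have : N = 1 := by omega
    subst this
    simp [meshSize] at hN
  have : Fact (1 < N) := ⟨h1⟩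
  intro h
  have h2 := congrFun h i
  simp [prev] at h2

lemma intervalIntegrable_cellInt_ite {N : ℕ} [NeZero N] (hT : 0 < T) {k : ℝ → Pt d → ℝ}
    (hk : Integrable (Function.uncurry k) (cylMeasure d T)) (i : Fin d) (F G : QFun d N) :
    IntervalIntegrable (fun t => cellInt fun K =>
      F K * upperMean N i (k t) K + G K * lowerMean N i (k t) K) volume 0 T := by
  have hk' : ∀ a b : ℝ, Integrable (Function.uncurry fun t x =>
      k t x * if Int.fract ((N : ℝ) * x i) < 1 / 2 then a else b) (cylMeasure d T) := fun a b =>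
    hk.mul_bdd (c := |a| + |b|)
      ((measurable_ite_fract N i a b).comp measurable_snd).aestronglyMeasurable
      (Eventually.of_forall fun z => by
        rw [Real.norm_eq_abs]
        split_ifs
        · linarith [abs_nonneg b]
        · linarith [abs_nonneg a])
  simp only [cellInt_add]
  exact (intervalIntegrable_cellInt_projQ hT (hk' 0 1) F).add
    (intervalIntegrable_cellInt_projQ hT (hk' 1 0) G)

lemma torusInt_sum_comp_dualCellOf_mul {N : ℕ} [NeZero N] (G : Fin d → Cell d N → Cell d N → ℝ)
    {ψ : Fin d → Pt d → ℝ} (hψ : ∀ i, Integrable (ψ i) (torusMeasure d)) :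
    torusInt (fun x => ∑ i, G i (cellOf N x) (dualCellOf N i x) * ψ i x)
      = ∑ i, cellInt (fun K => G i K K * upperMean N i (ψ i) K
          + G i K (prev i K) * lowerMean N i (ψ i) K) := by
  have e := fun i => torusInt_comp_dualCellOf_mul (N := N) i (G i) (hψ i)
  unfold torusInt at e ⊢
  rw [integral_finsetSum _ fun i _ => (e i).1]
  exact Finset.sum_congr rfl fun i _ => (e i).2

/-- Only the one-sided telescoping is used: the scheme gives a lower bound for the entropy
increment. The dissipations, which are not bounded uniformly in time, occur with a favourable sign
except at level 0. -/
theorem entropy_consistent (hd : 0 < d) (hT : 0 < T) (hmu : 0 < mu) (hlam : 0 ≤ lam)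
    (hkappa : 0 < kappa) (hg : 1 < gamma) (heps : -1 < eps) {rho0 : Pt d → ℝ}
    {u0 : Fin d → Pt d → ℝ} {theta0 : Pt d → ℝ} (hu0 : ∀ j, MemW12 (u0 j))
    (htheta0 : MemW12 theta0) {r1 r2 t1 t2 : ℝ} (hr1 : 0 < r1) (ht1 : 0 < t1)
    (φ : TestFunction d T) (hφ : ∀ t ∈ Set.Icc 0 T, ∀ x, 0 ≤ φ.val t x) :
    ∃ C : ℝ, 0 < C ∧
      ∀ (N NT : ℕ) [NeZero N] (dt : ℝ), meshSize N < 1 → 0 < dt → NT * dt = T →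
      ∀ w : FVFields d N, IsFVSolution mu lam kappa gamma eps NT dt rho0 u0 theta0 w →
      w.Bounded NT r1 r2 t1 t2 → ∀ τ ∈ Set.Icc 0 T, ∃ e : ℝ,
        torusInt (fun x => w.rhoAt dt τ x * w.entropyAt gamma dt τ x * φ.val τ x)
            - torusInt (fun x => w.rhoAt dt 0 x * w.entropyAt gamma dt 0 x * φ.val 0 x)
          ≥ cylInt τ (fun t x => w.rhoAt dt t x * w.entropyAt gamma dt t x
                * (φ.dt t x + ∑ i, w.velAt dt i t x * φ.dx i t x))
            + cylInt τ (fun t x =>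
                (∑ i, ∑ j, w.stressAt mu lam dt i j t x * w.gradVelAt dt i j t x)
                  * (φ.val t x / w.tempAt dt t x))
            + cylInt τ (fun t x => ∑ i,
                kappa * φ.val t x / (w.tempOutAt dt i t x * w.tempAt dt t x)
                  * w.edgeGradTempAt dt i t x ^ 2)
            - cylInt τ (fun t x => kappa / w.tempAt dt t x
                * ∑ i, w.edgeGradTempAt dt i t x * φ.dx i t x)
            + e ∧
        |e| ≤ C * (dt + meshSize N + meshSize N ^ (1 - eps) + meshSize N ^ ((1 + eps) / 2)) := by
  obtain ⟨Cs, hCs, hsol⟩ := exists_solutionBounds (eps := eps) (rho0 := rho0) (r2 := r2) (t2 := t2)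
    hd hT hmu hlam hkappa hg hu0 htheta0 hr1 ht1
  obtain ⟨M, hM, -, hreg⟩ := φ.exists_regularAt
  obtain ⟨Ce, hCe, hCeb⟩ := exists_entropy_bound (r2 := r2) (t2 := t2) hg hr1 ht1
  obtain ⟨c, hcn, hcons⟩ := exists_entropy_consistency (eps := eps) (r2 := r2) (t2 := t2) d hM hmu
    hlam hkappa hg heps hr1 ht1
  obtain ⟨cf, hcfn, hcf⟩ := exists_entropyForm_bound (r2 := r2) (t2 := t2) d hM hmu
    hlam hkappa hg hr1 ht1
  -- The first summand is the uniform lower bound used on partial slabs. The second is the upper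
  -- bound for the form at level 0, where the dissipation is controlled by the initial data.
  set C0 := c * (1 + Cs) + cf * (1 + Cs + Cs + Cs) with hC0
  have hC0n : 0 ≤ C0 := by positivity
  refine ⟨(5 + T) * (M * (|r2| * Ce)) + 3 * C0 + c * Cs + 1, by positivity, ?_⟩
  intro N NT _ dt hN hdt hNT w hw hb τ hτ
  have hS := hsol N NT dt hdt hNT w hw hb
  have hh := meshSize_pos (N := N)
  have m0 : (0 : ℝ) ∈ Set.Icc 0 T := ⟨le_rfl, hT.le⟩
  set rate := meshSize N + meshSize N ^ (1 - eps) + meshSize N ^ (1 + eps) with hrate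
  have hrn : 0 ≤ rate := by positivity
  set p : ℕ → ℝ → ℝ := fun k t => torusInt fun x => w.rho k (cellOf N x)
    * discEntropy gamma (w.rho k) (w.temp k) (cellOf N x) * φ.val t x with hp
  set q : ℕ → ℝ → ℝ := fun k t => torusInt fun x => w.rho k (cellOf N x)
    * discEntropy gamma (w.rho k) (w.temp k) (cellOf N x) * φ.dt t x with hq
  -- `K` is the cell of a point and `K'` the lower cell of the face whose dual cell contains it.
  -- Together they determine the half of `K` and hence both the outer temperature and the jump.
  set G3 : ℕ → Fin d → Cell d N → Cell d N → ℝ := fun k i K K' =>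
    kappa / ((if K' = K then w.temp k (next i K) else w.temp k (prev i K)) * w.temp k K)
      * (jump (w.temp k) i K' / meshSize N) ^ 2 with hG3
  set G4 : ℕ → Fin d → Cell d N → Cell d N → ℝ := fun k i K K' =>
    kappa / w.temp k K * (jump (w.temp k) i K' / meshSize N) with hG4
  set H1 : ℕ → ℝ → ℝ := fun k t => ∑ i, cellInt fun K => w.rho k K
    * discEntropy gamma (w.rho k) (w.temp k) K * w.vel k i K * projQ N (φ.dx i t) K with hH1
  set H2 : ℕ → ℝ → ℝ := fun k t => cellInt fun K =>
    stressPower mu lam (w.vel k) K / w.temp k K * projQ N (φ.val t) K with hH2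
  set H3 : ℕ → ℝ → ℝ := fun k t => ∑ i, cellInt fun K =>
    G3 k i K K * upperMean N i (φ.val t) K + G3 k i K (prev i K) * lowerMean N i (φ.val t) K with hH3
  set H4 : ℕ → ℝ → ℝ := fun k t => ∑ i, cellInt fun K =>
    G4 k i K K * upperMean N i (φ.dx i t) K + G4 k i K (prev i K) * lowerMean N i (φ.dx i t) K
    with hH4
  set R : ℕ → ℝ := fun k => c * rate * levelSize eps (w.rho k) (w.vel k) (w.temp k) with hR
  have hRn : ∀ k, 0 ≤ R k := fun k =>
    mul_nonneg (by positivity) (zero_le_one.trans (one_le_levelSize _ _ _ _))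
  have hform : ∀ k t, H1 k t + H2 k t + H3 k t - H4 k t
      = entropyForm mu lam kappa gamma (w.rho k) (w.vel k) (w.temp k) (projQ N (φ.val t))
        (fun i => projQ N (φ.dx i t)) (fun i => upperMean N i (φ.val t))
        (fun i => lowerMean N i (φ.val t)) (fun i => upperMean N i (φ.dx i t))
        (fun i => lowerMean N i (φ.dx i t)) := by
    intro k t
    unfold entropyForm
    refine congrArg₂ _ (congrArg₂ _ (congrArg₂ _ rfl ?_) ?_) ?_
    · simp only [hH2]
      congr 1; funext K; ring
    · simp only [hH3]
      rw [Finset.mul_sum]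
      refine Finset.sum_congr rfl fun i _ => ?_
      rw [← cellInt_const_mul]
      congr 1; funext K
      simp only [hG3, if_true, if_neg (prev_ne_self hN i K)]
      ring
    · simp only [hH4]
      rw [Finset.mul_sum]
      refine Finset.sum_congr rfl fun i _ => ?_
      rw [← cellInt_const_mul]
      congr 1; funext K
      simp only [hG4]
      ring
  have hpt : ∀ k ≤ NT, TimeTest T (M * (|r2| * Ce)) (p k) (q k) := fun k hk =>
    φ.timeTest hT hM hreg (fun K => w.rho k K * discEntropy gamma (w.rho k) (w.temp k) K) (by
      rw [← cellInt_const (N := N) (d := d) (|r2| * Ce)]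
      refine cellInt_mono fun K => ?_
      rw [abs_mul, abs_of_pos (hr1.trans_le ((hS.range k hk).rho_ge K))]
      exact mul_le_mul (((hS.range k hk).rho_le K).trans (le_abs_self _))
        ((hCeb (hS.range k hk)).1 K) (abs_nonneg _) (abs_nonneg _))
  have hval := φ.integrable_val_cyl
  have hdx := fun i => (φ.memLp_dx i).integrable le_top
  have hH1i : ∀ k ≤ NT, IntervalIntegrable (H1 k) volume 0 T := fun k _ => by
    have : H1 k = ∑ i, fun t => cellInt fun K => (fun K => w.rho k K
        * discEntropy gamma (w.rho k) (w.temp k) K * w.vel k i K) K * projQ N (φ.dx i t) K := by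
      funext t; simp [hH1]
    rw [this]
    exact IntervalIntegrable.sum _ fun i _ => intervalIntegrable_cellInt_projQ hT (hdx i) _
  have hH2i : ∀ k ≤ NT, IntervalIntegrable (H2 k) volume 0 T := fun k _ =>
    intervalIntegrable_cellInt_projQ hT hval fun K => stressPower mu lam (w.vel k) K / w.temp k K
  have hH3i : ∀ k ≤ NT, IntervalIntegrable (H3 k) volume 0 T := fun k _ => by
    have : H3 k = ∑ i, fun t => cellInt fun K => (fun K => G3 k i K K) K
        * upperMean N i (φ.val t) K + (fun K => G3 k i K (prev i K)) K
        * lowerMean N i (φ.val t) K := by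
      funext t; simp [hH3]
    rw [this]
    exact IntervalIntegrable.sum _ fun i _ => intervalIntegrable_cellInt_ite hT hval i _ _
  have hH4i : ∀ k ≤ NT, IntervalIntegrable (H4 k) volume 0 T := fun k _ => by
    have : H4 k = ∑ i, fun t => cellInt fun K => (fun K => G4 k i K K) K
        * upperMean N i (φ.dx i t) K + (fun K => G4 k i K (prev i K)) K
        * lowerMean N i (φ.dx i t) K := by
      funext t; simp [hH4]
    rw [this]
    exact IntervalIntegrable.sum _ fun i _ => intervalIntegrable_cellInt_ite hT (hdx i) i _ _
  have key := time_telescope hT hdt hNT (by positivity) hC0n hRn hpt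
    (H := fun k t => H1 k t + H2 k t + H3 k t - H4 k t)
    (fun k hk => (((hH1i k hk).add (hH2i k hk)).add (hH3i k hk)).sub (hH4i k hk)) (by
    filter_upwards [hreg, ae_restrict_mem measurableSet_Ioo] with t ht htm k hk
    have e : (p (k + 1) t - p k t) / dt
        = cellInt fun K => (w.rho (k + 1) K * discEntropy gamma (w.rho (k + 1)) (w.temp (k + 1)) K
          - w.rho k K * discEntropy gamma (w.rho k) (w.temp k) K) / dt * projQ N (φ.val t) K := by
      simp only [hp]
      rw [torusInt_comp_cellOf_mul (fun K => w.rho (k + 1) K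
          * discEntropy gamma (w.rho (k + 1)) (w.temp (k + 1)) K) ht.integrable_val,
        torusInt_comp_cellOf_mul (fun K => w.rho k K * discEntropy gamma (w.rho k) (w.temp k) K)
          ht.integrable_val, ← cellInt_sub, div_eq_inv_mul, ← cellInt_const_mul]
      congr 1; funext K; ring
    have hpos : ∀ K, 0 ≤ projQ N (φ.val t) K := fun K =>
      mul_nonneg (by positivity)
        (integral_nonneg fun x => hφ t (Set.Ioo_subset_Icc_self htm) x)
    obtain ⟨f1, f2⟩ := hcons hdt (hS.step k hk) (hS.range k hk.le) (hS.range (k + 1) hk)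
      (ht.discTest N) hpos (ht.halfSplit_val N) (ht.halfSplit_dx N)
    rw [e, hform]
    refine ⟨f1, le_trans ?_ f2⟩
    have f3 : c * (1 + cellInt fun K => ∑ j, w.vel (k + 1) j K ^ 2) ≤ c * (1 + Cs) := by
      gcongr; exact hS.vel_sq_le (k + 1) hk
    have f4 : 0 ≤ cf * (1 + Cs + Cs + Cs) := by positivity
    simp only [hR, hC0]
    linarith) (by
    filter_upwards [hreg] with t ht
    rw [hform]
    refine (hcf (hS.range 0 (Nat.zero_le _)) (ht.discTest N) (ht.halfSplit_val N)
      (ht.halfSplit_dx N)).trans ?_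
    have f1 := hS.vel_sq_le 0 (Nat.zero_le _)
    have f2 := hS.symGrad_zero_le
    have f3 := hS.jump_temp_zero_le
    have f4 : 0 ≤ c * (1 + Cs) := by positivity
    have f5 := mul_le_mul_of_nonneg_left (add_le_add (add_le_add (add_le_add (le_refl (1 : ℝ)) f1)
      f2) f3) hcfn
    linarith) hτ
  have iq := intervalIntegrable_mono (intervalIntegrable_floor hdt hNT
    fun k hk => (hpt k hk).integrable) m0 hτ
  have iH1 := intervalIntegrable_mono (intervalIntegrable_floor hdt hNT hH1i) m0 hτ
  have iH2 := intervalIntegrable_mono (intervalIntegrable_floor hdt hNT hH2i) m0 hτ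
  have iH3 := intervalIntegrable_mono (intervalIntegrable_floor hdt hNT hH3i) m0 hτ
  have iH4 := intervalIntegrable_mono (intervalIntegrable_floor hdt hNT hH4i) m0 hτ
  have hcyl1 : cylInt τ (fun t x => w.rhoAt dt t x * w.entropyAt gamma dt t x
      * (φ.dt t x + ∑ i, w.velAt dt i t x * φ.dx i t x))
      = (∫ t in (0 : ℝ)..τ, q ⌊t / dt⌋₊ t) + ∫ t in (0 : ℝ)..τ, H1 ⌊t / dt⌋₊ t := by
    rw [← intervalIntegral.integral_add iq iH1]
    refine cylInt_congr hτ ?_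
    filter_upwards [hreg] with t ht
    obtain ⟨s1, s2⟩ := torusInt_sum_comp_cellOf_mul (N := N)
      (fun i K => w.rho ⌊t / dt⌋₊ K * discEntropy gamma (w.rho ⌊t / dt⌋₊) (w.temp ⌊t / dt⌋₊) K
        * w.vel ⌊t / dt⌋₊ i K) ht.integrable_dx
    simp only [hH1, hq]
    rw [← s2]
    simp only [mul_add, Finset.mul_sum, ← mul_assoc]
    exact integral_add (integrable_comp_cellOf_mul (fun K => w.rho ⌊t / dt⌋₊ K
      * discEntropy gamma (w.rho ⌊t / dt⌋₊) (w.temp ⌊t / dt⌋₊) K) ht.integrable_dt) s1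
  have hcyl2 : cylInt τ (fun t x =>
      (∑ i, ∑ j, w.stressAt mu lam dt i j t x * w.gradVelAt dt i j t x)
        * (φ.val t x / w.tempAt dt t x)) = ∫ t in (0 : ℝ)..τ, H2 ⌊t / dt⌋₊ t := by
    refine cylInt_congr hτ ?_
    filter_upwards [hreg] with t ht
    simp only [hH2]
    rw [← torusInt_comp_cellOf_mul (fun K => stressPower mu lam (w.vel ⌊t / dt⌋₊) K
      / w.temp ⌊t / dt⌋₊ K) ht.integrable_val]
    congr 1; funext x
    rw [mul_div_assoc', mul_div_right_comm]
    rfl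
  have hcyl3 : cylInt τ (fun t x => ∑ i,
      kappa * φ.val t x / (w.tempOutAt dt i t x * w.tempAt dt t x)
        * w.edgeGradTempAt dt i t x ^ 2) = ∫ t in (0 : ℝ)..τ, H3 ⌊t / dt⌋₊ t := by
    refine cylInt_congr hτ ?_
    filter_upwards [hreg] with t ht
    simp only [hH3]
    rw [← torusInt_sum_comp_dualCellOf_mul (G3 ⌊t / dt⌋₊) fun _ => ht.integrable_val]
    congr 1; funext x
    refine Finset.sum_congr rfl fun i _ => ?_
    simp only [hG3, FVFields.tempOutAt, FVFields.tempAt, FVFields.edgeGradTempAt, recon, outVal,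
      edgeGrad]
    ring
  have hcyl4 : cylInt τ (fun t x => kappa / w.tempAt dt t x
      * ∑ i, w.edgeGradTempAt dt i t x * φ.dx i t x) = ∫ t in (0 : ℝ)..τ, H4 ⌊t / dt⌋₊ t := by
    refine cylInt_congr hτ ?_
    filter_upwards [hreg] with t ht
    simp only [hH4]
    rw [← torusInt_sum_comp_dualCellOf_mul (G4 ⌊t / dt⌋₊) ht.integrable_dx]
    congr 1; funext x
    rw [Finset.mul_sum]
    refine Finset.sum_congr rfl fun i _ => ?_
    rw [← mul_assoc]
    rfl
  have e0 : torusInt (fun x => w.rhoAt dt 0 x * w.entropyAt gamma dt 0 x * φ.val 0 x) = p 0 0 := by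
    simp [hp, FVFields.rhoAt, FVFields.entropyAt, recon]
  rw [intervalIntegral.integral_sub ((iH1.add iH2).add iH3) iH4,
    intervalIntegral.integral_add (iH1.add iH2) iH3, intervalIntegral.integral_add iH1 iH2] at key
  -- The statement is an inequality, so the error may be taken to be the negative of the whole
  -- bound.
  refine ⟨-(dt * ((5 + T) * (M * (|r2| * Ce)) + 3 * C0
    + ∑ k ∈ Finset.range NT, R (k + 1))), ?_, ?_⟩
  · rw [hcyl1, hcyl2, hcyl3, hcyl4, e0, ge_iff_le]
    refine le_trans (le_of_eq ?_) key
    ring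
  · have hsum : 0 ≤ ∑ k ∈ Finset.range NT, R (k + 1) := Finset.sum_nonneg fun k _ => hRn _
    rw [abs_neg, abs_of_nonneg (by positivity)]
    have h1 : dt * ∑ k ∈ Finset.range NT, R (k + 1) ≤ c * rate * Cs := by
      simp only [hR]
      rw [← Finset.mul_sum, mul_left_comm]
      have := hS.sum_level_le
      gcongr
    set rate' := meshSize N + meshSize N ^ (1 - eps) + meshSize N ^ ((1 + eps) / 2) with hrate'
    -- The argument yields the exponent 1 + ε, which for h ≤ 1 and 1 + ε > 0 is at least as good as
    -- its half.
    have h5 : rate ≤ rate' := by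
      have : meshSize N ^ (1 + eps) ≤ meshSize N ^ ((1 + eps) / 2) :=
        Real.rpow_le_rpow_of_exponent_ge hh meshSize_le_one (by linarith)
      rw [hrate, hrate']; linarith
    have h6 : c * rate * Cs ≤ c * rate' * Cs := by gcongr
    have hrn' : 0 ≤ rate' := hrn.trans h5
    have h2 : 0 ≤ ((5 + T) * (M * (|r2| * Ce)) + 3 * C0) * rate' := by positivity
    have h3 : 0 ≤ (c * Cs + 1) * dt := by positivity
    have h4 : dt + meshSize N + meshSize N ^ (1 - eps) + meshSize N ^ ((1 + eps) / 2)
        = dt + rate' := by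
      rw [hrate']; ring
    rw [h4]
    linarith

end Entropy

end FVNSF

end

/-! ### The three consistency statements together. -/

theorem mainTheorem4 (d : ℕ) (hd : d = 2 ∨ d = 3)
    (T mu lam kappa gamma eps : ℝ) (hT : 0 < T) (hmu : 0 < mu) (hlam : 0 ≤ lam)
    (hkappa : 0 < kappa) (hgamma : 1 < gamma) (heps : -1 < eps) (heps' : eps < 1)
    (rho0 : FVNSF.Pt d → ℝ) (u0 : Fin d → FVNSF.Pt d → ℝ) (theta0 : FVNSF.Pt d → ℝ)
    (hrho0 : FVNSF.MemW12 rho0) (hu0 : ∀ j, FVNSF.MemW12 (u0 j)) (htheta0 : FVNSF.MemW12 theta0)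
    (hrho0_pos : ∀ᵐ x ∂(FVNSF.torusMeasure d), 0 < rho0 x)
    (htheta0_pos : ∀ᵐ x ∂(FVNSF.torusMeasure d), 0 < theta0 x)
    (rhoMin rhoMax thetaMin thetaMax : ℝ) (hrhoMin : 0 < rhoMin) (hthetaMin : 0 < thetaMin) :
    -- continuity equation
    (∀ φ : FVNSF.TestFunction d T, ∃ C : ℝ, 0 < C ∧
      ∀ (N NT : ℕ) [NeZero N] (dt : ℝ), FVNSF.meshSize N < 1 → 0 < dt → dt < 1 → NT * dt = T →
      ∀ w : FVNSF.FVFields d N,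
      FVNSF.IsFVSolution mu lam kappa gamma eps NT dt rho0 u0 theta0 w →
      w.Bounded NT rhoMin rhoMax thetaMin thetaMax →
      ∀ τ ∈ Set.Icc 0 T, ∃ e : ℝ,
        FVNSF.torusInt (fun x => w.rhoAt dt τ x * φ.val τ x)
            - FVNSF.torusInt (fun x => w.rhoAt dt 0 x * φ.val 0 x)
          = FVNSF.cylInt τ (fun t x => w.rhoAt dt t x * φ.dt t x
              + (∑ i, w.rhoAt dt t x * w.velAt dt i t x * φ.dx i t x))
            + e ∧
        |e| ≤ C * (dt + FVNSF.meshSize N + FVNSF.meshSize N ^ (1 - eps)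
          + FVNSF.meshSize N ^ (1 + eps))) ∧
    -- momentum equation
    (∀ φ : Fin d → FVNSF.TestFunction d T, ∃ C : ℝ, 0 < C ∧
      ∀ (N NT : ℕ) [NeZero N] (dt : ℝ), FVNSF.meshSize N < 1 → 0 < dt → dt < 1 → NT * dt = T →
      ∀ w : FVNSF.FVFields d N,
      FVNSF.IsFVSolution mu lam kappa gamma eps NT dt rho0 u0 theta0 w →
      w.Bounded NT rhoMin rhoMax thetaMin thetaMax →
      ∀ τ ∈ Set.Icc 0 T, ∃ e : ℝ,
        FVNSF.torusInt (fun x => ∑ i, w.rhoAt dt τ x * w.velAt dt i τ x * (φ i).val τ x)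
            - FVNSF.torusInt (fun x => ∑ i, w.rhoAt dt 0 x * w.velAt dt i 0 x * (φ i).val 0 x)
          = FVNSF.cylInt τ (fun t x =>
              (∑ i, w.rhoAt dt t x * w.velAt dt i t x * (φ i).dt t x)
              + (∑ i, ∑ j, w.rhoAt dt t x * w.velAt dt i t x * w.velAt dt j t x * (φ i).dx j t x))
            + FVNSF.cylInt τ (fun t x => ∑ i, ∑ j,
                ((if i = j then w.pressAt dt t x else 0) - w.stressAt mu lam dt i j t x)
                  * (φ i).dx j t x)
            + e ∧
        |e| ≤ C * (dt + FVNSF.meshSize N + FVNSF.meshSize N ^ ((1 - eps) / 2)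
          + FVNSF.meshSize N ^ (1 + eps))) ∧
    -- entropy inequality
    (∀ φ : FVNSF.TestFunction d T, (∀ t ∈ Set.Icc 0 T, ∀ x, 0 ≤ φ.val t x) → ∃ C : ℝ, 0 < C ∧
      ∀ (N NT : ℕ) [NeZero N] (dt : ℝ), FVNSF.meshSize N < 1 → 0 < dt → dt < 1 → NT * dt = T →
      ∀ w : FVNSF.FVFields d N,
      FVNSF.IsFVSolution mu lam kappa gamma eps NT dt rho0 u0 theta0 w →
      w.Bounded NT rhoMin rhoMax thetaMin thetaMax →
      ∀ τ ∈ Set.Icc 0 T, ∃ e : ℝ,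
        FVNSF.torusInt (fun x => w.rhoAt dt τ x * w.entropyAt gamma dt τ x * φ.val τ x)
            - FVNSF.torusInt (fun x => w.rhoAt dt 0 x * w.entropyAt gamma dt 0 x * φ.val 0 x)
          ≥ FVNSF.cylInt τ (fun t x => w.rhoAt dt t x * w.entropyAt gamma dt t x
                * (φ.dt t x + ∑ i, w.velAt dt i t x * φ.dx i t x))
            + FVNSF.cylInt τ (fun t x =>
                (∑ i, ∑ j, w.stressAt mu lam dt i j t x * w.gradVelAt dt i j t x)
                  * (φ.val t x / w.tempAt dt t x))
            + FVNSF.cylInt τ (fun t x => ∑ i,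
                kappa * φ.val t x / (w.tempOutAt dt i t x * w.tempAt dt t x)
                  * w.edgeGradTempAt dt i t x ^ 2)
            - FVNSF.cylInt τ (fun t x => kappa / w.tempAt dt t x
                * ∑ i, w.edgeGradTempAt dt i t x * φ.dx i t x)
            + e ∧
        |e| ≤ C * (dt + FVNSF.meshSize N + FVNSF.meshSize N ^ (1 - eps)
          + FVNSF.meshSize N ^ ((1 + eps) / 2))) := by
  have hd0 : 0 < d := by omega
  refine ⟨fun φ => ?_, fun φ => ?_, fun φ hφ => ?_⟩
  · obtain ⟨C, hC, h⟩ := FVNSF.continuity_consistent (eps := eps) (rho0 := rho0) (r2 := rhoMax)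
      (t2 := thetaMax) hd0 hT hmu hlam hkappa hgamma hu0 htheta0 hrhoMin hthetaMin φ
    exact ⟨C, hC, fun N NT _ dt _ hdt _ => h N NT dt hdt⟩
  · obtain ⟨C, hC, h⟩ := FVNSF.momentum_consistent (rho0 := rho0) (r2 := rhoMax)
      (t2 := thetaMax) hd0 hT hmu hlam hkappa hgamma heps' hu0 htheta0 hrhoMin hthetaMin φ
    exact ⟨C, hC, fun N NT _ dt _ hdt _ => h N NT dt hdt⟩
  · obtain ⟨C, hC, h⟩ := FVNSF.entropy_consistent (rho0 := rho0) (r2 := rhoMax)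
      (t2 := thetaMax) hd0 hT hmu hlam hkappa hgamma heps hu0 htheta0 hrhoMin hthetaMin φ hφ
    exact ⟨C, hC, fun N NT _ dt hN hdt _ => h N NT dt hN hdt⟩
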